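/- Conventions. $\widehat g(\xi)=\int_{\mathbb R^2}e^{-ix\cdot\xi}g(x)\,dx$. Fix $\{\phi_j\}_{j\in\mathbb Z}\subset\mathscr S(\mathbb R^2)$ with $0\le\widehat{\phi_0}\le1$, $\operatorname{supp}\widehat{\phi_0}\subset\{2^{-1}\le|\xi|\le2\}$, $\widehat{\phi_0}=1$ on $\{7/8\le|\xi|\le5/4\}$, $\widehat{\phi_j}(\xi)=\widehat{\phi_0}(2^{-j}\xi)$ and $\sum_{j}\widehat{\phi_j}(\xi)=1$ for $\xi\ne0$. Let $\mathscr P$ be the space of polynomials with complex coefficients. For $s\in\mathbb R$ and $1\le p,q\le\infty$, $\dot B^s_{p,q}(\mathbb R^2)$ is the set of $F\in\mathscr S'(\mathbb R^2)/\mathscr P(\mathbb R^2)$ with $$\|F\|_{\dot B^s_{p,q}}=\big\|\{2^{sj}\|\phi_j*F\|_{L^p}\}_{j\in\mathbb Z}\big\|_{\ell^q}<\infty .$$ For $v:\mathbb R^2\to\mathbb C^2$ put $\nabla^\perp=(-\partial_{x_2},\partial_{x_1})$, $$\mathcal T[\theta,v]=\mathscr F^{-1}\Big[\frac1{(2\pi)^2}\int_{\mathbb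 R^2}\frac{\xi-2\eta}{2i(|\eta|+|\xi-\eta|)}\otimes\widehat\theta(\xi-\eta)\widehat v(\eta)\,d\eta\Big],$$ $$\mathcal B[\theta_1,\theta_2]=(-\Delta)^{-1}\operatorname{div}\operatorname{div}\mathcal T\big[(-\Delta)^{-\frac12}\theta_1,\nabla^\perp(-\Delta)^{-\frac12}\theta_2\big],$$ so that, for nice functions $\theta$, $\mathcal B[\theta,\theta]=(-\Delta)^{-1}\operatorname{div}(\theta u)$ with $u=\nabla^\perp(-\Delta)^{-\frac12}\theta$. For general $\theta_1,\theta_2\in\mathscr S'/\mathscr P$, $\mathcal B[\theta_1,\theta_2]$ is understood as $\sum_{k,\ell\in\mathbb Z}\mathcal B[\phi_k*\theta_1,\phi_\ell*\theta_2]$, the series converging unconditionally in $\mathscr S'/\mathscr P$ (the dual of the space of Schwartz functions all of whose moments vanish). A solution of the stationary quasi-geostrophic equation with external force $f$ is a $\theta$ for which $\mathcal B[\theta,\theta]$ is defined in this sense and $$\theta=(-\Delta)^{-1}f+\mathcal B[\theta,\theta]\qquad\text{in }\mathscr S'(\mathbb R^2)/\mathscr P(\mathbb R^2).$$ Theorem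 1.1. Let $1\le p<4$ and $1\le q\le\infty$, or $(p,q)=(4,2)$. There are constants $\delta_0,\varepsilon_0>0$ depending only on $p,q$ (and on the fixed $\{\phi_j\}$) such that, with $$D_{p,q}=\big\{f\in\dot B^{\frac2p-3}_{p,q}(\mathbb R^2):\|f\|_{\dot B^{\frac2p-3}_{p,q}}\le\delta_0\big\},\qquad S_{p,q}=\big\{\theta\in\dot B^{\frac2p-1}_{p,q}(\mathbb R^2):\|\theta\|_{\dot B^{\frac2p-1}_{p,q}}\le\varepsilon_0\big\},$$ for every $f\in D_{p,q}$ there is a unique solution $\theta\in S_{p,q}$. Moreover the solution map $\Phi:D_{p,q}\ni f\mapsto\theta\in S_{p,q}$ is Lipschitz continuous: there is a constant $K$ with $$\|\Phi(f)-\Phi(g)\|_{\dot B^{\frac2p-1}_{p,q}}\le K\,\|f-g\|_{\dot B^{\frac2p-3}_{p,q}}\qquad(f,g\in D_{p,q}).$$ The distributions here may be complex-valued; if $f$ is real, then so is $\Phi(f)$. -/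

import Mathlib

open MeasureTheory
open scoped ENNReal NNReal SchwartzMap FourierTransform LineDeriv Laplacian

noncomputable section

namespace QG

/-- The Euclidean plane. -/
abbrev Plane := EuclideanSpace ℝ (Fin 2)

/-! ### Tempered distributions modulo polynomials -/

/-- The value of a polynomial with complex coefficients at a point of the plane. -/
def polyEval (P : MvPolynomial (Fin 2) ℂ) (x : Plane) : ℂ :=
  MvPolynomial.eval (fun i ↦ (x i : ℂ)) P

theorem hasTemperateGrowth_coord (i : Fin 2) :
    (fun x : Plane ↦ ((x i : ℝ) : ℂ)).HasTemperateGrowth :=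
  (Complex.ofRealCLM ∘L (EuclideanSpace.proj i : Plane →L[ℝ] ℝ)).hasTemperateGrowth

theorem hasTemperateGrowth_polyEval (P : MvPolynomial (Fin 2) ℂ) :
    (polyEval P).HasTemperateGrowth := by
  induction P using MvPolynomial.induction_on with
  | C c =>
    have : polyEval (MvPolynomial.C c) = fun _ ↦ c := by ext x; simp [polyEval]
    rw [this]
    exact Function.HasTemperateGrowth.const c
  | add P Q hP hQ =>
    have : polyEval (P + Q) = polyEval P + polyEval Q := by ext x; simp [polyEval]
    rw [this]
    exact hP.add hQ
  | mul_X P i hP =>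
    have : polyEval (P * MvPolynomial.X i) = polyEval P * fun x ↦ ((x i : ℝ) : ℂ) := by
      ext x; simp [polyEval]
    rw [this]
    exact hP.mul (hasTemperateGrowth_coord i)

theorem integrable_polyEval_mul (P : MvPolynomial (Fin 2) ℂ) (ψ : 𝓢(Plane, ℂ)) :
    Integrable (fun x ↦ polyEval P x * ψ x) := by
  have h := (SchwartzMap.smulLeftCLM ℂ (polyEval P) ψ).integrable (μ := volume)
  simpa [SchwartzMap.smulLeftCLM_apply (hasTemperateGrowth_polyEval P)] using h

/-- A polynomial, regarded as the tempered distribution `ψ ↦ ∫ P ψ`. -/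
def polyDistribution : MvPolynomial (Fin 2) ℂ →ₗ[ℂ] 𝓢'(Plane, ℂ) where
  toFun P := Function.HasTemperateGrowth.toTemperedDistribution volume
    (hasTemperateGrowth_polyEval P)
  map_add' P Q := by
    ext ψ
    have hP := integrable_polyEval_mul P ψ
    have hQ := integrable_polyEval_mul Q ψ
    simp only [Function.HasTemperateGrowth.toTemperedDistribution_apply, smul_eq_mul,
      _root_.add_apply]
    rw [← integral_add (by simpa [mul_comm] using hP) (by simpa [mul_comm] using hQ)]
    simp [polyEval, mul_add]
  map_smul' c P := by
    ext ψ
    simp only [Function.HasTemperateGrowth.toTemperedDistribution_apply, smul_eq_mul,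
      _root_.smul_apply, RingHom.id_apply]
    rw [← integral_const_mul]
    simp [polyEval, mul_left_comm]

theorem polyDistribution_apply (P : MvPolynomial (Fin 2) ℂ) (ψ : 𝓢(Plane, ℂ)) :
    polyDistribution P ψ = ∫ x, polyEval P x * ψ x := by
  simp [polyDistribution, mul_comm]

/-- The space of polynomials inside the space of tempered distributions. -/
def polynomials : Submodule ℂ 𝓢'(Plane, ℂ) := LinearMap.range polyDistribution

/-- Tempered distributions modulo polynomials. -/
abbrev DistModPoly := 𝓢'(Plane, ℂ) ⧸ polynomials

/-- A class is real if it contains a real tempered distribution, i.e. one that takes real values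
on real test functions. -/
def IsReal (F : DistModPoly) : Prop :=
  ∃ u : 𝓢'(Plane, ℂ), Submodule.Quotient.mk u = F ∧
    ∀ ψ : 𝓢(Plane, ℂ), (∀ x, (ψ x).im = 0) → (u ψ).im = 0

/-- The Schwartz functions all of whose moments vanish. Its dual is the space of tempered
distributions modulo polynomials. -/
def zeroMoments : Submodule ℂ 𝓢(Plane, ℂ) where
  carrier := {ψ | ∀ P, ∫ x, polyEval P x * ψ x = 0}
  zero_mem' := by simp
  add_mem' {ψ₁ ψ₂} h₁ h₂ P := by
    simp only [_root_.add_apply, mul_add]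
    rw [integral_add (integrable_polyEval_mul P ψ₁) (integrable_polyEval_mul P ψ₂), h₁ P, h₂ P,
      add_zero]
  smul_mem' c ψ h P := by
    simp only [_root_.smul_apply, smul_eq_mul, mul_left_comm _ c]
    rw [integral_const_mul, h P, mul_zero]

/-- The duality pairing between `𝓢' / 𝓟` and Schwartz functions with vanishing moments. -/
def pair (ψ : zeroMoments) : DistModPoly →ₗ[ℂ] ℂ :=
  polynomials.liftQ
    { toFun := fun u ↦ u (ψ : 𝓢(Plane, ℂ))
      map_add' := fun _ _ ↦ rfl
      map_smul' := fun _ _ ↦ rfl } <| by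
    rintro _ ⟨P, rfl⟩
    rw [LinearMap.mem_ker]
    exact (polyDistribution_apply P ψ).trans (ψ.2 P)

/-! ### The negative Laplacian on tempered distributions modulo polynomials -/

theorem exists_lineDeriv_polyEval (P : MvPolynomial (Fin 2) ℂ) (m : Plane) :
    ∃ Q, ∀ x, HasLineDerivAt ℝ (polyEval P) (polyEval Q x) x m := by
  induction P using MvPolynomial.induction_on with
  | C c =>
    refine ⟨0, fun x ↦ ?_⟩
    simpa [HasLineDerivAt, polyEval] using hasDerivAt_const (0 : ℝ) c
  | add P₁ P₂ h₁ h₂ =>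
    obtain ⟨Q₁, h₁⟩ := h₁
    obtain ⟨Q₂, h₂⟩ := h₂
    refine ⟨Q₁ + Q₂, fun x ↦ ?_⟩
    have h := HasDerivAt.add (h₁ x) (h₂ x)
    simpa [HasLineDerivAt, polyEval, Pi.add_def] using h
  | mul_X P i h =>
    obtain ⟨Q, h⟩ := h
    refine ⟨Q * MvPolynomial.X i + P * MvPolynomial.C (m i : ℂ), fun x ↦ ?_⟩
    have h₀ : HasDerivAt (fun t : ℝ ↦ (((x + t • m) i : ℝ) : ℂ)) (m i : ℂ) 0 := by
      have : HasDerivAt (fun t : ℝ ↦ (x + t • m) i) (m i) 0 := by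
        simpa using ((hasDerivAt_id (0 : ℝ)).mul_const (m i)).const_add (x i)
      exact this.ofReal_comp
    have h' := HasDerivAt.mul (h x) h₀
    simpa [HasLineDerivAt, polyEval, Pi.mul_def] using h'

theorem lineDeriv_mem_polynomials {u : 𝓢'(Plane, ℂ)} (hu : u ∈ polynomials) (m : Plane) :
    ∂_{m} u ∈ polynomials := by
  obtain ⟨P, rfl⟩ := hu
  obtain ⟨Q, hQ⟩ := exists_lineDeriv_polyEval P m
  refine ⟨Q, ?_⟩
  ext ψ
  rw [TemperedDistribution.lineDerivOp_apply_apply, map_neg, polyDistribution_apply,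
    polyDistribution_apply, eq_neg_iff_add_eq_zero, ← neg_eq_iff_add_eq_zero, eq_comm]
  exact integral_bilinear_hasLineDerivAt_right_eq_neg_left_of_integrable
    (B := ContinuousLinearMap.mul ℝ ℂ)
    (integrable_polyEval_mul Q ψ) (integrable_polyEval_mul P (∂_{m} ψ))
    (integrable_polyEval_mul P ψ) (fun x _ ↦ hQ x)
    (fun x _ ↦ (ψ.differentiableAt.hasFDerivAt).hasLineDerivAt m)

theorem laplacian_mem_polynomials {u : 𝓢'(Plane, ℂ)} (hu : u ∈ polynomials) :
    Δ u ∈ polynomials := by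
  rw [TemperedDistribution.laplacian_eq_sum (EuclideanSpace.basisFun (Fin 2) ℝ)]
  exact Submodule.sum_mem _ fun i _ ↦
    lineDeriv_mem_polynomials (lineDeriv_mem_polynomials hu _) _

/-- The operator `-Δ` on tempered distributions modulo polynomials. -/
def negLaplacian : DistModPoly →ₗ[ℂ] DistModPoly :=
  polynomials.mapQ polynomials
    (-(LineDeriv.laplacianCLM ℂ Plane 𝓢'(Plane, ℂ)).toLinearMap) fun u hu ↦ by
      simpa using laplacian_mem_polynomials hu

/-- `L = (-Δ)⁻¹ F` in the space of tempered distributions modulo polynomials, on which `-Δ` is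
bijective. -/
def IsInvLaplacian (F L : DistModPoly) : Prop := negLaplacian L = F

/-! ### Dyadic partitions of unity and homogeneous Besov spaces -/

/-- The Fourier transform `ξ ↦ ∫ exp(-i x·ξ) ψ(x) dx`. -/
def hat (ψ : Plane → ℂ) (ξ : Plane) : ℂ :=
  ∫ x, Complex.exp (-(Complex.I * (inner ℝ x ξ : ℝ))) * ψ x

/-- A homogeneous dyadic partition of unity `(φ_j)`. -/
structure DyadicPartition where
  /-- The Schwartz functions of the partition. -/
  φ : ℤ → 𝓢(Plane, ℂ)
  hat_im : ∀ ξ, (hat (φ 0) ξ).im = 0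
  hat_nonneg : ∀ ξ, 0 ≤ (hat (φ 0) ξ).re
  hat_le_one : ∀ ξ, (hat (φ 0) ξ).re ≤ 1
  hat_support : ∀ ξ, hat (φ 0) ξ ≠ 0 → 2⁻¹ ≤ ‖ξ‖ ∧ ‖ξ‖ ≤ 2
  hat_eq_one : ∀ ξ : Plane, 7 / 8 ≤ ‖ξ‖ → ‖ξ‖ ≤ 5 / 4 → hat (φ 0) ξ = 1
  hat_dilate : ∀ (j : ℤ) (ξ : Plane), hat (φ j) ξ = hat (φ 0) ((2 : ℝ) ^ (-j) • ξ)
  hat_sum : ∀ ξ : Plane, ξ ≠ 0 → HasSum (fun j ↦ hat (φ j) ξ) 1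

/-- The Schwartz function `y ↦ ψ (x - y)`. -/
def reflect (ψ : 𝓢(Plane, ℂ)) (x : Plane) : 𝓢(Plane, ℂ) :=
  SchwartzMap.compCLMOfContinuousLinearEquiv ℂ (ContinuousLinearEquiv.neg ℝ)
    (ψ.compSubConstCLM ℂ (-x))

theorem reflect_apply (ψ : 𝓢(Plane, ℂ)) (x y : Plane) : reflect ψ x y = ψ (x - y) := by
  simp [reflect, sub_eq_add_neg, add_comm]

theorem hat_eq_fourier (ψ : 𝓢(Plane, ℂ)) (ξ : Plane) :
    hat ψ ξ = 𝓕 ψ ((2 * Real.pi)⁻¹ • ξ) := by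
  rw [SchwartzMap.fourier_coe, Real.fourier_eq']
  unfold hat
  congr 1
  ext x
  rw [smul_eq_mul, inner_smul_right]
  congr 2
  have : (Real.pi : ℂ) ≠ 0 := by exact_mod_cast Real.pi_ne_zero
  push_cast
  field_simp

/-- A Schwartz function whose Fourier transform vanishes near the origin has no moments. -/
theorem mem_zeroMoments_of_fourier {ψ : 𝓢(Plane, ℂ)}
    (h : ∀ᶠ ξ in nhds (0 : Plane), 𝓕 ψ ξ = 0) : ψ ∈ zeroMoments := by
  intro P
  induction P using MvPolynomial.induction_on generalizing ψ with
  | C c =>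
    have h0 := h.self_of_nhds
    rw [SchwartzMap.fourier_coe, Real.fourier_eq'] at h0
    simp only [inner_zero_right, mul_zero, Complex.ofReal_zero, zero_mul, Complex.exp_zero,
      one_smul] at h0
    simp [polyEval, integral_const_mul, h0]
  | add P Q hP hQ =>
    have e : ∀ x, polyEval (P + Q) x * ψ x = polyEval P x * ψ x + polyEval Q x * ψ x := by
      intro x; simp [polyEval, add_mul]
    simp_rw [e]
    rw [integral_add (integrable_polyEval_mul P ψ) (integrable_polyEval_mul Q ψ), hP h, hQ h,
      add_zero]
  | mul_X P i hP =>
    set m : Plane := EuclideanSpace.single i 1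
    have hg : (fun x : Plane ↦ (inner ℝ x m : ℝ)).HasTemperateGrowth := by fun_prop
    set χ : 𝓢(Plane, ℂ) := SchwartzMap.smulLeftCLM ℂ (inner ℝ · m) ψ with hχ
    have hχx : ∀ x, χ x = (x i : ℂ) * ψ x := by
      intro x
      rw [hχ, SchwartzMap.smulLeftCLM_apply_apply hg]
      simp [m, EuclideanSpace.inner_single_right]
    have h1 : ∀ᶠ ξ in nhds (0 : Plane), 𝓕 χ ξ = 0 := by
      have h2 : ∀ᶠ ξ in nhds (0 : Plane), (∂_{m} (𝓕 ψ)) ξ = 0 := by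
        filter_upwards [h.eventually_nhds] with ξ hξ
        rw [SchwartzMap.lineDerivOp_apply_eq_fderiv]
        have : ((𝓕 ψ : 𝓢(Plane, ℂ)) : Plane → ℂ) =ᶠ[nhds ξ] fun _ ↦ 0 := hξ
        rw [this.fderiv_eq]
        simp
      filter_upwards [h2] with ξ hξ
      rw [SchwartzMap.lineDerivOp_fourier_eq] at hξ
      have e : 𝓕 (-(2 * Real.pi * Complex.I) • χ) ξ = -(2 * Real.pi * Complex.I) • 𝓕 χ ξ := by
        rw [FourierTransform.fourier_smul]; rfl
      rw [e] at hξ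
      have hne : -(2 * (Real.pi : ℂ) * Complex.I) ≠ 0 := by simp [Real.pi_ne_zero]
      exact (smul_eq_zero.mp hξ).resolve_left hne
    have := hP h1
    rw [← this]
    congr 1
    ext x
    simp [polyEval, hχx, mul_assoc]

theorem DyadicPartition.reflect_mem (D : DyadicPartition) (j : ℤ) (x : Plane) :
    reflect (D.φ j) x ∈ zeroMoments := by
  apply mem_zeroMoments_of_fourier
  have key : ∀ ξ : Plane, 𝓕 (reflect (D.φ j) x) ξ =
      Complex.exp (-(Complex.I * (inner ℝ x ((2 * Real.pi) • ξ) : ℝ))) *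
        hat (D.φ j) (-((2 * Real.pi) • ξ)) := by
    intro ξ
    have h1 := hat_eq_fourier (reflect (D.φ j) x) ((2 * Real.pi) • ξ)
    rw [inv_smul_smul₀ (by positivity)] at h1
    rw [← h1]
    unfold hat
    rw [← integral_const_mul,
      ← integral_sub_left_eq_self (fun y ↦ _ * (_ * (D.φ j) y)) volume x]
    congr 1
    ext y
    rw [reflect_apply, ← mul_assoc, ← Complex.exp_add]
    congr 2
    simp only [inner_sub_left, inner_neg_right]
    push_cast
    ring
  have hpos : (0 : ℝ) < (2 * Real.pi)⁻¹ * ((2 : ℝ) ^ j * 2⁻¹) := by positivity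
  filter_upwards [Metric.ball_mem_nhds (0 : Plane) hpos] with ξ hξ
  rw [key, D.hat_dilate, mul_eq_zero]
  right
  by_contra hne
  have := (D.hat_support _ hne).1
  rw [mem_ball_zero_iff] at hξ
  rw [norm_smul, norm_neg, norm_smul, Real.norm_of_nonneg (by positivity),
    Real.norm_of_nonneg (by positivity)] at this
  rw [inv_mul_eq_div, lt_div_iff₀ (by positivity)] at hξ
  have h2 : (2 : ℝ) ^ (-j) * (2 * Real.pi * ‖ξ‖) < (2 : ℝ) ^ (-j) * ((2 : ℝ) ^ j * 2⁻¹) := by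
    apply mul_lt_mul_of_pos_left _ (by positivity)
    linarith
  rw [← mul_assoc ((2 : ℝ) ^ (-j)) ((2 : ℝ) ^ j), ← zpow_add₀ (by norm_num), neg_add_cancel,
    zpow_zero, one_mul] at h2
  linarith

/-- The function `φ_j * F`, `x ↦ ⟨F, φ_j (x - ·)⟩`. -/
def DyadicPartition.block (D : DyadicPartition) (j : ℤ) (F : DistModPoly) (x : Plane) : ℂ :=
  pair ⟨reflect (D.φ j) x, D.reflect_mem j x⟩ F

/-- The norm of the homogeneous Besov space `Ḃ^s_{p,q}(ℝ²)`: the `ℓ^q` norm of the sequence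
`2^{sj} ‖φ_j * F‖_{L^p}`, with value `∞` allowed. -/
def DyadicPartition.besovNorm (D : DyadicPartition) (s : ℝ) (p q : ℝ≥0∞) (F : DistModPoly) :
    ℝ≥0∞ :=
  eLpNorm (fun j : ℤ ↦ ENNReal.ofReal ((2 : ℝ) ^ (s * j)) * eLpNorm (D.block j F) p volume) q
    Measure.count

/-- The homogeneous Besov space `Ḃ^s_{p,q}(ℝ²)`. -/
def DyadicPartition.besovSpace (D : DyadicPartition) (s : ℝ) (p q : ℝ≥0∞) : Set DistModPoly :=
  {F | D.besovNorm s p q F < ∞}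

/-- The closed ball of radius `r` around the origin of `Ḃ^s_{p,q}(ℝ²)`. -/
def DyadicPartition.besovBall (D : DyadicPartition) (s : ℝ) (p q : ℝ≥0∞) (r : ℝ) :
    Set DistModPoly :=
  {F | F ∈ D.besovSpace s p q ∧ D.besovNorm s p q F ≤ ENNReal.ofReal r}

/-! ### The nonlinearity -/

/-- `η^⊥ = (-η₂, η₁)`, so that `∇^⊥` has the symbol `i η^⊥`. -/
def perp (η : Plane) : Plane := !₂[-η 1, η 0]

/-- The `a`-th component of the symbol `(ξ - η) / (2i(|ξ| + |η|))` of the bilinear operator `𝒯`,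
where `ξ` and `η` are the frequencies of the first and the second argument. -/
def symbolT (a : Fin 2) (ξ η : Plane) : ℂ :=
  ((ξ a - η a : ℝ) : ℂ) / (2 * Complex.I * ((‖ξ‖ + ‖η‖ : ℝ) : ℂ))

/-- The symbol of the bilinear operator
`ℬ[θ₁, θ₂] = (-Δ)⁻¹ ∑_{a,b} ∂_a ∂_b 𝒯_a[(-Δ)^{-1/2} θ₁, (∇^⊥ (-Δ)^{-1/2} θ₂)_b]`,
where `ξ` and `η` are the frequencies of `θ₁` and `θ₂`, and hence `ξ + η` is that of the output. -/
def symbolB (ξ η : Plane) : ℂ :=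
  ((‖ξ + η‖ ^ 2 : ℝ) : ℂ)⁻¹ * ∑ a : Fin 2, ∑ b : Fin 2,
    (Complex.I * ((ξ + η) a : ℝ)) * (Complex.I * ((ξ + η) b : ℝ)) *
      (symbolT a ξ η * (‖ξ‖ : ℂ)⁻¹ * (Complex.I * (perp η b : ℝ) * (‖η‖ : ℂ)⁻¹))

/-- The value at the test function `ψ` of the bilinear Fourier multiplier
`T_m[G, H](x) = (2π)⁻⁴ ∬ exp(i x·(ξ + η)) m(ξ, η) Ĝ(ξ) Ĥ(η) dξ dη`
(normalised so that `T_1[G, H] = G H`) for functions `G`, `H` of polynomial growth for which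
`Ĝ = χ₁ Ĝ` and `Ĥ = χ₂ Ĥ`. The Fourier transforms of `G` and `H` are moved to the test side, so
that `⟨T_m[G, H], ψ⟩ = ∬ G(y) H(z) K(y, z) dy dz` with
`K(y, z) = (2π)⁻⁴ ∬ exp(-i(y·ξ + z·η)) χ₁(ξ) χ₂(η) m(ξ, η) ψ̂(-ξ - η) dξ dη`. -/
def bilinearMultiplier (m : Plane → Plane → ℂ) (χ₁ χ₂ : Plane → ℂ) (G H : Plane → ℂ)
    (ψ : 𝓢(Plane, ℂ)) : ℂ :=
  ∫ y : Plane × Plane, G y.1 * H y.2 * ((2 * Real.pi : ℂ) ^ (-4 : ℤ) *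
    ∫ w : Plane × Plane,
      Complex.exp (-(Complex.I * ((inner ℝ y.1 w.1 + inner ℝ y.2 w.2 : ℝ) : ℂ))) *
        (χ₁ w.1 * χ₂ w.2 * m w.1 w.2 * hat ψ (-w.1 - w.2)))

/-- A compactly supported cutoff that equals `1` on the support of the Fourier transform
of `φ_k`. -/
def DyadicPartition.cutoff (D : DyadicPartition) (k : ℤ) (ξ : Plane) : ℂ :=
  hat (D.φ (k - 1)) ξ + hat (D.φ k) ξ + hat (D.φ (k + 1)) ξ

/-- `N = ℬ[θ₁, θ₂]` in the space of tempered distributions modulo polynomials: the series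
`∑_{k,l} ℬ[φ_k * θ₁, φ_l * θ₂]` converges there, unconditionally, to `N`. -/
def DyadicPartition.IsBilinear (D : DyadicPartition) (θ₁ θ₂ N : DistModPoly) : Prop :=
  ∀ ψ : zeroMoments, HasSum (fun k : ℤ × ℤ ↦
    bilinearMultiplier symbolB (D.cutoff k.1) (D.cutoff k.2) (D.block k.1 θ₁) (D.block k.2 θ₂) ψ)
    (pair ψ N)

/-- `θ` solves `θ = (-Δ)⁻¹ f + ℬ[θ, θ]` in the space of tempered distributions modulo
polynomials. -/
def DyadicPartition.IsSolution (D : DyadicPartition) (f θ : DistModPoly) : Prop :=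
  ∃ L N, IsInvLaplacian f L ∧ D.IsBilinear θ θ N ∧ θ = L + N

end QG

end

/-! With L = (-Δ)⁻¹f the equation is the fixed-point problem θ = L + ℬ[θ, θ], and Ḃ^{2/p-1}_{p,q} is
its scale-invariant space (`crit p` is 2/p - 1). Two facts suffice: (-Δ)⁻¹ gains two derivatives
(`exists_isInvLaplacian`), and ℬ is a bounded bilinear map of this Banach space into itself
(`exists_bilinear`). A contraction on a small ball then gives existence, and absorbing the quadratic
difference gives uniqueness and the Lipschitz bound at once (`exists_eq_add_quadratic`,
`norm_sub_le_two_mul_of_quadratic`).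

The bilinear estimate. By `symbolB_eq` the symbol of ℬ is -1/2 ∑_b W_b(ξ+η)(P_b(η) + P_b(ξ)) with
W_b(ζ) = ζ_b/|ζ|² and P_b(ζ) = ζ^⊥_b/|ζ|, a symmetrised (-Δ)⁻¹div(θu) of order -1. Take inputs at
frequencies 2^k and 2^l and the output at 2^j. If k ≥ l + 7 the output sits near 2^k, and
Bernstein's inequality for the low factor leaves 2^{l-k}, for every p. The obstacle is high-high to
low, where k ≈ l, j may be far below k, and the factor 2^{-j} from W is too large. The remedy is a
cancellation: P_b is odd, so both Riesz terms are convolutions with one odd kernel κ, and W * (G κ*H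
+ κ*G H) becomes a derivative of W applied to averages of products of translates of G and H weighted
by y κ(y) (`cv_symm_eq_transport`). This replaces 2^{-j} by 2^{-k}. For p ≥ 2, Hölder into L^{p/2}
and Bernstein leave 2^{(4/p-1)(j-k)}, which decays exactly when p < 4; for p < 2, Hölder in L^p ×
L^∞ leaves 2^{(2/p-1)(j-k)}. At p = 4 no decay is left: the sum over j is handled by a square
function estimate from Plancherel (`exists_tsum_eLpNorm_cv_kern_sq_le`) and the sum over k by
Cauchy-Schwarz (`exists_tsum_close_le`), which is where q = 2 enters.

Passage to 𝓢'/𝓟. A class is determined by its blocks, because a distribution whose Fourier transform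
lives at the origin is a polynomial (`mem_polynomials_of_ucv_eq_zero`). Conversely, functions at
frequency 2^j of size O(2^j) sum to a tempered distribution (`exists_distribution`); this produces
(-Δ)⁻¹f, the values of ℬ, and the limits needed for completeness. Tested against ψ, the series over
k, l and j converges absolutely, which yields the unconditional convergence in the meaning of ℬ.

Reality follows from uniqueness applied to the conjugate of the solution. The φ_j may be
complex-valued, so conjugation leads to the conjugate partition; one returns by showing that ℬ does
not depend on the partition (`IsBilinear.change`) and that the norms are equivalent, with δ₀ small
enough to keep the conjugate in the ball. -/

noncomputable section

namespace QG

/-! ### Minkowski's integral inequality -/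

section Minkowski

variable {α β : Type*} [MeasurableSpace α] [MeasurableSpace β] {μ : Measure α} {ν : Measure β}

/-- Write S^p = S · S^{p-1}, apply Hölder in x and divide by (∫ S^p)^{1/p'}. The division needs ∫
S^p finite, so the inequality is proved for a minorant S of the inner integral. -/
theorem lintegral_rpow_le_of_le_lintegral [SFinite μ] [SFinite ν] {p : ℝ} (hp : 1 ≤ p)
    {F : α → β → ℝ≥0∞} (hF : Measurable (Function.uncurry F)) {S : α → ℝ≥0∞} (hS : Measurable S)
    (hSF : ∀ x, S x ≤ ∫⁻ y, F x y ∂ν) (hfin : ∫⁻ x, S x ^ p ∂μ ≠ ∞) :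
    (∫⁻ x, S x ^ p ∂μ) ^ (1 / p) ≤ ∫⁻ y, (∫⁻ x, F x y ^ p ∂μ) ^ (1 / p) ∂ν := by
  rcases hp.eq_or_lt with rfl | hp1
  · simp only [ENNReal.rpow_one, div_one]
    calc ∫⁻ x, S x ∂μ ≤ ∫⁻ x, ∫⁻ y, F x y ∂ν ∂μ := lintegral_mono hSF
      _ = _ := lintegral_lintegral_swap hF.aemeasurable
  have hp0 : 0 < p := by linarith
  set q := p.conjExponent with hq
  have hpq : p.HolderConjugate q := Real.HolderConjugate.conjExponent hp1
  set I := ∫⁻ x, S x ^ p ∂μ with hI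
  have key : I ≤ (∫⁻ y, (∫⁻ x, F x y ^ p ∂μ) ^ (1 / p) ∂ν) * I ^ (1 / q) := by
    calc I = ∫⁻ x, S x * S x ^ (p - 1) ∂μ := by
          refine lintegral_congr fun x ↦ ?_
          conv_lhs => rw [show p = 1 + (p - 1) by ring]
          rw [ENNReal.rpow_add_of_nonneg _ _ zero_le_one (by linarith), ENNReal.rpow_one]
      _ ≤ ∫⁻ x, (∫⁻ y, F x y ∂ν) * S x ^ (p - 1) ∂μ :=
          lintegral_mono fun x ↦ mul_le_mul_left (hSF x) _
      _ = ∫⁻ x, ∫⁻ y, F x y * S x ^ (p - 1) ∂ν ∂μ := by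
          refine lintegral_congr fun x ↦ ?_
          rw [lintegral_mul_const _ (show Measurable fun y ↦ F x y from hF.comp measurable_prodMk_left)]
      _ = ∫⁻ y, ∫⁻ x, F x y * S x ^ (p - 1) ∂μ ∂ν := by
          apply lintegral_lintegral_swap
          exact (hF.mul ((hS.comp measurable_fst).pow_const _)).aemeasurable
      _ ≤ ∫⁻ y, (∫⁻ x, F x y ^ p ∂μ) ^ (1 / p) * I ^ (1 / q) ∂ν := by
          refine lintegral_mono fun y ↦ ?_
          refine (ENNReal.lintegral_mul_le_Lp_mul_Lq μ hpq
            (hF.comp measurable_prodMk_right).aemeasurable (hS.pow_const _).aemeasurable).trans_eq ?_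
          congr 2
          refine lintegral_congr fun x ↦ ?_
          rw [← ENNReal.rpow_mul, hpq.sub_one_mul_conj]
      _ = _ := by
          rw [lintegral_mul_const]
          exact (Measurable.lintegral_prod_left' (hF.pow_const p)).pow_const _
  rcases eq_or_ne I 0 with h0 | h0
  · rw [h0, ENNReal.zero_rpow_of_pos (by positivity)]; exact zero_le
  have h1 : I ^ (1 / q) ≠ 0 := by
    simp [h0, hfin]
  have h2 : I ^ (1 / q) ≠ ∞ := ENNReal.rpow_ne_top_of_nonneg (by have := hpq.symm.pos; positivity) hfin
  have h3 : I = I ^ (1 / p) * I ^ (1 / q) := by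
    rw [← ENNReal.rpow_add _ _ h0 hfin, one_div, one_div, hpq.inv_add_inv_eq_one, ENNReal.rpow_one]
  exact (ENNReal.mul_le_mul_iff_left h1 h2).1 (h3.symm.trans_le key)

/-- Cutting the inner integral off at height n and to a set of finite measure gives admissible
minorants; monotone convergence removes the cut. -/
theorem lintegral_rpow_lintegral_le [SigmaFinite μ] [SFinite ν] {p : ℝ} (hp : 1 ≤ p)
    {F : α → β → ℝ≥0∞} (hF : Measurable (Function.uncurry F)) :
    (∫⁻ x, (∫⁻ y, F x y ∂ν) ^ p ∂μ) ^ (1 / p) ≤ ∫⁻ y, (∫⁻ x, F x y ^ p ∂μ) ^ (1 / p) ∂ν := by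
  have hp0 : 0 < p := by linarith
  set T : α → ℝ≥0∞ := fun x ↦ ∫⁻ y, F x y ∂ν with hT
  have hTm : Measurable T := hF.lintegral_prod_right'
  set E := spanningSets μ with hE
  set S : ℕ → α → ℝ≥0∞ := fun n ↦ (E n).indicator (fun x ↦ min (T x) n) with hSdef
  have hSm : ∀ n, Measurable (S n) := fun n ↦
    (hTm.min measurable_const).indicator (measurableSet_spanningSets μ n)
  have hmono : Monotone S := by
    intro m n hmn x
    simp only [hSdef]
    refine (Set.indicator_le_indicator_of_subset (monotone_spanningSets μ hmn)
      (fun _ ↦ zero_le) x).trans ?_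
    refine Set.indicator_le_indicator' (fun _ ↦ ?_)
    exact min_le_min le_rfl (by exact_mod_cast hmn)
  have hST : ∀ n x, S n x ≤ T x := fun n x ↦ by
    simp only [hSdef]
    exact (Set.indicator_le_self _ _ x).trans (min_le_left _ _)
  have hsup : ∀ x, ⨆ n, S n x = T x := by
    intro x
    refine le_antisymm (iSup_le fun n ↦ hST n x) ?_
    have hx : x ∈ ⋃ n, E n := by rw [hE, iUnion_spanningSets]; trivial
    obtain ⟨m, hm⟩ := Set.mem_iUnion.1 hx
    refine le_of_forall_lt fun c hc ↦ ?_
    obtain ⟨k, hk⟩ := ENNReal.exists_nat_gt hc.ne_top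
    refine lt_of_lt_of_le ?_ (le_iSup (fun n ↦ S n x) (max m k))
    have : x ∈ E (max m k) := monotone_spanningSets μ (le_max_left _ _) hm
    simp only [hSdef, Set.indicator_of_mem this]
    refine lt_min hc (hk.trans_le ?_)
    exact_mod_cast le_max_right m k
  have hfin : ∀ n, ∫⁻ x, S n x ^ p ∂μ ≠ ∞ := by
    intro n
    have : ∫⁻ x, S n x ^ p ∂μ ≤ ∫⁻ x, (E n).indicator (fun _ ↦ (n : ℝ≥0∞) ^ p) x ∂μ := by
      refine lintegral_mono fun x ↦ ?_
      by_cases hx : x ∈ E n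
      · simp only [hSdef, Set.indicator_of_mem hx]
        exact ENNReal.rpow_le_rpow (min_le_right _ _) hp0.le
      · simp [hSdef, Set.indicator_of_notMem hx, hp0]
    refine ne_top_of_le_ne_top ?_ this
    rw [lintegral_indicator (measurableSet_spanningSets μ n)]
    simp only [lintegral_const, Measure.restrict_apply MeasurableSet.univ, Set.univ_inter]
    exact ENNReal.mul_ne_top (ENNReal.rpow_ne_top_of_nonneg hp0.le (by simp))
      (measure_spanningSets_lt_top μ n).ne
  have hlim : ∫⁻ x, T x ^ p ∂μ = ⨆ n, ∫⁻ x, S n x ^ p ∂μ := by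
    rw [← lintegral_iSup (fun n ↦ (hSm n).pow_const p)
      (fun m n hmn x ↦ ENNReal.rpow_le_rpow (hmono hmn x) hp0.le)]
    refine lintegral_congr fun x ↦ ?_
    rw [← hsup x]
    exact (ENNReal.orderIsoRpow p hp0).map_iSup _
  rw [hlim, one_div, ENNReal.rpow_inv_le_iff hp0]
  refine iSup_le fun n ↦ ?_
  rw [← ENNReal.rpow_inv_le_iff hp0, ← one_div]
  exact lintegral_rpow_le_of_le_lintegral hp hF (hSm n) (hST n) (hfin n)

/-- Minkowski's integral inequality. -/
theorem eLpNorm_lintegral_le [SigmaFinite μ] [SFinite ν] {p : ℝ≥0∞} (hp : 1 ≤ p) (hp' : p ≠ ∞)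
    {F : α → β → ℝ≥0∞} (hF : Measurable (Function.uncurry F)) :
    eLpNorm (fun x ↦ ∫⁻ y, F x y ∂ν) p μ ≤ ∫⁻ y, eLpNorm (fun x ↦ F x y) p μ ∂ν := by
  have h0 : p ≠ 0 := (zero_lt_one.trans_le hp).ne'
  simp only [eLpNorm_eq_eLpNorm' h0 hp', eLpNorm', enorm_eq_self]
  refine lintegral_rpow_lintegral_le ?_ hF
  rw [← ENNReal.toReal_one]
  exact ENNReal.toReal_mono hp' hp

/-- The triangle inequality for countable sums. -/
theorem eLpNorm_tsum_le [SigmaFinite μ] {ι : Type*} [Countable ι] {p : ℝ≥0∞} (hp : 1 ≤ p)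
    (hp' : p ≠ ∞) {F : ι → α → ℝ≥0∞} (hF : ∀ i, Measurable (F i)) :
    eLpNorm (fun x ↦ ∑' i, F i x) p μ ≤ ∑' i, eLpNorm (F i) p μ := by
  let _ : MeasurableSpace ι := ⊤
  have := eLpNorm_lintegral_le (μ := μ) (ν := Measure.count) hp hp' (F := fun x i ↦ F i x)
    (measurable_from_prod_countable_left fun i ↦ hF i)
  simpa [lintegral_count] using this

end Minkowski

/-! ### Sequence spaces -/

theorem eLpNorm_count_tsum_le {ι κ : Type*} [Countable ι] [Countable κ] [MeasurableSpace κ]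
    [MeasurableSingletonClass κ] {q : ℝ≥0∞} (hq : 1 ≤ q) (F : ι → κ → ℝ≥0∞) :
    eLpNorm (fun j ↦ ∑' i, F i j) q Measure.count ≤ ∑' i, eLpNorm (F i) q Measure.count := by
  by_cases h : q = ∞
  · subst h
    rw [eLpNorm_exponent_top]
    refine essSup_le_of_ae_le _ (Filter.Eventually.of_forall fun j ↦ ?_)
    simp only [enorm_eq_self]
    exact ENNReal.tsum_le_tsum fun i ↦ enorm_le_eLpNorm_count (F i) j (by simp)
  · exact eLpNorm_tsum_le hq h fun i ↦ measurable_of_countable _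

theorem eLpNorm_count_add_right (c : ℤ → ℝ≥0∞) (d : ℤ) (q : ℝ≥0∞) :
    eLpNorm (fun j ↦ c (j + d)) q Measure.count = eLpNorm c q Measure.count := by
  have h : MeasurePreserving (fun j : ℤ ↦ j + d) Measure.count Measure.count := by
    refine ⟨measurable_of_countable _, ?_⟩
    ext s hs
    rw [Measure.map_apply (measurable_of_countable _) hs, Measure.count_apply hs,
      Measure.count_apply (Set.to_countable _).measurableSet,
      ← (add_left_injective d).encard_image,
      Set.image_preimage_eq (f := fun x ↦ x + d) s (Equiv.addRight d).surjective]
  exact eLpNorm_comp_measurePreserving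
    (measurable_of_countable c).aestronglyMeasurable h

theorem eLpNorm_count_le_const_mul {a b : ℤ → ℝ≥0∞} {C : ℝ≥0∞} (hC : C ≠ ∞)
    (h : ∀ j, a j ≤ C * b j) (q : ℝ≥0∞) :
    eLpNorm a q Measure.count ≤ C * eLpNorm b q Measure.count := by
  lift C to ℝ≥0 using hC
  simpa using eLpNorm_le_mul_eLpNorm_of_ae_le_mul'' (f := a) (g := b) (c := (C : ℝ≥0∞)) q
    (measurable_of_countable b).aestronglyMeasurable
    (Filter.Eventually.of_forall fun j ↦ by simpa using h j)

/-- The basic estimate for a weighted sum of products of two sequences. -/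
theorem eLpNorm_count_weighted_le {q : ℝ≥0∞} (hq : 1 ≤ q) (β : ℤ × ℤ → ℝ≥0∞)
    (hβ : ∀ i, β i ≠ ∞) (a b : ℤ → ℝ≥0∞) :
    eLpNorm (fun j ↦ ∑' i : ℤ × ℤ, β i * (a (j + i.1) * b (j + i.1 + i.2))) q Measure.count ≤
      (∑' i, β i) * (eLpNorm a q Measure.count * eLpNorm b q Measure.count) := by
  have hq0 : q ≠ 0 := (zero_lt_one.trans_le hq).ne'
  refine (eLpNorm_count_tsum_le hq
    (fun i : ℤ × ℤ ↦ fun j ↦ β i * (a (j + i.1) * b (j + i.1 + i.2)))).trans ?_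
  rw [← ENNReal.tsum_mul_right]
  refine ENNReal.tsum_le_tsum fun i ↦ ?_
  refine (eLpNorm_count_le_const_mul (b := fun j ↦ a (j + i.1) * b (j + i.1 + i.2)) (hβ i)
    (fun _ ↦ le_rfl) q).trans ?_
  gcongr
  -- For infinite ‖a‖ the bound is trivial unless ‖b‖ = 0, and then b vanishes identically.
  -- Otherwise ℓ^q ⊂ ℓ^∞ replaces a by its norm, and the shift of b costs nothing.
  by_cases ha : eLpNorm a q Measure.count = ∞
  · rcases eq_or_ne (eLpNorm b q Measure.count) 0 with hb | hb
    · have : ∀ j, b j = 0 := fun j ↦ by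
        have := enorm_le_eLpNorm_count b j hq0
        rw [hb] at this
        simpa using this
      simp [this]
    · rw [ha, ENNReal.top_mul hb]; exact le_top
  refine (eLpNorm_count_le_const_mul (b := fun j ↦ b (j + (i.1 + i.2))) ha (fun j ↦ ?_) q).trans ?_
  · rw [add_assoc]
    gcongr
    simpa using enorm_le_eLpNorm_count a (j + i.1) hq0
  · rw [eLpNorm_count_add_right]

/-! ### Convolution with bounded continuous functions -/

/-- The function is continuous and bounded. -/
def BddCont (G : Plane → ℂ) : Prop := Continuous G ∧ ∃ C, ∀ x, ‖G x‖ ≤ C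

/-- The convolution `K * G`. -/
def cv (K G : Plane → ℂ) (x : Plane) : ℂ := ∫ y, K y * G (x - y)

theorem cv_eq (K G : Plane → ℂ) (x : Plane) : cv K G x = ∫ y, K (x - y) * G y := by
  rw [cv, ← integral_sub_left_eq_self (fun y ↦ K y * G (x - y)) volume x]
  simp

namespace BddCont

variable {G H : Plane → ℂ}

theorem exists_pos (hG : BddCont G) : ∃ C, 0 < C ∧ ∀ x, ‖G x‖ ≤ C := by
  obtain ⟨C, hC⟩ := hG.2
  exact ⟨max C 1, by positivity, fun x ↦ (hC x).trans (le_max_left _ _)⟩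

theorem add (hG : BddCont G) (hH : BddCont H) : BddCont (fun x ↦ G x + H x) := by
  obtain ⟨C, hC⟩ := hG.2
  obtain ⟨D, hD⟩ := hH.2
  exact ⟨hG.1.add hH.1, C + D, fun x ↦ (norm_add_le _ _).trans (add_le_add (hC x) (hD x))⟩

theorem mul (hG : BddCont G) (hH : BddCont H) : BddCont (fun x ↦ G x * H x) := by
  obtain ⟨C, hC0, hC⟩ := hG.exists_pos
  obtain ⟨D, hD⟩ := hH.2
  refine ⟨hG.1.mul hH.1, C * D, fun x ↦ ?_⟩
  rw [norm_mul]
  exact mul_le_mul (hC x) (hD x) (norm_nonneg _) hC0.le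

theorem const_mul (hG : BddCont G) (c : ℂ) : BddCont (fun x ↦ c * G x) :=
  mul (G := fun _ ↦ c) ⟨continuous_const, ‖c‖, fun _ ↦ le_rfl⟩ hG

theorem sub (hG : BddCont G) (hH : BddCont H) : BddCont (fun x ↦ G x - H x) := by
  simpa [sub_eq_add_neg] using hG.add (hH.const_mul (-1))

theorem zero : BddCont (fun _ ↦ 0) := ⟨continuous_const, 0, by simp⟩

theorem comp_sub_left (hG : BddCont G) (x : Plane) : BddCont (fun y ↦ G (x - y)) :=
  ⟨hG.1.comp (continuous_const.sub continuous_id), hG.2.imp fun _ h _ ↦ h _⟩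

theorem integrable_mul (hG : BddCont G) {K : Plane → ℂ} (hK : Integrable K) :
    Integrable (fun y ↦ K y * G y) := by
  obtain ⟨C, hC⟩ := hG.2
  exact hK.mul_bdd hG.1.aestronglyMeasurable (Filter.Eventually.of_forall hC)

theorem integrable_cv (hG : BddCont G) {K : Plane → ℂ} (hK : Integrable K) (x : Plane) :
    Integrable (fun y ↦ K y * G (x - y)) :=
  (hG.comp_sub_left x).integrable_mul hK

theorem norm_cv_le {C : ℝ} (hC : ∀ x, ‖G x‖ ≤ C) {K : Plane → ℂ}
    (hK : Integrable K) (x : Plane) : ‖cv K G x‖ ≤ (∫ y, ‖K y‖) * C := by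
  rw [cv, ← integral_mul_const]
  refine norm_integral_le_of_norm_le (hK.norm.mul_const C) (Filter.Eventually.of_forall fun y ↦ ?_)
  rw [norm_mul]
  gcongr
  exact hC _

theorem cv (hG : BddCont G) {K : Plane → ℂ} (hK : Integrable K) : BddCont (cv K G) := by
  obtain ⟨C, hC0, hC⟩ := hG.exists_pos
  refine ⟨?_, _, norm_cv_le hC hK⟩
  refine continuous_of_dominated (bound := fun y ↦ ‖K y‖ * C) ?_ ?_ (hK.norm.mul_const C) ?_
  · exact fun x ↦ (hG.integrable_cv hK x).aestronglyMeasurable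
  · refine fun x ↦ Filter.Eventually.of_forall fun y ↦ ?_
    rw [norm_mul]
    gcongr
    exact hC _
  · exact Filter.Eventually.of_forall fun y ↦
      continuous_const.mul (hG.1.comp (continuous_id.sub continuous_const))

end BddCont

theorem bddCont_schwartz (ψ : 𝓢(Plane, ℂ)) : BddCont ψ :=
  ⟨ψ.continuous, _, fun x ↦ SchwartzMap.norm_le_seminorm ℂ ψ x⟩

section Linear

variable {K K' G G' : Plane → ℂ}

theorem cv_sub_left (hK : Integrable K) (hK' : Integrable K') (hG : BddCont G) (x : Plane) :
    cv (fun y ↦ K y - K' y) G x = cv K G x - cv K' G x := by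
  simp only [cv, sub_mul]
  exact integral_sub (hG.integrable_cv hK x) (hG.integrable_cv hK' x)

theorem cv_add_right (hK : Integrable K) (hG : BddCont G) (hG' : BddCont G') (x : Plane) :
    cv K (fun y ↦ G y + G' y) x = cv K G x + cv K G' x := by
  simp only [cv, mul_add]
  exact integral_add (hG.integrable_cv hK x) (hG'.integrable_cv hK x)

theorem cv_const_mul_right (c : ℂ) (x : Plane) :
    cv K (fun y ↦ c * G y) x = c * cv K G x := by
  simp only [cv, mul_left_comm _ c]
  exact integral_const_mul _ _

theorem cv_sub_right (hK : Integrable K) (hG : BddCont G) (hG' : BddCont G') (x : Plane) :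
    cv K (fun y ↦ G y - G' y) x = cv K G x - cv K G' x := by
  simp only [cv, mul_sub]
  exact integral_sub (hG.integrable_cv hK x) (hG'.integrable_cv hK x)

theorem cv_zero_left (x : Plane) : cv (fun _ ↦ 0) G x = 0 := by simp [cv]

theorem cv_zero_right (x : Plane) : cv K (fun _ ↦ 0) x = 0 := by simp [cv]

end Linear

/-- The convolution of two Schwartz functions. -/
def sconv (K L : 𝓢(Plane, ℂ)) : 𝓢(Plane, ℂ) :=
  SchwartzMap.convolution (ContinuousLinearMap.mul ℂ ℂ) K L

theorem sconv_apply (K L : 𝓢(Plane, ℂ)) (x : Plane) : sconv K L x = cv K L x := by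
  rw [sconv, SchwartzMap.convolution_apply]
  rfl

theorem fourier_sconv (K L : 𝓢(Plane, ℂ)) (ξ : Plane) :
    𝓕 (sconv K L) ξ = 𝓕 K ξ * 𝓕 L ξ := by
  rw [sconv, SchwartzMap.fourier_convolution]
  rfl

theorem schwartz_ext_fourier {K L : 𝓢(Plane, ℂ)} (h : ∀ ξ, 𝓕 K ξ = 𝓕 L ξ) : K = L := by
  have h1 : 𝓕 K = 𝓕 L := SchwartzMap.ext h
  have h2 := congrArg (fun f ↦ 𝓕⁻ f) h1
  simpa using h2

theorem cv_cv (K L : 𝓢(Plane, ℂ)) {G : Plane → ℂ} (hG : BddCont G) (x : Plane) :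
    cv K (cv L G) x = cv (sconv K L) G x := by
  obtain ⟨C, hC0, hC⟩ := hG.exists_pos
  have hint : Integrable (fun p : Plane × Plane ↦ K p.1 * (L (p.2 - p.1) * G (x - p.2)))
      (volume.prod volume) := by
    have h1 : Integrable (fun p : Plane × Plane ↦ K p.2 * L (p.1 - p.2)) (volume.prod volume) :=
      K.integrable.convolution_integrand (ContinuousLinearMap.mul ℂ ℂ) L.integrable
    have h2 := h1.swap.mul_bdd (g := fun p : Plane × Plane ↦ G (x - p.2)) (c := C)
      (hG.1.comp (continuous_const.sub continuous_snd)).aestronglyMeasurable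
      (Filter.Eventually.of_forall fun p ↦ hC _)
    refine h2.congr (Filter.Eventually.of_forall fun p ↦ ?_)
    simp [mul_assoc]
  calc cv K (cv L G) x = ∫ y, ∫ z, K y * (L (z - y) * G (x - z)) := by
        rw [cv]
        refine integral_congr_ae (Filter.Eventually.of_forall fun y ↦ ?_)
        simp only
        rw [integral_const_mul, cv, ← integral_sub_right_eq_self _ y]
        simp
    _ = ∫ z, ∫ y, K y * (L (z - y) * G (x - z)) := integral_integral_swap hint
    _ = _ := by
        rw [cv]
        refine integral_congr_ae (Filter.Eventually.of_forall fun z ↦ ?_)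
        simp only
        rw [sconv_apply, cv, ← integral_mul_const]
        simp [mul_assoc]

theorem integral_cv_mul {K ψ G : Plane → ℂ} (hK : Integrable K) (hψ : Integrable ψ)
    (hG : BddCont G) :
    ∫ x, cv K G x * ψ x = ∫ x, G x * cv (fun y ↦ K (-y)) ψ x := by
  obtain ⟨C, hC0, hC⟩ := hG.exists_pos
  have hint : Integrable (fun p : Plane × Plane ↦ (K p.2 * G (p.1 - p.2)) * ψ p.1)
      (volume.prod volume) := by
    have h1 : Integrable (fun p : Plane × Plane ↦ ψ p.1 * K p.2) (volume.prod volume) :=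
      hψ.mul_prod hK
    have h2 := h1.mul_bdd (g := fun p : Plane × Plane ↦ G (p.1 - p.2)) (c := C)
      (hG.1.comp (continuous_fst.sub continuous_snd)).aestronglyMeasurable
      (Filter.Eventually.of_forall fun p ↦ hC _)
    refine h2.congr (Filter.Eventually.of_forall fun p ↦ ?_)
    simp only
    ring
  -- The shear (y, x) ↦ (y, y + x) preserves measure, so integrability survives the change of
  -- variables.
  have hint2 : Integrable (fun p : Plane × Plane ↦ (K p.1 * G p.2) * ψ (p.2 + p.1))
      (volume.prod volume) := by
    have h := (measurePreserving_prod_add (volume : Measure Plane)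
      (volume : Measure Plane)).integrable_comp_of_integrable hint.swap
    refine h.congr (Filter.Eventually.of_forall fun p ↦ ?_)
    simp [add_comm]
  calc ∫ x, cv K G x * ψ x = ∫ x, ∫ y, (K y * G (x - y)) * ψ x := by
        simp only [cv, integral_mul_const]
    _ = ∫ y, ∫ x, (K y * G (x - y)) * ψ x := integral_integral_swap hint
    _ = ∫ y, ∫ x, (K y * G x) * ψ (x + y) := by
        refine integral_congr_ae (Filter.Eventually.of_forall fun y ↦ ?_)
        simp only
        rw [← integral_add_right_eq_self _ y]
        simp
    _ = ∫ x, ∫ y, (K y * G x) * ψ (x + y) := integral_integral_swap hint2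
    _ = _ := by
        refine integral_congr_ae (Filter.Eventually.of_forall fun x ↦ ?_)
        simp only
        rw [cv, ← integral_const_mul, ← integral_neg_eq_self]
        refine integral_congr_ae (Filter.Eventually.of_forall fun y ↦ ?_)
        simp only [← sub_eq_add_neg]
        ring

theorem enorm_cv_le (K G : Plane → ℂ) (x : Plane) :
    ‖cv K G x‖ₑ ≤ ∫⁻ y, ‖K y‖ₑ * ‖G (x - y)‖ₑ := by
  refine (enorm_integral_le_lintegral_enorm _).trans_eq ?_
  simp only [enorm_mul]

theorem eLpNorm_comp_sub_right {G : Plane → ℂ} (hG : Continuous G) (y : Plane) (p : ℝ≥0∞) :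
    eLpNorm (fun x ↦ G (x - y)) p volume = eLpNorm G p volume :=
  eLpNorm_comp_measurePreserving hG.aestronglyMeasurable (measurePreserving_sub_right volume y)

/-- Young's inequality for an integrable kernel. -/
theorem eLpNorm_cv_le {p : ℝ≥0∞} (hp : 1 ≤ p) (hp' : p ≠ ∞) {K G : Plane → ℂ} (hK : Continuous K)
    (hG : Continuous G) :
    eLpNorm (cv K G) p volume ≤ (∫⁻ y, ‖K y‖ₑ) * eLpNorm G p volume := by
  have hF : Measurable (Function.uncurry fun x y : Plane ↦ ‖K y‖ₑ * ‖G (x - y)‖ₑ) := by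
    exact (hK.measurable.comp measurable_snd).enorm.mul
      (hG.measurable.comp (measurable_fst.sub measurable_snd)).enorm
  calc eLpNorm (cv K G) p volume
      ≤ eLpNorm (fun x ↦ ∫⁻ y, ‖K y‖ₑ * ‖G (x - y)‖ₑ) p volume :=
        eLpNorm_mono_enorm fun x ↦ by simpa using enorm_cv_le K G x
    _ ≤ ∫⁻ y, eLpNorm (fun x ↦ ‖K y‖ₑ * ‖G (x - y)‖ₑ) p volume := eLpNorm_lintegral_le hp hp' hF
    _ = ∫⁻ y, ‖K y‖ₑ * eLpNorm G p volume := by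
        refine lintegral_congr fun y ↦ ?_
        rw [← eLpNorm_comp_sub_right hG y p]
        have : eLpNorm (fun x ↦ K y * G (x - y)) p volume =
            ‖K y‖ₑ * eLpNorm (fun x ↦ G (x - y)) p volume :=
          eLpNorm_const_smul (K y) (fun x ↦ G (x - y)) p volume
        rw [← this]
        refine eLpNorm_congr_enorm_ae (Filter.Eventually.of_forall fun x ↦ ?_)
        simp
    _ = _ := lintegral_mul_const _ hK.measurable.enorm

/-! ### Translations of Schwartz functions -/

/-- The translate `y ↦ R (y - x)`. -/
def trans (R : 𝓢(Plane, ℂ)) (x : Plane) : 𝓢(Plane, ℂ) := R.compSubConstCLM ℂ x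

theorem trans_apply (R : 𝓢(Plane, ℂ)) (x y : Plane) : trans R x y = R (y - x) := rfl

theorem iteratedFDeriv_trans (R : 𝓢(Plane, ℂ)) (x y : Plane) (n : ℕ) :
    iteratedFDeriv ℝ n (trans R x) y = iteratedFDeriv ℝ n R (y - x) := by
  have : (trans R x : Plane → ℂ) = fun z ↦ R (z - x) := rfl
  rw [this, iteratedFDeriv_comp_sub]

theorem pow_norm_le_of_norm_le {y z : Plane} {M : ℝ} (h : ‖y‖ ≤ ‖z‖ + M) (hM : 0 ≤ M) (k : ℕ) :
    ‖y‖ ^ k ≤ 2 ^ k * (‖z‖ ^ k + M ^ k) := by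
  calc ‖y‖ ^ k ≤ (‖z‖ + M) ^ k := by gcongr
    _ ≤ 2 ^ (k - 1) * (‖z‖ ^ k + M ^ k) := add_pow_le (norm_nonneg _) hM k
    _ ≤ 2 ^ k * (‖z‖ ^ k + M ^ k) := by
        gcongr
        · norm_num
        · omega

theorem norm_pow_mul_iteratedFDeriv_le (R : 𝓢(Plane, ℂ)) {y z : Plane} {M : ℝ}
    (h : ‖y‖ ≤ ‖z‖ + M) (hM : 0 ≤ M) (k n : ℕ) :
    ‖y‖ ^ k * ‖iteratedFDeriv ℝ n R z‖ ≤
      2 ^ k * (SchwartzMap.seminorm ℂ k n R + M ^ k * SchwartzMap.seminorm ℂ 0 n R) := by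
  have h1 := SchwartzMap.le_seminorm ℂ k n R z
  have h2 := SchwartzMap.norm_iteratedFDeriv_le_seminorm ℂ R n z
  calc ‖y‖ ^ k * ‖iteratedFDeriv ℝ n R z‖
      ≤ (2 ^ k * (‖z‖ ^ k + M ^ k)) * ‖iteratedFDeriv ℝ n R z‖ := by
        gcongr; exact pow_norm_le_of_norm_le h hM k
    _ = 2 ^ k * (‖z‖ ^ k * ‖iteratedFDeriv ℝ n R z‖ + M ^ k * ‖iteratedFDeriv ℝ n R z‖) := by ring
    _ ≤ _ := by gcongr

theorem seminorm_trans_le (R : 𝓢(Plane, ℂ)) (x : Plane) (k n : ℕ) :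
    SchwartzMap.seminorm ℂ k n (trans R x) ≤
      2 ^ k * (SchwartzMap.seminorm ℂ k n R + ‖x‖ ^ k * SchwartzMap.seminorm ℂ 0 n R) := by
  refine SchwartzMap.seminorm_le_bound ℂ k n _ (by positivity) fun y ↦ ?_
  rw [iteratedFDeriv_trans]
  refine norm_pow_mul_iteratedFDeriv_le R ?_ (norm_nonneg _) k n
  calc ‖y‖ = ‖(y - x) + x‖ := by simp
    _ ≤ _ := norm_add_le _ _

/-- Mean value inequality along the segment from y - x₀ to y - x: each of its points z satisfies ‖y‖
≤ ‖z‖ + ‖x‖ + ‖x₀‖, so the weight ‖y‖^k can be moved to z. This makes translation continuous in the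
Schwartz topology. -/
theorem seminorm_trans_sub_le (R : 𝓢(Plane, ℂ)) (x x₀ : Plane) (k n : ℕ) :
    SchwartzMap.seminorm ℂ k n (trans R x - trans R x₀) ≤
      2 ^ k * (SchwartzMap.seminorm ℂ k (n + 1) R +
        (‖x‖ + ‖x₀‖) ^ k * SchwartzMap.seminorm ℂ 0 (n + 1) R) * ‖x - x₀‖ := by
  refine SchwartzMap.seminorm_le_bound ℂ k n _ (by positivity) fun y ↦ ?_
  have e : iteratedFDeriv ℝ n (trans R x - trans R x₀ : 𝓢(Plane, ℂ)) y =
      iteratedFDeriv ℝ n R (y - x) - iteratedFDeriv ℝ n R (y - x₀) := by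
    rw [← iteratedFDeriv_trans, ← iteratedFDeriv_trans]
    exact iteratedFDeriv_sub_apply ((trans R x).smooth n).contDiffAt
      ((trans R x₀).smooth n).contDiffAt
  rw [e]
  -- For y ≠ 0 one divides by ‖y‖^k. At y = 0 only k = 0 has content, and there the unweighted mean
  -- value inequality is used.
  rcases eq_or_ne y 0 with rfl | hy
  swap
  · have hyk : 0 < ‖y‖ ^ k := by positivity
    have := (convex_segment (y - x₀) (y - x)).norm_image_sub_le_of_norm_hasFDerivWithin_le
      (f := iteratedFDeriv ℝ n R) (f' := fun z ↦ fderiv ℝ (iteratedFDeriv ℝ n R) z)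
      (C := (2 ^ k * (SchwartzMap.seminorm ℂ k (n + 1) R +
        (‖x‖ + ‖x₀‖) ^ k * SchwartzMap.seminorm ℂ 0 (n + 1) R)) / ‖y‖ ^ k) ?_ ?_
      (left_mem_segment ℝ _ _) (right_mem_segment ℝ _ _)
    · rw [show y - x - (y - x₀) = -(x - x₀) by abel, norm_neg, div_mul_eq_mul_div,
        le_div_iff₀ hyk] at this
      linarith
    · intro z _
      exact ((R.smooth (n + 1)).differentiable_iteratedFDeriv (by norm_cast; simp) z).hasFDerivAt.hasFDerivWithinAt
    · intro z hz
      rw [norm_fderiv_iteratedFDeriv, le_div_iff₀ hyk, mul_comm]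
      refine norm_pow_mul_iteratedFDeriv_le R ?_ (by positivity) k (n + 1)
      obtain ⟨a, b, ha, hb, hab, rfl⟩ := hz
      have : y = (a • (y - x₀) + b • (y - x)) + (a • x₀ + b • x) := by
        rw [smul_sub, smul_sub]
        nth_rewrite 1 [← one_smul ℝ y, ← hab, add_smul]
        abel
      calc ‖y‖ = ‖(a • (y - x₀) + b • (y - x)) + (a • x₀ + b • x)‖ := by rw [← this]
        _ ≤ ‖a • (y - x₀) + b • (y - x)‖ + ‖a • x₀ + b • x‖ := norm_add_le _ _
        _ ≤ ‖a • (y - x₀) + b • (y - x)‖ + (‖x‖ + ‖x₀‖) := by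
            gcongr
            refine (norm_add_le _ _).trans ?_
            rw [norm_smul, norm_smul, Real.norm_of_nonneg ha, Real.norm_of_nonneg hb]
            have h1 : a * ‖x₀‖ ≤ ‖x₀‖ := mul_le_of_le_one_left (norm_nonneg _) (by linarith)
            have h2 : b * ‖x‖ ≤ ‖x‖ := mul_le_of_le_one_left (norm_nonneg _) (by linarith)
            linarith
  · rcases Nat.eq_zero_or_pos k with rfl | hk
    swap
    · rw [norm_zero, zero_pow hk.ne', zero_mul]; positivity
    have := (convex_univ (𝕜 := ℝ) (E := Plane)).norm_image_sub_le_of_norm_hasFDerivWithin_le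
      (f := iteratedFDeriv ℝ n R) (f' := fun z ↦ fderiv ℝ (iteratedFDeriv ℝ n R) z)
      (C := SchwartzMap.seminorm ℂ 0 (n + 1) R) (x := 0 - x₀) (y := 0 - x)
      (fun z _ ↦ ((R.smooth (n + 1)).differentiable_iteratedFDeriv (by norm_cast; simp)
        z).hasFDerivAt.hasFDerivWithinAt) (fun z _ ↦ by
        rw [norm_fderiv_iteratedFDeriv]
        exact SchwartzMap.norm_iteratedFDeriv_le_seminorm ℂ R (n + 1) z)
      (Set.mem_univ _) (Set.mem_univ _)
    rw [show (0 : Plane) - x - (0 - x₀) = -(x - x₀) by abel, norm_neg] at this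
    have h3 : 0 ≤ SchwartzMap.seminorm ℂ 0 (n + 1) R * ‖x - x₀‖ := by positivity
    simp only [pow_zero, one_mul]
    linarith

theorem continuous_trans (R : 𝓢(Plane, ℂ)) : Continuous (trans R) := by
  refine continuous_iff_continuousAt.2 fun x₀ ↦ ?_
  rw [ContinuousAt, (schwartz_withSeminorms ℂ Plane ℂ).tendsto_nhds]
  rintro ⟨k, n⟩ ε hε
  have h : Filter.Tendsto (fun x ↦ 2 ^ k * (SchwartzMap.seminorm ℂ k (n + 1) R +
        (‖x‖ + ‖x₀‖) ^ k * SchwartzMap.seminorm ℂ 0 (n + 1) R) * ‖x - x₀‖) (nhds x₀) (nhds 0) := by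
    have : Continuous (fun x ↦ 2 ^ k * (SchwartzMap.seminorm ℂ k (n + 1) R +
        (‖x‖ + ‖x₀‖) ^ k * SchwartzMap.seminorm ℂ 0 (n + 1) R) * ‖x - x₀‖) := by fun_prop
    simpa using this.tendsto x₀
  filter_upwards [h.eventually (gt_mem_nhds hε)] with x hx
  exact (seminorm_trans_sub_le R x x₀ k n).trans_lt hx

theorem lineDeriv_sconv (K R : 𝓢(Plane, ℂ)) (m : Plane) :
    ∂_{m} (sconv K R) = sconv K (∂_{m} R) := by
  have hg : (fun x : Plane ↦ (inner ℝ x m : ℝ)).HasTemperateGrowth := by fun_prop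
  refine schwartz_ext_fourier fun ξ ↦ ?_
  rw [fourier_sconv, SchwartzMap.fourier_lineDerivOp_eq, SchwartzMap.fourier_lineDerivOp_eq]
  simp only [_root_.smul_apply, SchwartzMap.smulLeftCLM_apply_apply hg, fourier_sconv,
    smul_eq_mul, Complex.real_smul]
  ring

theorem iteratedLineDeriv_sconv (K R : 𝓢(Plane, ℂ)) (n : ℕ) (m : Fin n → Plane) :
    ∂^{m} (sconv K R) = sconv K (∂^{m} R) := by
  induction n with
  | zero => simp [LineDeriv.iteratedLineDerivOp_fin_zero]
  | succ n ih => rw [LineDeriv.iteratedLineDerivOp_succ_left, ih, lineDeriv_sconv, LineDeriv.iteratedLineDerivOp_succ_left]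

/-! ### Embedding into spaces of bounded continuous functions -/

/-- The space of continuous multilinear forms of `n` variables, with the operator norm. -/
def MultiForm (n : ℕ) : Type := Plane [×n]→L[ℝ] ℂ

instance (n : ℕ) : NormedAddCommGroup (MultiForm n) :=
  inferInstanceAs (NormedAddCommGroup (Plane [×n]→L[ℝ] ℂ))

instance (n : ℕ) : NormedSpace ℂ (MultiForm n) :=
  inferInstanceAs (NormedSpace ℂ (Plane [×n]→L[ℝ] ℂ))

instance (n : ℕ) : CompleteSpace (MultiForm n) :=
  inferInstanceAs (CompleteSpace (Plane [×n]→L[ℝ] ℂ))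

/-- Evaluation of multilinear forms. -/
def MultiForm.eval {n : ℕ} (m : Fin n → Plane) : MultiForm n →L[ℂ] ℂ :=
  LinearMap.mkContinuous
    { toFun := fun M : Plane [×n]→L[ℝ] ℂ ↦ M m
      map_add' := fun _ _ ↦ rfl
      map_smul' := fun _ _ ↦ rfl } (∏ i, ‖m i‖) fun M ↦ by
      rw [mul_comm]
      exact ContinuousMultilinearMap.le_opNorm (M : Plane [×n]→L[ℝ] ℂ) m

/-- The `n`-th derivative as a multilinear form. -/
def multiDeriv (n : ℕ) (ψ : 𝓢(Plane, ℂ)) (y : Plane) : MultiForm n := iteratedFDeriv ℝ n ψ y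

theorem continuous_multiDeriv (n : ℕ) (ψ : 𝓢(Plane, ℂ)) : Continuous (multiDeriv n ψ) :=
  (ψ.smooth n).continuous_iteratedFDeriv (m := n) le_rfl

theorem multiDeriv_add (n : ℕ) (ψ χ : 𝓢(Plane, ℂ)) (y : Plane) :
    multiDeriv n (ψ + χ) y = multiDeriv n ψ y + multiDeriv n χ y :=
  iteratedFDeriv_add_apply (ψ.smooth n).contDiffAt (χ.smooth n).contDiffAt

theorem multiDeriv_smul (n : ℕ) (c : ℂ) (ψ : 𝓢(Plane, ℂ)) (y : Plane) :
    multiDeriv n (c • ψ) y = c • multiDeriv n ψ y :=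
  iteratedFDeriv_const_smul_apply (ψ.smooth n).contDiffAt

/-- The function `y ↦ ‖y‖ ^ k • D^n ψ (y)`. -/
def weighted (k n : ℕ) : 𝓢(Plane, ℂ) →ₗ[ℂ] BoundedContinuousFunction Plane (MultiForm n) where
  toFun ψ := BoundedContinuousFunction.ofNormedAddCommGroup
    (fun y ↦ ((‖y‖ ^ k : ℝ) : ℂ) • multiDeriv n ψ y)
    (by
      have := continuous_multiDeriv n ψ
      fun_prop) (SchwartzMap.seminorm ℂ k n ψ) fun y ↦ by
      rw [norm_smul, Complex.norm_real, Real.norm_of_nonneg (by positivity)]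
      exact SchwartzMap.le_seminorm ℂ k n ψ y
  map_add' ψ χ := by
    ext1 y
    simp only [BoundedContinuousFunction.coe_ofNormedAddCommGroup,
      BoundedContinuousFunction.add_apply, multiDeriv_add, smul_add]
  map_smul' c ψ := by
    ext1 y
    simp only [BoundedContinuousFunction.coe_ofNormedAddCommGroup,
      BoundedContinuousFunction.smul_apply, RingHom.id_apply, multiDeriv_smul]
    rw [smul_comm]

theorem weighted_apply (k n : ℕ) (ψ : 𝓢(Plane, ℂ)) (y : Plane) :
    weighted k n ψ y = ((‖y‖ ^ k : ℝ) : ℂ) • multiDeriv n ψ y := rfl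

theorem norm_weighted (k n : ℕ) (ψ : 𝓢(Plane, ℂ)) :
    ‖weighted k n ψ‖ = SchwartzMap.seminorm ℂ k n ψ := by
  apply le_antisymm
  · refine (BoundedContinuousFunction.norm_le (by positivity)).2 fun y ↦ ?_
    rw [weighted_apply, norm_smul, Complex.norm_real, Real.norm_of_nonneg (by positivity)]
    exact SchwartzMap.le_seminorm ℂ k n ψ y
  · refine SchwartzMap.seminorm_le_bound ℂ k n _ (norm_nonneg _) fun y ↦ ?_
    have := (weighted k n ψ).norm_coe_le_norm y
    rwa [weighted_apply, norm_smul, Complex.norm_real, Real.norm_of_nonneg (by positivity)] at this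

theorem norm_le_sum_seminorm (u : 𝓢'(Plane, ℂ)) :
    ∃ (s : Finset (ℕ × ℕ)) (C : ℝ), 0 ≤ C ∧
      ∀ ψ, ‖u ψ‖ ≤ C * ∑ i ∈ s, SchwartzMap.seminorm ℂ i.1 i.2 ψ := by
  obtain ⟨s, C, -, h⟩ := Seminorm.bound_of_continuous (schwartz_withSeminorms ℂ Plane ℂ)
    ((normSeminorm ℂ ℂ).comp (u : 𝓢(Plane, ℂ) →L[ℂ] ℂ).toLinearMap) (by
      have := u.continuous
      exact continuous_norm.comp this)
  refine ⟨s, C, C.2, fun ψ ↦ (h ψ).trans ?_⟩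
  simp only [_root_.smul_apply, NNReal.smul_def, smul_eq_mul]
  gcongr
  refine Seminorm.finset_sup_apply_le (Finset.sum_nonneg fun i _ ↦ apply_nonneg _ _) fun i hi ↦ ?_
  exact Finset.single_le_sum (f := fun i : ℕ × ℕ ↦ SchwartzMap.seminorm ℂ i.1 i.2 ψ)
    (fun i _ ↦ apply_nonneg _ _) hi

theorem continuous_distribution_trans (u : 𝓢'(Plane, ℂ)) (R : 𝓢(Plane, ℂ)) :
    Continuous fun x ↦ u (trans R x) := u.continuous.comp (continuous_trans R)

theorem continuous_weighted_trans (k n : ℕ) (R : 𝓢(Plane, ℂ)) :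
    Continuous fun x ↦ weighted k n (trans R x) := by
  refine continuous_iff_continuousAt.2 fun x₀ ↦ ?_
  rw [ContinuousAt, tendsto_iff_norm_sub_tendsto_zero]
  simp only [← map_sub, norm_weighted]
  have h : Continuous fun x ↦ SchwartzMap.seminorm ℂ k n (trans R x - trans R x₀) :=
    ((schwartz_withSeminorms ℂ Plane ℂ).continuous_seminorm (k, n)).comp
      ((continuous_trans R).sub continuous_const)
  simpa using h.tendsto x₀

theorem integrable_weighted_trans (K R : 𝓢(Plane, ℂ)) (k n : ℕ) :
    Integrable fun x ↦ K x • weighted k n (trans R x) := by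
  have h1 : Integrable fun x ↦ 2 ^ k * (‖K x‖ * SchwartzMap.seminorm ℂ k n R +
      ‖x‖ ^ k * ‖K x‖ * SchwartzMap.seminorm ℂ 0 n R) :=
    ((K.integrable.norm.mul_const _).add ((K.integrable_pow_mul volume k).mul_const _)).const_mul _
  refine h1.mono' (K.continuous.smul (continuous_weighted_trans k n R)).aestronglyMeasurable
    (Filter.Eventually.of_forall fun x ↦ ?_)
  rw [norm_smul, norm_weighted]
  refine (mul_le_mul_of_nonneg_left (seminorm_trans_le R x k n) (norm_nonneg _)).trans_eq ?_
  ring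

theorem weighted_sconv (K R : 𝓢(Plane, ℂ)) (k n : ℕ) :
    weighted k n (sconv K R) = ∫ x, K x • weighted k n (trans R x) := by
  ext1 y
  refine ContinuousMultilinearMap.ext fun m ↦ ?_
  have h := ((MultiForm.eval m).comp (BoundedContinuousFunction.evalCLM ℂ y)).integral_comp_comm
    (integrable_weighted_trans K R k n)
  refine Eq.trans ?_ h
  have h2 : ∀ x, ((MultiForm.eval m).comp (BoundedContinuousFunction.evalCLM ℂ y))
      (K x • weighted k n (trans R x)) = ((‖y‖ ^ k : ℝ) : ℂ) * (K x * (∂^{m} R) (y - x)) := by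
    intro x
    have : ((MultiForm.eval m).comp (BoundedContinuousFunction.evalCLM ℂ y))
      (K x • weighted k n (trans R x)) =
      K x * (((‖y‖ ^ k : ℝ) : ℂ) * iteratedFDeriv ℝ n (trans R x) y m) := rfl
    rw [this, iteratedFDeriv_trans, SchwartzMap.iteratedLineDerivOp_eq_iteratedFDeriv]
    ring
  simp only [h2]
  refine Eq.trans (b := ((‖y‖ ^ k : ℝ) : ℂ) * iteratedFDeriv ℝ n (sconv K R) y m) rfl ?_
  rw [← SchwartzMap.iteratedLineDerivOp_eq_iteratedFDeriv, iteratedLineDeriv_sconv,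
    sconv_apply, integral_const_mul, cv]

/-- A tempered distribution commutes with the integral that defines a convolution. -/
theorem distribution_sconv (u : 𝓢'(Plane, ℂ)) (K R : 𝓢(Plane, ℂ)) :
    u (sconv K R) = ∫ x, K x * u (trans R x) := by
  obtain ⟨s, C, hC0, hC⟩ := norm_le_sum_seminorm u
  -- The Schwartz space is not normed, so Bochner integration is moved elsewhere: u is controlled by
  -- finitely many seminorms, hence factors through the map Λ into a finite product of Banach spaces
  -- in which those seminorms are norms.
  let X := ∀ i : s, BoundedContinuousFunction Plane (MultiForm i.1.2)
  let Λ : 𝓢(Plane, ℂ) →ₗ[ℂ] X := LinearMap.pi fun i ↦ weighted i.1.1 i.1.2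
  have hΛ : ∀ ψ, ‖u ψ‖ ≤ (C * s.card) * ‖Λ ψ‖ := by
    intro ψ
    refine (hC ψ).trans ?_
    rw [mul_assoc]
    gcongr
    rw [← nsmul_eq_mul]
    refine Finset.sum_le_card_nsmul _ _ _ fun i hi ↦ ?_
    rw [← norm_weighted]
    exact norm_le_pi_norm (Λ ψ) ⟨i, hi⟩
  have hker : LinearMap.ker Λ ≤ LinearMap.ker (u : 𝓢(Plane, ℂ) →L[ℂ] ℂ).toLinearMap := by
    intro ψ hψ
    rw [LinearMap.mem_ker] at hψ ⊢
    have := hΛ ψ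
    rw [hψ, norm_zero, mul_zero] at this
    exact norm_le_zero_iff.1 this
  let f : LinearMap.range Λ →ₗ[ℂ] ℂ :=
    ((LinearMap.ker Λ).liftQ _ hker).comp Λ.quotKerEquivRange.symm.toLinearMap
  have hf : ∀ ψ, f ⟨Λ ψ, LinearMap.mem_range_self Λ ψ⟩ = u ψ := by
    intro ψ
    simp only [f, LinearMap.comp_apply, LinearEquiv.coe_coe]
    rw [Λ.quotKerEquivRange_symm_apply_image]
    rfl
  let f' : LinearMap.range Λ →L[ℂ] ℂ := f.mkContinuous (C * s.card) (by
    rintro ⟨_, ψ, rfl⟩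
    rw [hf]
    exact hΛ ψ)
  -- By Hahn-Banach the functional on the range of Λ extends to the whole Banach space, and a
  -- continuous functional there commutes with the integral.
  obtain ⟨g, hg, -⟩ := exists_extension_norm_eq (LinearMap.range Λ) f'
  have hg' : ∀ ψ, g (Λ ψ) = u ψ := fun ψ ↦ (hg ⟨Λ ψ, LinearMap.mem_range_self Λ ψ⟩).trans (hf ψ)
  have hint : Integrable fun x ↦ K x • Λ (trans R x) :=
    Integrable.of_eval fun i ↦ integrable_weighted_trans K R i.1.1 i.1.2
  have hsum : Λ (sconv K R) = ∫ x, K x • Λ (trans R x) := by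
    funext i
    rw [eval_integral fun i ↦ integrable_weighted_trans K R i.1.1 i.1.2]
    exact weighted_sconv K R i.1.1 i.1.2
  rw [← hg', hsum, ← g.integral_comp_comm hint]
  refine integral_congr_ae (Filter.Eventually.of_forall fun x ↦ ?_)
  simp only [map_smul, smul_eq_mul, hg']

/-- The function `u * Φ`. -/
def ucv (u : 𝓢'(Plane, ℂ)) (Φ : 𝓢(Plane, ℂ)) (x : Plane) : ℂ := u (reflect Φ x)

theorem block_mk (D : DyadicPartition) (j : ℤ) (u : 𝓢'(Plane, ℂ)) :
    D.block j (Submodule.Quotient.mk u) = ucv u (D.φ j) := rfl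

theorem reflect_eq_trans (Φ : 𝓢(Plane, ℂ)) (x : Plane) : reflect Φ x = trans (reflect Φ 0) x := by
  ext y
  rw [trans_apply, reflect_apply, reflect_apply]
  congr 1
  abel

theorem continuous_ucv (u : 𝓢'(Plane, ℂ)) (Φ : 𝓢(Plane, ℂ)) : Continuous (ucv u Φ) := by
  have e : ucv u Φ = fun x ↦ u (trans (reflect Φ 0) x) := by
    ext x
    rw [ucv, reflect_eq_trans]
  rw [e]
  exact continuous_distribution_trans u _

/-- Convolution with Schwartz functions is associative. -/
theorem cv_ucv (u : 𝓢'(Plane, ℂ)) (K Φ : 𝓢(Plane, ℂ)) (x : Plane) :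
    cv K (ucv u Φ) x = ucv u (sconv K Φ) x := by
  have e : reflect (sconv K Φ) x = sconv (reflect K x) (reflect Φ 0) := by
    ext y
    rw [reflect_apply, sconv_apply, sconv_apply, cv, cv,
      ← integral_sub_left_eq_self (fun z ↦ K z * Φ (x - y - z)) volume x]
    refine integral_congr_ae (Filter.Eventually.of_forall fun z ↦ ?_)
    simp only [reflect_apply]
    congr 2
    abel
  rw [ucv, e, distribution_sconv, cv_eq]
  refine integral_congr_ae (Filter.Eventually.of_forall fun z ↦ ?_)
  simp only [reflect_apply, ucv, reflect_eq_trans Φ z]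

/-- The integral of `u * Φ` against a Schwartz function. -/
theorem integral_ucv_mul (u : 𝓢'(Plane, ℂ)) (ψ Φ : 𝓢(Plane, ℂ)) :
    ∫ x, ucv u Φ x * ψ x = u (sconv ψ (reflect Φ 0)) := by
  rw [distribution_sconv]
  refine integral_congr_ae (Filter.Eventually.of_forall fun z ↦ ?_)
  simp only [ucv, reflect_eq_trans Φ z]
  ring

/-! ### Smooth cutoffs -/

/-- A smooth bump function that equals `1` on the unit ball. -/
def unitBump : ContDiffBump (0 : Plane) := ⟨1, 2, one_pos, one_lt_two⟩

/-- The dilated bump function, which equals `1` on the ball of radius `r` and vanishes outside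
the ball of radius `2 r`. -/
def bump (r : ℝ) (ξ : Plane) : ℂ := (unitBump (r⁻¹ • ξ) : ℝ)

theorem contDiff_bump (r : ℝ) {n : ℕ∞} : ContDiff ℝ n (bump r) :=
  Complex.ofRealCLM.contDiff.comp (unitBump.contDiff.comp (contDiff_const_smul _))

theorem bump_eq_one {r : ℝ} (hr : 0 < r) {ξ : Plane} (h : ‖ξ‖ ≤ r) : bump r ξ = 1 := by
  rw [bump, unitBump.one_of_mem_closedBall, Complex.ofReal_one]
  rw [mem_closedBall_zero_iff, norm_smul, norm_inv, Real.norm_of_nonneg hr.le, inv_mul_le_iff₀ hr]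
  simpa [unitBump] using h

theorem bump_eq_zero {r : ℝ} (hr : 0 < r) {ξ : Plane} (h : 2 * r ≤ ‖ξ‖) : bump r ξ = 0 := by
  rw [bump, unitBump.zero_of_le_dist, Complex.ofReal_zero]
  rw [dist_zero_right, norm_smul, norm_inv, Real.norm_of_nonneg hr.le, le_inv_mul_iff₀ hr]
  simp only [unitBump]
  linarith

theorem hasCompactSupport_bump {r : ℝ} (hr : 0 < r) : HasCompactSupport (bump r) := by
  refine HasCompactSupport.of_support_subset_isCompact (isCompact_closedBall (0 : Plane) (2 * r))
    fun ξ hξ ↦ ?_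
  rw [mem_closedBall_zero_iff]
  by_contra h
  exact hξ (bump_eq_zero hr (not_le.1 h).le)

theorem hasTemperateGrowth_bump {r : ℝ} (hr : 0 < r) : (bump r).HasTemperateGrowth :=
  (hasCompactSupport_bump hr).hasTemperateGrowth (contDiff_bump r)

/-- All cutoffs are dilates of one profile, so the constant is independent of r. -/
theorem norm_iteratedFDeriv_bump_le (i : ℕ) :
    ∃ C, 0 ≤ C ∧ ∀ r, 0 < r → ∀ ξ, ‖iteratedFDeriv ℝ i (bump r) ξ‖ ≤ C * (r⁻¹) ^ i := by
  let χ : 𝓢(Plane, ℂ) := (hasCompactSupport_bump one_pos).toSchwartzMap (contDiff_bump 1)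
  refine ⟨SchwartzMap.seminorm ℂ 0 i χ, by positivity, fun r hr ξ ↦ ?_⟩
  have e : bump r = fun ξ ↦ bump 1 (r⁻¹ • ξ) := by
    ext ξ
    simp [bump]
  rw [e, iteratedFDeriv_comp_const_smul r⁻¹ (contDiff_bump 1)]
  simp only [norm_smul, norm_pow, norm_inv, Real.norm_of_nonneg hr.le]
  rw [mul_comm]
  gcongr
  exact SchwartzMap.norm_iteratedFDeriv_le_seminorm ℂ χ i (r⁻¹ • ξ)

/-- The product of a Schwartz function and a dilated bump function. -/
def cut (r : ℝ) (g : 𝓢(Plane, ℂ)) : 𝓢(Plane, ℂ) := SchwartzMap.smulLeftCLM ℂ (bump r) g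

theorem cut_apply {r : ℝ} (hr : 0 < r) (g : 𝓢(Plane, ℂ)) (ξ : Plane) :
    cut r g ξ = bump r ξ * g ξ :=
  SchwartzMap.smulLeftCLM_apply_apply (hasTemperateGrowth_bump hr) g ξ

theorem norm_iteratedFDeriv_cut_le (n : ℕ) :
    ∃ C, 0 ≤ C ∧ ∀ r, 0 < r → ∀ (g : 𝓢(Plane, ℂ)) ξ, ‖iteratedFDeriv ℝ n (cut r g) ξ‖ ≤
      C * ∑ i ∈ Finset.range (n + 1), (r⁻¹) ^ (n - i) * ‖iteratedFDeriv ℝ i g ξ‖ := by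
  choose C hC0 hC using norm_iteratedFDeriv_bump_le
  refine ⟨∑ i ∈ Finset.range (n + 1), (n.choose i : ℝ) * C (n - i),
    Finset.sum_nonneg fun i _ ↦ mul_nonneg (by positivity) (hC0 _), fun r hr g ξ ↦ ?_⟩
  have e : (cut r g : Plane → ℂ) = fun ξ ↦ g ξ * bump r ξ := by
    ext ξ; rw [cut_apply hr, mul_comm]
  rw [e]
  refine (norm_iteratedFDeriv_mul_le (g.smooth n) (contDiff_bump r) ξ le_rfl).trans ?_
  rw [Finset.sum_mul]
  refine Finset.sum_le_sum fun i hi ↦ ?_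
  calc (n.choose i : ℝ) * ‖iteratedFDeriv ℝ i g ξ‖ * ‖iteratedFDeriv ℝ (n - i) (bump r) ξ‖
      ≤ (n.choose i : ℝ) * ‖iteratedFDeriv ℝ i g ξ‖ * (C (n - i) * (r⁻¹) ^ (n - i)) := by
        gcongr; exact hC _ r hr ξ
    _ = ((n.choose i : ℝ) * C (n - i)) * ((r⁻¹) ^ (n - i) * ‖iteratedFDeriv ℝ i g ξ‖) := by ring
    _ ≤ _ := by
        have := hC0 (n - i)
        gcongr
        exact Finset.single_le_sum (f := fun i ↦ (r⁻¹) ^ (n - i) * ‖iteratedFDeriv ℝ i g ξ‖)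
          (fun i _ ↦ by positivity) hi

theorem iteratedFDeriv_eq_zero_of_eventuallyEq {f : Plane → ℂ} {ξ : Plane}
    (h : f =ᶠ[nhds ξ] fun _ ↦ 0) (n : ℕ) : iteratedFDeriv ℝ n f ξ = 0 := by
  rw [h.iteratedFDeriv ℝ n |>.eq_of_nhds]
  simp

/-- A Schwartz function is the limit of its compactly supported truncations. -/
theorem exists_seminorm_sub_cut_le (g : 𝓢(Plane, ℂ)) (k n : ℕ) :
    ∃ C, 0 ≤ C ∧ ∀ r, 1 ≤ r → SchwartzMap.seminorm ℂ k n (g - cut r g) ≤ C * r⁻¹ := by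
  obtain ⟨A, hA0, hA⟩ := norm_iteratedFDeriv_cut_le n
  refine ⟨SchwartzMap.seminorm ℂ (k + 1) n g +
    A * ∑ i ∈ Finset.range (n + 1), SchwartzMap.seminorm ℂ (k + 1) i g, by positivity,
    fun r hr ↦ ?_⟩
  have hr0 : 0 < r := by linarith
  refine SchwartzMap.seminorm_le_bound ℂ k n _ (by positivity) fun ξ ↦ ?_
  rcases lt_or_ge ‖ξ‖ r with h | h
  · have : ((g - cut r g : 𝓢(Plane, ℂ)) : Plane → ℂ) =ᶠ[nhds ξ] fun _ ↦ 0 := by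
      filter_upwards [continuous_norm.continuousAt.eventually (gt_mem_nhds h)] with z hz
      rw [_root_.sub_apply, cut_apply hr0, bump_eq_one hr0 hz.le, one_mul, sub_self]
    rw [iteratedFDeriv_eq_zero_of_eventuallyEq this, norm_zero, mul_zero]
    positivity
  · have e : iteratedFDeriv ℝ n (g - cut r g : 𝓢(Plane, ℂ)) ξ =
        iteratedFDeriv ℝ n g ξ - iteratedFDeriv ℝ n (cut r g) ξ :=
      iteratedFDeriv_sub_apply (g.smooth n).contDiffAt ((cut r g).smooth n).contDiffAt
    -- Outside the ball of radius r an extra power of ‖ξ‖, paid for by a higher seminorm of g, buys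
    -- the factor r⁻¹.
    have hk : ‖ξ‖ ^ k ≤ r⁻¹ * ‖ξ‖ ^ (k + 1) := by
      rw [le_inv_mul_iff₀ hr0, pow_succ, mul_comm]
      gcongr
    have h1 : ‖iteratedFDeriv ℝ n (cut r g) ξ‖ ≤
        A * ∑ i ∈ Finset.range (n + 1), ‖iteratedFDeriv ℝ i g ξ‖ := by
      refine (hA r hr0 g ξ).trans ?_
      gcongr with i _
      refine mul_le_of_le_one_left (norm_nonneg _) (pow_le_one₀ (by positivity) ?_)
      exact inv_le_one_of_one_le₀ hr
    calc ‖ξ‖ ^ k * ‖iteratedFDeriv ℝ n (g - cut r g : 𝓢(Plane, ℂ)) ξ‖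
        ≤ (r⁻¹ * ‖ξ‖ ^ (k + 1)) * (‖iteratedFDeriv ℝ n g ξ‖ +
          A * ∑ i ∈ Finset.range (n + 1), ‖iteratedFDeriv ℝ i g ξ‖) := by
          rw [e]
          gcongr
          exact (norm_sub_le _ _).trans (by gcongr)
      _ = (‖ξ‖ ^ (k + 1) * ‖iteratedFDeriv ℝ n g ξ‖ +
          A * ∑ i ∈ Finset.range (n + 1), ‖ξ‖ ^ (k + 1) * ‖iteratedFDeriv ℝ i g ξ‖) * r⁻¹ := by
          rw [← Finset.mul_sum]; ring
      _ ≤ _ := by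
          gcongr with i _
          · exact SchwartzMap.le_seminorm ℂ (k + 1) n g ξ
          · exact SchwartzMap.le_seminorm ℂ (k + 1) i g ξ

/-- Taylor's estimate for a function that vanishes to order `N` at the origin. -/
theorem exists_norm_iteratedFDeriv_le_of_flat (g : 𝓢(Plane, ℂ)) (N : ℕ)
    (hg : ∀ i ≤ N, iteratedFDeriv ℝ i g 0 = 0) :
    ∃ C, 0 ≤ C ∧ ∀ i ≤ N, ∀ ξ, ‖iteratedFDeriv ℝ i g ξ‖ ≤ C * ‖ξ‖ ^ (N + 1 - i) := by
  refine ⟨SchwartzMap.seminorm ℂ 0 (N + 1) g, by positivity, ?_⟩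
  -- Descending induction on the order of the derivative: d counts the integrations along segments
  -- from the origin, each gaining a power of ‖ξ‖.
  have key : ∀ d ≤ N + 1, ∀ ξ, ‖iteratedFDeriv ℝ (N + 1 - d) g ξ‖ ≤
      SchwartzMap.seminorm ℂ 0 (N + 1) g * ‖ξ‖ ^ d := by
    intro d
    induction d with
    | zero =>
      intro _ ξ
      simpa using SchwartzMap.norm_iteratedFDeriv_le_seminorm ℂ g (N + 1) ξ
    | succ d ih =>
      intro hd ξ
      set i := N + 1 - (d + 1) with hi
      have hi1 : N + 1 - d = i + 1 := by omega
      have := (convex_segment (0 : Plane) ξ).norm_image_sub_le_of_norm_hasFDerivWithin_le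
        (f := iteratedFDeriv ℝ i g) (f' := fun z ↦ fderiv ℝ (iteratedFDeriv ℝ i g) z)
        (C := SchwartzMap.seminorm ℂ 0 (N + 1) g * ‖ξ‖ ^ d) (fun z _ ↦
          ((g.smooth (i + 1)).differentiable_iteratedFDeriv (by norm_cast; simp)
            z).hasFDerivAt.hasFDerivWithinAt) (fun z hz ↦ by
          rw [norm_fderiv_iteratedFDeriv, ← hi1]
          refine (ih (by omega) z).trans ?_
          gcongr
          have := norm_sub_le_of_mem_segment hz
          simpa using this)
        (left_mem_segment ℝ _ _) (right_mem_segment ℝ _ _)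
      rw [hg i (by omega), sub_zero, sub_zero] at this
      rw [pow_succ]
      linarith
  intro i hi ξ
  have := key (N + 1 - i) (by omega) ξ
  rwa [show N + 1 - (N + 1 - i) = i by omega] at this

/-- The truncation of a flat function to a small ball is small. -/
theorem exists_seminorm_cut_le (g : 𝓢(Plane, ℂ)) (N : ℕ)
    (hg : ∀ i ≤ N, iteratedFDeriv ℝ i g 0 = 0) (k n : ℕ) (hn : n ≤ N) :
    ∃ C, 0 ≤ C ∧ ∀ r, 0 < r → r ≤ 1 → SchwartzMap.seminorm ℂ k n (cut r g) ≤ C * r := by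
  obtain ⟨A, hA0, hA⟩ := norm_iteratedFDeriv_cut_le n
  obtain ⟨B, hB0, hB⟩ := exists_norm_iteratedFDeriv_le_of_flat g N hg
  refine ⟨2 ^ k * (A * ∑ i ∈ Finset.range (n + 1), B * 2 ^ (N + 1 - i)), by positivity,
    fun r hr hr1 ↦ ?_⟩
  refine SchwartzMap.seminorm_le_bound ℂ k n _ (by positivity) fun ξ ↦ ?_
  rcases lt_or_ge (2 * r) ‖ξ‖ with h | h
  · have : ((cut r g : 𝓢(Plane, ℂ)) : Plane → ℂ) =ᶠ[nhds ξ] fun _ ↦ 0 := by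
      filter_upwards [continuous_norm.continuousAt.eventually (lt_mem_nhds h)] with z hz
      rw [cut_apply hr, bump_eq_zero hr hz.le, zero_mul]
    rw [iteratedFDeriv_eq_zero_of_eventuallyEq this, norm_zero, mul_zero]
    positivity
  · calc ‖ξ‖ ^ k * ‖iteratedFDeriv ℝ n (cut r g) ξ‖
        ≤ 2 ^ k * (A * ∑ i ∈ Finset.range (n + 1),
            (r⁻¹) ^ (n - i) * ‖iteratedFDeriv ℝ i g ξ‖) := by
          gcongr
          · linarith
          · exact hA r hr g ξ
      _ ≤ 2 ^ k * (A * ∑ i ∈ Finset.range (n + 1), B * 2 ^ (N + 1 - i) * r) := by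
          refine mul_le_mul_of_nonneg_left (mul_le_mul_of_nonneg_left
            (Finset.sum_le_sum fun i hi ↦ ?_) hA0) (by positivity)
          have hi' : i ≤ n := by simpa [Nat.lt_succ_iff] using hi
          -- Derivatives on the cutoff cost r^{-(n-i)} while flatness of g gives r^{N+1-i}; the
          -- balance r^{N+1-n} is at most r because n ≤ N and r ≤ 1.
          calc (r⁻¹) ^ (n - i) * ‖iteratedFDeriv ℝ i g ξ‖
              ≤ (r⁻¹) ^ (n - i) * (B * (2 * r) ^ (N + 1 - i)) := by
                gcongr
                exact (hB i (by omega) ξ).trans (by gcongr)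
            _ = B * 2 ^ (N + 1 - i) * ((r⁻¹) ^ (n - i) * r ^ (n - i) * r ^ (N + 1 - n)) := by
                rw [mul_pow, mul_assoc _ (r ^ (n - i)), ← pow_add,
                  show n - i + (N + 1 - n) = N + 1 - i by omega]
                ring
            _ ≤ B * 2 ^ (N + 1 - i) * r := by
                rw [← mul_pow, inv_mul_cancel₀ hr.ne', one_pow, one_mul]
                gcongr
                exact pow_le_of_le_one hr.le hr1 (by omega)
      _ = _ := by rw [← Finset.sum_mul]; ring

/-- A tempered distribution that vanishes on the truncations to annuli vanishes on all functions
that are flat to sufficiently high order at the origin. -/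
theorem exists_order_of_vanishing (v : 𝓢'(Plane, ℂ))
    (hv : ∀ g : 𝓢(Plane, ℂ), ∀ r R, 0 < r → 0 < R → v (cut R g - cut r g) = 0) :
    ∃ N, ∀ g : 𝓢(Plane, ℂ), (∀ i ≤ N, iteratedFDeriv ℝ i g 0 = 0) → v g = 0 := by
  obtain ⟨s, C, hC0, hC⟩ := norm_le_sum_seminorm v
  -- The order is the largest number of derivatives occurring in the finitely many seminorms that
  -- control v.
  refine ⟨s.sup Prod.snd, fun g hg ↦ ?_⟩
  choose! A hA0 hA using fun i : ℕ × ℕ ↦ exists_seminorm_sub_cut_le g i.1 i.2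
  have hB : ∀ i ∈ s, ∃ B, 0 ≤ B ∧ ∀ r, 0 < r → r ≤ 1 →
      SchwartzMap.seminorm ℂ i.1 i.2 (cut r g) ≤ B * r := fun i hi ↦
    exists_seminorm_cut_le g _ hg i.1 i.2 (Finset.le_sup (f := Prod.snd) hi)
  choose! B hB0 hB using hB
  have key : ∀ r, 0 < r → r ≤ 1 → ‖v g‖ ≤ (C * ∑ i ∈ s, (A i + B i)) * r := by
    intro r hr hr1
    -- Taking 1/r for the outer radius makes the tail and the part near the origin both O(r), while
    -- the annular part is killed by hypothesis.
    have h1 : v g = v (g - cut r⁻¹ g) + v (cut r g) := by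
      have := hv g r r⁻¹ hr (by positivity)
      rw [map_sub, sub_eq_zero] at this
      rw [map_sub, this]
      ring
    rw [h1]
    refine (norm_add_le _ _).trans ((add_le_add (hC _) (hC _)).trans ?_)
    rw [← mul_add, ← Finset.sum_add_distrib, mul_assoc, Finset.sum_mul]
    gcongr with i hi
    have h2 := hA i r⁻¹ (one_le_inv_iff₀.2 ⟨hr, hr1⟩)
    have h3 := hB i hi r hr hr1
    rw [inv_inv] at h2
    linarith
  by_contra hne
  have hpos : 0 < ‖v g‖ := norm_pos_iff.2 hne
  set M := C * ∑ i ∈ s, (A i + B i)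
  have hM : 0 ≤ M := mul_nonneg hC0 (Finset.sum_nonneg fun i hi ↦ add_nonneg (hA0 i) (hB0 i hi))
  have := key (min 1 (‖v g‖ / (2 * (M + 1)))) (by positivity) (min_le_left _ _)
  have h2 : M * min 1 (‖v g‖ / (2 * (M + 1))) ≤ (M + 1) * (‖v g‖ / (2 * (M + 1))) := by
    gcongr
    · linarith
    · exact min_le_right _ _
  have h3 : (M + 1) * (‖v g‖ / (2 * (M + 1))) = ‖v g‖ / 2 := by field_simp
  linarith

/-! ### Frequency localisation -/

/-- The dyadic annulus `2 ^ (j - m) ≤ |2πξ| ≤ 2 ^ (j + m)`. -/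
def annulus (m : ℕ) (j : ℤ) : Set Plane :=
  {ξ | (2 : ℝ) ^ (j - m) ≤ 2 * Real.pi * ‖ξ‖ ∧ 2 * Real.pi * ‖ξ‖ ≤ (2 : ℝ) ^ (j + m)}

namespace DyadicPartition

variable (D : DyadicPartition)

theorem fourier_phi (j : ℤ) (ξ : Plane) : 𝓕 (D.φ j) ξ = hat (D.φ j) ((2 * Real.pi) • ξ) := by
  rw [hat_eq_fourier, inv_smul_smul₀ (by positivity)]

theorem norm_two_pi_smul (ξ : Plane) : ‖(2 * Real.pi) • ξ‖ = 2 * Real.pi * ‖ξ‖ := by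
  rw [norm_smul, Real.norm_of_nonneg (by positivity)]

theorem fourier_phi_support {j : ℤ} {ξ : Plane} (h : 𝓕 (D.φ j) ξ ≠ 0) : ξ ∈ annulus 1 j := by
  rw [fourier_phi, D.hat_dilate] at h
  obtain ⟨h1, h2⟩ := D.hat_support _ h
  rw [norm_smul, norm_two_pi_smul, Real.norm_of_nonneg (by positivity), zpow_neg] at h1 h2
  rw [le_inv_mul_iff₀ (by positivity)] at h1
  rw [inv_mul_le_iff₀ (by positivity)] at h2
  constructor
  · rw [Nat.cast_one, zpow_sub_one₀ two_ne_zero]; exact h1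
  · rw [Nat.cast_one, zpow_add_one₀ two_ne_zero]; exact h2

/-- The set where a continuous function is nonzero is open, so small dilations of ξ remain in the
closed support and make its bounds strict. Strictness excludes interaction between blocks whose
indices differ by 2 or more. -/
theorem fourier_phi_support_lt {j : ℤ} {ξ : Plane} (h : 𝓕 (D.φ j) ξ ≠ 0) :
    (2 : ℝ) ^ (j - 1) < 2 * Real.pi * ‖ξ‖ ∧ 2 * Real.pi * ‖ξ‖ < (2 : ℝ) ^ (j + 1) := by
  have hev : ∀ᶠ t : ℝ in nhds 1, 𝓕 (D.φ j) (t • ξ) ≠ 0 := by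
    have hc : Continuous fun t : ℝ ↦ 𝓕 (D.φ j) (t • ξ) :=
      (𝓕 (D.φ j)).continuous.comp (continuous_id.smul continuous_const)
    exact hc.continuousAt.eventually_ne (by simpa using h)
  obtain ⟨ε, hε, hball⟩ := Metric.eventually_nhds_iff.1 hev
  have hξ : 0 < ‖ξ‖ := by
    have := (D.fourier_phi_support h).1
    have h2 : (0 : ℝ) < 2 ^ (j - (1 : ℕ)) := by positivity
    by_contra hle
    have h3 : ‖ξ‖ = 0 := le_antisymm (not_lt.1 hle) (norm_nonneg _)
    rw [h3, mul_zero] at this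
    linarith
  have key : ∀ t : ℝ, 0 < t → |t - 1| < ε →
      (2 : ℝ) ^ (j - 1) ≤ t * (2 * Real.pi * ‖ξ‖) ∧
        t * (2 * Real.pi * ‖ξ‖) ≤ (2 : ℝ) ^ (j + 1) := by
    intro t ht htε
    have := D.fourier_phi_support (hball (by rwa [Real.dist_eq]))
    rw [annulus, Set.mem_ofPred_eq, norm_smul, Real.norm_of_nonneg ht.le, Nat.cast_one] at this
    constructor
    · linarith [this.1]
    · linarith [this.2]
  have hpos : 0 < 2 * Real.pi * ‖ξ‖ := by positivity
  have hη : 0 < min (ε / 2) (1 / 2) := by positivity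
  have h1 := (key (1 - min (ε / 2) (1 / 2)) (by linarith [min_le_right (ε / 2) (1 / 2)]) (by
    rw [abs_lt]; constructor <;> linarith [min_le_left (ε / 2) (1 / 2)])).1
  have h2 := (key (1 + min (ε / 2) (1 / 2)) (by linarith) (by
    rw [abs_lt]; constructor <;> linarith [min_le_left (ε / 2) (1 / 2)])).2
  constructor <;> nlinarith

theorem hasSum_fourier_phi {ξ : Plane} (hξ : ξ ≠ 0) : HasSum (fun j ↦ 𝓕 (D.φ j) ξ) 1 := by
  simp only [fourier_phi]
  exact D.hat_sum _ (smul_ne_zero (by positivity) hξ)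

end DyadicPartition

theorem zpow_le_zpow_iff_two {a b : ℤ} : (2 : ℝ) ^ a ≤ (2 : ℝ) ^ b ↔ a ≤ b :=
  zpow_le_zpow_iff_right₀ one_lt_two

theorem ne_zero_of_mem_annulus {m : ℕ} {j : ℤ} {ξ : Plane} (h : ξ ∈ annulus m j) : ξ ≠ 0 := by
  rintro rfl
  have := h.1
  rw [norm_zero, mul_zero] at this
  have h2 : (0 : ℝ) < 2 ^ (j - m) := by positivity
  linarith

theorem neg_mem_annulus {m : ℕ} {j : ℤ} {ξ : Plane} : -ξ ∈ annulus m j ↔ ξ ∈ annulus m j := by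
  simp [annulus]

theorem abs_sub_le_of_mem_annulus {m n : ℕ} {i j : ℤ} {ξ : Plane} (h : ξ ∈ annulus m i)
    (h' : ξ ∈ annulus n j) : |i - j| ≤ m + n := by
  have h1 := zpow_le_zpow_iff_two.1 (h.1.trans h'.2)
  have h2 := zpow_le_zpow_iff_two.1 (h'.1.trans h.2)
  rw [abs_le]
  constructor <;> linarith

namespace DyadicPartition

variable (D : DyadicPartition)

/-- The sum of the `φ_i` over `|i - j| ≤ n`. -/
def wide (n : ℕ) (j : ℤ) : 𝓢(Plane, ℂ) := ∑ i ∈ Finset.Icc (j - n) (j + n), D.φ i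

theorem fourier_wide (n : ℕ) (j : ℤ) (ξ : Plane) :
    𝓕 (D.wide n j) ξ = ∑ i ∈ Finset.Icc (j - n) (j + n), 𝓕 (D.φ i) ξ := by
  rw [wide]
  have : 𝓕 (∑ i ∈ Finset.Icc (j - n) (j + n), D.φ i) =
      ∑ i ∈ Finset.Icc (j - n) (j + n), 𝓕 (D.φ i) :=
    map_sum (FourierTransform.fourierCLM ℂ 𝓢(Plane, ℂ)) _ _
  rw [this, FunLike.coe_sum, Finset.sum_apply]

theorem fourier_wide_eq_one {m n : ℕ} (hmn : m ≤ n) {j : ℤ} {ξ : Plane}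
    (h : ξ ∈ annulus m j) : 𝓕 (D.wide n j) ξ = 1 := by
  rw [fourier_wide]
  refine (hasSum_sum_of_ne_finset_zero fun i hi ↦ ?_).unique
    (D.hasSum_fourier_phi (ne_zero_of_mem_annulus h))
  by_contra hne
  obtain ⟨h1, h2⟩ := D.fourier_phi_support_lt hne
  have h3 := (zpow_lt_zpow_iff_right₀ one_lt_two).1 (h1.trans_le h.2)
  have h4 := (zpow_lt_zpow_iff_right₀ one_lt_two).1 (h.1.trans_lt h2)
  refine hi (Finset.mem_Icc.2 ⟨?_, ?_⟩) <;> omega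

theorem fourier_wide_support {n : ℕ} {j : ℤ} {ξ : Plane} (h : 𝓕 (D.wide n j) ξ ≠ 0) :
    ξ ∈ annulus (n + 1) j := by
  rw [fourier_wide] at h
  obtain ⟨i, hi, hne⟩ := Finset.exists_ne_zero_of_sum_ne_zero h
  rw [Finset.mem_Icc] at hi
  obtain ⟨h1, h2⟩ := D.fourier_phi_support hne
  constructor
  · refine le_trans (zpow_le_zpow_iff_two.2 ?_) h1
    push_cast; linarith
  · refine h2.trans (zpow_le_zpow_iff_two.2 ?_)
    push_cast; linarith

theorem fourier_wide_eq_zero {n : ℕ} {j : ℤ} {ξ : Plane} (h : ξ ∉ annulus (n + 1) j) :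
    𝓕 (D.wide n j) ξ = 0 :=
  not_not.1 (mt D.fourier_wide_support h)

end DyadicPartition

theorem fourier_reflect_zero (Φ : 𝓢(Plane, ℂ)) (ξ : Plane) : 𝓕 (reflect Φ 0) ξ = 𝓕 Φ (-ξ) := by
  rw [SchwartzMap.fourier_coe, SchwartzMap.fourier_coe, Real.fourier_eq', Real.fourier_eq',
    ← integral_neg_eq_self]
  refine integral_congr_ae (Filter.Eventually.of_forall fun x ↦ ?_)
  simp [reflect_apply]

/-! ### Distributions whose Fourier transform is supported at the origin -/

/-- A difference of two cutoffs lives in an annulus and so is seen by finitely many blocks. The sign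
in -ξ comes from the reflection in the definition of a block. -/
theorem cut_sub_cut_eq_sum (D : DyadicPartition) (g : 𝓢(Plane, ℂ)) {r R : ℝ} (hr : 0 < r)
    (hR : 0 < R) :
    ∃ n : ℕ, ∀ ξ, (cut R g - cut r g) ξ * 𝓕 (D.wide n 0) (-ξ) = (cut R g - cut r g) ξ := by
  obtain ⟨a, ha⟩ := exists_pow_lt_of_lt_one (show 0 < min r R by positivity) (one_half_lt_one (α := ℝ))
  obtain ⟨b, hb⟩ := pow_unbounded_of_one_lt (2 * Real.pi * (2 * max r R)) (one_lt_two (α := ℝ))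
  refine ⟨a + b + 1, fun ξ ↦ ?_⟩
  by_cases h : ξ ∈ annulus (a + b) 0
  · rw [D.fourier_wide_eq_one (Nat.le_succ _) (neg_mem_annulus.2 h), mul_one]
  · have : (cut R g - cut r g) ξ = 0 := by
      rw [_root_.sub_apply, cut_apply hr, cut_apply hR]
      rw [annulus, Set.mem_ofPred_eq, not_and_or, not_le, not_le] at h
      rcases h with h | h
      · have h1 : ‖ξ‖ ≤ min r R := by
          have e : (2 : ℝ) ^ ((0 : ℤ) - ((a + b : ℕ) : ℤ)) ≤ (1 / 2) ^ a := by
            rw [zero_sub, zpow_neg, zpow_natCast, one_div, inv_pow]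
            gcongr
            · norm_num
            · omega
          have hpi := Real.pi_gt_three
          nlinarith [norm_nonneg ξ]
        rw [bump_eq_one hr (h1.trans (min_le_left _ _)), bump_eq_one hR (h1.trans (min_le_right _ _)),
          sub_self]
      · have h1 : 2 * max r R ≤ ‖ξ‖ := by
          have e : (2 : ℝ) ^ b ≤ (2 : ℝ) ^ ((0 : ℤ) + ((a + b : ℕ) : ℤ)) := by
            rw [zero_add, zpow_natCast]
            gcongr
            · norm_num
            · omega
          have hpi := Real.pi_pos
          by_contra hlt
          have := mul_lt_mul_of_pos_left (not_le.1 hlt) (show 0 < 2 * Real.pi by positivity)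
          linarith
        rw [bump_eq_zero hr (le_trans (by gcongr; exact le_max_left _ _) h1),
          bump_eq_zero hR (le_trans (by gcongr; exact le_max_right _ _) h1)]
        ring
    rw [this, zero_mul]

/-- The product of the coordinates `x_{f 0} ⋯ x_{f (n-1)}`. -/
def coordProd {n : ℕ} (f : Fin n → Fin 2) : MvPolynomial (Fin 2) ℂ := ∏ i, MvPolynomial.X (f i)

/-- Derivatives of the Fourier transform at the origin are moments, since each derivative brings
down -2πi times a coordinate. What matters is that c depends on n alone. -/
theorem exists_iteratedLineDeriv_fourier (n : ℕ) :
    ∃ c : ℂ, ∀ (f : Fin n → Fin 2) (ψ : 𝓢(Plane, ℂ)),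
      (∂^{fun i ↦ (EuclideanSpace.basisFun (Fin 2) ℝ) (f i)} (𝓕 ψ)) 0 =
        c * ∫ x, polyEval (coordProd f) x * ψ x := by
  induction n with
  | zero =>
    refine ⟨1, fun f ψ ↦ ?_⟩
    rw [LineDeriv.iteratedLineDerivOp_fin_zero, SchwartzMap.fourier_coe, Real.fourier_eq']
    simp [coordProd, polyEval]
  | succ n ih =>
    obtain ⟨c, hc⟩ := ih
    refine ⟨c * -(2 * Real.pi * Complex.I), fun f ψ ↦ ?_⟩
    rw [LineDeriv.iteratedLineDerivOp_succ_right, SchwartzMap.lineDerivOp_fourier_eq]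
    refine (hc (fun i ↦ f i.castSucc) _).trans ?_
    rw [mul_assoc c, ← integral_const_mul (-(2 * (Real.pi : ℂ) * Complex.I))]
    congr 2
    ext x
    have hg : (fun x : Plane ↦ (inner ℝ x ((EuclideanSpace.basisFun (Fin 2) ℝ)
      (f (Fin.last n))) : ℝ)).HasTemperateGrowth := by fun_prop
    rw [_root_.smul_apply, SchwartzMap.smulLeftCLM_apply_apply hg]
    simp only [coordProd, polyEval, Fin.prod_univ_castSucc, map_mul, MvPolynomial.eval_X,
      EuclideanSpace.basisFun_apply, EuclideanSpace.inner_single_right, smul_eq_mul,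
      Complex.real_smul]
    simp
    ring

theorem iteratedFDeriv_fourier_eq_zero (n : ℕ) (ψ : 𝓢(Plane, ℂ))
    (h : ∀ f : Fin n → Fin 2, ∫ x, polyEval (coordProd f) x * ψ x = 0) :
    iteratedFDeriv ℝ n (𝓕 ψ : 𝓢(Plane, ℂ)) 0 = 0 := by
  obtain ⟨c, hc⟩ := exists_iteratedLineDeriv_fourier n
  apply ContinuousMultilinearMap.toMultilinearMap_injective
  refine Module.Basis.ext_multilinear (fun _ ↦ (EuclideanSpace.basisFun (Fin 2) ℝ).toBasis) fun f ↦ ?_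
  have := hc f ψ
  rw [h f, mul_zero, SchwartzMap.iteratedLineDerivOp_eq_iteratedFDeriv] at this
  simpa using this

/-- A tempered distribution all of whose blocks vanish is a polynomial. -/
theorem mem_polynomials_of_ucv_eq_zero (D : DyadicPartition) (u : 𝓢'(Plane, ℂ))
    (hu : ∀ j x, ucv u (D.φ j) x = 0) : u ∈ polynomials := by
  have h0 : ∀ (j : ℤ) (ψ : 𝓢(Plane, ℂ)), u (sconv ψ (reflect (D.φ j) 0)) = 0 := by
    intro j ψ
    rw [← integral_ucv_mul]
    simp [hu]
  -- On the Fourier side u kills every function cut to an annulus, because such a function is a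
  -- finite sum of functions tested by the blocks.
  obtain ⟨N, hN⟩ := exists_order_of_vanishing (𝓕⁻ u) fun g r R hr hR ↦ by
    obtain ⟨n, hn⟩ := cut_sub_cut_eq_sum D g hr hR
    set h := cut R g - cut r g
    rw [TemperedDistribution.fourierInv_apply]
    have : 𝓕⁻ h = ∑ i ∈ Finset.Icc ((0 : ℤ) - n) (0 + n), sconv (𝓕⁻ h) (reflect (D.φ i) 0) := by
      refine schwartz_ext_fourier fun ξ ↦ ?_
      have e : 𝓕 (∑ i ∈ Finset.Icc ((0 : ℤ) - n) (0 + n), sconv (𝓕⁻ h) (reflect (D.φ i) 0)) =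
          ∑ i ∈ Finset.Icc ((0 : ℤ) - n) (0 + n), 𝓕 (sconv (𝓕⁻ h) (reflect (D.φ i) 0)) :=
        map_sum (FourierTransform.fourierCLM ℂ 𝓢(Plane, ℂ)) _ _
      rw [e, FunLike.coe_sum, Finset.sum_apply]
      simp only [fourier_sconv, fourier_reflect_zero, FourierTransform.fourier_fourierInv_eq]
      rw [← Finset.mul_sum, ← D.fourier_wide, hn]
    rw [this, map_sum]
    exact Finset.sum_eq_zero fun i _ ↦ h0 i _
  let ι := Σ n : Fin (N + 1), (Fin n → Fin 2)
  let L : ι → 𝓢(Plane, ℂ) →ₗ[ℂ] ℂ := fun i ↦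
    (polyDistribution (coordProd i.2) : 𝓢(Plane, ℂ) →L[ℂ] ℂ).toLinearMap
  -- Now u vanishes wherever all moments up to order N vanish, and a functional that vanishes on the
  -- common kernel of finitely many functionals is a linear combination of them.
  have hL : (u : 𝓢(Plane, ℂ) →L[ℂ] ℂ).toLinearMap ∈ Submodule.span ℂ (Set.range L) := by
    refine mem_span_of_iInf_ker_le_ker fun ψ hψ ↦ ?_
    rw [Submodule.mem_iInf] at hψ
    have := hN (𝓕 ψ) fun i hi ↦ iteratedFDeriv_fourier_eq_zero i ψ fun f ↦ by
      rw [← polyDistribution_apply]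
      exact hψ ⟨⟨i, by omega⟩, f⟩
    rw [TemperedDistribution.fourierInv_apply, FourierTransform.fourierInv_fourier_eq] at this
    exact this
  obtain ⟨c, hc⟩ := (Submodule.mem_span_range_iff_exists_fun ℂ).1 hL
  refine ⟨∑ i, c i • coordProd i.2, ?_⟩
  ext ψ
  have := congrArg (fun l ↦ l ψ) hc
  simp only [LinearMap.sum_apply, LinearMap.smul_apply] at this
  rw [map_sum]
  simp only [map_smul]
  refine Eq.trans ?_ this
  rw [FunLike.coe_sum, Finset.sum_apply]
  rfl

/-- An element of `𝓢' / 𝓟` is determined by its blocks. -/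
theorem DyadicPartition.ext_block (D : DyadicPartition) {F G : DistModPoly}
    (h : ∀ j x, D.block j F x = D.block j G x) : F = G := by
  obtain ⟨u, rfl⟩ := Submodule.Quotient.mk_surjective _ F
  obtain ⟨v, rfl⟩ := Submodule.Quotient.mk_surjective _ G
  rw [Submodule.Quotient.eq]
  refine mem_polynomials_of_ucv_eq_zero D _ fun j x ↦ ?_
  have := h j x
  rw [block_mk, block_mk] at this
  exact sub_eq_zero.2 this

/-! ### Bounded functions localised in frequency. -/

/-- A bounded continuous function whose Fourier transform is supported in the annulus
`2 ^ (j - 1) ≤ |2πξ| ≤ 2 ^ (j + 1)`. -/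
def Spec (j : ℤ) (G : Plane → ℂ) : Prop :=
  BddCont G ∧ ∀ K : 𝓢(Plane, ℂ), (∀ ξ ∈ annulus 1 j, 𝓕 K ξ = 0) → ∀ x, cv K G x = 0

/-- The value of K * G at 0 is the pairing of K with y ↦ G(-y), so this is the fundamental lemma of
the calculus of variations. -/
theorem integral_schwartz_mul_eq_zero {G : Plane → ℂ} (hG : Continuous G)
    (h : ∀ K : 𝓢(Plane, ℂ), cv K G 0 = 0) : G = 0 := by
  have hc : Continuous fun y : Plane ↦ G (-y) := hG.comp continuous_neg
  have := ae_eq_zero_of_integral_contDiff_smul_eq_zero (μ := volume) hc.locallyIntegrable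
    fun g hg hgs ↦ by
    have h1 : ContDiff ℝ ((⊤ : ℕ∞) : WithTop ℕ∞) fun y ↦ (g y : ℂ) := Complex.ofRealCLM.contDiff.comp hg
    have h2 : HasCompactSupport fun y ↦ (g y : ℂ) :=
      hgs.comp_left (g := fun t : ℝ ↦ (t : ℂ)) Complex.ofReal_zero
    have := h (h2.toSchwartzMap h1)
    rw [cv] at this
    simpa using this
  have h0 := (hc.ae_eq_iff_eq volume continuous_const).1 this
  ext x
  simpa using congrFun h0 (-x)

section

variable {j : ℤ} {G H : Plane → ℂ}

theorem Spec.cv_congr (hG : Spec j G) {K L : 𝓢(Plane, ℂ)} (h : ∀ ξ ∈ annulus 1 j, 𝓕 K ξ = 𝓕 L ξ) :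
    cv K G = cv L G := by
  ext x
  have h1 := hG.2 (K - L) (fun ξ hξ ↦ by
    have e : 𝓕 (K - L) = 𝓕 K - 𝓕 L := map_sub (FourierTransform.fourierCLM ℂ 𝓢(Plane, ℂ)) _ _
    rw [e, _root_.sub_apply, h ξ hξ, sub_self]) x
  have h2 := cv_sub_left K.integrable L.integrable hG.1 x
  rw [← sub_eq_zero, ← h2]
  exact h1

/-- K * G and G have the same convolution with every Schwartz function, since L * K and L agree in
frequency on the annulus of G. -/
theorem Spec.cv_eq_self (hG : Spec j G) {K : 𝓢(Plane, ℂ)} (h : ∀ ξ ∈ annulus 1 j, 𝓕 K ξ = 1) :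
    cv K G = G := by
  have hK := hG.1.cv K.integrable
  have := integral_schwartz_mul_eq_zero (hK.sub hG.1).1 fun L ↦ by
    rw [cv_sub_right L.integrable hK hG.1, cv_cv _ _ hG.1, sub_eq_zero]
    refine congrFun (hG.cv_congr fun ξ hξ ↦ ?_) 0
    rw [fourier_sconv, h ξ hξ, mul_one]
  ext x
  exact sub_eq_zero.1 (congrFun this x)

theorem Spec.cv_wide (D : DyadicPartition) (hG : Spec j G) {n : ℕ} (hn : 1 ≤ n) :
    cv (D.wide n j) G = G :=
  hG.cv_eq_self fun _ hξ ↦ D.fourier_wide_eq_one hn hξ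

theorem Spec.add (hG : Spec j G) (hH : Spec j H) : Spec j fun x ↦ G x + H x :=
  ⟨hG.1.add hH.1, fun K hK x ↦ by
    rw [cv_add_right K.integrable hG.1 hH.1, hG.2 K hK, hH.2 K hK, add_zero]⟩

theorem Spec.const_mul (c : ℂ) (hG : Spec j G) : Spec j fun x ↦ c * G x :=
  ⟨hG.1.const_mul c, fun K hK x ↦ by rw [cv_const_mul_right, hG.2 K hK, mul_zero]⟩

theorem Spec.zero : Spec j fun _ ↦ 0 := ⟨BddCont.zero, fun _ _ x ↦ cv_zero_right x⟩

theorem Spec.sum {ι : Type*} (s : Finset ι) {G : ι → Plane → ℂ} (hG : ∀ i ∈ s, Spec j (G i)) :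
    Spec j (fun x ↦ ∑ i ∈ s, G i x) := by
  induction s using Finset.cons_induction with
  | empty => simpa using Spec.zero
  | cons a s ha ih =>
    simp only [Finset.sum_cons]
    exact (hG a (by simp)).add (ih fun i hi ↦ hG i (by simp [hi]))

section Series

variable {ι : Type*} [Countable ι] {F : ι → Plane → ℂ} {C : ι → ℝ}

theorem BddCont.tsum {ι : Type*} {F : ι → Plane → ℂ} {C : ι → ℝ} (hF : ∀ i, Continuous (F i))
    (hC : Summable C) (hFC : ∀ i x, ‖F i x‖ ≤ C i) : BddCont fun x ↦ ∑' i, F i x :=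
  ⟨continuous_tsum hF hC hFC, ∑' i, C i, fun x ↦ tsum_of_norm_bounded hC.hasSum (hFC · x)⟩

theorem hasSum_integral_mul (hF : ∀ i, Continuous (F i)) (hC : Summable C)
    (hFC : ∀ i x, ‖F i x‖ ≤ C i) {K : Plane → ℂ} (hK : Integrable K) :
    HasSum (fun i ↦ ∫ y, K y * F i y) (∫ y, K y * ∑' i, F i y) := by
  refine hasSum_integral_of_dominated_convergence (fun i y ↦ ‖K y‖ * C i) ?_ ?_ ?_ ?_ ?_
  · exact fun i ↦ hK.aestronglyMeasurable.mul (hF i).aestronglyMeasurable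
  · refine fun i ↦ Filter.Eventually.of_forall fun y ↦ ?_
    rw [norm_mul]
    exact mul_le_mul_of_nonneg_left (hFC i y) (norm_nonneg _)
  · exact Filter.Eventually.of_forall fun y ↦ hC.mul_left _
  · simp only [tsum_mul_left]
    exact hK.norm.mul_const _
  · refine Filter.Eventually.of_forall fun y ↦ ?_
    exact (Summable.of_norm_bounded hC (hFC · y)).hasSum.mul_left _

theorem hasSum_cv (hF : ∀ i, Continuous (F i)) (hC : Summable C)
    (hFC : ∀ i x, ‖F i x‖ ≤ C i) {K : Plane → ℂ} (hK : Integrable K) (x : Plane) :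
    HasSum (fun i ↦ cv K (F i) x) (cv K (fun y ↦ ∑' i, F i y) x) :=
  hasSum_integral_mul (F := fun i y ↦ F i (x - y))
    (fun i ↦ (hF i).comp (continuous_const.sub continuous_id)) hC (fun i _ ↦ hFC i _) hK

/-- Absolutely convergent series preserve the frequency localisation. -/
theorem Spec.tsum (hF : ∀ i, Spec j (F i)) (hC : Summable C) (hFC : ∀ i x, ‖F i x‖ ≤ C i) :
    Spec j fun x ↦ ∑' i, F i x := by
  refine ⟨BddCont.tsum (fun i ↦ (hF i).1.1) hC hFC, fun K hK x ↦ ?_⟩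
  have h1 := hasSum_cv (fun i ↦ (hF i).1.1) hC hFC K.integrable x
  simp only [(hF _).2 K hK x] at h1
  exact h1.unique hasSum_zero

end Series

theorem BddCont.spec_cv (hG : BddCont G) {K : 𝓢(Plane, ℂ)} (h : ∀ ξ, 𝓕 K ξ ≠ 0 → ξ ∈ annulus 1 j) :
    Spec j (QG.cv K G) := by
  refine ⟨hG.cv K.integrable, fun L hL x ↦ ?_⟩
  have : sconv L K = 0 := schwartz_ext_fourier fun ξ ↦ by
    rw [fourier_sconv, FourierTransform.fourier_zero, _root_.zero_apply]
    by_cases hK : 𝓕 K ξ = 0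
    · rw [hK, mul_zero]
    · rw [hL ξ (h ξ hK), zero_mul]
  rw [cv_cv L K hG, this]
  exact cv_zero_left x

theorem spec_ucv {u : 𝓢'(Plane, ℂ)} {Φ : 𝓢(Plane, ℂ)} (h : ∀ ξ, 𝓕 Φ ξ ≠ 0 → ξ ∈ annulus 1 j)
    (hb : ∃ C, ∀ x, ‖ucv u Φ x‖ ≤ C) : Spec j (ucv u Φ) := by
  refine ⟨⟨continuous_ucv u Φ, hb⟩, fun L hL x ↦ ?_⟩
  have : sconv L Φ = 0 := schwartz_ext_fourier fun ξ ↦ by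
    rw [fourier_sconv, FourierTransform.fourier_zero, _root_.zero_apply]
    by_cases hK : 𝓕 Φ ξ = 0
    · rw [hK, mul_zero]
    · rw [hL ξ (h ξ hK), zero_mul]
  rw [cv_ucv, this, ucv]
  have h0 : reflect 0 x = 0 := by ext; simp [reflect_apply]
  rw [h0, map_zero]

end

/-! ### Homogeneous symbols and their kernels -/

/-- A symbol that is homogeneous, and smooth away from the origin. -/
structure HomSymbol where
  /-- The symbol. -/
  toFun : Plane → ℂ
  /-- The degree of homogeneity. -/
  deg : ℤ
  contDiffOn : ContDiffOn ℝ ((⊤ : ℕ∞) : WithTop ℕ∞) toFun {0}ᶜ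
  hom : ∀ t : ℝ, 0 < t → ∀ ζ, toFun (t • ζ) = ((t ^ deg : ℝ) : ℂ) * toFun ζ

namespace HomSymbol

instance : CoeFun HomSymbol fun _ ↦ Plane → ℂ := ⟨toFun⟩

instance : Mul HomSymbol where
  mul σ τ :=
    { toFun := fun ζ ↦ σ ζ * τ ζ
      deg := σ.deg + τ.deg
      contDiffOn := σ.contDiffOn.mul τ.contDiffOn
      hom := fun t ht ζ ↦ by
        rw [σ.hom t ht, τ.hom t ht, zpow_add₀ ht.ne']
        push_cast
        ring }

theorem mul_apply (σ τ : HomSymbol) (ζ : Plane) : (σ * τ) ζ = σ ζ * τ ζ := rfl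

/-- A constant symbol. -/
def const (c : ℂ) : HomSymbol where
  toFun _ := c
  deg := 0
  contDiffOn := contDiffOn_const
  hom := by simp

/-- The symbol `ζ ↦ ζ_b`. -/
def coord (b : Fin 2) : HomSymbol where
  toFun ζ := (ζ b : ℂ)
  deg := 1
  contDiffOn := (Complex.ofRealCLM.contDiff.comp
    (EuclideanSpace.proj b : Plane →L[ℝ] ℝ).contDiff).contDiffOn
  hom := by simp

/-- The symbol `ζ ↦ |ζ|⁻¹`. -/
def normInv : HomSymbol where
  toFun ζ := ((‖ζ‖⁻¹ : ℝ) : ℂ)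
  deg := -1
  contDiffOn := by
    refine Complex.ofRealCLM.contDiff.comp_contDiffOn ?_
    refine (contDiffOn_id.norm ℝ fun x hx ↦ hx).inv fun x hx ↦ norm_ne_zero_iff.2 hx
  hom t ht ζ := by
    rw [norm_smul, Real.norm_of_nonneg ht.le, mul_inv, zpow_neg_one]
    push_cast
    rfl

end HomSymbol

theorem contDiff_symbol_mul (σ : HomSymbol) {χ : 𝓢(Plane, ℂ)} {r : ℝ} (hr : 0 < r)
    (h : ∀ ξ, ‖ξ‖ < r → χ ξ = 0) :
    ContDiff ℝ ((⊤ : ℕ∞) : WithTop ℕ∞) fun ξ ↦ σ ((2 * Real.pi) • ξ) * χ ξ := by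
  refine contDiff_iff_contDiffAt.2 fun ξ ↦ ?_
  by_cases hξ : ξ = 0
  · have : (fun ξ ↦ σ ((2 * Real.pi) • ξ) * χ ξ) =ᶠ[nhds ξ] fun _ ↦ 0 := by
      rw [hξ]
      filter_upwards [Metric.ball_mem_nhds (0 : Plane) hr] with x hx
      rw [h x (by simpa using hx), mul_zero]
    exact contDiffAt_const.congr_of_eventuallyEq this
  · refine ContDiffAt.mul ?_ (χ.smooth _).contDiffAt
    have h1 : ContDiffAt ℝ ((⊤ : ℕ∞) : WithTop ℕ∞) σ ((2 * Real.pi) • ξ) :=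
      σ.contDiffOn.contDiffAt (isOpen_compl_singleton.mem_nhds
        (smul_ne_zero (by positivity) hξ))
    exact h1.comp ξ (contDiff_const_smul _).contDiffAt

namespace DyadicPartition

variable (D : DyadicPartition)

theorem fourier_wide_eq_zero_of_norm_lt (n : ℕ) (j : ℤ) {ξ : Plane}
    (h : ‖ξ‖ < (2 * Real.pi)⁻¹ * 2 ^ (j - (n + 1 : ℕ))) : 𝓕 (D.wide n j) ξ = 0 := by
  refine D.fourier_wide_eq_zero fun hξ ↦ ?_
  have := hξ.1
  rw [inv_mul_eq_div, lt_div_iff₀ (by positivity)] at h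
  linarith

/-- The product of a homogeneous symbol and the Fourier transform of `wide n j`. -/
def symbolWide (σ : HomSymbol) (n : ℕ) (j : ℤ) : 𝓢(Plane, ℂ) :=
  HasCompactSupport.toSchwartzMap (f := fun ξ ↦ σ ((2 * Real.pi) • ξ) * 𝓕 (D.wide n j) ξ)
    (by
      refine HasCompactSupport.intro
        (isCompact_closedBall (0 : Plane) (2 ^ (j + (n + 1 : ℕ)))) fun ξ hξ ↦ ?_
      rw [D.fourier_wide_eq_zero fun h ↦ hξ ?_, mul_zero]
      rw [mem_closedBall_zero_iff]
      have := h.2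
      nlinarith [norm_nonneg ξ, Real.pi_gt_three])
    (contDiff_symbol_mul σ (r := (2 * Real.pi)⁻¹ * 2 ^ (j - (n + 1 : ℕ))) (by positivity)
      fun _ h ↦ D.fourier_wide_eq_zero_of_norm_lt n j h)

theorem symbolWide_apply (σ : HomSymbol) (n : ℕ) (j : ℤ) (ξ : Plane) :
    D.symbolWide σ n j ξ = σ ((2 * Real.pi) • ξ) * 𝓕 (D.wide n j) ξ := rfl

/-- The convolution kernel of the multiplier with symbol `σ`, localised to frequencies of size
`2 ^ (j - n - 1)` to `2 ^ (j + n + 1)`. -/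
def kern (σ : HomSymbol) (n : ℕ) (j : ℤ) : 𝓢(Plane, ℂ) := 𝓕⁻ (D.symbolWide σ n j)

theorem fourier_kern (σ : HomSymbol) (n : ℕ) (j : ℤ) (ξ : Plane) :
    𝓕 (D.kern σ n j) ξ = σ ((2 * Real.pi) • ξ) * 𝓕 (D.wide n j) ξ := by
  rw [kern, FourierTransform.fourier_fourierInv_eq, symbolWide_apply]

theorem fourier_kern_support {σ : HomSymbol} {n : ℕ} {j : ℤ} {ξ : Plane}
    (h : 𝓕 (D.kern σ n j) ξ ≠ 0) : ξ ∈ annulus (n + 1) j := by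
  rw [fourier_kern] at h
  exact D.fourier_wide_support (right_ne_zero_of_mul h)

theorem fourier_phi_dilate (j : ℤ) (ξ : Plane) :
    𝓕 (D.φ j) ξ = 𝓕 (D.φ 0) ((2 : ℝ) ^ (-j) • ξ) := by
  rw [fourier_phi, fourier_phi, D.hat_dilate, smul_comm]

theorem fourier_wide_dilate (n : ℕ) (j : ℤ) (ξ : Plane) :
    𝓕 (D.wide n j) ξ = 𝓕 (D.wide n 0) ((2 : ℝ) ^ (-j) • ξ) := by
  rw [fourier_wide, fourier_wide]
  refine Finset.sum_bij' (fun i _ ↦ i - j) (fun i _ ↦ i + j) ?_ ?_ ?_ ?_ ?_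
  · intro i hi; rw [Finset.mem_Icc] at *; omega
  · intro i hi; rw [Finset.mem_Icc] at *; omega
  · intro i _; ring
  · intro i _; ring
  · intro i _
    rw [D.fourier_phi_dilate i, D.fourier_phi_dilate (i - j), smul_smul,
      ← zpow_add₀ two_ne_zero]
    congr 3
    ring

theorem symbolWide_dilate (σ : HomSymbol) (n : ℕ) (j : ℤ) (ξ : Plane) :
    D.symbolWide σ n j ((2 : ℝ) ^ j • ξ) =
      ((((2 : ℝ) ^ j) ^ σ.deg : ℝ) : ℂ) * D.symbolWide σ n 0 ξ := by
  rw [symbolWide_apply, symbolWide_apply, fourier_wide_dilate, smul_smul ((2 : ℝ) ^ (-j)),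
    ← zpow_add₀ two_ne_zero, neg_add_cancel, zpow_zero, one_smul, smul_comm,
    σ.hom _ (by positivity), mul_assoc]

/-- Homogeneity of the symbol and dilation of the cutoff make all these kernels rescalings of the
one with j = 0, so all their bounds are uniform up to a power of 2^j. The 2 in the exponent is the
dimension. -/
theorem kern_dilate (σ : HomSymbol) (n : ℕ) (j : ℤ) (x : Plane) :
    D.kern σ n j x =
      ((((2 : ℝ) ^ j) ^ (σ.deg + 2) : ℝ) : ℂ) * D.kern σ n 0 ((2 : ℝ) ^ j • x) := by
  have hp : (0 : ℝ) < 2 ^ j := by positivity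
  rw [kern, kern, SchwartzMap.fourierInv_coe, SchwartzMap.fourierInv_coe, Real.fourierInv_eq',
    Real.fourierInv_eq']
  have := Measure.integral_comp_smul volume
    (fun ξ ↦ Complex.exp (((2 * Real.pi * inner ℝ ξ x : ℝ) : ℂ) * Complex.I) •
      D.symbolWide σ n j ξ) ((2 : ℝ) ^ j)
  rw [finrank_euclideanSpace_fin, abs_of_pos (by positivity), eq_inv_smul_iff₀ (by positivity)] at this
  rw [← this, zpow_add₀ hp.ne', ← integral_const_mul]
  rw [← integral_smul]
  congr 1
  ext ξ
  rw [symbolWide_dilate, real_inner_smul_left, real_inner_smul_right]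
  simp only [smul_eq_mul, Complex.real_smul]
  push_cast
  norm_cast
  ring

theorem integral_pow_norm_mul_kern (σ : HomSymbol) (n : ℕ) (j : ℤ) (m : ℕ) :
    ∫ x, ‖x‖ ^ m * ‖D.kern σ n j x‖ =
      ((2 : ℝ) ^ j) ^ (σ.deg - m) * ∫ x, ‖x‖ ^ m * ‖D.kern σ n 0 x‖ := by
  have hp : (0 : ℝ) < 2 ^ j := by positivity
  have := Measure.integral_comp_smul volume
    (fun x : Plane ↦ ‖x‖ ^ m * ‖D.kern σ n 0 x‖) ((2 : ℝ) ^ j)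
  rw [finrank_euclideanSpace_fin, abs_of_pos (by positivity)] at this
  rw [eq_inv_smul_iff₀ (by positivity)] at this
  rw [← this, smul_eq_mul, ← mul_assoc, ← integral_const_mul]
  congr 1
  ext x
  rw [kern_dilate, norm_mul, norm_smul, Complex.norm_real, Real.norm_of_nonneg (by positivity),
    Real.norm_of_nonneg hp.le, sub_eq_add_neg, zpow_add₀ hp.ne', zpow_add₀ hp.ne', zpow_neg,
    zpow_natCast, mul_pow]
  field_simp

theorem exists_kern_bounds (σ : HomSymbol) (n : ℕ) :
    ∃ C : ℝ, 0 < C ∧ ∀ j : ℤ,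
      (∀ x, ‖D.kern σ n j x‖ ≤ C * ((2 : ℝ) ^ j) ^ (σ.deg + 2)) ∧
      ∫ x, ‖D.kern σ n j x‖ ≤ C * ((2 : ℝ) ^ j) ^ σ.deg ∧
      ∫ x, ‖x‖ * ‖D.kern σ n j x‖ ≤ C * ((2 : ℝ) ^ j) ^ (σ.deg - 1) := by
  obtain ⟨C, hC0, hC⟩ := (bddCont_schwartz (D.kern σ n 0)).exists_pos
  have e0 := fun j ↦ D.integral_pow_norm_mul_kern σ n j 0
  have e1 := fun j ↦ D.integral_pow_norm_mul_kern σ n j 1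
  simp only [pow_zero, one_mul, Nat.cast_zero, sub_zero, pow_one, Nat.cast_one] at e0 e1
  have p0 : 0 ≤ ∫ x, ‖D.kern σ n 0 x‖ := by positivity
  have p1 : 0 ≤ ∫ x, ‖x‖ * ‖D.kern σ n 0 x‖ := by positivity
  refine ⟨C + (∫ x, ‖D.kern σ n 0 x‖) + ∫ x, ‖x‖ * ‖D.kern σ n 0 x‖, by positivity,
    fun j ↦ ⟨fun x ↦ ?_, ?_, ?_⟩⟩
  · rw [kern_dilate, norm_mul, Complex.norm_real, Real.norm_of_nonneg (by positivity), mul_comm]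
    gcongr
    linarith [hC ((2 : ℝ) ^ j • x)]
  · rw [e0, mul_comm]
    gcongr
    linarith
  · rw [e1, mul_comm]
    gcongr
    linarith

theorem lineDeriv_kern (σ : HomSymbol) (n : ℕ) (j : ℤ) (a : Fin 2) :
    ∂_{EuclideanSpace.single a (1 : ℝ)} (D.kern σ n j) =
      D.kern (HomSymbol.const Complex.I * HomSymbol.coord a * σ) n j := by
  have hg : (fun x : Plane ↦ (inner ℝ x (EuclideanSpace.single a (1 : ℝ)) : ℝ)).HasTemperateGrowth := by
    fun_prop
  refine schwartz_ext_fourier fun ξ ↦ ?_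
  rw [SchwartzMap.fourier_lineDerivOp_eq, _root_.smul_apply,
    SchwartzMap.smulLeftCLM_apply_apply hg, fourier_kern, fourier_kern]
  simp only [HomSymbol.mul_apply, HomSymbol.const, HomSymbol.coord,
    EuclideanSpace.inner_single_right, smul_eq_mul, Complex.real_smul]
  simp
  ring

end DyadicPartition

/-! ### Powers of two -/

/-- The power `2 ^ a` in the extended nonnegative reals. -/
def dy (a : ℝ) : ℝ≥0∞ := (2 : ℝ≥0∞) ^ a

theorem dy_add (a b : ℝ) : dy (a + b) = dy a * dy b :=
  ENNReal.rpow_add _ _ (by norm_num) (by norm_num)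

theorem dy_zero : dy 0 = 1 := ENNReal.rpow_zero

theorem dy_ne_top (a : ℝ) : dy a ≠ ∞ := by
  rw [dy]
  exact ENNReal.rpow_ne_top_of_ne_zero (by norm_num) (by norm_num)

theorem dy_mono {a b : ℝ} (h : a ≤ b) : dy a ≤ dy b :=
  ENNReal.rpow_le_rpow_of_exponent_le (by norm_num) h

theorem dy_rpow (a b : ℝ) : dy a ^ b = dy (a * b) := (ENNReal.rpow_mul _ _ _).symm

theorem ofReal_two_rpow (a : ℝ) : ENNReal.ofReal ((2 : ℝ) ^ a) = dy a := by
  rw [dy, ← ENNReal.ofReal_rpow_of_pos two_pos, ENNReal.ofReal_ofNat]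

theorem ofReal_two_zpow (j d : ℤ) : ENNReal.ofReal (((2 : ℝ) ^ j) ^ d) = dy (d * j) := by
  rw [← ofReal_two_rpow, ← zpow_mul, ← Real.rpow_intCast]
  push_cast
  rw [mul_comm]

/-! ### Bernstein inequalities -/

/-- Hölder with respect to the measure |K(x - y)| dy: its total mass contributes the power 1 - 1/t
and the bound b on its density the power 1/t. -/
theorem enorm_cv_le_eLpNorm {K T : Plane → ℂ} (hK : Continuous K) (hT : Continuous T)
    {t : ℝ≥0∞} (ht : 1 ≤ t) (ht' : t ≠ ∞) {b : ℝ≥0∞} (hb : ∀ x, ‖K x‖ₑ ≤ b) (x : Plane) :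
    ‖cv K T x‖ₑ ≤ b ^ (1 / t.toReal) * (∫⁻ y, ‖K y‖ₑ) ^ (1 - 1 / t.toReal) *
      eLpNorm T t volume := by
  have hKx : Continuous fun y ↦ K (x - y) := hK.comp (continuous_const.sub continuous_id)
  set ν := (volume : Measure Plane).withDensity fun y ↦ ‖K (x - y)‖ₑ
  have h1 : ‖cv K T x‖ₑ ≤ eLpNorm T 1 ν := by
    rw [cv_eq, eLpNorm_one_eq_lintegral_enorm]
    refine (enorm_integral_le_lintegral_enorm _).trans (le_of_eq ?_)
    rw [lintegral_withDensity_eq_lintegral_mul _ hKx.enorm.measurable hT.enorm.measurable]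
    simp [enorm_mul]
  have h2 : ν Set.univ = ∫⁻ y, ‖K y‖ₑ := by
    rw [withDensity_apply _ MeasurableSet.univ, setLIntegral_univ]
    exact lintegral_sub_left_eq_self (fun y ↦ ‖K y‖ₑ) x
  have h3 : ν ≤ b • volume := by
    rw [← withDensity_const]
    exact withDensity_mono (Filter.Eventually.of_forall fun y ↦ hb _)
  have h4 : eLpNorm T t ν ≤ b ^ (1 / t.toReal) * eLpNorm T t volume := by
    refine (eLpNorm_mono_measure T h3).trans (le_of_eq ?_)
    rw [eLpNorm_smul_measure_of_ne_top ht']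
    simp [smul_eq_mul]
  calc _ ≤ eLpNorm T 1 ν := h1
    _ ≤ eLpNorm T t ν * ν Set.univ ^ (1 / (1 : ℝ≥0∞).toReal - 1 / t.toReal) :=
        eLpNorm_le_eLpNorm_mul_rpow_measure_univ ht hT.aestronglyMeasurable
    _ ≤ (b ^ (1 / t.toReal) * eLpNorm T t volume) * (∫⁻ y, ‖K y‖ₑ) ^ (1 - 1 / t.toReal) := by
        rw [h2, ENNReal.toReal_one, div_one]
        gcongr
    _ = _ := by ring

/-- Interpolation of L^p between L^t and L^∞: of the p powers of |f|, t are integrated and the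
others are bounded by M. -/
theorem eLpNorm_le_of_enorm_le {f : Plane → ℂ} (hf : Continuous f) {t p : ℝ≥0∞} (ht : t ≠ 0) (htp : t ≤ p)
    (hp : p ≠ ∞) {M : ℝ≥0∞} (hM : ∀ x, ‖f x‖ₑ ≤ M) :
    eLpNorm f p volume ≤ M ^ (1 - t.toReal / p.toReal) *
      eLpNorm f t volume ^ (t.toReal / p.toReal) := by
  have ht' : t ≠ ∞ := ne_top_of_le_ne_top hp htp
  have ht0 : 0 < t.toReal := ENNReal.toReal_pos ht ht'
  have htp' : t.toReal ≤ p.toReal := ENNReal.toReal_mono hp htp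
  have hp0 : 0 < p.toReal := ht0.trans_le htp'
  have hp00 : p ≠ 0 := (ENNReal.toReal_pos_iff.1 hp0).1.ne'
  rw [eLpNorm_eq_lintegral_rpow_enorm_toReal hp00 hp, eLpNorm_eq_lintegral_rpow_enorm_toReal ht ht']
  have h1 : ∫⁻ x, ‖f x‖ₑ ^ p.toReal ≤ M ^ (p.toReal - t.toReal) * ∫⁻ x, ‖f x‖ₑ ^ t.toReal := by
    rw [← lintegral_const_mul _ (by fun_prop)]
    refine lintegral_mono fun x ↦ ?_
    calc ‖f x‖ₑ ^ p.toReal = ‖f x‖ₑ ^ (p.toReal - t.toReal) * ‖f x‖ₑ ^ t.toReal := by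
          rw [← ENNReal.rpow_add_of_nonneg _ _ (by linarith) ht0.le, sub_add_cancel]
      _ ≤ _ := by
          gcongr
          exact hM x
  refine (ENNReal.rpow_le_rpow h1 (by positivity)).trans (le_of_eq ?_)
  rw [ENNReal.mul_rpow_of_nonneg _ _ (by positivity), ← ENNReal.rpow_mul, ← ENNReal.rpow_mul]
  congr 2 <;> field_simp

namespace DyadicPartition

variable (D : DyadicPartition)

theorem exists_enorm_kern_bounds (σ : HomSymbol) (n : ℕ) :
    ∃ C : ℝ≥0∞, C ≠ 0 ∧ C ≠ ∞ ∧ ∀ j : ℤ,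
      (∀ x, ‖D.kern σ n j x‖ₑ ≤ C * dy ((σ.deg + 2) * j)) ∧
      ∫⁻ x, ‖D.kern σ n j x‖ₑ ≤ C * dy (σ.deg * j) ∧
      ∫⁻ x, ‖x‖ₑ * ‖D.kern σ n j x‖ₑ ≤ C * dy ((σ.deg - 1) * j) := by
  obtain ⟨C, hC0, hC⟩ := D.exists_kern_bounds σ n
  refine ⟨ENNReal.ofReal C, by simpa using hC0, ENNReal.ofReal_ne_top, fun j ↦ ⟨fun x ↦ ?_, ?_, ?_⟩⟩
  · have := ofReal_two_zpow j (σ.deg + 2)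
    push_cast at this
    rw [← this, ← ENNReal.ofReal_mul hC0.le, ← ofReal_norm]
    exact ENNReal.ofReal_le_ofReal ((hC j).1 x)
  · rw [← ofReal_two_zpow, ← ENNReal.ofReal_mul hC0.le,
      ← ofReal_integral_norm_eq_lintegral_enorm (D.kern σ n j).integrable]
    exact ENNReal.ofReal_le_ofReal (hC j).2.1
  · have := ofReal_two_zpow j (σ.deg - 1)
    push_cast at this
    rw [← this, ← ENNReal.ofReal_mul hC0.le]
    have h := (D.kern σ n j).integrable_pow_mul volume 1
    simp only [pow_one] at h
    have h2 := ofReal_integral_norm_eq_lintegral_enorm h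
    simp only [norm_mul, norm_norm, enorm_mul, enorm_norm] at h2
    rw [← h2]
    exact ENNReal.ofReal_le_ofReal (hC j).2.2

theorem exists_eLpNorm_cv_kern_le (σ : HomSymbol) (n : ℕ) :
    ∃ C : ℝ≥0∞, C ≠ ∞ ∧ ∀ (j : ℤ) (G : Plane → ℂ), Continuous G → ∀ p : ℝ≥0∞, 1 ≤ p → p ≠ ∞ →
      eLpNorm (cv (D.kern σ n j) G) p volume ≤ C * dy (σ.deg * j) * eLpNorm G p volume := by
  obtain ⟨C, -, hC, h⟩ := D.exists_enorm_kern_bounds σ n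
  refine ⟨C, hC, fun j G hG p hp hp' ↦ ?_⟩
  refine (eLpNorm_cv_le hp hp' (D.kern σ n j).continuous hG).trans ?_
  gcongr
  exact (h j).2.1

theorem exists_enorm_cv_kern_le (σ : HomSymbol) (n : ℕ) :
    ∃ C : ℝ≥0∞, C ≠ ∞ ∧ ∀ (j : ℤ) (G : Plane → ℂ) (M : ℝ≥0∞), (∀ x, ‖G x‖ₑ ≤ M) → ∀ x,
      ‖cv (D.kern σ n j) G x‖ₑ ≤ C * dy (σ.deg * j) * M := by
  obtain ⟨C, -, hC, h⟩ := D.exists_enorm_kern_bounds σ n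
  refine ⟨C, hC, fun j G M hM x ↦ ?_⟩
  rw [cv]
  calc _ ≤ ∫⁻ y, ‖D.kern σ n j y * G (x - y)‖ₑ := enorm_integral_le_lintegral_enorm _
    _ ≤ ∫⁻ y, ‖D.kern σ n j y‖ₑ * M := by
        refine lintegral_mono fun y ↦ ?_
        rw [enorm_mul]
        gcongr
        exact hM _
    _ = (∫⁻ y, ‖D.kern σ n j y‖ₑ) * M :=
        lintegral_mul_const _ (D.kern σ n j).continuous.enorm.measurable
    _ ≤ _ := by gcongr; exact (h j).2.1

/-- Bernstein's inequality from `L^t` to `L^∞` for localised kernels. -/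
theorem exists_enorm_cv_kern_le_eLpNorm (σ : HomSymbol) (n : ℕ) {t : ℝ≥0∞} (ht : 1 ≤ t)
    (ht' : t ≠ ∞) :
    ∃ C : ℝ≥0∞, C ≠ ∞ ∧ ∀ (j : ℤ) (T : Plane → ℂ), Continuous T → ∀ x,
      ‖cv (D.kern σ n j) T x‖ₑ ≤ C * dy (σ.deg * j + 2 / t.toReal * j) * eLpNorm T t volume := by
  obtain ⟨C, hC0, hC, h⟩ := D.exists_enorm_kern_bounds σ n
  have ht1 : 1 ≤ t.toReal := by simpa using ENNReal.toReal_mono ht' ht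
  have h1 : 0 ≤ 1 - 1 / t.toReal := by
    rw [sub_nonneg, div_le_one (by linarith)]; exact ht1
  refine ⟨C, hC, fun j T hT x ↦ ?_⟩
  refine (enorm_cv_le_eLpNorm (D.kern σ n j).continuous hT ht ht' (h j).1 x).trans ?_
  refine mul_le_mul_left ?_ _
  calc _ ≤ (C * dy ((σ.deg + 2) * j)) ^ (1 / t.toReal) *
        (C * dy (σ.deg * j)) ^ (1 - 1 / t.toReal) := by
        gcongr
        exact (h j).2.1
    _ = (C ^ (1 / t.toReal) * C ^ (1 - 1 / t.toReal)) *
        (dy ((σ.deg + 2) * j) ^ (1 / t.toReal) * dy (σ.deg * j) ^ (1 - 1 / t.toReal)) := by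
        rw [ENNReal.mul_rpow_of_nonneg _ _ (by positivity), ENNReal.mul_rpow_of_nonneg _ _ h1]
        ring
    _ = _ := by
        rw [← ENNReal.rpow_add _ _ hC0 hC, dy_rpow, dy_rpow, ← dy_add, add_sub_cancel,
          ENNReal.rpow_one]
        congr 2
        field_simp
        ring

/-- Bernstein's inequality from `L^t` to `L^p` for localised kernels. -/
theorem exists_eLpNorm_cv_kern_le_eLpNorm (σ : HomSymbol) (n : ℕ) {t p : ℝ≥0∞} (ht : 1 ≤ t)
    (htp : t ≤ p) (hp : p ≠ ∞) :
    ∃ C : ℝ≥0∞, C ≠ ∞ ∧ ∀ (j : ℤ) (T : Plane → ℂ), BddCont T →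
      eLpNorm (cv (D.kern σ n j) T) p volume ≤
        C * dy (σ.deg * j + (2 / t.toReal - 2 / p.toReal) * j) * eLpNorm T t volume := by
  have ht' : t ≠ ∞ := ne_top_of_le_ne_top hp htp
  obtain ⟨C₁, hC₁, h₁⟩ := D.exists_enorm_cv_kern_le_eLpNorm σ n ht ht'
  obtain ⟨C₂, hC₂, h₂⟩ := D.exists_eLpNorm_cv_kern_le σ n
  have ht1 : 1 ≤ t.toReal := by simpa using ENNReal.toReal_mono ht' ht
  have htp' : t.toReal ≤ p.toReal := ENNReal.toReal_mono hp htp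
  have hp0 : 0 < p.toReal := by linarith
  have e0 : 0 ≤ t.toReal / p.toReal := by positivity
  have e1 : 0 ≤ 1 - t.toReal / p.toReal := by rw [sub_nonneg, div_le_one hp0]; exact htp'
  refine ⟨C₁ ^ (1 - t.toReal / p.toReal) * C₂ ^ (t.toReal / p.toReal), ?_, fun j T hT ↦ ?_⟩
  · exact ENNReal.mul_ne_top (ENNReal.rpow_ne_top_of_nonneg e1 hC₁)
      (ENNReal.rpow_ne_top_of_nonneg e0 hC₂)
  refine (eLpNorm_le_of_enorm_le (hT.cv (D.kern σ n j).integrable).1 (zero_lt_one.trans_le ht).ne' htp hp (h₁ j T hT.1)).trans ?_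
  calc _ ≤ (C₁ * dy (σ.deg * j + 2 / t.toReal * j) * eLpNorm T t volume) ^
          (1 - t.toReal / p.toReal) *
        (C₂ * dy (σ.deg * j) * eLpNorm T t volume) ^ (t.toReal / p.toReal) := by
        gcongr
        exact h₂ j T hT.1 t ht ht'
    _ = C₁ ^ (1 - t.toReal / p.toReal) * C₂ ^ (t.toReal / p.toReal) *
        (dy (σ.deg * j + 2 / t.toReal * j) ^ (1 - t.toReal / p.toReal) *
          dy (σ.deg * j) ^ (t.toReal / p.toReal)) *
        (eLpNorm T t volume ^ (1 - t.toReal / p.toReal) *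
          eLpNorm T t volume ^ (t.toReal / p.toReal)) := by
        simp only [ENNReal.mul_rpow_of_nonneg _ _ e0, ENNReal.mul_rpow_of_nonneg _ _ e1]
        ring
    _ = _ := by
        rw [← ENNReal.rpow_add_of_nonneg _ _ e1 e0, dy_rpow, dy_rpow, ← dy_add, sub_add_cancel,
          ENNReal.rpow_one]
        congr 3
        field_simp
        ring

end DyadicPartition

/-! ### Trilinear forms and bilinear multipliers -/

theorem schwartz_fourier_inversion (A : 𝓢(Plane, ℂ)) (x : Plane) :
    A x = ∫ ξ, Complex.exp (((2 * Real.pi * inner ℝ ξ x : ℝ) : ℂ) * Complex.I) * 𝓕 A ξ := by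
  have h : 𝓕⁻ (𝓕 A) x = A x := by rw [FourierTransform.fourierInv_fourier_eq]
  rw [SchwartzMap.fourierInv_coe, Real.fourierInv_eq'] at h
  exact h.symm

theorem norm_exp_mul_I (t : ℝ) : ‖Complex.exp ((t : ℂ) * Complex.I)‖ = 1 :=
  Complex.norm_exp_ofReal_mul_I t

/-- The phase `exp(-2πi (y·ξ + z·η))`. -/
def phase (y w : Plane × Plane) : ℂ :=
  Complex.exp (((-(2 * Real.pi * (inner ℝ y.1 w.1 + inner ℝ y.2 w.2)) : ℝ) : ℂ) * Complex.I)

theorem norm_phase (y w : Plane × Plane) : ‖phase y w‖ = 1 := norm_exp_mul_I _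

theorem continuous_phase (y : Plane × Plane) : Continuous (phase y) := by
  unfold phase
  fun_prop

theorem fourier_eq_integral (v : Plane → ℂ) (ξ : Plane) :
    𝓕 v ξ = ∫ x, Complex.exp (((2 * Real.pi * inner ℝ x ξ : ℝ) : ℂ) * Complex.I) * v (-x) := by
  rw [Real.fourier_eq', ← integral_neg_eq_self]
  congr 1
  ext x
  rw [smul_eq_mul, inner_neg_left, mul_neg]
  norm_num

section

variable {v : Plane → ℂ} (A B : 𝓢(Plane, ℂ))

/-- Fourier inversion for A and B, then Fubini. The function v is only integrable, because the one
used later has the transform ζ_b/|ζ|² times a Schwartz function; its own transform enters merely as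
a bounded factor. -/
theorem integral_phase_mul (hv : Integrable v) (y : Plane × Plane) :
    ∫ w : Plane × Plane, phase y w * (𝓕 A w.1 * 𝓕 B w.2 * 𝓕 v (w.1 + w.2)) =
      ∫ x, v (-x) * (A (x - y.1) * B (x - y.2)) := by
  have hv' : Integrable fun x ↦ v (-x) := hv.comp_neg
  have hAB : Integrable fun w : Plane × Plane ↦ phase y w * (𝓕 A w.1 * 𝓕 B w.2) := by
    refine ((𝓕 A).integrable.mul_prod (𝓕 B).integrable).bdd_mul (c := 1)
      (continuous_phase y).aestronglyMeasurable ?_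
    exact Filter.Eventually.of_forall fun w ↦ (norm_phase y w).le
  let E : Plane × Plane → Plane → ℂ := fun w x ↦
    Complex.exp (((2 * Real.pi * inner ℝ x (w.1 + w.2) : ℝ) : ℂ) * Complex.I)
  have hE : Continuous (Function.uncurry E) := by
    unfold E
    fun_prop
  have hint : Integrable (Function.uncurry fun (w : Plane × Plane) (x : Plane) ↦
      E w x * ((phase y w * (𝓕 A w.1 * 𝓕 B w.2)) * v (-x))) (volume.prod volume) := by
    refine (hAB.mul_prod hv').bdd_mul (c := 1) hE.aestronglyMeasurable ?_
    exact Filter.Eventually.of_forall fun w ↦ (norm_exp_mul_I _).le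
  calc _ = ∫ w : Plane × Plane, ∫ x, E w x * ((phase y w * (𝓕 A w.1 * 𝓕 B w.2)) * v (-x)) := by
        congr 1
        ext w
        rw [fourier_eq_integral, ← mul_assoc, ← integral_const_mul]
        congr 1
        ext x
        ring
    _ = ∫ x, ∫ w : Plane × Plane, E w x * ((phase y w * (𝓕 A w.1 * 𝓕 B w.2)) * v (-x)) :=
        integral_integral_swap hint
    _ = _ := by
        congr 1
        ext x
        rw [schwartz_fourier_inversion A, schwartz_fourier_inversion B, ← integral_prod_mul,
          ← integral_const_mul]
        congr 1
        ext w
        have : E w x * phase y w =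
            Complex.exp (((2 * Real.pi * inner ℝ w.1 (x - y.1) : ℝ) : ℂ) * Complex.I) *
              Complex.exp (((2 * Real.pi * inner ℝ w.2 (x - y.2) : ℝ) : ℂ) * Complex.I) := by
          rw [phase, ← Complex.exp_add, ← Complex.exp_add]
          congr 1
          simp only [inner_add_right, inner_sub_right, real_inner_comm x, real_inner_comm y.1,
            real_inner_comm y.2]
          push_cast
          ring
        linear_combination (𝓕 A w.1 * 𝓕 B w.2 * v (-x)) * this

theorem integrable_phase_mul (hv : Integrable v) (y : Plane × Plane) :
    Integrable fun w : Plane × Plane ↦ phase y w * (𝓕 A w.1 * 𝓕 B w.2 * 𝓕 v (w.1 + w.2)) := by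
  have hc : Continuous (𝓕 v) := VectorFourier.fourierIntegral_continuous Real.continuous_fourierChar
    (by exact continuous_inner) hv
  have hb : ∀ ξ, ‖𝓕 v ξ‖ ≤ ∫ x, ‖v x‖ := fun ξ ↦ VectorFourier.norm_fourierIntegral_le_integral_norm _ _ _ _ _
  refine Integrable.bdd_mul (c := 1) ?_ (continuous_phase y).aestronglyMeasurable
    (Filter.Eventually.of_forall fun w ↦ (norm_phase y w).le)
  refine ((𝓕 A).integrable.mul_prod (𝓕 B).integrable).mul_bdd (c := ∫ x, ‖v x‖) ?_ ?_
  · exact (hc.comp (continuous_fst.add continuous_snd)).aestronglyMeasurable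
  · exact Filter.Eventually.of_forall fun w ↦ hb _

theorem integrable_trilinear (hv : Integrable v) {G H : Plane → ℂ} (hG : BddCont G)
    (hH : BddCont H) :
    Integrable (Function.uncurry fun (y : Plane × Plane) (x : Plane) ↦
      G y.1 * H y.2 * (v (-x) * (A (x - y.1) * B (x - y.2)))) (volume.prod volume) := by
  have hv' : Integrable fun x ↦ v (-x) := hv.comp_neg
  obtain ⟨C, hC0, hC⟩ := hG.exists_pos
  obtain ⟨C', -, hC'⟩ := hH.exists_pos
  have hGc := hG.1
  have hHc := hH.1
  refine Integrable.bdd_mul (c := C * C') (g := fun z : (Plane × Plane) × Plane ↦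
    v (-z.2) * (A (z.2 - z.1.1) * B (z.2 - z.1.2))) ?_
    (by fun_prop : Continuous fun z : (Plane × Plane) × Plane ↦
      G z.1.1 * H z.1.2).aestronglyMeasurable ?_
  · have hm : AEStronglyMeasurable (fun z : (Plane × Plane) × Plane ↦
        v (-z.2) * (A (z.2 - z.1.1) * B (z.2 - z.1.2))) (volume.prod volume) :=
      hv'.aestronglyMeasurable.comp_snd.mul (by
        have hA := A.continuous
        have hB := B.continuous
        exact (by fun_prop : Continuous fun z : (Plane × Plane) × Plane ↦
          A (z.2 - z.1.1) * B (z.2 - z.1.2)).aestronglyMeasurable)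
    refine (integrable_prod_iff' hm).2 ⟨Filter.Eventually.of_forall fun x ↦ ?_, ?_⟩
    · exact (((A.integrable (μ := volume)).comp_sub_left x).mul_prod
        ((B.integrable (μ := volume)).comp_sub_left x)).const_mul (v (-x))
    · have e : ∀ x, ∫ y : Plane × Plane, ‖v (-x) * (A (x - y.1) * B (x - y.2))‖ =
          ‖v (-x)‖ * ((∫ y, ‖A y‖) * ∫ z, ‖B z‖) := by
        intro x
        simp only [norm_mul]
        rw [integral_const_mul]
        refine congrArg _ ((integral_prod_mul (μ := volume) (ν := volume) (fun y ↦ ‖A (x - y)‖)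
          (fun z ↦ ‖B (x - z)‖)).trans ?_)
        rw [integral_sub_left_eq_self (fun y ↦ ‖A y‖) volume x,
          integral_sub_left_eq_self (fun y ↦ ‖B y‖) volume x]
      simp only [e]
      exact hv'.norm.mul_const _
  · refine Filter.Eventually.of_forall fun z ↦ ?_
    rw [norm_mul]
    exact mul_le_mul (hC _) (hC' _) (norm_nonneg _) hC0.le

theorem integral_trilinear (hv : Integrable v) {G H : Plane → ℂ} (hG : BddCont G)
    (hH : BddCont H) :
    ∫ y : Plane × Plane, G y.1 * H y.2 * ∫ x, v (-x) * (A (x - y.1) * B (x - y.2)) =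
      ∫ x, v (-x) * (cv A G x * cv B H x) := by
  simp only [← integral_const_mul]
  rw [integral_integral_swap (integrable_trilinear A B hv hG hH)]
  congr 1
  ext x
  rw [cv_eq, cv_eq, ← integral_prod_mul, ← integral_const_mul]
  congr 1
  ext y
  ring

end

/-- If the frequencies of `v(-·)`, `G` and `H` cannot add up to zero then `∫ v(-x) G(x) H(x) dx`
vanishes. -/
theorem integral_trilinear_eq_zero {v G H : Plane → ℂ} (A B : 𝓢(Plane, ℂ)) (hv : Integrable v)
    (hG : BddCont G) (hH : BddCont H) (h : ∀ ξ η, 𝓕 A ξ * 𝓕 B η * 𝓕 v (ξ + η) = 0) :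
    ∫ x, v (-x) * (cv A G x * cv B H x) = 0 := by
  rw [← integral_trilinear A B hv hG hH]
  simp only [← integral_phase_mul A B hv, h, mul_zero, integral_zero]

/-- Once the localised symbol times the transform of ψ is a sum of products of functions of ξ, of η
and of ξ + η, the form becomes a sum of integrals of products of convolutions. The change of
variables by 2π passes between the two normalisations of the Fourier transform; its Jacobian on the
product of two planes cancels (2π)⁻⁴. -/
theorem bilinearMultiplier_eq_sum {ι : Type*} (s : Finset ι) {m : Plane → Plane → ℂ}
    {χ₁ χ₂ : Plane → ℂ} {G H : Plane → ℂ} {ψ : 𝓢(Plane, ℂ)} (A B : ι → 𝓢(Plane, ℂ))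
    {v : ι → Plane → ℂ} (hv : ∀ i, Integrable (v i)) (hG : BddCont G) (hH : BddCont H)
    (h : ∀ ξ η : Plane, χ₁ ((2 * Real.pi) • ξ) * χ₂ ((2 * Real.pi) • η) *
        m ((2 * Real.pi) • ξ) ((2 * Real.pi) • η) * 𝓕 ψ (-ξ - η) =
      ∑ i ∈ s, 𝓕 (A i) ξ * 𝓕 (B i) η * 𝓕 (v i) (ξ + η)) :
    bilinearMultiplier m χ₁ χ₂ G H ψ =
      ∑ i ∈ s, ∫ x, v i (-x) * (cv (A i) G x * cv (B i) H x) := by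
  have hpi : (0 : ℝ) < 2 * Real.pi := by positivity
  have key : ∀ y : Plane × Plane, (2 * Real.pi : ℂ) ^ (-4 : ℤ) *
      ∫ w : Plane × Plane,
        Complex.exp (-(Complex.I * ((inner ℝ y.1 w.1 + inner ℝ y.2 w.2 : ℝ) : ℂ))) *
          (χ₁ w.1 * χ₂ w.2 * m w.1 w.2 * hat ψ (-w.1 - w.2)) =
      ∑ i ∈ s, ∫ x, v i (-x) * (A i (x - y.1) * B i (x - y.2)) := by
    intro y
    have : (volume : Measure (Plane × Plane)).IsAddHaarMeasure :=
      inferInstanceAs ((volume : Measure Plane).prod volume).IsAddHaarMeasure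
    have h1 := Measure.integral_comp_smul (volume : Measure (Plane × Plane))
      (fun w : Plane × Plane ↦
        Complex.exp (-(Complex.I * ((inner ℝ y.1 w.1 + inner ℝ y.2 w.2 : ℝ) : ℂ))) *
          (χ₁ w.1 * χ₂ w.2 * m w.1 w.2 * hat ψ (-w.1 - w.2))) (2 * Real.pi)
    rw [Module.finrank_prod, finrank_euclideanSpace_fin, abs_of_pos (by positivity)] at h1
    have e : (2 * Real.pi : ℂ) ^ (-4 : ℤ) = ((((2 * Real.pi) ^ (2 + 2))⁻¹ : ℝ) : ℂ) := by
      push_cast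
      rfl
    rw [e, ← Complex.real_smul, ← h1]
    simp only [← integral_phase_mul _ _ (hv _)]
    rw [← integral_finsetSum _ fun i _ ↦ integrable_phase_mul (A i) (B i) (hv i) y]
    congr 1
    ext w
    rw [← Finset.mul_sum, ← h]
    have e1 : hat ψ (-((2 * Real.pi) • w).1 - ((2 * Real.pi) • w).2) = 𝓕 ψ (-w.1 - w.2) := by
      rw [hat_eq_fourier]
      congr 1
      rw [Prod.smul_fst, Prod.smul_snd, ← smul_neg, ← smul_sub, inv_smul_smul₀ hpi.ne']
    rw [e1, phase]
    congr 2
    rw [Prod.smul_fst, Prod.smul_snd, inner_smul_right, inner_smul_right]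
    push_cast
    ring
  rw [bilinearMultiplier]
  simp only [key, Finset.mul_sum]
  rw [integral_finsetSum]
  · exact Finset.sum_congr rfl fun i _ ↦ integral_trilinear (A i) (B i) (hv i) hG hH
  · intro i _
    have := (integrable_trilinear (A i) (B i) (hv i) hG hH).integral_prod_left
    simp only [Function.uncurry_apply_pair, integral_const_mul] at this
    exact this

/-! ### Translation differences in `L¹` -/

/-- The partial derivative `∂_a R`. -/
def pd (a : Fin 2) (R : 𝓢(Plane, ℂ)) : 𝓢(Plane, ℂ) := ∂_{EuclideanSpace.single a (1 : ℝ)} R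

theorem fderiv_apply_eq_sum (R : 𝓢(Plane, ℂ)) (x y : Plane) :
    fderiv ℝ R x y = ∑ a, (y a : ℂ) * pd a R x := by
  have hy : y = ∑ a, y a • EuclideanSpace.single a (1 : ℝ) := by
    have := (EuclideanSpace.basisFun (Fin 2) ℝ).sum_repr y
    simpa using this.symm
  conv_lhs => rw [hy]
  rw [map_sum]
  simp [pd, SchwartzMap.lineDerivOp_apply_eq_fderiv]

theorem apply_add_sub_eq_integral (R : 𝓢(Plane, ℂ)) (x y : Plane) :
    R (x + y) - R x = ∫ t in (0 : ℝ)..1, ∑ a, (y a : ℂ) * pd a R (x + t • y) := by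
  have hd : ∀ t ∈ Set.uIcc (0 : ℝ) 1, HasDerivAt (fun t : ℝ ↦ R (x + t • y))
      (∑ a, (y a : ℂ) * pd a R (x + t • y)) t := by
    intro t _
    rw [← fderiv_apply_eq_sum]
    have h1 : HasDerivAt (fun t : ℝ ↦ x + t • y) y t := by
      simpa using ((hasDerivAt_id t).smul_const y).const_add x
    exact (R.differentiableAt (x := x + t • y)).hasFDerivAt.comp_hasDerivAt t h1
  rw [intervalIntegral.integral_eq_sub_of_hasDerivAt hd]
  · simp
  · refine Continuous.intervalIntegrable ?_ _ _
    have h : ∀ a, Continuous (pd a R) := fun a ↦ (pd a R).continuous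
    fun_prop

theorem enorm_coord_le (y : Plane) (a : Fin 2) : ‖(y a : ℂ)‖ₑ ≤ ‖y‖ₑ := by
  rw [← ofReal_norm, ← ofReal_norm, Complex.norm_real]
  exact ENNReal.ofReal_le_ofReal (PiLp.norm_apply_le y a)

theorem enorm_intervalIntegral_sum_le (y : Plane) {F : Fin 2 → ℝ → ℂ} :
    ‖∫ t in (0 : ℝ)..1, ∑ a, (y a : ℂ) * F a t‖ₑ ≤
      ∫⁻ t in Set.Ioc (0 : ℝ) 1, ∑ a, ‖y‖ₑ * ‖F a t‖ₑ := by
  rw [intervalIntegral.integral_of_le zero_le_one]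
  refine (enorm_integral_le_lintegral_enorm _).trans (lintegral_mono fun t ↦ ?_)
  refine (enorm_sum_le _ _).trans (Finset.sum_le_sum fun a _ ↦ ?_)
  rw [enorm_mul]
  gcongr
  exact enorm_coord_le y a

theorem lintegral_translate_sub_le (R : 𝓢(Plane, ℂ)) (y : Plane) :
    ∫⁻ x, ‖R (x + y) - R x‖ₑ ≤ ‖y‖ₑ * ∑ a, ∫⁻ x, ‖pd a R x‖ₑ := by
  have hc : ∀ a, Continuous (pd a R) := fun a ↦ (pd a R).continuous
  calc _ ≤ ∫⁻ x, ∫⁻ t in Set.Ioc (0 : ℝ) 1, ∑ a, ‖y‖ₑ * ‖pd a R (x + t • y)‖ₑ := by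
        refine lintegral_mono fun x ↦ ?_
        rw [apply_add_sub_eq_integral]
        exact enorm_intervalIntegral_sum_le y
    _ = ∫⁻ t in Set.Ioc (0 : ℝ) 1, ∫⁻ x, ∑ a, ‖y‖ₑ * ‖pd a R (x + t • y)‖ₑ := by
        refine lintegral_lintegral_swap (Measurable.aemeasurable ?_)
        exact Finset.measurable_fun_sum _ fun a _ ↦ Measurable.const_mul
          (by fun_prop : Continuous fun z : Plane × ℝ ↦
            ‖pd a R (z.1 + z.2 • y)‖ₑ).measurable _
    _ = ∫⁻ t in Set.Ioc (0 : ℝ) 1, ‖y‖ₑ * ∑ a, ∫⁻ x, ‖pd a R x‖ₑ := by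
        refine lintegral_congr fun t ↦ ?_
        have hm : ∀ a, Measurable fun x ↦ ‖pd a R (x + t • y)‖ₑ := fun a ↦
          Continuous.measurable (by fun_prop)
        rw [lintegral_finsetSum _ fun a _ ↦ (hm a).const_mul _, Finset.mul_sum]
        refine Finset.sum_congr rfl fun a _ ↦ ?_
        rw [lintegral_const_mul _ (hm a),
          lintegral_add_right_eq_self (fun x ↦ ‖pd a R x‖ₑ)]
    _ = _ := by simp

/-- Vanishing moments of orders 0 and 1 allow the first Taylor polynomial of W at x to be
subtracted, and the remainder is an integral of differences of first derivatives. -/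
theorem cv_eq_of_moments {ψ : 𝓢(Plane, ℂ)} (hψ : ψ ∈ zeroMoments) (W : 𝓢(Plane, ℂ)) (x : Plane) :
    cv ψ W x = ∫ y, ψ y * ∫ t in (0 : ℝ)..1,
      ∑ a, ((-y) a : ℂ) * (pd a W (x + t • -y) - pd a W x) := by
  have h0 : ∫ y, ψ y = 0 := by
    simpa [polyEval] using hψ 1
  have h1 : ∀ a, ∫ y, (y a : ℂ) * ψ y = 0 := by
    intro a
    simpa [polyEval] using hψ (MvPolynomial.X a)
  have hi : ∀ a, Integrable fun y : Plane ↦ (y a : ℂ) * ψ y := by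
    intro a
    simpa [polyEval] using integrable_polyEval_mul (MvPolynomial.X a) ψ
  have e : ∀ y : Plane, ∫ t in (0 : ℝ)..1,
      ∑ a, ((-y) a : ℂ) * (pd a W (x + t • -y) - pd a W x) =
      W (x - y) - W x + ∑ a, (y a : ℂ) * pd a W x := by
    intro y
    have hc : ∀ a, Continuous (pd a W) := fun a ↦ (pd a W).continuous
    simp only [mul_sub, Finset.sum_sub_distrib]
    rw [intervalIntegral.integral_sub, ← apply_add_sub_eq_integral, ← sub_eq_add_neg]
    · simp [sub_eq_add_neg]
    · exact Continuous.intervalIntegrable (by fun_prop) _ _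
    · exact Continuous.intervalIntegrable (by fun_prop) _ _
  simp only [e]
  simp only [mul_add, mul_sub]
  rw [integral_add, integral_sub, integral_mul_const, h0, zero_mul, sub_zero]
  · have : ∫ y, ψ y * ∑ a, (y a : ℂ) * pd a W x = 0 := by
      simp only [Finset.mul_sum]
      rw [integral_finsetSum]
      · refine Finset.sum_eq_zero fun a _ ↦ ?_
        have e2 : ∀ y : Plane, ψ y * ((y a : ℂ) * pd a W x) = (y a : ℂ) * ψ y * pd a W x := by
          intro y; ring
        simp only [e2]
        rw [integral_mul_const, h1, zero_mul]
      · intro a _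
        refine ((hi a).mul_const (pd a W x)).congr (Filter.Eventually.of_forall fun y ↦ ?_)
        simp only
        ring
    rw [this, add_zero, cv]
  · exact (bddCont_schwartz W).integrable_cv ψ.integrable x
  · exact ψ.integrable.mul_const _
  · exact ((bddCont_schwartz W).integrable_cv ψ.integrable x).sub (ψ.integrable.mul_const _)
  · simp only [Finset.mul_sum]
    refine integrable_finsetSum _ fun a _ ↦ ?_
    refine ((hi a).mul_const (pd a W x)).congr (Filter.Eventually.of_forall fun y ↦ ?_)
    simp only
    ring

/-- Two derivatives pass to W at the price of the second absolute moment of ψ. For a kernel W at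
frequency 2^j this is a gain of 2^{2j}, which controls low frequencies. -/
theorem lintegral_cv_le_of_moments {ψ : 𝓢(Plane, ℂ)} (hψ : ψ ∈ zeroMoments) (W : 𝓢(Plane, ℂ)) :
    ∫⁻ x, ‖cv ψ W x‖ₑ ≤
      (∫⁻ y, ‖ψ y‖ₑ * ‖y‖ₑ ^ 2) * ∑ a, ∑ b, ∫⁻ x, ‖pd b (pd a W) x‖ₑ := by
  have hc : ∀ a, Continuous (pd a W) := fun a ↦ (pd a W).continuous
  have hψc := ψ.continuous
  calc _ ≤ ∫⁻ x, ∫⁻ y, ‖ψ y‖ₑ * ∫⁻ t in Set.Ioc (0 : ℝ) 1,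
        ∑ a, ‖-y‖ₑ * ‖pd a W (x + t • -y) - pd a W x‖ₑ := by
        refine lintegral_mono fun x ↦ ?_
        rw [cv_eq_of_moments hψ]
        refine (enorm_integral_le_lintegral_enorm _).trans (lintegral_mono fun y ↦ ?_)
        rw [enorm_mul]
        gcongr
        exact enorm_intervalIntegral_sum_le (-y)
    _ = ∫⁻ y, ‖ψ y‖ₑ * ∫⁻ t in Set.Ioc (0 : ℝ) 1,
        ∑ a, ‖-y‖ₑ * ∫⁻ x, ‖pd a W (x + t • -y) - pd a W x‖ₑ := by
        have hm : ∀ a, Measurable fun z : (Plane × Plane) × ℝ ↦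
            ‖-z.1.2‖ₑ * ‖pd a W (z.1.1 + z.2 • -z.1.2) - pd a W z.1.1‖ₑ := fun a ↦
          (by fun_prop : Continuous fun z : (Plane × Plane) × ℝ ↦ ‖-z.1.2‖ₑ).measurable.mul
            (by fun_prop : Continuous fun z : (Plane × Plane) × ℝ ↦
              ‖pd a W (z.1.1 + z.2 • -z.1.2) - pd a W z.1.1‖ₑ).measurable
        rw [lintegral_lintegral_swap]
        · refine lintegral_congr fun y ↦ ?_
          have hm' : Measurable fun z : Plane × ℝ ↦
              ∑ a, ‖-y‖ₑ * ‖pd a W (z.1 + z.2 • -y) - pd a W z.1‖ₑ :=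
            Finset.measurable_fun_sum _ fun a _ ↦ Measurable.const_mul
              (by fun_prop : Continuous fun z : Plane × ℝ ↦
                ‖pd a W (z.1 + z.2 • -y) - pd a W z.1‖ₑ).measurable _
          rw [lintegral_const_mul _ hm'.lintegral_prod_right']
          congr 1
          rw [lintegral_lintegral_swap hm'.aemeasurable]
          refine lintegral_congr fun t ↦ ?_
          have hm'' : ∀ a, Measurable fun x ↦ ‖pd a W (x + t • -y) - pd a W x‖ₑ := fun a ↦
            Continuous.measurable (by fun_prop)
          rw [lintegral_finsetSum _ fun a _ ↦ (hm'' a).const_mul _]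
          refine Finset.sum_congr rfl fun a _ ↦ ?_
          rw [lintegral_const_mul _ (hm'' a)]
        · have h1 : Measurable fun z : Plane × Plane ↦ ‖ψ z.2‖ₑ :=
            (hψc.comp continuous_snd).enorm.measurable
          have h2 : Measurable fun z : (Plane × Plane) × ℝ ↦
              ∑ a, ‖-z.1.2‖ₑ * ‖pd a W (z.1.1 + z.2 • -z.1.2) - pd a W z.1.1‖ₑ :=
            Finset.measurable_fun_sum _ fun a _ ↦ hm a
          exact (h1.mul (h2.lintegral_prod_right' (ν := volume.restrict (Set.Ioc 0 1)))).aemeasurable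
    _ ≤ ∫⁻ y, ‖ψ y‖ₑ * (‖y‖ₑ ^ 2 * ∑ a, ∑ b, ∫⁻ x, ‖pd b (pd a W) x‖ₑ) := by
        refine lintegral_mono fun y ↦ ?_
        gcongr
        calc _ ≤ ∫⁻ t in Set.Ioc (0 : ℝ) 1, ∑ a, ‖y‖ₑ *
              (‖y‖ₑ * ∑ b, ∫⁻ x, ‖pd b (pd a W) x‖ₑ) := by
              refine setLIntegral_mono' measurableSet_Ioc fun t ht ↦ ?_
              refine Finset.sum_le_sum fun a _ ↦ ?_
              rw [enorm_neg]
              gcongr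
              refine (lintegral_translate_sub_le (pd a W) (t • -y)).trans ?_
              gcongr
              rw [enorm_smul, enorm_neg]
              refine mul_le_of_le_one_left' ?_
              rw [Real.enorm_eq_ofReal ht.1.le]
              simpa using ht.2
          _ = _ := by
              rw [lintegral_const]
              simp only [Measure.restrict_apply_univ, Real.volume_Ioc, sub_zero,
                ENNReal.ofReal_one, mul_one, ← mul_assoc, ← Finset.mul_sum]
              ring
    _ = _ := by
        simp only [← mul_assoc]
        rw [lintegral_mul_const _ (by fun_prop)]

/-! ### Series in `L¹` -/

theorem summable_two_rpow_neg_abs {c : ℝ} (hc : 0 < c) :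
    Summable fun j : ℤ ↦ (2 : ℝ) ^ (-(c * |(j : ℝ)|)) := by
  have h : Summable fun n : ℕ ↦ ((2 : ℝ) ^ (-c)) ^ n :=
    summable_geometric_of_lt_one (by positivity) (Real.rpow_lt_one_of_one_lt_of_neg one_lt_two
      (by linarith))
  have e : ∀ n : ℕ, ((2 : ℝ) ^ (-c)) ^ n = (2 : ℝ) ^ (-(c * (n : ℝ))) := by
    intro n
    rw [← Real.rpow_natCast, ← Real.rpow_mul two_pos.le, neg_mul]
  simp only [e] at h
  refine Summable.of_nat_of_neg ?_ ?_
  · simpa using h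
  · simpa using h

theorem tsum_dy_neg_abs_ne_top {c : ℝ} (hc : 0 < c) :
    ∑' j : ℤ, dy (-(c * |(j : ℝ)|)) ≠ ∞ := by
  simp only [← ofReal_two_rpow]
  exact (summable_two_rpow_neg_abs hc).tsum_ofReal_ne_top

theorem summable_integral_norm {ι : Type*} {F : ι → Plane → ℂ} (hF : ∀ i, Integrable (F i))
    (hs : ∑' i, ∫⁻ x, ‖F i x‖ₑ ≠ ∞) : Summable fun i ↦ ∫ x, ‖F i x‖ := by
  have : ∀ i, ∫ x, ‖F i x‖ = (∫⁻ x, ‖F i x‖ₑ).toReal := fun i ↦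
    integral_norm_eq_lintegral_enorm (hF i).aestronglyMeasurable
  simp only [this]
  exact ENNReal.summable_toReal hs

section

variable {ι : Type*} [Countable ι] {F : ι → Plane → ℂ}

theorem integrable_tsum (hF : ∀ i, Integrable (F i))
    (hs : ∑' i, ∫⁻ x, ‖F i x‖ₑ ≠ ∞) : Integrable fun x ↦ ∑' i, F i x := by
  have hm : ∀ i, AEMeasurable (fun x ↦ ‖F i x‖ₑ) volume := fun i ↦
    (hF i).aestronglyMeasurable.enorm
  have hfin : ∀ᵐ x : Plane, ∑' i, ‖F i x‖ₑ < ∞ := by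
    refine ae_lt_top' (AEMeasurable.tsum hm) ?_
    rwa [lintegral_tsum hm]
  have hsum : ∀ᵐ x : Plane, Summable fun i ↦ F i x := by
    filter_upwards [hfin] with x hx
    exact Summable.of_enorm hx.ne
  refine ⟨?_, ?_⟩
  · refine aestronglyMeasurable_of_tendsto_ae (Filter.atTop : Filter (Finset ι))
      (f := fun s x ↦ ∑ i ∈ s, F i x) (fun s ↦ ?_) ?_
    · exact Finset.aestronglyMeasurable_fun_sum _ fun i _ ↦ (hF i).aestronglyMeasurable
    · filter_upwards [hsum] with x hx
      exact hx.hasSum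
  · refine lt_of_le_of_lt (lintegral_mono fun x ↦ enorm_tsum_le_tsum_enorm) ?_
    rw [lintegral_tsum hm]
    exact hs.lt_top

theorem hasSum_integral_tsum_mul (hF : ∀ i, Integrable (F i))
    (hs : ∑' i, ∫⁻ x, ‖F i x‖ₑ ≠ ∞) {M : Plane → ℂ} (hM : AEStronglyMeasurable M volume) {C : ℝ}
    (hC : ∀ x, ‖M x‖ ≤ C) :
    HasSum (fun i ↦ ∫ x, F i x * M x) (∫ x, (∑' i, F i x) * M x) := by
  simp only [← tsum_mul_right]
  refine hasSum_integral_of_summable_integral_norm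
    (fun i ↦ (hF i).mul_bdd hM (Filter.Eventually.of_forall hC)) ?_
  refine Summable.of_nonneg_of_le (fun i ↦ by positivity) (fun i ↦ ?_)
    ((summable_integral_norm hF hs).mul_right C)
  rw [← integral_mul_const]
  refine integral_mono_of_nonneg (Filter.Eventually.of_forall fun x ↦ norm_nonneg _)
    ((hF i).norm.mul_const C) (Filter.Eventually.of_forall fun x ↦ ?_)
  simp only [norm_mul]
  exact mul_le_mul_of_nonneg_left (hC x) (norm_nonneg _)

theorem hasSum_fourier_tsum (hF : ∀ i, Integrable (F i))
    (hs : ∑' i, ∫⁻ x, ‖F i x‖ₑ ≠ ∞) (ξ : Plane) :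
    HasSum (fun i ↦ 𝓕 (F i) ξ) (𝓕 (fun x ↦ ∑' i, F i x) ξ) := by
  have := hasSum_integral_tsum_mul hF hs (M := fun x ↦
    Complex.exp (((-2 * Real.pi * inner ℝ x ξ : ℝ) : ℂ) * Complex.I))
    (by fun_prop : Continuous fun x : Plane ↦
      Complex.exp (((-2 * Real.pi * inner ℝ x ξ : ℝ) : ℂ) * Complex.I)).aestronglyMeasurable
    (C := 1) fun x ↦ (norm_exp_mul_I _).le
  simpa only [Real.fourier_eq', smul_eq_mul, mul_comm (Complex.exp _)] using this

end

theorem cv_comm (K L : Plane → ℂ) : cv K L = cv L K := by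
  ext x
  rw [cv, cv_eq]
  simp only [mul_comm]

/-! ### The symbol of ℬ in terms of homogeneous symbols. -/

namespace HomSymbol

/-- The symbol of `∂_a` composed with `σ`. -/
def d (a : Fin 2) (σ : HomSymbol) : HomSymbol := const Complex.I * coord a * σ

theorem deg_d (a : Fin 2) (σ : HomSymbol) : (σ.d a).deg = σ.deg + 1 := by
  change 0 + 1 + σ.deg = _
  ring

/-- The symbol `ζ ↦ ζ_b / |ζ|²`. -/
def W (b : Fin 2) : HomSymbol := coord b * normInv * normInv

theorem deg_W (b : Fin 2) : (W b).deg = -1 := rfl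

/-- The symbol `ζ ↦ ζ^⊥_b / |ζ|`. -/
def P (b : Fin 2) : HomSymbol := const (if b = 0 then -1 else 1) * coord (1 - b) * normInv

theorem deg_P (b : Fin 2) : (P b).deg = 0 := rfl

theorem P_apply (b : Fin 2) (ζ : Plane) : P b ζ = ((perp ζ b / ‖ζ‖ : ℝ) : ℂ) := by
  simp only [P, mul_apply, const, coord, normInv, perp]
  fin_cases b <;> simp [div_eq_mul_inv]

theorem W_apply (b : Fin 2) (ζ : Plane) : W b ζ = ((ζ b / ‖ζ‖ ^ 2 : ℝ) : ℂ) := by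
  simp only [W, mul_apply, coord, normInv]
  push_cast
  rw [div_eq_mul_inv, pow_two, mul_inv, mul_assoc]

end HomSymbol

/-- Since (ξ+η)·(ξ-η) = |ξ|² - |η|², the denominator |ξ| + |η| cancels and |ξ| - |η| remains. With
(ξ+η)·η^⊥ = ξ·η^⊥ = -(ξ+η)·ξ^⊥, dividing by |ξ||η| splits the rest into a term for each input. -/
theorem symbolB_eq {ξ η : Plane} (hξ : ξ ≠ 0) (hη : η ≠ 0) :
    symbolB ξ η = -(1 / 2) * ∑ b, HomSymbol.W b (ξ + η) * (HomSymbol.P b η + HomSymbol.P b ξ) := by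
  have hx : ‖ξ‖ ≠ 0 := norm_ne_zero_iff.2 hξ
  have hy : ‖η‖ ≠ 0 := norm_ne_zero_iff.2 hη
  have hxy : ‖ξ‖ + ‖η‖ ≠ 0 := by positivity
  have e1 : ‖ξ‖ ^ 2 = ξ 0 ^ 2 + ξ 1 ^ 2 := by
    rw [EuclideanSpace.norm_sq_eq]; simp
  have e2 : ‖η‖ ^ 2 = η 0 ^ 2 + η 1 ^ 2 := by
    rw [EuclideanSpace.norm_sq_eq]; simp
  simp only [symbolB, symbolT, HomSymbol.W_apply, HomSymbol.P_apply, perp, Fin.sum_univ_two]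
  generalize ‖ξ + η‖ ^ 2 = r at *
  generalize ‖ξ‖ = x at *
  generalize ‖η‖ = y at *
  have hx' : (x : ℂ) ≠ 0 := by exact_mod_cast hx
  have hy' : (y : ℂ) ≠ 0 := by exact_mod_cast hy
  have hxy' : (x : ℂ) + y ≠ 0 := by exact_mod_cast hxy
  have e1' : (x : ℂ) ^ 2 = (ξ 0 : ℂ) ^ 2 + (ξ 1 : ℂ) ^ 2 := by exact_mod_cast e1
  have e2' : (y : ℂ) ^ 2 = (η 0 : ℂ) ^ 2 + (η 1 : ℂ) ^ 2 := by exact_mod_cast e2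
  simp only [PiLp.add_apply]
  simp
  -- When ξ + η = 0 both sides vanish by the convention for division by zero.
  by_cases hr : (r : ℂ) = 0
  · simp [hr]
  field_simp
  simp only [Complex.I_sq]
  linear_combination ((ξ 0 : ℂ) * η 1 - (η 0 : ℂ) * ξ 1) * (e2' - e1')

/-! ### The bilinear form as a sum of dyadic pieces -/

theorem lintegral_enorm_cv_le {K G : Plane → ℂ} (hK : Continuous K) (hG : Continuous G) :
    ∫⁻ x, ‖cv K G x‖ₑ ≤ (∫⁻ y, ‖K y‖ₑ) * ∫⁻ y, ‖G y‖ₑ := by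
  have := eLpNorm_cv_le (p := 1) le_rfl ENNReal.one_ne_top hK hG
  simpa only [eLpNorm_one_eq_lintegral_enorm] using this

theorem lintegral_enorm_ne_top (ψ : 𝓢(Plane, ℂ)) : ∫⁻ y, ‖ψ y‖ₑ ≠ ∞ := ψ.integrable.2.ne

theorem lintegral_enorm_mul_sq_ne_top (ψ : 𝓢(Plane, ℂ)) : ∫⁻ y, ‖ψ y‖ₑ * ‖y‖ₑ ^ 2 ≠ ∞ := by
  have h := (ψ.integrable_pow_mul volume 2).2.ne
  simpa [enorm_mul, mul_comm] using h

namespace DyadicPartition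

variable (D : DyadicPartition)

theorem pd_kern (a : Fin 2) (σ : HomSymbol) (n : ℕ) (j : ℤ) :
    pd a (D.kern σ n j) = D.kern (σ.d a) n j := D.lineDeriv_kern σ n j a

/-- The convolutions of a Schwartz function without moments with localised kernels of degree `-1`
decay exponentially in `L¹` in both directions. -/
theorem exists_lintegral_cv_kern_le {σ : HomSymbol} (hσ : σ.deg = -1) {χ : 𝓢(Plane, ℂ)}
    (hχ : χ ∈ zeroMoments) :
    ∃ C : ℝ≥0∞, C ≠ ∞ ∧ ∀ j : ℤ,
      ∫⁻ x, ‖cv (D.kern σ 0 j) χ x‖ₑ ≤ C * dy (-(1 * |(j : ℝ)|)) := by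
  obtain ⟨C₀, -, hC₀, h₀⟩ := D.exists_enorm_kern_bounds σ 0
  choose C₁ _ hC₁ h₁ using fun ab : Fin 2 × Fin 2 ↦
    D.exists_enorm_kern_bounds ((σ.d ab.1).d ab.2) 0
  refine ⟨C₀ * (∫⁻ y, ‖χ y‖ₑ) + (∫⁻ y, ‖χ y‖ₑ * ‖y‖ₑ ^ 2) * ∑ a, ∑ b, C₁ (a, b), ?_, fun j ↦ ?_⟩
  · refine ENNReal.add_ne_top.2 ⟨ENNReal.mul_ne_top hC₀ (lintegral_enorm_ne_top χ),
      ENNReal.mul_ne_top (lintegral_enorm_mul_sq_ne_top χ) ?_⟩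
    exact ENNReal.sum_ne_top.2 fun a _ ↦ ENNReal.sum_ne_top.2 fun b _ ↦ hC₁ _
  rcases le_total 0 j with hj | hj
  · have hj' : (0 : ℝ) ≤ j := by exact_mod_cast hj
    refine (lintegral_enorm_cv_le (D.kern σ 0 j).continuous χ.continuous).trans ?_
    calc _ ≤ (C₀ * dy (σ.deg * j)) * ∫⁻ y, ‖χ y‖ₑ := by gcongr; exact (h₀ j).2.1
      _ = C₀ * (∫⁻ y, ‖χ y‖ₑ) * dy (-(1 * |(j : ℝ)|)) := by
          rw [hσ, abs_of_nonneg hj']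
          push_cast
          rw [neg_one_mul, one_mul]
          ring
      _ ≤ _ := by gcongr; exact le_self_add
  · have hj' : (j : ℝ) ≤ 0 := by exact_mod_cast hj
    rw [cv_comm]
    refine (lintegral_cv_le_of_moments hχ _).trans ?_
    calc _ ≤ (∫⁻ y, ‖χ y‖ₑ * ‖y‖ₑ ^ 2) * ∑ a, ∑ b, C₁ (a, b) * dy (-(1 * |(j : ℝ)|)) := by
          gcongr with a _ b _
          rw [pd_kern, pd_kern]
          refine ((h₁ (a, b) j).2.1).trans (le_of_eq ?_)
          rw [HomSymbol.deg_d, HomSymbol.deg_d, hσ, abs_of_nonpos hj']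
          push_cast
          ring_nf
      _ = ((∫⁻ y, ‖χ y‖ₑ * ‖y‖ₑ ^ 2) * ∑ a, ∑ b, C₁ (a, b)) * dy (-(1 * |(j : ℝ)|)) := by
          simp only [← Finset.sum_mul]
          ring
      _ ≤ _ := by gcongr; exact le_add_self

/-- The operator with symbol `P_b`, applied to a function localised to frequencies `2 ^ k`. -/
def riesz (k : ℤ) (b : Fin 2) (G : Plane → ℂ) : Plane → ℂ := cv (D.kern (HomSymbol.P b) 1 k) G

/-- The product `G P_b H + P_b G H`. -/
def rieszProd (k l : ℤ) (b : Fin 2) (G H : Plane → ℂ) (x : Plane) : ℂ :=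
  G x * D.riesz l b H x + D.riesz k b G x * H x

/-- The part of the bilinear form of `G` and `H` at frequency `2 ^ j`. -/
def piece (k l : ℤ) (G H : Plane → ℂ) (j : ℤ) (x : Plane) : ℂ :=
  -(1 / 2) * ∑ b, cv (D.kern (HomSymbol.W b) 0 j) (D.rieszProd k l b G H) x

end DyadicPartition

theorem BddCont.riesz (D : DyadicPartition) {G : Plane → ℂ} (hG : BddCont G) (k : ℤ) (b : Fin 2) :
    BddCont (D.riesz k b G) := hG.cv (D.kern _ 1 k).integrable

theorem BddCont.rieszProd (D : DyadicPartition) {G H : Plane → ℂ} (hG : BddCont G)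
    (hH : BddCont H) (k l : ℤ) (b : Fin 2) : BddCont (D.rieszProd k l b G H) :=
  (hG.mul (hH.riesz D l b)).add ((hG.riesz D k b).mul hH)

theorem BddCont.spec_piece (D : DyadicPartition) {G H : Plane → ℂ} (hG : BddCont G)
    (hH : BddCont H) (k l j : ℤ) : Spec j (D.piece k l G H j) :=
  (Spec.sum _ fun b _ ↦ (hG.rieszProd D hH k l b).spec_cv
    fun _ h ↦ by simpa using D.fourier_kern_support h).const_mul _

theorem reflect_zero_mem {ψ : 𝓢(Plane, ℂ)} (hψ : ψ ∈ zeroMoments) : reflect ψ 0 ∈ zeroMoments := by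
  intro P
  let Q : MvPolynomial (Fin 2) ℂ := MvPolynomial.aeval (fun i ↦ -MvPolynomial.X i) P
  have hQ : ∀ x, polyEval Q x = polyEval P (-x) := by
    intro x
    simp only [polyEval, Q]
    rw [← MvPolynomial.coe_aeval_eq_eval, ← MvPolynomial.coe_aeval_eq_eval, RingHom.coe_coe,
      RingHom.coe_coe, MvPolynomial.comp_aeval_apply]
    congr 2
    ext i
    simp
  rw [← hψ Q, ← integral_neg_eq_self]
  congr 1
  ext x
  simp [hQ, reflect_apply]

theorem cv_reflect_neg (K : Plane → ℂ) (ψ : 𝓢(Plane, ℂ)) (x : Plane) :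
    cv K (reflect ψ 0) (-x) = cv (fun y ↦ K (-y)) ψ x := by
  rw [cv, cv, ← integral_neg_eq_self]
  congr 1
  ext y
  rw [reflect_apply]
  congr 2
  abel

/-- The multiplier `ζ_b / |ζ|²` acts on functions without moments. -/
theorem exists_fourier_eq_W_mul (D : DyadicPartition) {χ : 𝓢(Plane, ℂ)} (hχ : χ ∈ zeroMoments)
    (b : Fin 2) :
    ∃ v : Plane → ℂ, Integrable v ∧
      (∀ ζ, 𝓕 v ζ = HomSymbol.W b ((2 * Real.pi) • ζ) * 𝓕 χ ζ) ∧
      ∀ M : Plane → ℂ, BddCont M →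
        HasSum (fun j ↦ ∫ x, cv (D.kern (HomSymbol.W b) 0 j) χ x * M x) (∫ x, v x * M x) := by
  let F : ℤ → Plane → ℂ := fun j ↦ cv (D.kern (HomSymbol.W b) 0 j) χ
  have e1 : ∀ j, F j = sconv (D.kern (HomSymbol.W b) 0 j) χ := fun j ↦ by
    ext x; rw [sconv_apply]
  have hF : ∀ j, Integrable (F j) := fun j ↦ by
    rw [e1]
    exact (sconv _ χ).integrable
  have hs : ∑' j, ∫⁻ x, ‖F j x‖ₑ ≠ ∞ := by
    obtain ⟨C, hC, h⟩ := D.exists_lintegral_cv_kern_le (HomSymbol.deg_W b) hχ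
    refine ne_top_of_le_ne_top ?_ (ENNReal.tsum_le_tsum h)
    rw [ENNReal.tsum_mul_left]
    exact ENNReal.mul_ne_top hC (tsum_dy_neg_abs_ne_top one_pos)
  refine ⟨fun x ↦ ∑' j, F j x, integrable_tsum hF hs, fun ζ ↦ ?_, fun M hM ↦ ?_⟩
  · have h1 := hasSum_fourier_tsum hF hs ζ
    have e : ∀ j, 𝓕 (F j) ζ =
        𝓕 (D.φ j) ζ * (HomSymbol.W b ((2 * Real.pi) • ζ) * 𝓕 χ ζ) := by
      intro j
      rw [e1, ← SchwartzMap.fourier_coe, fourier_sconv, D.fourier_kern, D.fourier_wide]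
      simp
      ring
    simp only [e] at h1
    -- At the origin the partition does not sum to 1, but W_b takes the value 0 there.
    by_cases hζ : ζ = 0
    · have h0 : HomSymbol.W b ((2 * Real.pi) • ζ) = 0 := by
        rw [HomSymbol.W_apply, hζ]; simp
      simp only [h0, zero_mul, mul_zero] at h1 ⊢
      exact h1.unique hasSum_zero
    · have h2 := (D.hasSum_fourier_phi hζ).mul_right (HomSymbol.W b ((2 * Real.pi) • ζ) * 𝓕 χ ζ)
      rw [one_mul] at h2
      exact h1.unique h2
  · obtain ⟨C, hC⟩ := hM.2
    exact hasSum_integral_tsum_mul hF hs hM.1.aestronglyMeasurable hC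

/-- The bilinear form in physical space. -/
theorem bilinearMultiplier_symbolB_eq (D : DyadicPartition) {k l : ℤ} {G H : Plane → ℂ}
    (hG : Spec k G) (hH : Spec l H) (ψ : 𝓢(Plane, ℂ)) {v : Fin 2 → Plane → ℂ}
    (hv : ∀ b, Integrable (v b))
    (hvF : ∀ b ζ, 𝓕 (v b) ζ = HomSymbol.W b ((2 * Real.pi) • ζ) * 𝓕 (reflect ψ 0) ζ) :
    bilinearMultiplier symbolB (D.cutoff k) (D.cutoff l) G H ψ =
      -(1 / 2) * ∑ b, ∫ x, v b (-x) * D.rieszProd k l b G H x := by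
  have hcut : ∀ (k : ℤ) ξ, D.cutoff k ((2 * Real.pi) • ξ) = 𝓕 (D.wide 1 k) ξ := by
    intro k ξ
    have e : Finset.Icc (k - (1 : ℕ)) (k + (1 : ℕ)) = {k - 1, k, k + 1} := by
      ext i
      simp only [Finset.mem_Icc, Finset.mem_insert, Finset.mem_singleton]
      omega
    rw [D.fourier_wide, DyadicPartition.cutoff, e, Finset.sum_insert (by simp; omega),
      Finset.sum_pair (by simp), D.fourier_phi, D.fourier_phi, D.fourier_phi, add_assoc]
  have hA : cv (D.wide 1 k) G = G := hG.cv_wide D le_rfl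
  have hB : cv (D.wide 1 l) H = H := hH.cv_wide D le_rfl
  have hpi : (0 : ℝ) < 2 * Real.pi := by positivity
  -- The first index is the component b and the second says which input carries P_b. The other input
  -- is convolved with `wide 1`, which reproduces it.
  have h1 := bilinearMultiplier_eq_sum (Finset.univ : Finset (Fin 2 × Fin 2))
    (m := symbolB) (χ₁ := D.cutoff k) (χ₂ := D.cutoff l) (ψ := ψ)
    (fun i ↦ if i.2 = 0 then D.wide 1 k else D.kern (HomSymbol.P i.1) 1 k)
    (fun i ↦ if i.2 = 0 then D.kern (HomSymbol.P i.1) 1 l else D.wide 1 l)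
    (v := fun i x ↦ -(1 / 2) * v i.1 x) (fun i ↦ (hv i.1).const_mul _) hG.1 hH.1 (by
      intro ξ η
      have e2 : 𝓕 ψ (-ξ - η) = 𝓕 (reflect ψ 0) (ξ + η) := by
        rw [fourier_reflect_zero]
        congr 1
        abel
      have e3 : ∀ b, 𝓕 (fun x ↦ -(1 / 2) * v b x) (ξ + η) = -(1 / 2) * 𝓕 (v b) (ξ + η) := by
        intro b
        rw [Real.fourier_eq', Real.fourier_eq', ← integral_const_mul]
        congr 1
        ext x
        simp only [smul_eq_mul]
        ring
      rw [hcut, hcut, e2, Fintype.sum_prod_type]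
      simp only [Fin.sum_univ_two, e3, hvF, one_ne_zero, if_true, if_false, D.fourier_kern]
      -- The formula for the symbol needs nonzero frequencies; at zero frequency the cutoffs vanish.
      by_cases hξ : ξ = 0
      · rw [hξ, D.fourier_wide_eq_zero fun h ↦ ne_zero_of_mem_annulus h rfl]
        simp
      by_cases hη : η = 0
      · rw [hη, D.fourier_wide_eq_zero fun h ↦ ne_zero_of_mem_annulus h rfl]
        simp
      rw [symbolB_eq (smul_ne_zero hpi.ne' hξ) (smul_ne_zero hpi.ne' hη), Fin.sum_univ_two,
        smul_add]
      ring)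
  rw [h1, Fintype.sum_prod_type]
  simp only [Fin.sum_univ_two, one_ne_zero, if_true, if_false, hA, hB]
  have e : ∀ b, ∫ x, v b (-x) * D.rieszProd k l b G H x =
      (∫ x, v b (-x) * (G x * D.riesz l b H x)) + ∫ x, v b (-x) * (D.riesz k b G x * H x) := by
    intro b
    rw [← integral_add ((hG.1.mul (hH.1.riesz D l b)).integrable_mul (hv b).comp_neg)
      (((hG.1.riesz D k b).mul hH.1).integrable_mul (hv b).comp_neg)]
    simp only [← mul_add]
    rfl
  rw [e, e]
  simp only [mul_assoc, integral_const_mul, DyadicPartition.riesz]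
  ring

/-- The bilinear form tested against a function without moments is the sum of its dyadic pieces. -/
theorem hasSum_integral_piece (D : DyadicPartition) {k l : ℤ} {G H : Plane → ℂ} (hG : Spec k G)
    (hH : Spec l H) {ψ : 𝓢(Plane, ℂ)} (hψ : ψ ∈ zeroMoments) :
    HasSum (fun j ↦ ∫ x, D.piece k l G H j x * ψ x)
      (bilinearMultiplier symbolB (D.cutoff k) (D.cutoff l) G H ψ) := by
  choose v hv hvF hvM using exists_fourier_eq_W_mul D (reflect_zero_mem hψ)
  rw [bilinearMultiplier_symbolB_eq D hG hH ψ hv hvF]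
  have hM : ∀ b, BddCont (D.rieszProd k l b G H) := fun b ↦ hG.1.rieszProd D hH.1 k l b
  have key : ∀ b, HasSum (fun j ↦ ∫ x, cv (D.kern (HomSymbol.W b) 0 j)
      (D.rieszProd k l b G H) x * ψ x) (∫ x, v b (-x) * D.rieszProd k l b G H x) := by
    intro b
    have h2 := hvM b (fun x ↦ D.rieszProd k l b G H (-x))
      ⟨(hM b).1.comp continuous_neg, (hM b).2.imp fun C hC x ↦ hC _⟩
    convert h2 using 1
    · ext j
      rw [integral_cv_mul (D.kern _ 0 j).integrable ψ.integrable (hM b), ← integral_neg_eq_self]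
      congr 1
      ext x
      rw [← cv_reflect_neg, neg_neg, mul_comm]
    · rw [← integral_neg_eq_self]
      simp only [neg_neg]
  have h3 := ((key 0).add (key 1)).mul_left (-(1 / 2))
  have hi : ∀ b j, Integrable fun x ↦
      cv (D.kern (HomSymbol.W b) 0 j) (D.rieszProd k l b G H) x * ψ x := fun b j ↦ by
    simpa only [mul_comm] using ((hG.1.rieszProd D hH.1 k l b).cv
      (D.kern (HomSymbol.W b) 0 j).integrable).integrable_mul ψ.integrable
  have e1 : ∀ j, ∫ x, D.piece k l G H j x * ψ x = -(1 / 2) *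
      ((∫ x, cv (D.kern (HomSymbol.W 0) 0 j) (D.rieszProd k l 0 G H) x * ψ x) +
        ∫ x, cv (D.kern (HomSymbol.W 1) 0 j) (D.rieszProd k l 1 G H) x * ψ x) := by
    intro j
    rw [← integral_add (hi 0 j) (hi 1 j), ← integral_const_mul]
    congr 1
    ext x
    rw [DyadicPartition.piece, Fin.sum_univ_two]
    ring
  simp only [e1, Fin.sum_univ_two]
  exact h3

/-! ### Tempered distributions with prescribed dyadic pieces -/

theorem fourier_laplacian (ψ : 𝓢(Plane, ℂ)) (ξ : Plane) :
    𝓕 (Δ ψ) ξ = -(((2 * Real.pi * ‖ξ‖) ^ 2 : ℝ) : ℂ) * 𝓕 ψ ξ := by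
  rw [SchwartzMap.laplacian_eq_sum (EuclideanSpace.basisFun (Fin 2) ℝ)]
  have e : 𝓕 (∑ i, ∂_{(EuclideanSpace.basisFun (Fin 2) ℝ) i}
      (∂_{(EuclideanSpace.basisFun (Fin 2) ℝ) i} ψ)) = ∑ i, 𝓕 (∂_{(EuclideanSpace.basisFun (Fin 2) ℝ) i}
      (∂_{(EuclideanSpace.basisFun (Fin 2) ℝ) i} ψ)) :=
    map_sum (FourierTransform.fourierCLM ℂ 𝓢(Plane, ℂ)) _ _
  have hg : ∀ m : Plane, (fun x : Plane ↦ (inner ℝ x m : ℝ)).HasTemperateGrowth := by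
    intro m; fun_prop
  have e1 : ‖ξ‖ ^ 2 = ξ 0 ^ 2 + ξ 1 ^ 2 := by
    rw [EuclideanSpace.norm_sq_eq]; simp
  rw [e, FunLike.coe_sum, Finset.sum_apply, Fin.sum_univ_two]
  simp only [SchwartzMap.fourier_lineDerivOp_eq, _root_.smul_apply,
    SchwartzMap.smulLeftCLM_apply_apply (hg _)]
  simp only [EuclideanSpace.basisFun_apply, EuclideanSpace.inner_single_right, mul_pow, e1]
  simp
  ring_nf
  simp only [Complex.I_sq]
  ring

theorem integral_mul_eq_cv (g : Plane → ℂ) (ψ : 𝓢(Plane, ℂ)) :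
    ∫ x, g x * ψ x = cv (reflect ψ 0) g 0 := by
  rw [cv_eq]
  congr 1
  ext x
  rw [reflect_apply, mul_comm]
  congr 2
  abel

/-- The pairing sees ψ only on the reflected annulus of g, so ψ may be replaced there by a
convolution involving χ, and the convolution moved onto g. With K an inverse Laplacian this is
integration by parts. -/
theorem Spec.norm_integral_mul_le {j : ℤ} {g : Plane → ℂ} (hg : Spec j g) {M : ℝ}
    (hM : ∀ x, ‖g x‖ ≤ M) {ψ K χ : 𝓢(Plane, ℂ)}
    (h : ∀ ξ ∈ annulus 1 j, 𝓕 K ξ * 𝓕 χ (-ξ) = 𝓕 ψ (-ξ)) :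
    ‖∫ x, g x * ψ x‖ ≤ (∫ x, ‖K x‖) * M * ∫ x, ‖χ x‖ := by
  have e : ∫ x, g x * ψ x = ∫ x, cv K g x * χ x := by
    rw [integral_mul_eq_cv, integral_mul_eq_cv, cv_cv _ _ hg.1]
    refine congrFun (hg.cv_congr fun ξ hξ ↦ ?_) 0
    rw [fourier_sconv, fourier_reflect_zero, fourier_reflect_zero, ← h ξ hξ, mul_comm]
  rw [e, ← integral_const_mul]
  refine norm_integral_le_of_norm_le (χ.integrable.norm.const_mul _)
    (Filter.Eventually.of_forall fun x ↦ ?_)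
  rw [norm_mul]
  gcongr
  exact BddCont.norm_cv_le hM K.integrable x

namespace DyadicPartition

variable (D : DyadicPartition)

theorem fourier_kern_eq (σ : HomSymbol) {n : ℕ} (hn : 1 ≤ n) {j : ℤ} {ξ : Plane}
    (hξ : ξ ∈ annulus 1 j) : 𝓕 (D.kern σ n j) ξ = σ ((2 * Real.pi) • ξ) := by
  rw [fourier_kern, D.fourier_wide_eq_one hn hξ, mul_one]

/-- A function localised to frequencies `2 ^ j` and of size at most `2 ^ j` pairs with a test
function up to an exponentially small factor. -/
theorem exists_norm_integral_mul_le (D : DyadicPartition) :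
    ∃ C : ℝ, 0 < C ∧ ∀ (j : ℤ) (g : Plane → ℂ) (M : ℝ), Spec j g →
      (∀ x, ‖g x‖ ≤ M * (2 : ℝ) ^ j) → ∀ ψ : 𝓢(Plane, ℂ), ‖∫ x, g x * ψ x‖ ≤
        C * M * (2 : ℝ) ^ (-(1 * |(j : ℝ)|)) * ((∫ x, ‖ψ x‖) + ∫ x, ‖(Δ ψ) x‖) := by
  obtain ⟨C₀, hC₀, h₀⟩ := D.exists_kern_bounds (HomSymbol.const 1) 1
  obtain ⟨C₂, hC₂, h₂⟩ := D.exists_kern_bounds (HomSymbol.normInv * HomSymbol.normInv) 1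
  refine ⟨C₀ + C₂, by positivity, fun j g M hg hM ψ ↦ ?_⟩
  have p0 : 0 ≤ ∫ x, ‖ψ x‖ := by positivity
  have p1 : 0 ≤ ∫ x, ‖(Δ ψ) x‖ := by positivity
  have pj : (0 : ℝ) < 2 ^ j := by positivity
  have hM0 : 0 ≤ M := by
    have := (norm_nonneg _).trans (hM 0)
    by_contra hneg
    nlinarith
  -- For j ≤ 0 the size 2^j of g is itself the decay. For j ≥ 0, writing ψ as (-Δ)⁻¹ of -Δψ at
  -- frequency 2^j gains 2^{-2j}, which beats 2^j.
  rcases le_total j 0 with hj | hj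
  · have hj' : (j : ℝ) ≤ 0 := by exact_mod_cast hj
    refine (hg.norm_integral_mul_le hM (K := D.kern (HomSymbol.const 1) 1 j) (χ := ψ) ?_).trans ?_
    · intro ξ hξ
      rw [D.fourier_kern_eq _ le_rfl hξ]
      exact one_mul _
    · have := (h₀ j).2.1
      rw [abs_of_nonpos hj', mul_neg, one_mul, neg_neg, Real.rpow_intCast]
      change _ ≤ C₀ * ((2 : ℝ) ^ j) ^ (0 : ℤ) at this
      rw [zpow_zero, mul_one] at this
      calc _ ≤ C₀ * (M * 2 ^ j) * ∫ x, ‖ψ x‖ := by gcongr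
        _ ≤ (C₀ + C₂) * (M * 2 ^ j) * ((∫ x, ‖ψ x‖) + ∫ x, ‖(Δ ψ) x‖) := by
            gcongr <;> linarith
        _ = _ := by ring
  · have hj' : (0 : ℝ) ≤ j := by exact_mod_cast hj
    refine (hg.norm_integral_mul_le hM (K := D.kern (HomSymbol.normInv * HomSymbol.normInv) 1 j)
      (χ := -Δ ψ) ?_).trans ?_
    · intro ξ hξ
      have hξ0 := norm_ne_zero_iff.2 (ne_zero_of_mem_annulus hξ)
      have e : 𝓕 (-Δ ψ) = -𝓕 (Δ ψ) := map_neg (FourierTransform.fourierCLM ℂ 𝓢(Plane, ℂ)) _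
      rw [D.fourier_kern_eq _ le_rfl hξ, e, _root_.neg_apply, fourier_laplacian,
        HomSymbol.mul_apply, norm_neg]
      simp only [HomSymbol.normInv, norm_two_pi_smul]
      have : ((2 * Real.pi * ‖ξ‖ : ℝ) : ℂ) ≠ 0 := by
        exact_mod_cast (by positivity : 2 * Real.pi * ‖ξ‖ ≠ 0)
      rw [Complex.ofReal_inv, Complex.ofReal_pow]
      field_simp
    · have := (h₂ j).2.1
      rw [abs_of_nonneg hj', one_mul, Real.rpow_neg two_pos.le, Real.rpow_intCast]
      change _ ≤ C₂ * ((2 : ℝ) ^ j) ^ (-2 : ℤ) at this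
      simp only [_root_.neg_apply, norm_neg]
      calc _ ≤ C₂ * ((2 : ℝ) ^ j) ^ (-2 : ℤ) * (M * 2 ^ j) * ∫ x, ‖(Δ ψ) x‖ := by gcongr
        _ = C₂ * (M * (2 ^ j)⁻¹) * ∫ x, ‖(Δ ψ) x‖ := by
            rw [show (-2 : ℤ) = -1 + -1 by norm_num, zpow_add₀ pj.ne', zpow_neg_one]
            field_simp
        _ ≤ (C₀ + C₂) * (M * (2 ^ j)⁻¹) * ((∫ x, ‖ψ x‖) + ∫ x, ‖(Δ ψ) x‖) := by
            gcongr <;> linarith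
        _ = _ := by ring

/-- The j-th term is O(2^{-|j|}) with a constant controlled by the L¹ norms of ψ and Δψ, so the sum
is a continuous functional on genuine Schwartz functions, without moment conditions. The size 2^j is
that of the blocks of an element of a scale-invariant space. -/
theorem exists_distribution (D : DyadicPartition) {g : ℤ → Plane → ℂ} (hg : ∀ j, Spec j (g j)) {M : ℝ}
    (hM : ∀ j x, ‖g j x‖ ≤ M * (2 : ℝ) ^ j) :
    ∃ u : 𝓢'(Plane, ℂ), ∀ ψ, HasSum (fun j ↦ ∫ x, g j x * ψ x) (u ψ) := by
  obtain ⟨C, hC0, hC⟩ := D.exists_norm_integral_mul_le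
  have hb := fun j ↦ hC j (g j) M (hg j) (hM j)
  have hs : ∀ ψ : 𝓢(Plane, ℂ), Summable fun j : ℤ ↦
      C * M * (2 : ℝ) ^ (-(1 * |(j : ℝ)|)) * ((∫ x, ‖ψ x‖) + ∫ x, ‖(Δ ψ) x‖) := fun ψ ↦
    ((summable_two_rpow_neg_abs one_pos).mul_left _).mul_right _
  have hsum : ∀ ψ : 𝓢(Plane, ℂ), Summable fun j ↦ ∫ x, g j x * ψ x := fun ψ ↦
    Summable.of_norm_bounded (hs ψ) fun j ↦ hb j ψ
  have hi : ∀ j (ψ : 𝓢(Plane, ℂ)), Integrable fun x ↦ g j x * ψ x := fun j ψ ↦ by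
    simpa only [mul_comm] using (hg j).1.integrable_mul ψ.integrable
  let L : 𝓢(Plane, ℂ) →ₗ[ℂ] ℂ :=
    { toFun := fun ψ ↦ ∑' j, ∫ x, g j x * ψ x
      map_add' := fun ψ χ ↦ by
        rw [← (hsum ψ).tsum_add (hsum χ)]
        congr 1
        ext j
        rw [← integral_add (hi j ψ) (hi j χ)]
        simp [mul_add]
      map_smul' := fun c ψ ↦ by
        rw [RingHom.id_apply, smul_eq_mul, ← tsum_mul_left]
        congr 1
        ext j
        rw [← integral_const_mul]
        simp [mul_left_comm] }
  have hL : Continuous L := by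
    refine continuous_of_continuousAt_zero L ?_
    set A : ℝ := ∑' j : ℤ, C * M * (2 : ℝ) ^ (-(1 * |(j : ℝ)|))
    let N : 𝓢(Plane, ℂ) → ℝ := fun ψ ↦ A * (‖SchwartzMap.toLpCLM ℂ ℂ 1 volume ψ‖ +
      ‖SchwartzMap.toLpCLM ℂ ℂ 1 volume (LineDeriv.laplacianCLM ℂ Plane 𝓢(Plane, ℂ) ψ)‖)
    have hN : Filter.Tendsto N (nhds 0) (nhds 0) := by
      have : Continuous N := by fun_prop
      have h0 : N 0 = 0 := by simp only [N, map_zero, norm_zero, add_zero, mul_zero]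
      simpa only [h0] using this.tendsto 0
    rw [ContinuousAt, map_zero]
    refine squeeze_zero_norm (fun ψ ↦ ?_) hN
    refine (tsum_of_norm_bounded (hs ψ).hasSum fun j ↦ hb j ψ).trans (le_of_eq ?_)
    rw [tsum_mul_right]
    simp only [N, SchwartzMap.toLpCLM_apply, SchwartzMap.norm_toLp_one, A,
      SchwartzMap.laplacianCLM_eq]
  exact ⟨ContinuousLinearMap.toPointwiseConvergenceCLM _ _ _ _ ⟨L, hL⟩, fun ψ ↦ (hsum ψ).hasSum⟩

theorem cv_phi_eq_zero {g : Plane → ℂ} {i j : ℤ} (hg : Spec j g) (h : 1 < |i - j|) (x : Plane) :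
    cv (D.φ i) g x = 0 := by
  refine hg.2 _ (fun ξ hξ ↦ ?_) x
  by_contra hne
  obtain ⟨h1, h2⟩ := D.fourier_phi_support_lt hne
  have h3 := (zpow_lt_zpow_iff_right₀ one_lt_two).1 (h1.trans_le hξ.2)
  have h4 := (zpow_lt_zpow_iff_right₀ one_lt_two).1 (hξ.1.trans_lt h2)
  rw [lt_abs] at h
  omega

theorem block_eq_sum_cv {g : ℤ → Plane → ℂ} (hg : ∀ j, Spec j (g j)) {u : 𝓢'(Plane, ℂ)}
    (hu : ∀ ψ, HasSum (fun j ↦ ∫ x, g j x * ψ x) (u ψ)) (i : ℤ) (x : Plane) :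
    D.block i (Submodule.Quotient.mk u) x = ∑ j ∈ Finset.Icc (i - 1) (i + 1), cv (D.φ i) (g j) x := by
  have h := hu (reflect (D.φ i) x)
  have e : ∀ j, ∫ y, g j y * reflect (D.φ i) x y = cv (D.φ i) (g j) x := by
    intro j
    rw [cv_eq]
    simp only [reflect_apply, mul_comm]
  simp only [e] at h
  refine h.unique (hasSum_sum_of_ne_finset_zero fun j hj ↦ D.cv_phi_eq_zero (hg j) ?_ x)
  rw [Finset.mem_Icc] at hj
  rw [lt_abs]
  omega

end DyadicPartition

/-! ### Frequency interactions and the high-low estimate -/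

theorem fourier_comp_const_add_eq_zero (W : 𝓢(Plane, ℂ)) (x : Plane) {ζ : Plane} (h : 𝓕 W ζ = 0) :
    𝓕 (fun y ↦ W (x + y)) ζ = 0 := by
  rw [SchwartzMap.fourier_coe, Real.fourier_eq'] at h
  rw [Real.fourier_eq', ← integral_sub_right_eq_self _ x]
  have e : ∀ y, Complex.exp (((-2 * Real.pi * inner ℝ (y - x) ζ : ℝ) : ℂ) * Complex.I) •
      W (x + (y - x)) = Complex.exp (((2 * Real.pi * inner ℝ x ζ : ℝ) : ℂ) * Complex.I) *
        (Complex.exp (((-2 * Real.pi * inner ℝ y ζ : ℝ) : ℂ) * Complex.I) • W y) := by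
    intro y
    rw [add_sub_cancel, smul_eq_mul, smul_eq_mul, ← mul_assoc, ← Complex.exp_add, inner_sub_left]
    congr 2
    push_cast
    ring
  simp only [e]
  rw [integral_const_mul, h, mul_zero]

/-- Frequencies add under multiplication, so W sees nothing of the product if it vanishes at all
sums ξ + η. -/
theorem cv_mul_cv_eq_zero {G H : Plane → ℂ} (hG : BddCont G) (hH : BddCont H)
    {A B W : 𝓢(Plane, ℂ)} (h : ∀ ξ η, 𝓕 A ξ ≠ 0 → 𝓕 B η ≠ 0 → 𝓕 W (ξ + η) = 0) (x : Plane) :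
    cv W (fun y ↦ cv A G y * cv B H y) x = 0 := by
  have hv : Integrable fun y ↦ W (x + y) := (W.integrable (μ := volume)).comp_add_left x
  rw [cv_eq]
  refine integral_trilinear_eq_zero A B hv hG hH fun ξ η ↦ ?_
  by_cases hA : 𝓕 A ξ = 0
  · rw [hA, zero_mul, zero_mul]
  by_cases hB : 𝓕 B η = 0
  · rw [hB, mul_zero, zero_mul]
  rw [fourier_comp_const_add_eq_zero W x (h ξ η hA hB), mul_zero]

/-- The annuli of width 2 are the supports of the widened cutoffs. The gap 7 forces 2π|η| ≤ 2^{k-5},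
so the sum keeps the size of ξ, between 7 · 2^{k-5} and 129 · 2^{k-5}. -/
theorem add_notMem_annulus_of_sep {k l j : ℤ} (hkl : l + 7 ≤ k) (hj : 5 < |j - k|) {ξ η : Plane}
    (hξ : ξ ∈ annulus 2 k) (hη : η ∈ annulus 2 l) : ξ + η ∉ annulus 1 j := by
  intro h
  have hpi : (0 : ℝ) < 2 * Real.pi := by positivity
  have h1 : ‖ξ + η‖ ≤ ‖ξ‖ + ‖η‖ := norm_add_le _ _
  have h2 : ‖ξ‖ ≤ ‖ξ + η‖ + ‖η‖ := by
    have := norm_sub_le (ξ + η) η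
    rwa [add_sub_cancel_right] at this
  have e1 := hξ.1
  have e2 := hξ.2
  have e3 := hη.2
  have e4 := h.1
  have e5 := h.2
  have e6 : (2 : ℝ) ^ (l + (2 : ℕ)) ≤ 2 ^ (k - 5) := zpow_le_zpow_iff_two.2 (by push_cast; omega)
  have p : (0 : ℝ) < 2 ^ (k - 5) := by positivity
  have e7 : (2 : ℝ) ^ (k - (2 : ℕ)) = 8 * 2 ^ (k - 5) := by
    rw [show k - ((2 : ℕ) : ℤ) = 3 + (k - 5) by push_cast; ring, zpow_add₀ two_ne_zero]; norm_num
  have e8 : (2 : ℝ) ^ (k + (2 : ℕ)) = 128 * 2 ^ (k - 5) := by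
    rw [show k + ((2 : ℕ) : ℤ) = 7 + (k - 5) by push_cast; ring, zpow_add₀ two_ne_zero]; norm_num
  have u1 : 2 * Real.pi * ‖ξ + η‖ ≤ 2 * Real.pi * ‖ξ‖ + 2 * Real.pi * ‖η‖ := by nlinarith
  have u2 : 2 * Real.pi * ‖ξ‖ ≤ 2 * Real.pi * ‖ξ + η‖ + 2 * Real.pi * ‖η‖ := by nlinarith
  rcases lt_abs.1 hj with hj | hj
  · have e9 : (2 : ℝ) ^ (k + 4) ≤ 2 ^ (j - (1 : ℕ)) :=
      zpow_le_zpow_iff_two.2 (by push_cast; omega)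
    have e10 : (2 : ℝ) ^ (k + 4) = 512 * 2 ^ (k - 5) := by
      rw [show k + 4 = 9 + (k - 5) by ring, zpow_add₀ two_ne_zero]; norm_num
    linarith
  · have e9 : (2 : ℝ) ^ (j + (1 : ℕ)) ≤ 2 ^ (k - 5) :=
      zpow_le_zpow_iff_two.2 (by push_cast; omega)
    linarith

theorem add_notMem_annulus_of_close {k l j : ℤ} (hkl : |k - l| < 7) (hj : k + 11 < j)
    {ξ η : Plane} (hξ : ξ ∈ annulus 2 k) (hη : η ∈ annulus 2 l) : ξ + η ∉ annulus 1 j := by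
  intro h
  have hpi : (0 : ℝ) < 2 * Real.pi := by positivity
  have h1 : ‖ξ + η‖ ≤ ‖ξ‖ + ‖η‖ := norm_add_le _ _
  rw [abs_lt] at hkl
  have e2 : 2 * Real.pi * ‖ξ‖ ≤ 2 ^ (j - 3) :=
    hξ.2.trans (zpow_le_zpow_iff_two.2 (by push_cast; omega))
  have e3 : 2 * Real.pi * ‖η‖ ≤ 2 ^ (j - 3) :=
    hη.2.trans (zpow_le_zpow_iff_two.2 (by push_cast; omega))
  have e4 := h.1
  have e5 : (2 : ℝ) ^ (j - (1 : ℕ)) = 4 * 2 ^ (j - 3) := by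
    rw [show j - ((1 : ℕ) : ℤ) = 2 + (j - 3) by push_cast; ring, zpow_add₀ two_ne_zero]; norm_num
  have p : (0 : ℝ) < 2 ^ (j - 3) := by positivity
  nlinarith

namespace DyadicPartition

variable (D : DyadicPartition)

theorem piece_eq_zero {k l j : ℤ} {G H : Plane → ℂ} (hG : Spec k G) (hH : Spec l H)
    (h : ∀ ξ ∈ annulus 2 k, ∀ η ∈ annulus 2 l, ξ + η ∉ annulus 1 j) (x : Plane) :
    D.piece k l G H j x = 0 := by
  have hA : cv (D.wide 1 k) G = G := hG.cv_wide D le_rfl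
  have hB : cv (D.wide 1 l) H = H := hH.cv_wide D le_rfl
  have hW : ∀ b {A B : 𝓢(Plane, ℂ)}, (∀ ξ, 𝓕 A ξ ≠ 0 → ξ ∈ annulus 2 k) →
      (∀ ξ, 𝓕 B ξ ≠ 0 → ξ ∈ annulus 2 l) →
      ∀ ξ η, 𝓕 A ξ ≠ 0 → 𝓕 B η ≠ 0 → 𝓕 (D.kern (HomSymbol.W b) 0 j) (ξ + η) = 0 := by
    intro b A B hA hB ξ η hξ hη
    by_contra hne
    exact h ξ (hA ξ hξ) η (hB η hη) (by simpa using D.fourier_kern_support hne)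
  rw [piece, Finset.sum_eq_zero, mul_zero]
  intro b _
  have e : D.rieszProd k l b G H = fun y ↦
      cv (D.wide 1 k) G y * cv (D.kern (HomSymbol.P b) 1 l) H y +
        cv (D.kern (HomSymbol.P b) 1 k) G y * cv (D.wide 1 l) H y := by
    rw [hA, hB]
    rfl
  rw [e, cv_add_right (D.kern _ 0 j).integrable
    ((hG.1.cv (D.wide 1 k).integrable).mul (hH.1.cv (D.kern _ 1 l).integrable))
    ((hG.1.cv (D.kern _ 1 k).integrable).mul (hH.1.cv (D.wide 1 l).integrable)),
    cv_mul_cv_eq_zero hG.1 hH.1 (hW b (fun ξ ↦ D.fourier_wide_support)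
      fun ξ ↦ D.fourier_kern_support),
    cv_mul_cv_eq_zero hG.1 hH.1 (hW b (fun ξ ↦ D.fourier_kern_support)
      fun ξ ↦ D.fourier_wide_support), add_zero]

theorem piece_comm (k l j : ℤ) (G H : Plane → ℂ) : D.piece k l G H j = D.piece l k H G j := by
  have : ∀ b, D.rieszProd k l b G H = D.rieszProd l k b H G := fun b ↦ by
    ext x
    simp only [rieszProd]
    ring
  unfold piece
  simp only [this]

theorem eLpNorm_piece_le {k l : ℤ} {G H : Plane → ℂ} (hG : BddCont G) (hH : BddCont H) (j : ℤ)
    {p : ℝ≥0∞} (hp : 1 ≤ p) :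
    eLpNorm (D.piece k l G H j) p volume ≤
      ∑ b, eLpNorm (cv (D.kern (HomSymbol.W b) 0 j) (D.rieszProd k l b G H)) p volume := by
  refine le_trans (eLpNorm_mono_enorm (g := ∑ b, cv (D.kern (HomSymbol.W b) 0 j)
    (D.rieszProd k l b G H)) fun x ↦ ?_) (eLpNorm_sum_le (fun b _ ↦ ?_) hp)
  · rw [piece, enorm_mul, Finset.sum_apply]
    refine mul_le_of_le_one_left' ?_
    rw [← ofReal_norm]
    norm_num
  · exact ((hG.rieszProd D hH k l b).cv (D.kern _ 0 j).integrable).1.aestronglyMeasurable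

end DyadicPartition

theorem eLpNorm_mul_le_of_enorm_le {f g : Plane → ℂ} {M : ℝ≥0∞} (hM : M ≠ ∞)
    (hf : ∀ x, ‖f x‖ₑ ≤ M) (hg : Continuous g) (p : ℝ≥0∞) :
    eLpNorm (fun x ↦ f x * g x) p volume ≤ M * eLpNorm g p volume := by
  lift M to ℝ≥0 using hM
  refine eLpNorm_le_mul_eLpNorm_of_ae_le_mul'' p hg.aestronglyMeasurable
    (Filter.Eventually.of_forall fun x ↦ ?_)
  rw [enorm_mul]
  gcongr
  exact hf x

namespace DyadicPartition

variable (D : DyadicPartition)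

/-- The estimate of the pieces in `L^∞ × L^p`. -/
theorem exists_eLpNorm_piece_le_sup_mul :
    ∃ C : ℝ≥0∞, C ≠ ∞ ∧ ∀ (k l j : ℤ) (G H : Plane → ℂ) (M p : ℝ≥0∞), BddCont G → BddCont H →
      1 ≤ p → p ≠ ∞ → M ≠ ∞ → (∀ x, ‖G x‖ₑ ≤ M) →
      eLpNorm (D.piece k l G H j) p volume ≤ C * dy (-j) * M * eLpNorm H p volume := by
  choose C₁ hC₁ h₁ using fun b ↦ D.exists_eLpNorm_cv_kern_le (HomSymbol.W b) 0
  choose C₂ hC₂ h₂ using fun b ↦ D.exists_eLpNorm_cv_kern_le (HomSymbol.P b) 1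
  choose C₃ hC₃ h₃ using fun b ↦ D.exists_enorm_cv_kern_le (HomSymbol.P b) 1
  refine ⟨∑ b, C₁ b * (C₂ b + C₃ b), ENNReal.sum_ne_top.2 fun b _ ↦
    ENNReal.mul_ne_top (hC₁ b) (ENNReal.add_ne_top.2 ⟨hC₂ b, hC₃ b⟩), ?_⟩
  intro k l j G H M p hG hH hp hp' hM hGM
  refine (D.eLpNorm_piece_le hG hH j hp).trans ?_
  simp only [Finset.sum_mul]
  refine Finset.sum_le_sum fun b _ ↦ ?_
  have hM' : ∀ x, ‖D.riesz k b G x‖ₑ ≤ C₃ b * M := fun x ↦ by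
    have := h₃ b k G M hGM x
    rwa [HomSymbol.deg_P, Int.cast_zero, zero_mul, dy_zero, mul_one] at this
  have hP : eLpNorm (D.riesz l b H) p volume ≤ C₂ b * eLpNorm H p volume := by
    have := h₂ b l H hH.1 p hp hp'
    rwa [HomSymbol.deg_P, Int.cast_zero, zero_mul, dy_zero, mul_one] at this
  have e1 : eLpNorm (D.rieszProd k l b G H) p volume ≤
      (C₂ b + C₃ b) * (M * eLpNorm H p volume) := by
    calc _ ≤ eLpNorm (fun x ↦ G x * D.riesz l b H x) p volume +
          eLpNorm (fun x ↦ D.riesz k b G x * H x) p volume :=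
          eLpNorm_add_le (hG.mul (hH.riesz D l b)).1.aestronglyMeasurable
            ((hG.riesz D k b).mul hH).1.aestronglyMeasurable hp
      _ ≤ M * eLpNorm (D.riesz l b H) p volume + C₃ b * M * eLpNorm H p volume :=
          add_le_add (eLpNorm_mul_le_of_enorm_le hM hGM (hH.riesz D l b).1 p)
            (eLpNorm_mul_le_of_enorm_le (ENNReal.mul_ne_top (hC₃ b) hM) hM' hH.1 p)
      _ ≤ M * (C₂ b * eLpNorm H p volume) + C₃ b * M * eLpNorm H p volume := by gcongr
      _ = _ := by ring
  have e2 := h₁ b j _ (hG.rieszProd D hH k l b).1 p hp hp'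
  rw [HomSymbol.deg_W] at e2
  push_cast at e2
  rw [neg_one_mul] at e2
  calc _ ≤ C₁ b * dy (-j) * eLpNorm (D.rieszProd k l b G H) p volume := e2
    _ ≤ C₁ b * dy (-j) * ((C₂ b + C₃ b) * (M * eLpNorm H p volume)) := by gcongr
    _ = _ := by ring

end DyadicPartition

/-! ### The commutator structure of the high-high interactions -/

/-- Lebesgue measure on the unit interval. -/
def unitMeasure : Measure ℝ := volume.restrict (Set.Ioc 0 1)

instance : IsProbabilityMeasure unitMeasure := ⟨by simp [unitMeasure]⟩

theorem integrable_mul_prod_mul {Z : Type*} [MeasurableSpace Z] {μ : Measure Z} [SFinite μ]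
    {w : Plane → ℂ} (hw : Integrable w) {k : Z → ℂ} (hk : Integrable k μ) {B : Plane × Z → ℂ}
    (hB : AEStronglyMeasurable B (volume.prod μ)) {C : ℝ} (hC : ∀ z, ‖B z‖ ≤ C) :
    Integrable (fun z : Plane × Z ↦ w z.1 * k z.2 * B z) (volume.prod μ) :=
  (hw.mul_prod hk).mul_bdd hB (Filter.Eventually.of_forall hC)

theorem integral_mul_integral_swap {Z : Type*} [MeasurableSpace Z] {μ : Measure Z} [SFinite μ]
    {w : Plane → ℂ} (hw : Integrable w) {k : Z → ℂ} (hk : Integrable k μ) {B : Plane × Z → ℂ}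
    (hB : AEStronglyMeasurable B (volume.prod μ)) {C : ℝ} (hC : ∀ z, ‖B z‖ ≤ C) :
    ∫ s, w s * ∫ z, k z * B (s, z) ∂μ = ∫ z, k z * (∫ s, w s * B (s, z)) ∂μ := by
  simp only [← integral_const_mul]
  rw [integral_integral_swap]
  · refine integral_congr_ae (Filter.Eventually.of_forall fun z ↦ ?_)
    refine integral_congr_ae (Filter.Eventually.of_forall fun s ↦ ?_)
    simp only
    ring
  · refine (integrable_mul_prod_mul hw hk hB hC).congr (Filter.Eventually.of_forall fun z ↦ ?_)
    simp only [Function.uncurry]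
    ring

theorem cv_add_sub_eq_integral (W : 𝓢(Plane, ℂ)) {Q : Plane → ℂ} (hQ : BddCont Q) (x y : Plane) :
    cv W Q (x + y) - cv W Q x =
      ∫ t, ∑ a, (y a : ℂ) * cv (pd a W) Q (x + t • y) ∂unitMeasure := by
  obtain ⟨C, hC0, hC⟩ := hQ.exists_pos
  have hQc := hQ.1
  have hWc : ∀ a, Continuous (pd a W) := fun a ↦ (pd a W).continuous
  have hint : ∀ a, Integrable (fun z : Plane × ℝ ↦ pd a W (x + z.2 • y - z.1) * Q z.1)
      (volume.prod unitMeasure) := by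
    intro a
    have hm : AEStronglyMeasurable (fun z : Plane × ℝ ↦ pd a W (x + z.2 • y - z.1) * Q z.1)
        (volume.prod unitMeasure) := Continuous.aestronglyMeasurable (by fun_prop)
    have h1 : ∀ t : ℝ, Integrable fun s ↦ pd a W (x + t • y - s) * Q s := fun t ↦
      hQ.integrable_mul ((pd a W).integrable (μ := volume) |>.comp_sub_left _)
    refine (integrable_prod_iff' hm).2 ⟨Filter.Eventually.of_forall h1, ?_⟩
    refine Integrable.of_bound (C := (∫ s, ‖pd a W s‖) * C) hm.norm.prod_swap.integral_prod_right'
      (Filter.Eventually.of_forall fun t ↦ ?_)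
    rw [Real.norm_of_nonneg (by positivity),
      ← integral_sub_left_eq_self (fun s ↦ ‖pd a W s‖) volume (x + t • y), ← integral_mul_const]
    refine integral_mono (h1 t).norm
      ((((pd a W).integrable (μ := volume)).comp_sub_left _).norm.mul_const C) fun s ↦ ?_
    rw [norm_mul]
    gcongr
    exact hC s
  have e1 : ∀ s, (W (x + y - s) - W (x - s)) * Q s =
      ∫ t, ∑ a, (y a : ℂ) * (pd a W (x + t • y - s) * Q s) ∂unitMeasure := by
    intro s
    have h := apply_add_sub_eq_integral W (x - s) y
    rw [sub_add_eq_add_sub, intervalIntegral.integral_of_le zero_le_one] at h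
    rw [h, ← integral_mul_const]
    refine integral_congr_ae (Filter.Eventually.of_forall fun t ↦ ?_)
    simp only [Finset.sum_mul, mul_assoc, sub_add_eq_add_sub]
  rw [cv_eq, cv_eq, ← integral_sub
    (hQ.integrable_mul ((W.integrable (μ := volume)).comp_sub_left _))
    (hQ.integrable_mul ((W.integrable (μ := volume)).comp_sub_left _))]
  simp only [← sub_mul, e1]
  rw [integral_integral_swap]
  · refine integral_congr_ae ?_
    filter_upwards [] with t
    rw [integral_finsetSum]
    · refine Finset.sum_congr rfl fun a _ ↦ ?_
      rw [integral_const_mul, cv_eq]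
    · intro a _
      exact (hQ.integrable_mul (((pd a W).integrable (μ := volume)).comp_sub_left _)).const_mul _
  · exact integrable_finsetSum _ fun a _ ↦ (hint a).const_mul _

/-- The averages `∫∫ κ(y) y_a G(s + ty) H(s + ty - y) dt dy` over the unit interval in `t`. -/
def transport (κ : 𝓢(Plane, ℂ)) (a : Fin 2) (G H : Plane → ℂ) (s : Plane) : ℂ :=
  ∫ z : Plane × ℝ, κ z.1 * (z.1 a : ℂ) * (G (s + z.2 • z.1) * H (s + z.2 • z.1 - z.1))
    ∂(volume.prod unitMeasure)

section

variable (κ : 𝓢(Plane, ℂ)) (a : Fin 2) {G H : Plane → ℂ}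

theorem integrable_coord_mul : Integrable fun y : Plane ↦ κ y * (y a : ℂ) := by
  have h : Integrable fun y : Plane ↦ ‖y‖ * ‖κ y‖ := by
    simpa using κ.integrable_pow_mul volume 1
  have hc := κ.continuous
  refine h.mono' (Continuous.aestronglyMeasurable (by fun_prop))
    (Filter.Eventually.of_forall fun y ↦ ?_)
  rw [norm_mul, mul_comm, Complex.norm_real]
  gcongr
  exact PiLp.norm_apply_le y a

theorem integrable_coord_mul_prod :
    Integrable (fun z : Plane × ℝ ↦ κ z.1 * (z.1 a : ℂ)) (volume.prod unitMeasure) := by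
  simpa using (integrable_coord_mul κ a).mul_prod (integrable_const (1 : ℂ) (μ := unitMeasure))

theorem BddCont.transport (hG : BddCont G) (hH : BddCont H) : BddCont (transport κ a G H) := by
  obtain ⟨C, hC0, hC⟩ := hG.exists_pos
  obtain ⟨C', -, hC'⟩ := hH.exists_pos
  have hGc := hG.1
  have hHc := hH.1
  have hκ := κ.continuous
  have hb : ∀ (s : Plane) (z : Plane × ℝ),
      ‖κ z.1 * (z.1 a : ℂ) * (G (s + z.2 • z.1) * H (s + z.2 • z.1 - z.1))‖ ≤
        ‖κ z.1 * (z.1 a : ℂ)‖ * (C * C') := by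
    intro s z
    rw [norm_mul, norm_mul (G _)]
    gcongr
    exacts [hC _, hC' _]
  have hi := (integrable_coord_mul_prod κ a).norm.mul_const (C * C')
  constructor
  · refine continuous_of_dominated (bound := fun z : Plane × ℝ ↦
      ‖κ z.1 * (z.1 a : ℂ)‖ * (C * C')) ?_ ?_ hi ?_
    · exact fun s ↦ Continuous.aestronglyMeasurable (by fun_prop)
    · exact fun s ↦ Filter.Eventually.of_forall (hb s)
    · exact Filter.Eventually.of_forall fun z ↦ by fun_prop
  · exact ⟨_, fun s ↦ norm_integral_le_of_norm_le hi (Filter.Eventually.of_forall (hb s))⟩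

theorem eLpNorm_transport_le (hG : BddCont G) (hH : BddCont H) {p r t : ℝ≥0∞}
    [ENNReal.HolderTriple p r t] (ht : 1 ≤ t) (ht' : t ≠ ∞) :
    eLpNorm (transport κ a G H) t volume ≤
      (∫⁻ y, ‖y‖ₑ * ‖κ y‖ₑ) * (eLpNorm G p volume * eLpNorm H r volume) := by
  have hGc := hG.1
  have hHc := hH.1
  have hκ := κ.continuous
  let F : Plane → Plane × ℝ → ℝ≥0∞ := fun s z ↦
    ‖κ z.1 * (z.1 a : ℂ) * (G (s + z.2 • z.1) * H (s + z.2 • z.1 - z.1))‖ₑ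
  have hF : Measurable (Function.uncurry F) := by
    refine Continuous.measurable ?_
    change Continuous fun w : Plane × Plane × ℝ ↦ ‖κ w.2.1 * (w.2.1 a : ℂ) *
      (G (w.1 + w.2.2 • w.2.1) * H (w.1 + w.2.2 • w.2.1 - w.2.1))‖ₑ
    fun_prop
  have hone : ∀ z : Plane × ℝ, eLpNorm (fun s ↦ F s z) t volume ≤
      ‖z.1‖ₑ * ‖κ z.1‖ₑ * (eLpNorm G p volume * eLpNorm H r volume) := by
    intro z
    have e : eLpNorm (fun s ↦ G (s + z.2 • z.1) * H (s + z.2 • z.1 - z.1)) t volume ≤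
        eLpNorm G p volume * eLpNorm H r volume := by
      have h1 := eLpNorm_smul_le_mul_eLpNorm (μ := volume) (p := p) (q := r) (r := t)
        (f := fun s ↦ H (s + z.2 • z.1 - z.1)) (φ := fun s ↦ G (s + z.2 • z.1))
        (Continuous.aestronglyMeasurable (by fun_prop))
        (Continuous.aestronglyMeasurable (by fun_prop))
      have e1 : eLpNorm (fun s ↦ G (s + z.2 • z.1)) p volume = eLpNorm G p volume := by
        simpa using eLpNorm_comp_sub_right hG.1 (-(z.2 • z.1)) p
      have e2 : eLpNorm (fun s ↦ H (s + z.2 • z.1 - z.1)) r volume = eLpNorm H r volume := by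
        have := eLpNorm_comp_sub_right hH.1 (z.1 - z.2 • z.1) r
        simpa [sub_eq_add_neg, add_assoc, add_comm, add_left_comm] using this
      rw [e1, e2] at h1
      exact h1
    calc _ ≤ ‖κ z.1 * (z.1 a : ℂ)‖ₑ *
          eLpNorm (fun s ↦ G (s + z.2 • z.1) * H (s + z.2 • z.1 - z.1)) t volume := by
          refine le_trans (le_of_eq ?_) (eLpNorm_mul_le_of_enorm_le (f := fun _ ↦ κ z.1 * (z.1 a : ℂ))
            enorm_ne_top (fun _ ↦ le_rfl) (by fun_prop) t)
          exact eLpNorm_enorm _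
      _ ≤ _ := by
          rw [enorm_mul, mul_comm ‖κ z.1‖ₑ]
          gcongr
          exact enorm_coord_le _ _
  calc _ ≤ eLpNorm (fun s ↦ ∫⁻ z, F s z ∂(volume.prod unitMeasure)) t volume :=
        eLpNorm_mono_enorm fun s ↦ by
          rw [enorm_eq_self]
          exact enorm_integral_le_lintegral_enorm _
    _ ≤ ∫⁻ z, eLpNorm (fun s ↦ F s z) t volume ∂(volume.prod unitMeasure) :=
        eLpNorm_lintegral_le ht ht' hF
    _ ≤ ∫⁻ z : Plane × ℝ, ‖z.1‖ₑ * ‖κ z.1‖ₑ * (eLpNorm G p volume * eLpNorm H r volume)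
          ∂(volume.prod unitMeasure) := lintegral_mono hone
    _ = _ := by
        have hm : Measurable fun z : Plane × ℝ ↦ ‖z.1‖ₑ * ‖κ z.1‖ₑ :=
          (measurable_enorm.comp measurable_fst).mul (hκ.measurable.enorm.comp measurable_fst)
        rw [lintegral_mul_const _ hm, lintegral_prod _ hm.aemeasurable]
        simp

/-- For an odd kernel, `W * (G κ*H + κ*G H)` gains a derivative on `W`. -/
theorem cv_symm_eq_transport (hκ : ∀ y, κ (-y) = -κ y) (W : 𝓢(Plane, ℂ)) (hG : BddCont G)
    (hH : BddCont H) (x : Plane) :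
    cv W (fun s ↦ G s * cv κ H s + cv κ G s * H s) x =
      -∑ a, cv (pd a W) (transport κ a G H) x := by
  obtain ⟨C, hC0, hC⟩ := hG.exists_pos
  obtain ⟨C', -, hC'⟩ := hH.exists_pos
  have hGc := hG.1
  have hHc := hH.1
  have hκi : Integrable κ := κ.integrable
  -- Both products are averages over y of this one function: W * Q_y taken at x for the first, and
  -- at x + y for the second.
  let Q : Plane → Plane → ℂ := fun y s ↦ G s * H (s - y)
  have hQ : ∀ y, BddCont (Q y) := fun y ↦ hG.mul ⟨by fun_prop, C', fun s ↦ hC' _⟩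
  have hCC : ∀ s s', ‖G s * H s'‖ ≤ C * C' := fun s s' ↦ by
    rw [norm_mul]
    exact mul_le_mul (hC _) (hC' _) (norm_nonneg _) hC0.le
  have hWx : ∀ (R : 𝓢(Plane, ℂ)) (x : Plane), Integrable fun s ↦ R (x - s) := fun R x ↦
    (R.integrable (μ := volume)).comp_sub_left x
  have h1 : cv W (fun s ↦ G s * cv κ H s) x = ∫ y, κ y * cv W (Q y) x := by
    have := integral_mul_integral_swap (hWx W x) hκi (μ := volume)
      (B := fun z : Plane × Plane ↦ G z.1 * H (z.1 - z.2))
      (Continuous.aestronglyMeasurable (by fun_prop)) (fun z ↦ hCC _ _)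
    simp only [cv_eq W]
    rw [← this]
    congr 1
    ext s
    rw [cv, ← integral_const_mul]
    congr 2
    ext y
    ring
  -- Replacing y by -y costs a sign by oddness, and the shift s ↦ s - y turns G(s+y)H(s) into Q_y
  -- while moving the base point to x + y.
  have hneg : ∀ y, κ (-y) * ∫ s, W (x - s) * (G (s - -y) * H s) =
      -(κ y * cv W (Q y) (x + y)) := by
    intro y
    rw [hκ, neg_mul, cv_eq W, ← integral_sub_right_eq_self _ y]
    congr 3
    ext s
    simp only [Q]
    rw [sub_neg_eq_add, sub_add_cancel, sub_sub_eq_add_sub]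
  have hB₂ : AEStronglyMeasurable (fun z : Plane × Plane ↦ G (z.1 - z.2) * H z.1)
      (volume.prod volume) := Continuous.aestronglyMeasurable (by fun_prop)
  have h2 : cv W (fun s ↦ cv κ G s * H s) x = -∫ y, κ y * cv W (Q y) (x + y) := by
    have := integral_mul_integral_swap (hWx W x) hκi hB₂ (fun z ↦ hCC _ _)
    rw [cv_eq W, ← integral_neg]
    refine Eq.trans ?_ (this.trans ((integral_neg_eq_self _ _).symm.trans ?_))
    · congr 1
      ext s
      rw [cv, ← integral_mul_const]
      congr 2
      ext y
      exact mul_assoc _ _ _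
    · simp only [hneg]
  have hz := fun a ↦ integrable_coord_mul_prod κ a
  have hB : AEStronglyMeasurable (fun z : Plane × Plane × ℝ ↦
      G (z.1 + z.2.2 • z.2.1) * H (z.1 + z.2.2 • z.2.1 - z.2.1))
      (volume.prod (volume.prod unitMeasure)) :=
    Continuous.aestronglyMeasurable (by fun_prop)
  have hin : ∀ (a : Fin 2) (z : Plane × ℝ), ∫ s, pd a W (x - s) *
      (G (s + z.2 • z.1) * H (s + z.2 • z.1 - z.1)) = cv (pd a W) (Q z.1) (x + z.2 • z.1) := by
    intro a z
    rw [cv_eq]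
    refine Eq.trans ?_ (integral_add_right_eq_self _ (z.2 • z.1))
    congr 1
    ext s
    simp only [Q]
    rw [add_sub_add_right_eq_sub]
  have h3 : ∀ a, cv (pd a W) (transport κ a G H) x = ∫ z : Plane × ℝ,
      κ z.1 * (z.1 a : ℂ) * cv (pd a W) (Q z.1) (x + z.2 • z.1) ∂(volume.prod unitMeasure) := by
    intro a
    rw [cv_eq]
    refine (integral_mul_integral_swap (hWx (pd a W) x) (hz a) hB (fun z ↦ hCC _ _)).trans ?_
    simp only [hin]
  have h4 : ∀ a, Integrable (fun z : Plane × ℝ ↦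
      κ z.1 * (z.1 a : ℂ) * cv (pd a W) (Q z.1) (x + z.2 • z.1)) (volume.prod unitMeasure) := by
    intro a
    have := (integrable_mul_prod_mul (hWx (pd a W) x) (hz a) hB
      (fun z ↦ hCC _ _)).integral_prod_right
    refine this.congr (Filter.Eventually.of_forall fun z ↦ ?_)
    simp only [← hin, ← integral_const_mul]
    congr 1
    ext s
    ring
  have hi1 : Integrable fun y ↦ κ y * cv W (Q y) x := by
    have hB₁ : AEStronglyMeasurable (fun z : Plane × Plane ↦ G z.1 * H (z.1 - z.2))
        (volume.prod volume) := Continuous.aestronglyMeasurable (by fun_prop)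
    refine (integrable_mul_prod_mul (hWx W x) hκi hB₁
      (fun z ↦ hCC _ _)).integral_prod_right.congr (Filter.Eventually.of_forall fun y ↦ ?_)
    simp only [cv_eq W, ← integral_const_mul]
    congr 1
    ext s
    ring
  have hi2 : Integrable fun y ↦ κ y * cv W (Q y) (x + y) := by
    have h := (integrable_mul_prod_mul (hWx W x) hκi hB₂
      (fun z ↦ hCC _ _)).integral_prod_right.comp_neg.neg
    refine h.congr (Filter.Eventually.of_forall fun y ↦ ?_)
    change -(∫ s, W (x - s) * κ (-y) * (G (s - -y) * H s)) = κ y * cv W (Q y) (x + y)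
    rw [neg_eq_iff_eq_neg, ← hneg, ← integral_const_mul]
    congr 1
    ext s
    ring
  rw [cv_add_right W.integrable (hG.mul (hH.cv hκi)) ((hG.cv hκi).mul hH), h1, h2]
  simp only [h3]
  rw [← integral_finsetSum _ fun a _ ↦ h4 a, integral_prod _ (integrable_finsetSum _ fun a _ ↦ h4 a),
    ← sub_eq_add_neg, ← integral_sub hi1 hi2, ← integral_neg]
  congr 1
  ext y
  -- The two terms combine into κ(y) times a difference of W * Q_y at x and x + y, and the
  -- fundamental theorem of calculus brings out y · ∇W.
  rw [← mul_sub, ← neg_sub, cv_add_sub_eq_integral W (hQ y), mul_neg, ← integral_const_mul]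
  congr 2
  ext t
  rw [Finset.mul_sum]
  refine Finset.sum_congr rfl fun a _ ↦ ?_
  ring

end

namespace DyadicPartition

variable (D : DyadicPartition)

/-- An odd kernel that realises `P_b` on all frequencies comparable to `2 ^ k`. -/
def oddKern (b : Fin 2) (k : ℤ) : 𝓢(Plane, ℂ) :=
  (1 / 2 : ℂ) • (D.kern (HomSymbol.P b) 7 k - reflect (D.kern (HomSymbol.P b) 7 k) 0)

theorem oddKern_apply (b : Fin 2) (k : ℤ) (y : Plane) : D.oddKern b k y =
    (1 / 2) * (D.kern (HomSymbol.P b) 7 k y - D.kern (HomSymbol.P b) 7 k (-y)) := by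
  rw [oddKern, _root_.smul_apply, _root_.sub_apply, reflect_apply, zero_sub, smul_eq_mul]

theorem oddKern_neg (b : Fin 2) (k : ℤ) (y : Plane) : D.oddKern b k (-y) = -D.oddKern b k y := by
  rw [oddKern_apply, oddKern_apply, neg_neg]
  ring

/-- P_b is odd, so antisymmetrising the kernel leaves its symbol unchanged wherever the cutoff is 1
at both ξ and -ξ. -/
theorem fourier_oddKern {b : Fin 2} {k : ℤ} {ξ : Plane} (h : ξ ∈ annulus 7 k) :
    𝓕 (D.oddKern b k) ξ = HomSymbol.P b ((2 * Real.pi) • ξ) := by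
  have e : 𝓕 (D.oddKern b k) = (1 / 2 : ℂ) • (𝓕 (D.kern (HomSymbol.P b) 7 k) -
      𝓕 (reflect (D.kern (HomSymbol.P b) 7 k) 0)) := by
    rw [oddKern, FourierTransform.fourier_smul]
    congr 1
    exact map_sub (FourierTransform.fourierCLM ℂ 𝓢(Plane, ℂ)) _ _
  have hodd : ∀ ζ, HomSymbol.P b (-ζ) = -HomSymbol.P b ζ := by
    intro ζ
    rw [HomSymbol.P_apply, HomSymbol.P_apply, norm_neg, ← Complex.ofReal_neg, ← neg_div]
    congr 2
    fin_cases b <;> simp [perp]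
  rw [e, _root_.smul_apply, _root_.sub_apply, fourier_reflect_zero, fourier_kern, fourier_kern,
    D.fourier_wide_eq_one le_rfl h, D.fourier_wide_eq_one le_rfl (neg_mem_annulus.2 h), smul_neg,
    hodd, smul_eq_mul]
  ring

/-- The symbol has degree 0 and the weight |y| costs one inverse frequency. This 2^{-k}, against the
derivative placed on W, is the gain from the commutator. -/
theorem exists_lintegral_oddKern_le :
    ∃ C : ℝ≥0∞, C ≠ ∞ ∧ ∀ (b : Fin 2) (k : ℤ), ∫⁻ y, ‖y‖ₑ * ‖D.oddKern b k y‖ₑ ≤ C * dy (-k) := by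
  choose C _ hC h using fun b ↦ D.exists_enorm_kern_bounds (HomSymbol.P b) 7
  refine ⟨2 * ∑ b, C b, ENNReal.mul_ne_top (by simp) (ENNReal.sum_ne_top.2 fun b _ ↦ hC b),
    fun b k ↦ ?_⟩
  have hc := (D.kern (HomSymbol.P b) 7 k).continuous
  have hle : ∀ y, ‖y‖ₑ * ‖D.oddKern b k y‖ₑ ≤ ‖y‖ₑ * ‖D.kern (HomSymbol.P b) 7 k y‖ₑ +
      ‖-y‖ₑ * ‖D.kern (HomSymbol.P b) 7 k (-y)‖ₑ := by
    intro y
    rw [oddKern_apply, enorm_mul, enorm_neg, ← mul_add]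
    gcongr
    refine (mul_le_of_le_one_left' ?_).trans (enorm_sub_le)
    rw [← ofReal_norm]
    norm_num
  have h1 := (h b k).2.2
  rw [HomSymbol.deg_P] at h1
  calc _ ≤ ∫⁻ y, (‖y‖ₑ * ‖D.kern (HomSymbol.P b) 7 k y‖ₑ +
        ‖-y‖ₑ * ‖D.kern (HomSymbol.P b) 7 k (-y)‖ₑ) := lintegral_mono hle
    _ = 2 * ∫⁻ y, ‖y‖ₑ * ‖D.kern (HomSymbol.P b) 7 k y‖ₑ := by
        have hm : Measurable fun y : Plane ↦ ‖y‖ₑ * ‖D.kern (HomSymbol.P b) 7 k y‖ₑ :=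
          measurable_enorm.mul hc.measurable.enorm
        rw [lintegral_add_left hm,
          lintegral_neg_eq_self (fun y ↦ ‖y‖ₑ * ‖D.kern (HomSymbol.P b) 7 k y‖ₑ), two_mul]
    _ ≤ 2 * (C b * dy (-k)) := by
        gcongr
        simpa using h1
    _ ≤ _ := by
        rw [← mul_assoc]
        gcongr
        exact Finset.single_le_sum (f := C) (fun _ _ ↦ zero_le) (Finset.mem_univ b)

theorem annulus_one_subset {k l : ℤ} (h : |k - l| < 7) : annulus 1 l ⊆ annulus 7 k := by
  rw [abs_lt] at h
  exact fun ξ hξ ↦ ⟨(zpow_le_zpow_iff_two.2 (by push_cast; omega)).trans hξ.1,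
    hξ.2.trans (zpow_le_zpow_iff_two.2 (by push_cast; omega))⟩

/-- The cancellation requires the same kernel on both inputs, so the kernel at k is made wide enough
to act correctly on every frequency index l with |k - l| < 7. -/
theorem riesz_eq_cv_oddKern {k l : ℤ} (h : |k - l| < 7) {G : Plane → ℂ} (hG : Spec l G)
    (b : Fin 2) : D.riesz l b G = cv (D.oddKern b k) G :=
  hG.cv_congr fun ξ hξ ↦ by
    rw [D.fourier_kern_eq _ le_rfl hξ, D.fourier_oddKern (annulus_one_subset h hξ)]

theorem piece_eq_transport {k l : ℤ} (h : |k - l| < 7) {G H : Plane → ℂ} (hG : Spec k G)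
    (hH : Spec l H) (j : ℤ) (x : Plane) :
    D.piece k l G H j x = (1 / 2) * ∑ b, ∑ a, cv (D.kern ((HomSymbol.W b).d a) 0 j)
      (transport (D.oddKern b k) a G H) x := by
  have e : ∀ b, D.rieszProd k l b G H = fun s ↦ G s * cv (D.oddKern b k) H s +
      cv (D.oddKern b k) G s * H s := fun b ↦ by
    ext s
    rw [rieszProd, D.riesz_eq_cv_oddKern h hH, D.riesz_eq_cv_oddKern (k := k) (by simp) hG]
  simp only [piece, e, cv_symm_eq_transport _ (D.oddKern_neg _ k) _ hG.1 hH.1, D.pd_kern,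
    Finset.sum_neg_distrib]
  ring

/-! ### The square function estimate in `L²` -/

/-- Degree 0 makes the transforms uniformly bounded, and at each ξ only indices within 2 of a given
one can contribute, hence the factor 5. -/
theorem sum_norm_fourier_kern_sq_le {σ : HomSymbol} (hσ : σ.deg = 0) :
    ∃ C : ℝ, 0 ≤ C ∧ ∀ (s : Finset ℤ) (ξ : Plane), ∑ j ∈ s, ‖𝓕 (D.kern σ 0 j) ξ‖ ^ 2 ≤ C := by
  obtain ⟨C, hC0, hC⟩ := D.exists_kern_bounds σ 0
  have hb : ∀ j ξ, ‖𝓕 (D.kern σ 0 j) ξ‖ ≤ C := by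
    intro j ξ
    have h1 := (hC j).2.1
    rw [hσ, zpow_zero, mul_one] at h1
    refine le_trans ?_ h1
    rw [SchwartzMap.fourier_coe]
    exact VectorFourier.norm_fourierIntegral_le_integral_norm _ _ _ _ _
  refine ⟨5 * C ^ 2, by positivity, fun s ξ ↦ ?_⟩
  by_cases h : ∃ i, 𝓕 (D.kern σ 0 i) ξ ≠ 0
  · obtain ⟨i, hi⟩ := h
    have hi := D.fourier_kern_support hi
    have hz : ∀ j, j ∉ Finset.Icc (i - 2) (i + 2) → 𝓕 (D.kern σ 0 j) ξ = 0 := by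
      intro j hj
      by_contra hne
      have := abs_le.1 (abs_sub_le_of_mem_annulus hi (D.fourier_kern_support hne))
      push_cast at this
      rw [Finset.mem_Icc] at hj
      omega
    calc ∑ j ∈ s, ‖𝓕 (D.kern σ 0 j) ξ‖ ^ 2
        ≤ ∑ j ∈ s ∪ Finset.Icc (i - 2) (i + 2), ‖𝓕 (D.kern σ 0 j) ξ‖ ^ 2 :=
          Finset.sum_le_sum_of_subset_of_nonneg Finset.subset_union_left fun _ _ _ ↦ by positivity
      _ = ∑ j ∈ Finset.Icc (i - 2) (i + 2), ‖𝓕 (D.kern σ 0 j) ξ‖ ^ 2 := by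
          refine (Finset.sum_subset Finset.subset_union_right fun j _ hj ↦ ?_).symm
          rw [hz j hj]
          simp
      _ ≤ ∑ j ∈ Finset.Icc (i - 2) (i + 2), C ^ 2 := by
          gcongr with j _
          exact hb j ξ
      _ = _ := by
          rw [Finset.sum_const, Int.card_Icc, nsmul_eq_mul]
          rw [show i + 2 + 1 - (i - 2) = ((5 : ℕ) : ℤ) by push_cast; ring, Int.toNat_natCast]
          norm_num
  · push Not at h
    simp only [h, norm_zero]
    simp
    positivity

theorem eLpNorm_two_sq {f : Plane → ℂ} : eLpNorm f 2 volume ^ 2 = ∫⁻ x, ‖f x‖ₑ ^ 2 := by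
  have := eLpNorm_nnreal_pow_eq_lintegral (μ := volume) (f := f) (p := 2) (by norm_num)
  simpa using this

theorem lintegral_enorm_sq_fourier (f : 𝓢(Plane, ℂ)) :
    ∫⁻ ξ, ‖𝓕 f ξ‖ₑ ^ 2 = ∫⁻ x, ‖f x‖ₑ ^ 2 := by
  have hi : ∀ g : 𝓢(Plane, ℂ), ∫⁻ x, ‖g x‖ₑ ^ 2 = ENNReal.ofReal (∫ x, ‖g x‖ ^ 2) := by
    intro g
    rw [ofReal_integral_eq_lintegral_ofReal]
    · refine lintegral_congr fun x ↦ ?_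
      rw [← ofReal_norm, ENNReal.ofReal_pow (norm_nonneg _)]
    · exact (memLp_two_iff_integrable_sq_norm g.continuous.aestronglyMeasurable).1 (g.memLp 2)
    · exact Filter.Eventually.of_forall fun x ↦ by positivity
  rw [hi, hi, SchwartzMap.integral_norm_sq_fourier]

/-- By Plancherel this is the pointwise bound on the sum of the squared multipliers. -/
theorem exists_sum_eLpNorm_cv_schwartz_le {σ : HomSymbol} (hσ : σ.deg = 0) :
    ∃ C : ℝ≥0∞, C ≠ ∞ ∧ ∀ (s : Finset ℤ) (f : 𝓢(Plane, ℂ)),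
      ∑ j ∈ s, eLpNorm (cv (D.kern σ 0 j) f) 2 volume ^ 2 ≤ C * eLpNorm f 2 volume ^ 2 := by
  obtain ⟨C, hC0, hC⟩ := D.sum_norm_fourier_kern_sq_le hσ
  refine ⟨ENNReal.ofReal C, ENNReal.ofReal_ne_top, fun s f ↦ ?_⟩
  have e : ∀ j, eLpNorm (cv (D.kern σ 0 j) f) 2 volume ^ 2 =
      ∫⁻ ξ, ‖𝓕 (D.kern σ 0 j) ξ‖ₑ ^ 2 * ‖𝓕 f ξ‖ₑ ^ 2 := by
    intro j
    have : cv (D.kern σ 0 j) f = sconv (D.kern σ 0 j) f := by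
      ext x
      rw [sconv_apply]
    rw [this, eLpNorm_two_sq, ← lintegral_enorm_sq_fourier]
    simp only [fourier_sconv, enorm_mul, mul_pow]
  simp only [e]
  have hm : ∀ g : 𝓢(Plane, ℂ), Measurable fun ξ ↦ ‖g ξ‖ₑ ^ 2 := fun g ↦
    (g.continuous.measurable.enorm).pow_const 2
  rw [← lintegral_finsetSum' s (f := fun j ξ ↦ ‖𝓕 (D.kern σ 0 j) ξ‖ₑ ^ 2 * ‖𝓕 f ξ‖ₑ ^ 2)
    fun j _ ↦ ((hm _).mul (hm _)).aemeasurable, eLpNorm_two_sq,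
    ← lintegral_enorm_sq_fourier, ← lintegral_const_mul _ (hm _)]
  refine lintegral_mono fun ξ ↦ ?_
  rw [← Finset.sum_mul]
  gcongr
  calc ∑ j ∈ s, ‖𝓕 (D.kern σ 0 j) ξ‖ₑ ^ 2
      = ENNReal.ofReal (∑ j ∈ s, ‖𝓕 (D.kern σ 0 j) ξ‖ ^ 2) := by
        rw [ENNReal.ofReal_sum_of_nonneg fun _ _ ↦ by positivity]
        refine Finset.sum_congr rfl fun j _ ↦ ?_
        rw [← ofReal_norm, ENNReal.ofReal_pow (norm_nonneg _)]
    _ ≤ _ := ENNReal.ofReal_le_ofReal (hC s ξ)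

theorem _root_.ENNReal.add_sq_le_four_mul (a b : ℝ≥0∞) : (a + b) ^ 2 ≤ 4 * (a ^ 2 + b ^ 2) := by
  rcases le_total a b with h | h
  · calc (a + b) ^ 2 ≤ (b + b) ^ 2 := by gcongr
      _ = 4 * b ^ 2 := by ring
      _ ≤ _ := by gcongr; exact le_add_self
  · calc (a + b) ^ 2 ≤ (a + a) ^ 2 := by gcongr
      _ = 4 * a ^ 2 := by ring
      _ ≤ _ := by gcongr; exact le_self_add

theorem exists_schwartz_eLpNorm_sub_le {T : Plane → ℂ} (hT : MemLp T 2 volume) {ε : ℝ}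
    (hε : 0 < ε) :
    ∃ f : 𝓢(Plane, ℂ), eLpNorm (fun x ↦ T x - f x) 2 volume ≤ ENNReal.ofReal ε := by
  obtain ⟨g, hg, hg', h⟩ := hT.exist_eLpNorm_sub_le (by norm_num) (by norm_num) hε
  exact ⟨hg.toSchwartzMap hg', h⟩

/-- Plancherel is available for Schwartz functions, while T is only bounded and continuous. For a
finite set of indices T is approximated in L²; the error is multiplied by a constant that depends on
this set, but it tends to 0 before the supremum over sets is taken. -/
theorem exists_tsum_eLpNorm_cv_kern_sq_le {σ : HomSymbol} (hσ : σ.deg = 0) :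
    ∃ C : ℝ≥0∞, C ≠ ∞ ∧ ∀ T : Plane → ℂ, BddCont T →
      ∑' j, eLpNorm (cv (D.kern σ 0 j) T) 2 volume ^ 2 ≤ C * eLpNorm T 2 volume ^ 2 := by
  obtain ⟨C, hC, h⟩ := D.exists_sum_eLpNorm_cv_schwartz_le hσ
  obtain ⟨C', hC', h'⟩ := D.exists_eLpNorm_cv_kern_le σ 0
  -- The 1 keeps the constant nonzero, so that the right side is ∞ when the norm of T is.
  refine ⟨16 * C + 1, by finiteness, fun T hT ↦ ?_⟩
  by_cases hT2 : eLpNorm T 2 volume = ∞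
  · rw [hT2]
    simp
  have hTm : MemLp T 2 volume := ⟨hT.1.aestronglyMeasurable, lt_top_iff_ne_top.2 hT2⟩
  rw [ENNReal.tsum_eq_iSup_sum]
  refine iSup_le fun s ↦ ?_
  have key : ∀ n : ℕ, ∑ j ∈ s, eLpNorm (cv (D.kern σ 0 j) T) 2 volume ^ 2 ≤
      16 * C * eLpNorm T 2 volume ^ 2 +
        (16 * C + 4 * s.card * C' ^ 2) * ENNReal.ofReal (1 / ((n : ℝ) + 1)) ^ 2 := by
    intro n
    obtain ⟨f, hf⟩ := exists_schwartz_eLpNorm_sub_le hTm (ε := 1 / ((n : ℝ) + 1)) (by positivity)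
    set e := ENNReal.ofReal (1 / ((n : ℝ) + 1))
    have hR : BddCont fun x ↦ T x - f x := hT.sub (bddCont_schwartz f)
    have hfn : eLpNorm f 2 volume ^ 2 ≤ 4 * (eLpNorm T 2 volume ^ 2 + e ^ 2) := by
      refine le_trans ?_ ((ENNReal.add_sq_le_four_mul _ _).trans
        (mul_le_mul_right (add_le_add_right (pow_le_pow_left₀ zero_le hf 2) _) _))
      gcongr
      have := eLpNorm_sub_le (μ := volume) (p := 2) hT.1.aestronglyMeasurable
        hR.1.aestronglyMeasurable (by norm_num)
      refine le_trans (le_of_eq ?_) this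
      congr 1
      ext x
      simp
    have hj : ∀ j, eLpNorm (cv (D.kern σ 0 j) T) 2 volume ^ 2 ≤
        4 * (eLpNorm (cv (D.kern σ 0 j) f) 2 volume ^ 2 + C' ^ 2 * e ^ 2) := by
      intro j
      have h1 := h' j _ hR.1 2 (by norm_num) (by norm_num)
      rw [hσ, Int.cast_zero, zero_mul, dy_zero, mul_one] at h1
      have h2 : cv (D.kern σ 0 j) T =
          cv (D.kern σ 0 j) f + cv (D.kern σ 0 j) fun x ↦ T x - f x := by
        ext x
        rw [Pi.add_apply, ← cv_add_right (D.kern σ 0 j).integrable (bddCont_schwartz f) hR]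
        simp
      rw [h2, ← mul_pow]
      refine le_trans (pow_le_pow_left₀ zero_le (eLpNorm_add_le ?_ ?_ (by norm_num)) 2)
        ((ENNReal.add_sq_le_four_mul _ _).trans ?_)
      · exact ((bddCont_schwartz f).cv (D.kern σ 0 j).integrable).1.aestronglyMeasurable
      · exact (hR.cv (D.kern σ 0 j).integrable).1.aestronglyMeasurable
      · gcongr
        exact h1.trans (by gcongr)
    calc _ ≤ ∑ j ∈ s, 4 * (eLpNorm (cv (D.kern σ 0 j) f) 2 volume ^ 2 + C' ^ 2 * e ^ 2) :=
          Finset.sum_le_sum fun j _ ↦ hj j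
      _ = 4 * (∑ j ∈ s, eLpNorm (cv (D.kern σ 0 j) f) 2 volume ^ 2) +
          4 * s.card * C' ^ 2 * e ^ 2 := by
          rw [← Finset.mul_sum, Finset.sum_add_distrib, Finset.sum_const, nsmul_eq_mul]
          ring
      _ ≤ 4 * (C * (4 * (eLpNorm T 2 volume ^ 2 + e ^ 2))) + 4 * s.card * C' ^ 2 * e ^ 2 := by
          gcongr
          exact (h s f).trans (by gcongr)
      _ = _ := by ring
  have hlim : Filter.Tendsto (fun n : ℕ ↦ 16 * C * eLpNorm T 2 volume ^ 2 +
      (16 * C + 4 * s.card * C' ^ 2) * ENNReal.ofReal (1 / ((n : ℝ) + 1)) ^ 2) Filter.atTop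
      (nhds (16 * C * eLpNorm T 2 volume ^ 2 +
        (16 * C + 4 * s.card * C' ^ 2) * ENNReal.ofReal 0 ^ 2)) := by
    refine Filter.Tendsto.const_add _ (ENNReal.Tendsto.const_mul ?_ (Or.inr (by finiteness)))
    exact (((ENNReal.continuous_pow 2).comp ENNReal.continuous_ofReal).tendsto 0).comp
      tendsto_one_div_add_atTop_nhds_zero_nat
  refine (ge_of_tendsto' hlim key).trans ?_
  simp only [ENNReal.ofReal_zero, ne_eq, OfNat.ofNat_ne_zero, not_false_eq_true, zero_pow,
    mul_zero, add_zero]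
  gcongr
  exact le_self_add

end DyadicPartition

/-! ### Weighted bounds of the pieces -/

/-- The scale invariant smoothness index. -/
def crit (p : ℝ≥0∞) : ℝ := 2 / p.toReal - 1

/-- The weighted norm `2^{sj} ‖G‖_{L^p}`. -/
def wt (s : ℝ) (p : ℝ≥0∞) (j : ℤ) (G : Plane → ℂ) : ℝ≥0∞ := dy (s * j) * eLpNorm G p volume

theorem eLpNorm_eq_wt (s : ℝ) (p : ℝ≥0∞) (j : ℤ) (G : Plane → ℂ) :
    eLpNorm G p volume = dy (-(s * j)) * wt s p j G := by
  rw [wt, ← mul_assoc, ← dy_add, neg_add_cancel, dy_zero, one_mul]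

namespace DyadicPartition

variable (D : DyadicPartition)

theorem exists_eLpNorm_le_of_spec (D : DyadicPartition) {t p : ℝ≥0∞} (ht : 1 ≤ t) (htp : t ≤ p) (hp : p ≠ ∞) :
    ∃ C : ℝ≥0∞, C ≠ ∞ ∧ ∀ (j : ℤ) (G : Plane → ℂ), Spec j G →
      eLpNorm G p volume ≤ C * dy ((2 / t.toReal - 2 / p.toReal) * j) * eLpNorm G t volume := by
  obtain ⟨C, hC, h⟩ := D.exists_eLpNorm_cv_kern_le_eLpNorm (HomSymbol.const 1) 1 ht htp hp
  refine ⟨C, hC, fun j G hG ↦ ?_⟩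
  have := h j G hG.1
  rwa [hG.cv_eq_self fun ξ hξ ↦ D.fourier_kern_eq _ le_rfl hξ,
    show (HomSymbol.const 1).deg = 0 from rfl, Int.cast_zero, zero_mul, zero_add] at this

theorem exists_enorm_le_of_spec (D : DyadicPartition) {p : ℝ≥0∞} (hp : 1 ≤ p) (hp' : p ≠ ∞) :
    ∃ C : ℝ≥0∞, C ≠ ∞ ∧ ∀ (j : ℤ) (G : Plane → ℂ), Spec j G → ∀ x,
      ‖G x‖ₑ ≤ C * dy j * wt (crit p) p j G := by
  obtain ⟨C, hC, h⟩ := D.exists_enorm_cv_kern_le_eLpNorm (HomSymbol.const 1) 1 hp hp'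
  refine ⟨C, hC, fun j G hG x ↦ ?_⟩
  have := h j G hG.1.1 x
  rw [hG.cv_eq_self fun ξ hξ ↦ D.fourier_kern_eq _ le_rfl hξ,
    show (HomSymbol.const 1).deg = 0 from rfl] at this
  refine this.trans (le_of_eq ?_)
  rw [wt, mul_assoc, mul_assoc, ← mul_assoc (dy j), ← dy_add, crit]
  congr 3
  push_cast
  ring

theorem exists_eLpNorm_top_le_of_spec (D : DyadicPartition) {p : ℝ≥0∞} (hp : 1 ≤ p) (hp' : p ≠ ∞) :
    ∃ C : ℝ≥0∞, C ≠ ∞ ∧ ∀ (j : ℤ) (G : Plane → ℂ), Spec j G →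
      eLpNorm G ∞ volume ≤ C * dy j * wt (crit p) p j G := by
  obtain ⟨C, hC, h⟩ := D.exists_enorm_le_of_spec hp hp'
  refine ⟨C, hC, fun j G hG ↦ ?_⟩
  rw [eLpNorm_exponent_top]
  exact essSup_le_of_ae_le _ (Filter.Eventually.of_forall fun x ↦ h j G hG x)

/-- The high-low interactions. -/
theorem exists_wt_piece_le_of_sep {p : ℝ≥0∞} (hp : 1 ≤ p) (hp' : p ≠ ∞) {γ : ℝ}
    (hγ : γ ≤ 1 / 2) :
    ∃ C : ℝ≥0∞, C ≠ ∞ ∧ ∀ (k l j : ℤ) (G H : Plane → ℂ), Spec k G → Spec l H → l + 7 ≤ k →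
      wt (crit p) p j (D.piece k l G H j) ≤
        C * (dy (-(γ * |(k - j : ℝ)|)) * dy (-(γ * |(l - k : ℝ)|))) *
          (wt (crit p) p k G * wt (crit p) p l H) := by
  obtain ⟨C₁, hC₁, h₁⟩ := D.exists_eLpNorm_piece_le_sup_mul
  obtain ⟨C₂, hC₂, h₂⟩ := D.exists_enorm_le_of_spec hp hp'
  refine ⟨C₁ * C₂ * dy (5 * |crit p - 1| + 5),
    ENNReal.mul_ne_top (ENNReal.mul_ne_top hC₁ hC₂) (dy_ne_top _), fun k l j G H hG hH hkl ↦ ?_⟩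
  set s := crit p
  -- Only outputs with |j - k| ≤ 5 occur; the others vanish by the frequency supports.
  by_cases hj : 5 < |j - k|
  · have : D.piece k l G H j = fun _ ↦ 0 := by
      ext x
      exact D.piece_eq_zero hG hH (fun ξ hξ η hη ↦ add_notMem_annulus_of_sep hkl hj hξ hη) x
    rw [this]
    simp [wt]
  obtain ⟨M₀, hM₀⟩ := hH.1.2
  set M : ℝ≥0∞ := ⨆ x, ‖H x‖ₑ
  have hM : M ≠ ∞ := ne_top_of_le_ne_top (ENNReal.ofReal_ne_top (r := M₀)) (iSup_le fun x ↦ by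
    rw [← ofReal_norm]
    exact ENNReal.ofReal_le_ofReal (hM₀ x))
  have hM' : M ≤ C₂ * dy l * wt s p l H := iSup_le fun x ↦ h₂ l H hH x
  have h := h₁ l k j H G M p hH.1 hG.1 hp hp' hM fun x ↦ le_iSup (fun x ↦ ‖H x‖ₑ) x
  rw [D.piece_comm, eLpNorm_eq_wt s p k G] at h
  have hj' : |(j - k : ℝ)| ≤ 5 := by exact_mod_cast not_lt.1 hj
  have hkl' : (l : ℝ) + 7 ≤ k := by exact_mod_cast hkl
  -- The left side is (s-1)(j-k) + (l-k): a bounded error plus a full power of decay in k - l, of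
  -- which at most half is spent.
  have hexp : s * j + -j + l + -(s * k) ≤
      (5 * |s - 1| + 5) + -(γ * |(k - j : ℝ)|) + -(γ * |(l - k : ℝ)|) := by
    have e1 : (s - 1) * (j - k) ≤ |s - 1| * 5 :=
      (le_abs_self _).trans ((abs_mul _ _).trans_le (by gcongr))
    have e2 : γ * |(k - j : ℝ)| ≤ 1 / 2 * 5 := by
      rw [abs_sub_comm]
      gcongr
    have e3 : γ * |(l - k : ℝ)| ≤ 1 / 2 * (k - l) := by
      rw [abs_of_nonpos (by linarith), neg_sub]
      have : (0 : ℝ) ≤ k - l := by linarith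
      gcongr
    nlinarith
  calc wt s p j (D.piece k l G H j)
      ≤ dy (s * j) * (C₁ * dy (-j) * (C₂ * dy l * wt s p l H) * (dy (-(s * k)) * wt s p k G)) := by
        rw [wt]
        gcongr
        exact h.trans (by gcongr)
    _ = C₁ * C₂ * dy (s * j + -j + l + -(s * k)) * (wt s p k G * wt s p l H) := by
        simp only [dy_add]
        ring
    _ ≤ C₁ * C₂ * dy ((5 * |s - 1| + 5) + -(γ * |(k - j : ℝ)|) + -(γ * |(l - k : ℝ)|)) *
          (wt s p k G * wt s p l H) := by
        gcongr
        exact dy_mono hexp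
    _ = _ := by
        simp only [dy_add]
        ring

/-- The high-high interactions in a form that depends on the output frequency only through the
last convolution. -/
theorem exists_wt_piece_le_of_close {p t : ℝ≥0∞} (r : ℝ≥0∞) [ENNReal.HolderTriple p r t]
    (hp : 1 ≤ p) (ht : 1 ≤ t) (htp : t ≤ p) (hp' : p ≠ ∞) :
    ∃ C : ℝ≥0∞, C ≠ ∞ ∧ ∀ (k l j : ℤ) (G H : Plane → ℂ), Spec k G → Spec l H → |k - l| < 7 →
      eLpNorm (D.piece k l G H j) p volume ≤
        C * dy ((2 / t.toReal - 2 / p.toReal) * j) * dy (-k) *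
          (eLpNorm G p volume * eLpNorm H r volume) := by
  have ht' : t ≠ ∞ := ne_top_of_le_ne_top hp' htp
  choose C₁ hC₁ h₁ using fun ba : Fin 2 × Fin 2 ↦
    D.exists_eLpNorm_cv_kern_le_eLpNorm ((HomSymbol.W ba.1).d ba.2) 0 ht htp hp'
  obtain ⟨C₂, hC₂, h₂⟩ := D.exists_lintegral_oddKern_le
  refine ⟨(∑ b, ∑ a, C₁ (b, a)) * C₂, ENNReal.mul_ne_top (ENNReal.sum_ne_top.2 fun b _ ↦
    ENNReal.sum_ne_top.2 fun a _ ↦ hC₁ _) hC₂, fun k l j G H hG hH hkl ↦ ?_⟩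
  have hT : ∀ b a, BddCont (transport (D.oddKern b k) a G H) := fun b a ↦
    hG.1.transport _ a hH.1
  have hcont : ∀ b a, BddCont (cv (D.kern ((HomSymbol.W b).d a) 0 j)
      (transport (D.oddKern b k) a G H)) := fun b a ↦ (hT b a).cv (D.kern _ 0 j).integrable
  calc eLpNorm (D.piece k l G H j) p volume
      ≤ eLpNorm (∑ b, ∑ a, cv (D.kern ((HomSymbol.W b).d a) 0 j)
          (transport (D.oddKern b k) a G H)) p volume := by
        refine eLpNorm_mono_enorm fun x ↦ ?_
        rw [D.piece_eq_transport hkl hG hH, enorm_mul, Finset.sum_apply]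
        simp only [Finset.sum_apply]
        refine mul_le_of_le_one_left' ?_
        rw [← ofReal_norm]
        norm_num
    _ ≤ ∑ b, eLpNorm (∑ a, cv (D.kern ((HomSymbol.W b).d a) 0 j)
          (transport (D.oddKern b k) a G H)) p volume := by
        refine eLpNorm_sum_le (fun b _ ↦ ?_) hp
        exact Finset.aestronglyMeasurable_sum _ fun a _ ↦ (hcont b a).1.aestronglyMeasurable
    _ ≤ ∑ b, ∑ a, eLpNorm (cv (D.kern ((HomSymbol.W b).d a) 0 j)
          (transport (D.oddKern b k) a G H)) p volume := by
        gcongr with b _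
        exact eLpNorm_sum_le (fun a _ ↦ (hcont b a).1.aestronglyMeasurable) hp
    _ ≤ ∑ b, ∑ a, C₁ (b, a) * dy ((2 / t.toReal - 2 / p.toReal) * j) *
          (C₂ * dy (-k) * (eLpNorm G p volume * eLpNorm H r volume)) := by
        gcongr with b _ a _
        have := h₁ (b, a) j _ (hT b a)
        rw [HomSymbol.deg_d, HomSymbol.deg_W, neg_add_cancel, Int.cast_zero, zero_mul,
          zero_add] at this
        refine this.trans ?_
        gcongr
        refine (eLpNorm_transport_le _ a hG.1 hH.1 (p := p) (r := r) ht ht').trans ?_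
        gcongr
        exact h₂ b k
    _ = _ := by
        simp only [← Finset.sum_mul]
        ring

theorem wt_piece_eq_zero_of_close {k l j : ℤ} {G H : Plane → ℂ} (hG : Spec k G) (hH : Spec l H)
    (hkl : |k - l| < 7) (hj : k + 11 < j) (s : ℝ) (p : ℝ≥0∞) :
    wt s p j (D.piece k l G H j) = 0 := by
  have : D.piece k l G H j = fun _ ↦ 0 := by
    ext x
    exact D.piece_eq_zero hG hH (fun ξ hξ η hη ↦ add_notMem_annulus_of_close hkl hj hξ hη) x
  rw [this]
  simp [wt]

/-- For j ≤ k the term α(j-k) is the decay sought; for k < j ≤ k + 11 everything is bounded.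
Quantities depending on k - l are bounded because |k - l| < 7. -/
theorem close_exponent_le {α γ : ℝ} (hγ : 0 ≤ γ) (hγ' : γ ≤ 1 / 2) (hγα : γ ≤ α) {k l j : ℤ}
    (hkl : |k - l| < 7) (hj : j ≤ k + 11) {c e : ℝ} (he : e ≤ c * |(k - l : ℝ)|) (hc : 0 ≤ c) :
    α * (j - k) + e ≤ (11 * α + 9 + 7 * c) + -(γ * |(k - j : ℝ)|) + -(γ * |(l - k : ℝ)|) := by
  have hkl' : |(k - l : ℝ)| ≤ 7 := by exact_mod_cast hkl.le
  have hj' : (j : ℝ) ≤ k + 11 := by exact_mod_cast hj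
  have e1 : γ * |(l - k : ℝ)| ≤ 1 / 2 * 7 := by
    rw [abs_sub_comm]
    gcongr
  have e2 : c * |(k - l : ℝ)| ≤ c * 7 := by gcongr
  have e3 : α * (j - k) ≤ 11 * α + 11 / 2 + -(γ * |(k - j : ℝ)|) := by
    rcases le_total (j : ℝ) k with h | h
    · rw [abs_of_nonneg (by linarith)]
      nlinarith
    · rw [abs_of_nonpos (by linarith)]
      nlinarith
  linarith

/-- Hölder in L^p × L^∞, with Bernstein on the second input, leaves 2^{s(j-k)} for s = `crit p`.
This decays when p < 2. -/
theorem exists_wt_piece_le_of_close_lt_two {p : ℝ≥0∞} (hp : 1 ≤ p) (hp' : p ≠ ∞)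
    {γ : ℝ} (hγ : 0 ≤ γ) (hγ' : γ ≤ 1 / 2) (hγα : γ ≤ crit p) :
    ∃ C : ℝ≥0∞, C ≠ ∞ ∧ ∀ (k l j : ℤ) (G H : Plane → ℂ), Spec k G → Spec l H → |k - l| < 7 →
      wt (crit p) p j (D.piece k l G H j) ≤
        C * (dy (-(γ * |(k - j : ℝ)|)) * dy (-(γ * |(l - k : ℝ)|))) *
          (wt (crit p) p k G * wt (crit p) p l H) := by
  obtain ⟨C₁, hC₁, h₁⟩ := D.exists_wt_piece_le_of_close (t := p) ∞ hp hp le_rfl hp'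
  obtain ⟨C₂, hC₂, h₂⟩ := D.exists_eLpNorm_top_le_of_spec hp hp'
  refine ⟨C₁ * C₂ * dy (11 * crit p + 9 + 7 * 1),
    ENNReal.mul_ne_top (ENNReal.mul_ne_top hC₁ hC₂) (dy_ne_top _), fun k l j G H hG hH hkl ↦ ?_⟩
  rcases lt_or_ge (k + 11) j with hj | hj
  · rw [D.wt_piece_eq_zero_of_close hG hH hkl hj]
    exact zero_le
  set s := crit p
  have h := h₁ k l j G H hG hH hkl
  rw [sub_self, zero_mul, dy_zero, mul_one, eLpNorm_eq_wt s p k G] at h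
  have hexp := close_exponent_le hγ hγ' hγα hkl hj (c := 1) (e := l - k)
    (by rw [one_mul, abs_sub_comm]; exact le_abs_self _) zero_le_one
  calc wt s p j (D.piece k l G H j)
      ≤ dy (s * j) * (C₁ * dy (-k) * (dy (-(s * k)) * wt s p k G * (C₂ * dy l * wt s p l H))) := by
        rw [wt]
        gcongr
        refine h.trans ?_
        gcongr
        exact h₂ l H hH
    _ = C₁ * C₂ * dy (s * j + -k + -(s * k) + l) * (wt s p k G * wt s p l H) := by
        simp only [dy_add]
        ring
    _ = C₁ * C₂ * dy (s * (j - k) + (l - k)) * (wt s p k G * wt s p l H) := by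
        congr 3
        ring
    _ ≤ C₁ * C₂ * dy ((11 * s + 9 + 7 * 1) + -(γ * |(k - j : ℝ)|) + -(γ * |(l - k : ℝ)|)) *
          (wt s p k G * wt s p l H) := by
        gcongr
        exact dy_mono hexp
    _ = _ := by
        simp only [dy_add]
        ring

/-- Here t is p/2: Hölder in L^p × L^p and Bernstein on the output replace s by s + 2/p = 4/p - 1,
the exponent that is positive up to p = 4. -/
theorem exists_wt_piece_le_of_close_ge_two {p t : ℝ≥0∞} (hp : 1 ≤ p) (hp' : p ≠ ∞)
    (ht : 1 ≤ t) (htp : t ≤ p) [ENNReal.HolderTriple p p t] (htr : 2 / t.toReal = 4 / p.toReal)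
    {γ : ℝ} (hγ : 0 ≤ γ) (hγ' : γ ≤ 1 / 2) (hγα : γ ≤ 4 / p.toReal - 1) :
    ∃ C : ℝ≥0∞, C ≠ ∞ ∧ ∀ (k l j : ℤ) (G H : Plane → ℂ), Spec k G → Spec l H → |k - l| < 7 →
      wt (crit p) p j (D.piece k l G H j) ≤
        C * (dy (-(γ * |(k - j : ℝ)|)) * dy (-(γ * |(l - k : ℝ)|))) *
          (wt (crit p) p k G * wt (crit p) p l H) := by
  obtain ⟨C₁, hC₁, h₁⟩ := D.exists_wt_piece_le_of_close (t := t) p hp ht htp hp'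
  refine ⟨C₁ * dy (11 * (4 / p.toReal - 1) + 9 + 7 * |crit p|),
    ENNReal.mul_ne_top hC₁ (dy_ne_top _), fun k l j G H hG hH hkl ↦ ?_⟩
  rcases lt_or_ge (k + 11) j with hj | hj
  · rw [D.wt_piece_eq_zero_of_close hG hH hkl hj]
    exact zero_le
  set s := crit p with hs
  have h := h₁ k l j G H hG hH hkl
  rw [eLpNorm_eq_wt s p k G, eLpNorm_eq_wt s p l H, htr] at h
  have hexp := close_exponent_le hγ hγ' hγα hkl hj (c := |s|) (e := s * (k - l))
    (by rw [← abs_mul]; exact le_abs_self _) (abs_nonneg _)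
  calc wt s p j (D.piece k l G H j)
      ≤ dy (s * j) * (C₁ * dy ((4 / p.toReal - 2 / p.toReal) * j) * dy (-k) *
          (dy (-(s * k)) * wt s p k G * (dy (-(s * l)) * wt s p l H))) := by
        rw [wt]
        gcongr
    _ = C₁ * dy (s * j + (4 / p.toReal - 2 / p.toReal) * j + -k + -(s * k) + -(s * l)) *
          (wt s p k G * wt s p l H) := by
        simp only [dy_add]
        ring
    _ = C₁ * dy ((4 / p.toReal - 1) * (j - k) + s * (k - l)) * (wt s p k G * wt s p l H) := by
        congr 3
        rw [hs, crit]
        ring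
    _ ≤ C₁ * dy ((11 * (4 / p.toReal - 1) + 9 + 7 * |s|) + -(γ * |(k - j : ℝ)|) +
          -(γ * |(l - k : ℝ)|)) * (wt s p k G * wt s p l H) := by
        gcongr
        exact dy_mono hexp
    _ = _ := by
        simp only [dy_add]
        ring

/-- Symmetry reduces to the first input being the high one. When it is the low one, decay in |l - j|
must be traded for decay in |k - j| by the triangle inequality, and the estimate is therefore
invoked with 2γ. -/
theorem exists_wt_piece_le_of_far {p : ℝ≥0∞} (hp : 1 ≤ p) (hp' : p ≠ ∞) {γ : ℝ} (hγ : 0 ≤ γ)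
    (hγ' : γ ≤ 1 / 4) :
    ∃ C : ℝ≥0∞, C ≠ ∞ ∧ ∀ (k l j : ℤ) (G H : Plane → ℂ), Spec k G → Spec l H → ¬|k - l| < 7 →
      wt (crit p) p j (D.piece k l G H j) ≤
        C * (dy (-(γ * |(k - j : ℝ)|)) * dy (-(γ * |(l - k : ℝ)|))) *
          (wt (crit p) p k G * wt (crit p) p l H) := by
  obtain ⟨C, hC, h⟩ := D.exists_wt_piece_le_of_sep hp hp' (γ := 2 * γ) (by linarith)
  refine ⟨C, hC, fun k l j G H hG hH hkl ↦ ?_⟩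
  have h' : l + 7 ≤ k ∨ k + 7 ≤ l := by
    rw [abs_lt] at hkl
    omega
  rcases h' with h' | h'
  · refine (h k l j G H hG hH h').trans ?_
    gcongr <;> refine dy_mono (neg_le_neg ?_) <;> gcongr <;> linarith
  · have h1 := h l k j H G hH hG h'
    rw [D.piece_comm] at h1
    refine h1.trans ?_
    rw [mul_comm (wt _ _ l _), ← dy_add, ← dy_add]
    gcongr
    refine dy_mono ?_
    have e1 : |(k - j : ℝ)| ≤ |(l - j : ℝ)| + |(k - l : ℝ)| := by
      have := abs_add_le (l - j : ℝ) (k - l)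
      rwa [show (l - j + (k - l) : ℝ) = k - j by ring] at this
    have e2 : |(l - k : ℝ)| = |(k - l : ℝ)| := abs_sub_comm _ _
    rw [e2]
    have e3 := mul_le_mul_of_nonneg_left e1 hγ
    have e4 : 0 ≤ γ * |(l - j : ℝ)| := by positivity
    linarith

/-- For `p < 4` all interactions decay off the diagonal. -/
theorem exists_wt_piece_le {p : ℝ≥0∞} (hp : 1 ≤ p) (hp4 : p < 4) :
    ∃ (γ : ℝ) (C : ℝ≥0∞), 0 < γ ∧ C ≠ ∞ ∧ ∀ (k l j : ℤ) (G H : Plane → ℂ), Spec k G → Spec l H →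
      wt (crit p) p j (D.piece k l G H j) ≤
        C * (dy (-(γ * |(k - j : ℝ)|)) * dy (-(γ * |(l - k : ℝ)|))) *
          (wt (crit p) p k G * wt (crit p) p l H) := by
  have hp' : p ≠ ∞ := ne_top_of_lt hp4
  have hp1 : 1 ≤ p.toReal := by simpa using ENNReal.toReal_mono hp' hp
  have hclose : ∃ (γ : ℝ) (C : ℝ≥0∞), 0 < γ ∧ γ ≤ 1 / 4 ∧ C ≠ ∞ ∧
      ∀ (k l j : ℤ) (G H : Plane → ℂ), Spec k G → Spec l H → |k - l| < 7 →
        wt (crit p) p j (D.piece k l G H j) ≤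
          C * (dy (-(γ * |(k - j : ℝ)|)) * dy (-(γ * |(l - k : ℝ)|))) *
            (wt (crit p) p k G * wt (crit p) p l H) := by
    -- The exponent p/2 is usable in Hölder's inequality only for p ≥ 2; below that, `crit p` is
    -- already positive.
    rcases lt_or_ge p 2 with h2 | h2
    · have hα : 0 < crit p := by
        have : p.toReal < 2 := by simpa using (ENNReal.toReal_lt_toReal hp' (by simp)).2 h2
        rw [crit, sub_pos, one_lt_div (by linarith)]
        exact this
      obtain ⟨C, hC, h⟩ := D.exists_wt_piece_le_of_close_lt_two hp hp' (γ := min (1 / 4) (crit p))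
        (by positivity) ((min_le_left _ _).trans (by norm_num)) (min_le_right _ _)
      exact ⟨_, C, by positivity, min_le_left _ _, hC, h⟩
    · have hα : 0 < 4 / p.toReal - 1 := by
        have : p.toReal < 4 := by simpa using (ENNReal.toReal_lt_toReal hp' (by simp)).2 hp4
        rw [sub_pos, one_lt_div (by linarith)]
        exact this
      have : ENNReal.HolderTriple p p (p / 2) := ⟨by
        rw [ENNReal.inv_div (by simp) (by simp), ← two_mul, div_eq_mul_inv]⟩
      obtain ⟨C, hC, h⟩ := D.exists_wt_piece_le_of_close_ge_two (t := p / 2) hp hp'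
        (by rw [ENNReal.le_div_iff_mul_le (by simp) (by simp)]; simpa using h2)
        ENNReal.half_le_self
        (by rw [ENNReal.toReal_div]; simp; field_simp; norm_num)
        (γ := min (1 / 4) (4 / p.toReal - 1))
        (by positivity) ((min_le_left _ _).trans (by norm_num)) (min_le_right _ _)
      exact ⟨_, C, by positivity, min_le_left _ _, hC, h⟩
  obtain ⟨γ, C₁, hγ, hγ', hC₁, h₁⟩ := hclose
  obtain ⟨C₂, hC₂, h₂⟩ := D.exists_wt_piece_le_of_far hp hp' hγ.le hγ'
  refine ⟨γ, C₁ + C₂, hγ, by finiteness, fun k l j G H hG hH ↦ ?_⟩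
  by_cases hkl : |k - l| < 7
  · refine (h₁ k l j G H hG hH hkl).trans ?_
    gcongr
    exact le_self_add
  · refine (h₂ k l j G H hG hH hkl).trans ?_
    gcongr
    exact le_add_self

end DyadicPartition

/-! ### Summation -/

theorem exists_eLpNorm_count_decay_le {q : ℝ≥0∞} (hq : 1 ≤ q) {γ : ℝ} (hγ : 0 < γ) {C : ℝ≥0∞}
    (hC : C ≠ ∞) :
    ∃ C' : ℝ≥0∞, C' ≠ ∞ ∧ ∀ a b : ℤ → ℝ≥0∞,
      eLpNorm (fun j : ℤ ↦ ∑' i : ℤ × ℤ, C * (dy (-(γ * |(i.1 - j : ℝ)|)) *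
        dy (-(γ * |(i.2 - i.1 : ℝ)|))) * (a i.1 * b i.2)) q Measure.count ≤
      C' * (eLpNorm a q Measure.count * eLpNorm b q Measure.count) := by
  let β : ℤ × ℤ → ℝ≥0∞ := fun i ↦ C * (dy (-(γ * |(i.1 : ℝ)|)) * dy (-(γ * |(i.2 : ℝ)|)))
  have hS := tsum_dy_neg_abs_ne_top hγ
  refine ⟨∑' i, β i, ?_, fun a b ↦ ?_⟩
  · simp only [β]
    rw [ENNReal.tsum_mul_left,
      ENNReal.tsum_prod (f := fun m d : ℤ ↦ dy (-(γ * |(m : ℝ)|)) * dy (-(γ * |(d : ℝ)|)))]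
    simp only [ENNReal.tsum_mul_left, ENNReal.tsum_mul_right]
    finiteness
  · refine le_trans (le_of_eq ?_) (eLpNorm_count_weighted_le hq β
      (fun i ↦ ENNReal.mul_ne_top hC (ENNReal.mul_ne_top (dy_ne_top _) (dy_ne_top _))) a b)
    congr 1
    ext j
    -- In the coordinates k - j and l - k the weight does not depend on j, as the convolution
    -- estimate requires.
    let e : ℤ × ℤ ≃ ℤ × ℤ :=
      { toFun := fun i ↦ (j + i.1, j + i.1 + i.2)
        invFun := fun i ↦ (i.1 - j, i.2 - i.1)
        left_inv := fun i ↦ by ext <;> simp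
        right_inv := fun i ↦ by ext <;> simp }
    rw [← e.tsum_eq]
    refine tsum_congr fun i ↦ ?_
    simp [e, β]

theorem tsum_mul_le_eLpNorm_two (a b : ℤ → ℝ≥0∞) :
    ∑' k, a k * b k ≤ eLpNorm a 2 Measure.count * eLpNorm b 2 Measure.count := by
  have h := ENNReal.lintegral_mul_le_Lp_mul_Lq (Measure.count : Measure ℤ)
    (Real.HolderConjugate.two_two) (f := a) (g := b)
    (measurable_of_countable a).aemeasurable (measurable_of_countable b).aemeasurable
  rw [lintegral_count] at h
  rw [eLpNorm_eq_lintegral_rpow_enorm_toReal (by simp) (by simp),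
    eLpNorm_eq_lintegral_rpow_enorm_toReal (by simp) (by simp)]
  simpa using h

theorem eLpNorm_count_two_sq (a : ℤ → ℝ≥0∞) : eLpNorm a 2 Measure.count ^ 2 = ∑' k, a k ^ 2 := by
  rw [eLpNorm_eq_lintegral_rpow_enorm_toReal (by simp) (by simp), lintegral_count]
  simp only [enorm_eq_self]
  rw [← ENNReal.rpow_natCast, ← ENNReal.rpow_mul]
  simp

/-- Cauchy-Schwarz on each diagonal l = k + d with |d| < 7. The summable weight 2^{7-|d|} merely
dominates the indicator of these diagonals. -/
theorem exists_tsum_close_le :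
    ∃ C : ℝ≥0∞, C ≠ ∞ ∧ ∀ a b : ℤ → ℝ≥0∞,
      ∑' i : ℤ × ℤ, (if |i.1 - i.2| < 7 then a i.1 * b i.2 else 0) ≤
        C * (eLpNorm a 2 Measure.count * eLpNorm b 2 Measure.count) := by
  refine ⟨dy 7 * ∑' d : ℤ, dy (-(1 * |(d : ℝ)|)),
    ENNReal.mul_ne_top (dy_ne_top _) (tsum_dy_neg_abs_ne_top one_pos), fun a b ↦ ?_⟩
  let e : ℤ × ℤ ≃ ℤ × ℤ :=
    { toFun := fun i ↦ (i.2, i.2 + i.1)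
      invFun := fun i ↦ (i.2 - i.1, i.1)
      left_inv := fun i ↦ by ext <;> simp
      right_inv := fun i ↦ by ext <;> simp }
  rw [← e.tsum_eq]
  refine le_trans (le_of_eq (ENNReal.tsum_prod (f := fun d k : ℤ ↦
    if |k - (k + d)| < 7 then a k * b (k + d) else 0))) ?_
  rw [← ENNReal.tsum_mul_left, ← ENNReal.tsum_mul_right]
  refine ENNReal.tsum_le_tsum fun d ↦ ?_
  simp only [sub_add_cancel_left, abs_neg]
  split_ifs with hd
  · have hd' : |(d : ℝ)| ≤ 7 := by exact_mod_cast hd.le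
    calc ∑' k, a k * b (k + d) ≤ eLpNorm a 2 Measure.count * eLpNorm b 2 Measure.count := by
          rw [← eLpNorm_count_add_right b d]
          exact tsum_mul_le_eLpNorm_two a fun k ↦ b (k + d)
      _ ≤ _ := by
          refine le_mul_of_one_le_left' ?_
          rw [← dy_add, ← dy_zero]
          exact dy_mono (by linarith)
  · simp

namespace DyadicPartition

variable (D : DyadicPartition)

/-- The high-high interactions in the endpoint case. -/
theorem exists_eLpNorm_wt_piece_le_four :
    ∃ C : ℝ≥0∞, C ≠ ∞ ∧ ∀ (k l : ℤ) (G H : Plane → ℂ), Spec k G → Spec l H → |k - l| < 7 →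
      eLpNorm (fun j ↦ wt (crit 4) 4 j (D.piece k l G H j)) 2 Measure.count ≤
        C * (wt (crit 4) 4 k G * wt (crit 4) 4 l H) := by
  have hHT : ENNReal.HolderTriple 4 4 2 := ⟨by
    rw [← two_mul, ← ENNReal.toReal_eq_toReal_iff' (by finiteness) (by finiteness)]
    simp
    norm_num⟩
  obtain ⟨C₁, hC₁, h₁⟩ := exists_eLpNorm_le_of_spec D (t := 2) (p := 4) (by norm_num) (by norm_num)
    (by simp)
  choose C₂ hC₂ h₂ using fun ba : Fin 2 × Fin 2 ↦
    D.exists_tsum_eLpNorm_cv_kern_sq_le (σ := (HomSymbol.W ba.1).d ba.2)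
      (by rw [HomSymbol.deg_d, HomSymbol.deg_W, neg_add_cancel])
  obtain ⟨C₃, hC₃, h₃⟩ := D.exists_lintegral_oddKern_le
  refine ⟨C₁ * ((∑ b, ∑ a, C₂ (b, a) ^ (1 / 2 : ℝ)) * C₃ * dy 7), ?_,
    fun k l G H hG hH hkl ↦ ?_⟩
  · have : (∑ b, ∑ a, C₂ (b, a) ^ (1 / 2 : ℝ)) ≠ ∞ := ENNReal.sum_ne_top.2 fun b _ ↦
      ENNReal.sum_ne_top.2 fun a _ ↦ ENNReal.rpow_ne_top_of_nonneg (by norm_num) (hC₂ _)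
    have := dy_ne_top 7
    finiteness
  -- The weight 2^{-j/2} exactly cancels the cost 2^{j/2} of Bernstein from L² to L⁴. No decay in j
  -- remains, and summability comes from the square function.
  have hs : crit 4 = -(1 / 2) := by norm_num [crit]
  let T : Fin 2 → Fin 2 → Plane → ℂ := fun b a ↦ transport (D.oddKern b k) a G H
  have hT : ∀ b a, BddCont (T b a) := fun b a ↦ hG.1.transport _ a hH.1
  let V : Fin 2 → Fin 2 → ℤ → ℝ≥0∞ := fun b a j ↦
    eLpNorm (cv (D.kern ((HomSymbol.W b).d a) 0 j) (T b a)) 2 volume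
  have hcont : ∀ b a j, BddCont (cv (D.kern ((HomSymbol.W b).d a) 0 j) (T b a)) := fun b a j ↦
    (hT b a).cv (D.kern _ 0 j).integrable
  have hpiece : ∀ j, wt (crit 4) 4 j (D.piece k l G H j) ≤ C₁ * (∑ b, ∑ a, V b a) j := by
    intro j
    have h := h₁ j _ (hG.1.spec_piece D hH.1 k l j)
    have e : dy (crit 4 * j) * dy ((2 / (2 : ℝ≥0∞).toReal - 2 / (4 : ℝ≥0∞).toReal) * j) = 1 := by
      rw [← dy_add, ← dy_zero, hs]
      congr 1
      norm_num
    calc wt (crit 4) 4 j (D.piece k l G H j)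
        ≤ dy (crit 4 * j) * (C₁ * dy ((2 / (2 : ℝ≥0∞).toReal - 2 / (4 : ℝ≥0∞).toReal) * j) *
            eLpNorm (D.piece k l G H j) 2 volume) := by
          rw [wt]
          gcongr
      _ = C₁ * eLpNorm (D.piece k l G H j) 2 volume := by
          rw [mul_comm C₁, ← mul_assoc, ← mul_assoc, e, one_mul]
      _ ≤ _ := by
          gcongr
          simp only [Finset.sum_apply]
          calc eLpNorm (D.piece k l G H j) 2 volume
              ≤ eLpNorm (∑ b, ∑ a, cv (D.kern ((HomSymbol.W b).d a) 0 j) (T b a)) 2 volume := by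
                refine eLpNorm_mono_enorm fun x ↦ ?_
                rw [D.piece_eq_transport hkl hG hH, enorm_mul, Finset.sum_apply]
                simp only [Finset.sum_apply]
                refine mul_le_of_le_one_left' ?_
                rw [← ofReal_norm]
                norm_num
            _ ≤ ∑ b, eLpNorm (∑ a, cv (D.kern ((HomSymbol.W b).d a) 0 j) (T b a)) 2 volume := by
                refine eLpNorm_sum_le (fun b _ ↦ ?_) (by norm_num)
                exact Finset.aestronglyMeasurable_sum _ fun a _ ↦
                  (hcont b a j).1.aestronglyMeasurable
            _ ≤ _ := by
                gcongr with b _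
                exact eLpNorm_sum_le (fun a _ ↦ (hcont b a j).1.aestronglyMeasurable) (by norm_num)
  have hmeas : ∀ V : ℤ → ℝ≥0∞, AEStronglyMeasurable V Measure.count := fun V ↦
    (measurable_of_countable V).aestronglyMeasurable
  -- The averages have L² norm at most a constant times 2^{-k} 2^{k/2} 2^{l/2} times the weighted
  -- input norms, and these powers are bounded since |k - l| < 7.
  have hV : ∀ b a, eLpNorm (V b a) 2 Measure.count ≤
      C₂ (b, a) ^ (1 / 2 : ℝ) * (C₃ * dy 7 * (wt (crit 4) 4 k G * wt (crit 4) 4 l H)) := by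
    intro b a
    have h1 : eLpNorm (V b a) 2 Measure.count ^ 2 ≤ C₂ (b, a) * eLpNorm (T b a) 2 volume ^ 2 := by
      rw [eLpNorm_count_two_sq]
      exact h₂ (b, a) _ (hT b a)
    have h2 : eLpNorm (V b a) 2 Measure.count ≤
        C₂ (b, a) ^ (1 / 2 : ℝ) * eLpNorm (T b a) 2 volume := by
      have := ENNReal.rpow_le_rpow h1 (z := 1 / 2) (by norm_num)
      rw [ENNReal.mul_rpow_of_nonneg _ _ (by norm_num)] at this
      rw [← ENNReal.rpow_natCast, ← ENNReal.rpow_natCast, ← ENNReal.rpow_mul,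
        ← ENNReal.rpow_mul] at this
      simpa using this
    refine h2.trans ?_
    gcongr
    have h3 := eLpNorm_transport_le (D.oddKern b k) a hG.1 hH.1 (p := 4) (r := 4) (t := 2)
      (by norm_num) (by simp)
    refine h3.trans ?_
    rw [eLpNorm_eq_wt (crit 4) 4 k G, eLpNorm_eq_wt (crit 4) 4 l H]
    calc _ ≤ C₃ * dy (-k) * (dy (-(crit 4 * k)) * wt (crit 4) 4 k G *
          (dy (-(crit 4 * l)) * wt (crit 4) 4 l H)) := by
          gcongr
          exact h₃ b k
      _ = C₃ * dy (-k + -(crit 4 * k) + -(crit 4 * l)) *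
          (wt (crit 4) 4 k G * wt (crit 4) 4 l H) := by
          simp only [dy_add]
          ring
      _ ≤ _ := by
          gcongr
          refine dy_mono ?_
          have : |(k - l : ℝ)| ≤ 7 := by exact_mod_cast hkl.le
          rw [abs_le] at this
          rw [hs]
          linarith
  calc _ ≤ C₁ * eLpNorm (∑ b, ∑ a, V b a) 2 Measure.count :=
        eLpNorm_count_le_const_mul hC₁ hpiece 2
    _ ≤ C₁ * ∑ b, ∑ a, eLpNorm (V b a) 2 Measure.count := by
        gcongr
        refine (eLpNorm_sum_le (fun b _ ↦ hmeas _) (by norm_num)).trans ?_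
        gcongr with b _
        exact eLpNorm_sum_le (fun a _ ↦ hmeas _) (by norm_num)
    _ ≤ C₁ * ∑ b, ∑ a, C₂ (b, a) ^ (1 / 2 : ℝ) *
          (C₃ * dy 7 * (wt (crit 4) 4 k G * wt (crit 4) 4 l H)) := by
        gcongr with b _ a _
        exact hV b a
    _ = _ := by
        simp only [← Finset.sum_mul]
        ring

end DyadicPartition

/-- The exponents of the theorem. -/
def Admissible (p q : ℝ≥0∞) : Prop := (1 ≤ p ∧ p < 4 ∧ 1 ≤ q) ∨ (p = 4 ∧ q = 2)

/-- The `ℓ^q` norm of the sequence `2^{sj} ‖G_j‖_{L^p}`. -/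
def seqNorm (s : ℝ) (p q : ℝ≥0∞) (G : ℤ → Plane → ℂ) : ℝ≥0∞ :=
  eLpNorm (fun j ↦ wt s p j (G j)) q Measure.count

/-- The bilinear estimate. -/
theorem DyadicPartition.exists_eLpNorm_tsum_wt_piece_le (D : DyadicPartition) {p q : ℝ≥0∞}
    (hpq : Admissible p q) :
    ∃ C : ℝ≥0∞, C ≠ ∞ ∧ ∀ G H : ℤ → Plane → ℂ, (∀ k, Spec k (G k)) → (∀ l, Spec l (H l)) →
      eLpNorm (fun j ↦ ∑' i : ℤ × ℤ, wt (crit p) p j (D.piece i.1 i.2 (G i.1) (H i.2) j)) q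
        Measure.count ≤ C * (seqNorm (crit p) p q G * seqNorm (crit p) p q H) := by
  rcases hpq with ⟨hp, hp4, hq⟩ | ⟨rfl, rfl⟩
  · obtain ⟨γ, C, hγ, hC, h⟩ := D.exists_wt_piece_le hp hp4
    obtain ⟨C', hC', h'⟩ := exists_eLpNorm_count_decay_le hq hγ hC
    refine ⟨C', hC', fun G H hG hH ↦ ?_⟩
    refine le_trans (eLpNorm_mono_enorm fun j ↦ ?_) (h' (fun k ↦ wt (crit p) p k (G k))
      fun l ↦ wt (crit p) p l (H l))
    simp only [enorm_eq_self]
    exact ENNReal.tsum_le_tsum fun i ↦ h _ _ _ _ _ (hG _) (hH _)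
  -- Endpoint: separated frequencies decay as before. For comparable ones the ℓ² norm in j is taken
  -- pair by pair, and the pairs are summed by Cauchy-Schwarz, which needs both inputs in ℓ².
  · obtain ⟨C₁, hC₁, h₁⟩ := D.exists_wt_piece_le_of_far (p := 4) (by norm_num) (by simp)
      (γ := 1 / 4) (by norm_num) le_rfl
    obtain ⟨C₂, hC₂, h₂⟩ := D.exists_eLpNorm_wt_piece_le_four
    obtain ⟨C₃, hC₃, h₃⟩ := exists_eLpNorm_count_decay_le (q := 2) (by norm_num)
      (γ := 1 / 4) (by norm_num) hC₁
    obtain ⟨C₄, hC₄, h₄⟩ := exists_tsum_close_le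
    refine ⟨C₃ + C₂ * C₄, by finiteness, fun G H hG hH ↦ ?_⟩
    set A := fun k ↦ wt (crit 4) 4 k (G k)
    set B := fun l ↦ wt (crit 4) 4 l (H l)
    let F : ℤ × ℤ → ℤ → ℝ≥0∞ := fun i j ↦
      if |i.1 - i.2| < 7 then wt (crit 4) 4 j (D.piece i.1 i.2 (G i.1) (H i.2) j) else 0
    let E : ℤ → ℝ≥0∞ := fun j ↦ ∑' i : ℤ × ℤ, C₁ * (dy (-(1 / 4 * |(i.1 - j : ℝ)|)) *
        dy (-(1 / 4 * |(i.2 - i.1 : ℝ)|))) * (A i.1 * B i.2)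
    have hmeas : ∀ V : ℤ → ℝ≥0∞, AEStronglyMeasurable V Measure.count := fun V ↦
      (measurable_of_countable V).aestronglyMeasurable
    have hF : eLpNorm (fun j ↦ ∑' i, F i j) 2 Measure.count ≤
        C₂ * C₄ * (eLpNorm A 2 Measure.count * eLpNorm B 2 Measure.count) := by
      refine (eLpNorm_count_tsum_le (by norm_num) F).trans ?_
      calc ∑' i, eLpNorm (F i) 2 Measure.count
          ≤ ∑' i : ℤ × ℤ, C₂ * (if |i.1 - i.2| < 7 then A i.1 * B i.2 else 0) := by
            refine ENNReal.tsum_le_tsum fun i ↦ ?_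
            by_cases hi : |i.1 - i.2| < 7
            · simp only [F, if_pos hi]
              exact h₂ _ _ _ _ (hG _) (hH _) hi
            · simp only [F, if_neg hi]
              simp
        _ ≤ _ := by
            rw [ENNReal.tsum_mul_left, mul_assoc]
            gcongr
            exact h₄ A B
    calc _ ≤ eLpNorm (E + fun j ↦ ∑' i, F i j) 2 Measure.count := by
          refine eLpNorm_mono_enorm fun j ↦ ?_
          simp only [enorm_eq_self, Pi.add_apply, E]
          rw [← ENNReal.tsum_add]
          refine ENNReal.tsum_le_tsum fun i ↦ ?_
          by_cases hi : |i.1 - i.2| < 7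
          · simp only [F, if_pos hi]
            exact le_add_self
          · exact (h₁ _ _ _ _ _ (hG _) (hH _) hi).trans le_self_add
      _ ≤ eLpNorm E 2 Measure.count + eLpNorm (fun j ↦ ∑' i, F i j) 2 Measure.count :=
          eLpNorm_add_le (hmeas _) (hmeas _) (by norm_num)
      _ ≤ C₃ * (eLpNorm A 2 Measure.count * eLpNorm B 2 Measure.count) +
          C₂ * C₄ * (eLpNorm A 2 Measure.count * eLpNorm B 2 Measure.count) :=
          add_le_add (h₃ A B) hF
      _ = _ := (add_mul _ _ _).symm

/-! ### Distributions from dyadic sequences -/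

theorem le_eLpNorm_count (c : ℤ → ℝ≥0∞) {q : ℝ≥0∞} (hq : q ≠ 0) (j : ℤ) :
    c j ≤ eLpNorm c q Measure.count := by
  by_cases h : q = ∞
  · subst h
    have := ae_le_eLpNormEssSup (f := c) (μ := (Measure.count : Measure ℤ))
    rw [eLpNorm_exponent_top]
    have h2 := (Measure.ae_count_iff).1 this j
    simpa using h2
  · have hq' := ENNReal.toReal_pos hq h
    rw [eLpNorm_eq_lintegral_rpow_enorm_toReal hq h, lintegral_count]
    calc c j = (‖c j‖ₑ ^ q.toReal) ^ (1 / q.toReal) := by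
          rw [← ENNReal.rpow_mul, mul_one_div_cancel hq'.ne', ENNReal.rpow_one, enorm_eq_self]
      _ ≤ _ := by
          gcongr
          exact ENNReal.le_tsum (f := fun j ↦ ‖c j‖ₑ ^ q.toReal) j

theorem eLpNorm_tsum_le_tsum {ι : Type*} [Countable ι] {p : ℝ≥0∞} (hp : 1 ≤ p) (hp' : p ≠ ∞)
    {F : ι → Plane → ℂ} (hF : ∀ i, Continuous (F i)) :
    eLpNorm (fun x ↦ ∑' i, F i x) p volume ≤ ∑' i, eLpNorm (F i) p volume := by
  have h := eLpNorm_tsum_le (μ := (volume : Measure Plane)) hp hp' (F := fun i x ↦ ‖F i x‖ₑ)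
    fun i ↦ (hF i).measurable.enorm
  simp only [eLpNorm_enorm] at h
  refine le_trans (eLpNorm_mono_enorm fun x ↦ ?_) h
  rw [enorm_eq_self]
  exact enorm_tsum_le_tsum_enorm

namespace DyadicPartition

variable (D : DyadicPartition)

theorem phi_eq_kern (j : ℤ) : D.φ j = D.kern (HomSymbol.const 1) 0 j :=
  schwartz_ext_fourier fun ξ ↦ by
    rw [fourier_kern, fourier_wide]
    simp [HomSymbol.const]

theorem besovNorm_eq (s : ℝ) (p q : ℝ≥0∞) (F : DistModPoly) :
    D.besovNorm s p q F = seqNorm s p q fun j ↦ D.block j F := by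
  simp only [besovNorm, seqNorm, ofReal_two_rpow, wt]

/-- A series of frequency localised functions has a Besov norm controlled by its terms. -/
theorem exists_besovNorm_le (s : ℝ) {p q : ℝ≥0∞} (hp : 1 ≤ p) (hp' : p ≠ ∞) (hq : 1 ≤ q) :
    ∃ C : ℝ≥0∞, C ≠ ∞ ∧ ∀ (g : ℤ → Plane → ℂ) (u : 𝓢'(Plane, ℂ)), (∀ j, Spec j (g j)) →
      (∀ ψ, HasSum (fun j ↦ ∫ x, g j x * ψ x) (u ψ)) →
      D.besovNorm s p q (Submodule.Quotient.mk u) ≤ C * seqNorm s p q g := by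
  obtain ⟨C, hC, h⟩ := D.exists_eLpNorm_cv_kern_le (HomSymbol.const 1) 0
  refine ⟨∑ _d ∈ Finset.Icc (-1 : ℤ) 1, C * dy |s|, ?_, fun g u hg hu ↦ ?_⟩
  · exact ENNReal.sum_ne_top.2 fun _ _ ↦ ENNReal.mul_ne_top hC (dy_ne_top _)
  rw [besovNorm_eq]
  -- Block i meets only the terms i - 1, i, i + 1, and moving the weight by one index costs at most
  -- 2^{|s|}.
  let c : ℤ → ℤ → ℝ≥0∞ := fun d j ↦ C * dy |s| * wt s p (j + d) (g (j + d))
  have hle : ∀ i, wt s p i (D.block i (Submodule.Quotient.mk u)) ≤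
      ∑ d ∈ Finset.Icc (-1 : ℤ) 1, c d i := by
    intro i
    have hb : D.block i (Submodule.Quotient.mk u) =
        ∑ d ∈ Finset.Icc (-1 : ℤ) 1, cv (D.φ i) (g (i + d)) := by
      ext x
      rw [D.block_eq_sum_cv hg hu, Finset.sum_apply]
      refine Finset.sum_bij' (fun j _ ↦ j - i) (fun d _ ↦ i + d) ?_ ?_ ?_ ?_ ?_
      · intro j hj; rw [Finset.mem_Icc] at *; omega
      · intro j hj; rw [Finset.mem_Icc] at *; omega
      · intro j _; ring
      · intro j _; ring
      · intro j _; simp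
    have hm : ∀ d ∈ Finset.Icc (-1 : ℤ) 1, AEStronglyMeasurable (cv (D.φ i) (g (i + d))) :=
      fun d _ ↦ ((hg _).1.cv (D.φ i).integrable).1.aestronglyMeasurable
    rw [wt, hb]
    refine (mul_le_mul_right (eLpNorm_sum_le hm hp) _).trans ?_
    rw [Finset.mul_sum]
    refine Finset.sum_le_sum fun d hd ↦ ?_
    have h1 := h i (g (i + d)) (hg _).1.1 p hp hp'
    rw [← D.phi_eq_kern, show (HomSymbol.const 1).deg = 0 from rfl, Int.cast_zero, zero_mul,
      dy_zero, mul_one, eLpNorm_eq_wt s p (i + d) (g (i + d))] at h1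
    have hd' : |(d : ℝ)| ≤ 1 := by
      rw [Finset.mem_Icc] at hd
      rw [abs_le]
      exact_mod_cast hd
    calc _ ≤ dy (s * i) * (C * (dy (-(s * ((i + d : ℤ) : ℝ))) * wt s p (i + d) (g (i + d)))) := by
          gcongr
      _ = C * dy (s * i + -(s * ((i + d : ℤ) : ℝ))) * wt s p (i + d) (g (i + d)) := by
          rw [dy_add]
          ring
      _ ≤ _ := by
          simp only [c]
          gcongr
          refine dy_mono ?_
          push_cast
          calc s * i + -(s * (i + d)) = -(s * d) := by ring
            _ ≤ |s * d| := neg_le_abs _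
            _ ≤ |s| * 1 := by rw [abs_mul]; gcongr
            _ = |s| := mul_one _
  have hmeas : ∀ V : ℤ → ℝ≥0∞, AEStronglyMeasurable V Measure.count := fun V ↦
    (measurable_of_countable V).aestronglyMeasurable
  calc seqNorm s p q (fun j ↦ D.block j (Submodule.Quotient.mk u))
      ≤ eLpNorm (∑ d ∈ Finset.Icc (-1 : ℤ) 1, c d) q Measure.count := by
        refine eLpNorm_mono_enorm fun i ↦ ?_
        simpa using hle i
    _ ≤ ∑ d ∈ Finset.Icc (-1 : ℤ) 1, eLpNorm (c d) q Measure.count :=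
        eLpNorm_sum_le (fun d _ ↦ hmeas _) hq
    _ ≤ ∑ d ∈ Finset.Icc (-1 : ℤ) 1, C * dy |s| * seqNorm s p q g := by
        gcongr with d _
        refine (eLpNorm_count_le_const_mul (ENNReal.mul_ne_top hC (dy_ne_top _))
          (fun j ↦ le_rfl) q).trans (le_of_eq ?_)
        rw [seqNorm, ← eLpNorm_count_add_right (fun j ↦ wt s p j (g j)) d]
    _ = _ := by rw [Finset.sum_mul]

theorem summable_prod_of_le_mul {ι : Type*} {f : ℤ × ι → ℂ} {m : ι → ℤ → ℝ} {β : ℤ → ℝ} {M : ℝ}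
    (hm0 : ∀ i j, 0 ≤ m i j) (hm : ∀ j, Summable fun i ↦ m i j) (hM : ∀ j, ∑' i, m i j ≤ M)
    (hβ0 : ∀ j, 0 ≤ β j) (hβ : Summable β) (hf : ∀ i j, ‖f (j, i)‖ ≤ m i j * β j) :
    Summable f := by
  refine Summable.of_norm_bounded (g := fun w : ℤ × ι ↦ m w.2 w.1 * β w.1) ?_ fun w ↦ hf w.2 w.1
  have h0 : (0 : ℤ × ι → ℝ) ≤ fun w ↦ m w.2 w.1 * β w.1 := fun w ↦ mul_nonneg (hm0 _ _) (hβ0 _)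
  have h1 : ∀ j, Summable fun i ↦ m i j * β j := fun j ↦ (hm j).mul_right _
  rw [summable_prod_of_nonneg h0]
  refine ⟨h1, ?_⟩
  simp only [tsum_mul_right]
  refine Summable.of_nonneg_of_le (fun j ↦ mul_nonneg (tsum_nonneg fun i ↦ hm0 i j) (hβ0 j))
    (fun j ↦ ?_) (hβ.mul_left M)
  gcongr
  exacts [hβ0 j, hM j]

/-- An absolutely convergent double series of frequency localised functions. -/
theorem exists_distribution_tsum (D : DyadicPartition) {ι : Type*} [Countable ι] {P : ι → ℤ → Plane → ℂ}
    (hP : ∀ i j, Spec j (P i j)) {m : ι → ℤ → ℝ} (hPm : ∀ i j x, ‖P i j x‖ ≤ m i j * (2 : ℝ) ^ j)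
    (hm : ∀ j, Summable fun i ↦ m i j) {M : ℝ} (hM : ∀ j, ∑' i, m i j ≤ M) :
    ∃ u : 𝓢'(Plane, ℂ), (∀ j, Spec j fun x ↦ ∑' i, P i j x) ∧
      (∀ ψ, HasSum (fun j ↦ ∫ x, (∑' i, P i j x) * ψ x) (u ψ)) ∧
      ∀ (ψ : 𝓢(Plane, ℂ)) (b : ι → ℂ),
        (∀ i, HasSum (fun j ↦ ∫ x, P i j x * ψ x) (b i)) → HasSum b (u ψ) := by
  obtain ⟨C, hC0, hC⟩ := D.exists_norm_integral_mul_le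
  have hsum : ∀ j : ℤ, Summable fun i ↦ m i j * (2 : ℝ) ^ j := fun j ↦ (hm j).mul_right _
  have hN : ∀ j, Spec j fun x ↦ ∑' i, P i j x := fun j ↦
    Spec.tsum (fun i ↦ hP i j) (hsum j) (hPm · j)
  have hNb : ∀ j x, ‖∑' i, P i j x‖ ≤ M * (2 : ℝ) ^ j := by
    intro j x
    refine (tsum_of_norm_bounded ((hm j).hasSum.mul_right _) (hPm · j x)).trans ?_
    gcongr
    exact hM j
  obtain ⟨u, hu⟩ := D.exists_distribution hN hNb
  refine ⟨u, hN, hu, fun ψ b hb ↦ ?_⟩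
  set I := (∫ x, ‖ψ x‖) + ∫ x, ‖(Δ ψ) x‖
  have hI0 : 0 ≤ I := by positivity
  let f : ℤ × ι → ℂ := fun w ↦ ∫ x, P w.2 w.1 x * ψ x
  -- Absolute convergence over all pairs allows both orders of summation: fibres over j give u ψ,
  -- fibres over i give the sum of the b i.
  have hf : Summable f := by
    refine summable_prod_of_le_mul (β := fun j ↦ (2 : ℝ) ^ (-(1 * |(j : ℝ)|)) * (C * I))
      (fun i j ↦ ?_) hm hM (fun j ↦ by positivity)
      ((summable_two_rpow_neg_abs one_pos).mul_right _) fun i j ↦ ?_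
    · have := (norm_nonneg _).trans (hPm i j 0)
      exact nonneg_of_mul_nonneg_left this (by positivity)
    · refine (hC _ _ _ (hP i j) (hPm i j) ψ).trans (le_of_eq ?_)
      ring
  have h1 : HasSum (fun j ↦ ∫ x, (∑' i, P i j x) * ψ x) (∑' w, f w) := by
    refine hf.hasSum.prod_fiberwise fun j ↦ ?_
    have := hasSum_integral_mul (fun i ↦ (hP i j).1.1) (hsum j) (hPm · j) ψ.integrable
    simpa only [f, mul_comm] using this
  have h2 : HasSum b (∑' w, f w) := by
    have hswap : HasSum (fun w : ι × ℤ ↦ f (w.2, w.1)) (∑' w, f w) :=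
      (Equiv.prodComm ι ℤ).hasSum_iff.2 hf.hasSum
    exact hswap.prod_fiberwise hb
  rwa [h1.unique (hu ψ)] at h2

/-- The version of `exists_distribution_tsum` for Besov norms. -/
theorem exists_distribution_tsum_of_wt (D : DyadicPartition) {ι : Type*} [Countable ι]
    {p q : ℝ≥0∞} (hp : 1 ≤ p) (hp' : p ≠ ∞) (hq : 1 ≤ q) :
    ∃ C : ℝ≥0∞, C ≠ ∞ ∧ ∀ P : ι → ℤ → Plane → ℂ, (∀ i j, Spec j (P i j)) → ∀ S : ℝ≥0∞, S ≠ ∞ →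
      eLpNorm (fun j ↦ ∑' i, wt (crit p) p j (P i j)) q Measure.count ≤ S →
      ∃ u : 𝓢'(Plane, ℂ), D.besovNorm (crit p) p q (Submodule.Quotient.mk u) ≤ C * S ∧
        ∀ (ψ : 𝓢(Plane, ℂ)) (b : ι → ℂ),
          (∀ i, HasSum (fun j ↦ ∫ x, P i j x * ψ x) (b i)) → HasSum b (u ψ) := by
  obtain ⟨C₁, hC₁, h₁⟩ := D.exists_enorm_le_of_spec hp hp'
  obtain ⟨C₂, hC₂, h₂⟩ := D.exists_besovNorm_le (crit p) hp hp' hq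
  refine ⟨C₂, hC₂, fun P hP S hS hPS ↦ ?_⟩
  set s := crit p
  let c : ℤ → ℝ≥0∞ := fun j ↦ ∑' i, wt s p j (P i j)
  have hcj : ∀ j, c j ≤ S := fun j ↦
    (le_eLpNorm_count c (zero_lt_one.trans_le hq).ne' j).trans hPS
  have hcC : ∀ j, C₁ * c j ≠ ∞ := fun j ↦
    ENNReal.mul_ne_top hC₁ (ne_top_of_le_ne_top hS (hcj j))
  have e : ∀ j, C₁ * c j = ∑' i, C₁ * wt s p j (P i j) := fun j ↦ ENNReal.tsum_mul_left.symm
  have hwt : ∀ i j, C₁ * wt s p j (P i j) ≠ ∞ := fun i j ↦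
    ne_top_of_le_ne_top (hcC j) ((e j).symm ▸ ENNReal.le_tsum (f := fun i ↦ C₁ * wt s p j (P i j)) i)
  have hm : ∀ j, HasSum (fun i ↦ (C₁ * wt s p j (P i j)).toReal) (C₁ * c j).toReal := by
    intro j
    have h := hcC j
    rw [e] at h ⊢
    rw [ENNReal.tsum_toReal_eq (hwt · j)]
    exact (ENNReal.summable_toReal h).hasSum
  have hPm : ∀ i j x, ‖P i j x‖ ≤ (C₁ * wt s p j (P i j)).toReal * (2 : ℝ) ^ j := by
    intro i j x
    have h := h₁ j _ (hP i j) x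
    rw [mul_assoc, mul_comm (dy _), ← mul_assoc] at h
    have := ENNReal.toReal_mono (ENNReal.mul_ne_top (hwt i j) (dy_ne_top _)) h
    rwa [toReal_enorm, ENNReal.toReal_mul, ← ofReal_two_rpow,
      ENNReal.toReal_ofReal (by positivity), Real.rpow_intCast] at this
  obtain ⟨u, hN, hu, hb⟩ := D.exists_distribution_tsum hP hPm (fun j ↦ (hm j).summable)
    (M := (C₁ * S).toReal) fun j ↦ by
      rw [(hm j).tsum_eq]
      exact ENNReal.toReal_mono (ENNReal.mul_ne_top hC₁ hS) (mul_le_mul_right (hcj j) _)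
  refine ⟨u, (h₂ _ u hN hu).trans (mul_le_mul_right (le_trans ?_ hPS) _), hb⟩
  refine eLpNorm_mono_enorm fun j ↦ ?_
  simp only [enorm_eq_self, wt]
  rw [ENNReal.tsum_mul_left]
  gcongr
  exact eLpNorm_tsum_le_tsum hp hp' fun i ↦ (hP i j).1.1

end DyadicPartition

namespace Admissible

variable {p q : ℝ≥0∞}

theorem one_le (h : Admissible p q) : 1 ≤ p := by rcases h with h | ⟨rfl, -⟩ <;> [exact h.1; norm_num]

theorem ne_top (h : Admissible p q) : p ≠ ∞ := by rcases h with h | ⟨rfl, -⟩ <;> [exact ne_top_of_lt h.2.1; simp]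

theorem one_le_right (h : Admissible p q) : 1 ≤ q := by rcases h with h | ⟨-, rfl⟩ <;> [exact h.2.2; norm_num]

end Admissible

namespace DyadicPartition

variable (D : DyadicPartition)

/-- The bilinear form of two sequences of frequency localised functions. -/
def BilinearSum (G H : ℤ → Plane → ℂ) (N : DistModPoly) : Prop :=
  ∀ ψ : zeroMoments, HasSum (fun i : ℤ × ℤ ↦
    bilinearMultiplier symbolB (D.cutoff i.1) (D.cutoff i.2) (G i.1) (H i.2) ψ) (pair ψ N)

/-- The summed pieces define a distribution with the required norm, and the same absolute
convergence shows that the series over (k, l) converges unconditionally to it. -/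
theorem exists_bilinearSum {p q : ℝ≥0∞} (hpq : Admissible p q) :
    ∃ C : ℝ≥0∞, C ≠ ∞ ∧ ∀ G H : ℤ → Plane → ℂ, (∀ k, Spec k (G k)) → (∀ l, Spec l (H l)) →
      seqNorm (crit p) p q G ≠ ∞ → seqNorm (crit p) p q H ≠ ∞ →
      ∃ N, D.BilinearSum G H N ∧ D.besovNorm (crit p) p q N ≤
        C * (seqNorm (crit p) p q G * seqNorm (crit p) p q H) := by
  obtain ⟨C, hC, h⟩ := D.exists_eLpNorm_tsum_wt_piece_le hpq
  obtain ⟨C₂, hC₂, h₂⟩ := D.exists_distribution_tsum_of_wt (ι := ℤ × ℤ) (q := q) hpq.one_le hpq.ne_top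
    hpq.one_le_right
  refine ⟨C₂ * C, by finiteness, fun G H hG hH hGn hHn ↦ ?_⟩
  obtain ⟨u, hu, hb⟩ := h₂ (fun i j ↦ D.piece i.1 i.2 (G i.1) (H i.2) j)
    (fun i j ↦ (hG _).1.spec_piece D (hH _).1 _ _ _) _
    (ENNReal.mul_ne_top hC (ENNReal.mul_ne_top hGn hHn)) (h G H hG hH)
  refine ⟨Submodule.Quotient.mk u, fun ψ ↦ ?_, by rwa [mul_assoc]⟩
  exact hb ψ _ fun i ↦ hasSum_integral_piece D (hG i.1) (hH i.2) ψ.2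

end DyadicPartition

/-! ### The inverse Laplacian -/

theorem lineDeriv_reflect (Φ : 𝓢(Plane, ℂ)) (x m : Plane) :
    ∂_{m} (reflect Φ x) = -reflect (∂_{m} Φ) x := by
  ext y
  rw [_root_.neg_apply, reflect_apply, SchwartzMap.lineDerivOp_apply_eq_fderiv,
    SchwartzMap.lineDerivOp_apply_eq_fderiv]
  have e : (reflect Φ x : Plane → ℂ) = fun y ↦ Φ (x - y) := funext fun y ↦ reflect_apply Φ x y
  have h := (Φ.differentiableAt (x := x - y)).hasFDerivAt.comp y ((hasFDerivAt_id y).const_sub x)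
  have h' : fderiv ℝ (fun y ↦ Φ (x - y)) y = _ := h.fderiv
  rw [e, h']
  simp

theorem laplacian_reflect (Φ : 𝓢(Plane, ℂ)) (x : Plane) :
    Δ (reflect Φ x) = reflect (Δ Φ) x := by
  rw [SchwartzMap.laplacian_eq_sum (EuclideanSpace.basisFun (Fin 2) ℝ),
    SchwartzMap.laplacian_eq_sum (EuclideanSpace.basisFun (Fin 2) ℝ)]
  ext y
  rw [reflect_apply, FunLike.coe_sum, Finset.sum_apply, FunLike.coe_sum, Finset.sum_apply]
  refine Finset.sum_congr rfl fun i _ ↦ ?_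
  have e : ∀ ψ : 𝓢(Plane, ℂ), ∂_{(EuclideanSpace.basisFun (Fin 2) ℝ) i} (-ψ) =
      -∂_{(EuclideanSpace.basisFun (Fin 2) ℝ) i} ψ := fun ψ ↦
    map_neg (LineDeriv.lineDerivOpCLM ℂ 𝓢(Plane, ℂ) ((EuclideanSpace.basisFun (Fin 2) ℝ) i)) ψ
  rw [lineDeriv_reflect, e, lineDeriv_reflect, neg_neg, reflect_apply]

theorem ucv_laplacian (u : 𝓢'(Plane, ℂ)) (Φ : 𝓢(Plane, ℂ)) : ucv (Δ u) Φ = ucv u (Δ Φ) := by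
  ext x
  rw [ucv, ucv, ← laplacian_reflect]
  exact TemperedDistribution.laplacian_apply_apply u _

theorem ucv_add (u : 𝓢'(Plane, ℂ)) (Φ Ψ : 𝓢(Plane, ℂ)) (x : Plane) :
    ucv u (Φ + Ψ) x = ucv u Φ x + ucv u Ψ x := by
  have : reflect (Φ + Ψ) x = reflect Φ x + reflect Ψ x := by
    ext y
    simp [reflect_apply]
  rw [ucv, this, map_add]
  rfl

theorem ucv_zero (u : 𝓢'(Plane, ℂ)) (x : Plane) : ucv u 0 x = 0 := by
  have : reflect 0 x = 0 := by
    ext y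
    simp [reflect_apply]
  rw [ucv, this, map_zero]

theorem ucv_sum {ι : Type*} (u : 𝓢'(Plane, ℂ)) (s : Finset ι) (Φ : ι → 𝓢(Plane, ℂ)) (x : Plane) :
    ucv u (∑ i ∈ s, Φ i) x = ∑ i ∈ s, ucv u (Φ i) x := by
  induction s using Finset.cons_induction with
  | empty => simp [ucv_zero]
  | cons a s ha ih => rw [Finset.sum_cons, Finset.sum_cons, ucv_add, ih]

theorem ucv_neg (u : 𝓢'(Plane, ℂ)) (Φ : 𝓢(Plane, ℂ)) (x : Plane) : ucv u (-Φ) x = -ucv u Φ x := by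
  rw [eq_neg_iff_add_eq_zero, ← ucv_add, neg_add_cancel, ucv_zero]

namespace DyadicPartition

variable (D : DyadicPartition)

theorem block_negLaplacian (u : 𝓢'(Plane, ℂ)) (j : ℤ) :
    D.block j (negLaplacian (Submodule.Quotient.mk u)) = ucv u (-Δ (D.φ j)) := by
  ext x
  have e : negLaplacian (Submodule.Quotient.mk u) = Submodule.Quotient.mk (-Δ u) := by
    rw [negLaplacian, Submodule.mapQ_apply]
    simp
  rw [e, block_mk, ucv_neg, ← ucv_laplacian]
  rfl

/-- The symbol `|ζ|⁻²`. -/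
def invSq : HomSymbol := HomSymbol.normInv * HomSymbol.normInv

theorem invSq_apply (ζ : Plane) : invSq ζ = ((‖ζ‖⁻¹ * ‖ζ‖⁻¹ : ℝ) : ℂ) := by
  simp [invSq, HomSymbol.mul_apply, HomSymbol.normInv]

theorem fourier_neg_laplacian (Φ : 𝓢(Plane, ℂ)) (ξ : Plane) :
    𝓕 (-Δ Φ) ξ = (((2 * Real.pi * ‖ξ‖) ^ 2 : ℝ) : ℂ) * 𝓕 Φ ξ := by
  have e : 𝓕 (-Δ Φ) = -𝓕 (Δ Φ) := map_neg (FourierTransform.fourierCLM ℂ 𝓢(Plane, ℂ)) _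
  rw [e, _root_.neg_apply, fourier_laplacian]
  ring

theorem sq_mul_invSq {ξ : Plane} (hξ : ξ ≠ 0) :
    (((2 * Real.pi * ‖ξ‖) ^ 2 : ℝ) : ℂ) * invSq ((2 * Real.pi) • ξ) = 1 := by
  have h : 2 * Real.pi * ‖ξ‖ ≠ 0 := mul_ne_zero (by positivity) (norm_ne_zero_iff.2 hξ)
  rw [invSq_apply, norm_two_pi_smul, ← Complex.ofReal_mul]
  norm_cast
  field_simp

theorem fourier_wide_one_mul_phi (j : ℤ) (ξ : Plane) :
    𝓕 (D.wide 1 j) ξ * 𝓕 (D.φ j) ξ = 𝓕 (D.φ j) ξ := by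
  by_cases h : 𝓕 (D.φ j) ξ = 0
  · rw [h, mul_zero]
  · rw [D.fourier_wide_eq_one le_rfl (D.fourier_phi_support h), one_mul]

theorem sconv_wide_phi (j : ℤ) : sconv (D.wide 1 j) (D.φ j) = D.φ j :=
  schwartz_ext_fourier fun ξ ↦ by rw [fourier_sconv, fourier_wide_one_mul_phi]

theorem sconv_negLaplacian_invSq (i j : ℤ) :
    sconv (-Δ (D.φ i)) (sconv (D.kern invSq 1 j) (D.φ j)) = sconv (D.φ i) (D.φ j) :=
  schwartz_ext_fourier fun ξ ↦ by
    rw [fourier_sconv, fourier_sconv, fourier_sconv, fourier_neg_laplacian, fourier_kern,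
      mul_assoc (invSq _), fourier_wide_one_mul_phi]
    by_cases h : 𝓕 (D.φ j) ξ = 0
    · simp [h]
    · have := sq_mul_invSq (ne_zero_of_mem_annulus (D.fourier_phi_support h))
      linear_combination 𝓕 (D.φ i) ξ * 𝓕 (D.φ j) ξ * this

theorem sconv_phi_phi_eq_zero {i j : ℤ} (h : 1 < |i - j|) : sconv (D.φ i) (D.φ j) = 0 := by
  refine schwartz_ext_fourier fun ξ ↦ ?_
  rw [fourier_sconv, FourierTransform.fourier_zero, _root_.zero_apply, mul_eq_zero]
  by_contra! hne
  obtain ⟨h1, h2⟩ := D.fourier_phi_support_lt hne.1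
  obtain ⟨h3, h4⟩ := D.fourier_phi_support_lt hne.2
  have h5 := (zpow_lt_zpow_iff_right₀ one_lt_two).1 (h1.trans h4)
  have h6 := (zpow_lt_zpow_iff_right₀ one_lt_two).1 (h3.trans h2)
  rw [lt_abs] at h
  omega

theorem sum_sconv_phi (i : ℤ) :
    ∑ j ∈ Finset.Icc (i - 1) (i + 1), sconv (D.φ i) (D.φ j) = D.φ i := by
  refine schwartz_ext_fourier fun ξ ↦ ?_
  have e : 𝓕 (∑ j ∈ Finset.Icc (i - 1) (i + 1), sconv (D.φ i) (D.φ j)) =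
      ∑ j ∈ Finset.Icc (i - 1) (i + 1), 𝓕 (sconv (D.φ i) (D.φ j)) :=
    map_sum (FourierTransform.fourierCLM ℂ 𝓢(Plane, ℂ)) _ _
  rw [e, FunLike.coe_sum, Finset.sum_apply]
  simp only [fourier_sconv]
  rw [← Finset.mul_sum]
  have := D.fourier_wide_one_mul_phi i ξ
  rw [fourier_wide, mul_comm] at this
  exact_mod_cast this

/-- The blocks of `L` are determined by those of `-Δ L`. -/
theorem block_eq_cv_negLaplacian (L : DistModPoly) (j : ℤ) :
    D.block j L = cv (D.kern invSq 1 j) (D.block j (negLaplacian L)) := by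
  obtain ⟨u, rfl⟩ := Submodule.Quotient.mk_surjective _ L
  ext x
  rw [block_negLaplacian, cv_ucv, block_mk]
  congr 1
  refine schwartz_ext_fourier fun ξ ↦ ?_
  rw [fourier_sconv, fourier_neg_laplacian, fourier_kern]
  by_cases h : 𝓕 (D.φ j) ξ = 0
  · simp [h]
  · have hm := D.fourier_phi_support h
    have := sq_mul_invSq (ne_zero_of_mem_annulus hm)
    rw [D.fourier_wide_eq_one le_rfl hm]
    linear_combination -𝓕 (D.φ j) ξ * this

theorem negLaplacian_injective (D : DyadicPartition) : Function.Injective negLaplacian := fun L L' h ↦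
  D.ext_block fun j x ↦ by
    rw [D.block_eq_cv_negLaplacian L, h, ← D.block_eq_cv_negLaplacian L']

/-- The blocks of an element of a Besov space are bounded functions. -/
theorem spec_block {p : ℝ≥0∞} (hp : 1 ≤ p) (hp' : p ≠ ∞) {F : DistModPoly} {j : ℤ}
    (h : eLpNorm (D.block j F) p volume ≠ ∞) : Spec j (D.block j F) := by
  obtain ⟨u, rfl⟩ := Submodule.Quotient.mk_surjective _ F
  rw [block_mk] at h ⊢
  refine spec_ucv (fun ξ ↦ D.fourier_phi_support) ?_
  -- Boundedness is not yet known here, so Bernstein is used in the form that asks only for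
  -- continuity; it applies because the block is reproduced by convolution with `wide 1`.
  obtain ⟨C, hC, hb⟩ := D.exists_enorm_cv_kern_le_eLpNorm (HomSymbol.const 1) 1 hp hp'
  have hfin : C * dy ((HomSymbol.const 1).deg * j + 2 / p.toReal * j) *
      eLpNorm (ucv u (D.φ j)) p volume ≠ ∞ :=
    ENNReal.mul_ne_top (ENNReal.mul_ne_top hC (dy_ne_top _)) h
  have e : D.kern (HomSymbol.const 1) 1 j = D.wide 1 j := schwartz_ext_fourier fun ξ ↦ by
    rw [fourier_kern]
    simp [HomSymbol.const]
  refine ⟨(C * dy ((HomSymbol.const 1).deg * j + 2 / p.toReal * j) *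
    eLpNorm (ucv u (D.φ j)) p volume).toReal, fun x ↦ ?_⟩
  have h1 := hb j _ (continuous_ucv u (D.φ j)) x
  rw [e, cv_ucv, sconv_wide_phi] at h1
  have := ENNReal.toReal_mono hfin h1
  rwa [toReal_enorm] at this

theorem eLpNorm_block_ne_top {s : ℝ} {p q : ℝ≥0∞} (hq : 1 ≤ q) {F : DistModPoly}
    (h : D.besovNorm s p q F ≠ ∞) (j : ℤ) : eLpNorm (D.block j F) p volume ≠ ∞ := by
  rw [eLpNorm_eq_wt s]
  refine ENNReal.mul_ne_top (dy_ne_top _) (ne_top_of_le_ne_top h ?_)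
  rw [besovNorm_eq]
  exact le_eLpNorm_count (fun j ↦ wt s p j (D.block j F)) (zero_lt_one.trans_le hq).ne' j

theorem spec_block_of_besovNorm {s : ℝ} {p q : ℝ≥0∞} (hp : 1 ≤ p) (hp' : p ≠ ∞) (hq : 1 ≤ q)
    {F : DistModPoly} (h : D.besovNorm s p q F ≠ ∞) (j : ℤ) : Spec j (D.block j F) :=
  D.spec_block hp hp' (D.eLpNorm_block_ne_top hq h j)

/-- The kernel of |ζ|⁻² is applied to each block of F; the results have size O(2^j) and sum to a
distribution u. That -Δu equals F is verified on blocks, where only neighbouring indices contribute.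
-/
theorem exists_isInvLaplacian {p q : ℝ≥0∞} (hp : 1 ≤ p) (hp' : p ≠ ∞) (hq : 1 ≤ q) :
    ∃ C : ℝ≥0∞, C ≠ ∞ ∧ ∀ F, D.besovNorm (crit p - 2) p q F ≠ ∞ → ∃ L, IsInvLaplacian F L ∧
      D.besovNorm (crit p) p q L ≤ C * D.besovNorm (crit p - 2) p q F := by
  obtain ⟨C₁, hC₁, h₁⟩ := D.exists_eLpNorm_cv_kern_le invSq 1
  obtain ⟨C₂, hC₂, h₂⟩ := D.exists_enorm_le_of_spec hp hp'
  have hdeg : invSq.deg = -2 := rfl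
  refine ⟨C₁, hC₁, fun F hF ↦ ?_⟩
  have hspec := D.spec_block_of_besovNorm hp hp' hq hF
  set s := crit p
  have hwt : ∀ j, wt s p j (cv (D.kern invSq 1 j) (D.block j F)) ≤
      C₁ * wt (s - 2) p j (D.block j F) := by
    intro j
    have h := h₁ j _ (hspec j).1.1 p hp hp'
    rw [hdeg] at h
    calc _ ≤ dy (s * j) * (C₁ * dy (((-2 : ℤ) : ℝ) * j) * eLpNorm (D.block j F) p volume) := by
          rw [wt]
          gcongr
      _ = C₁ * (dy (s * j + ((-2 : ℤ) : ℝ) * j) * eLpNorm (D.block j F) p volume) := by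
          rw [dy_add]
          ring
      _ = _ := by
          rw [wt]
          congr 3
          push_cast
          ring
  have hg : ∀ j, Spec j (cv (D.kern invSq 1 j) (D.block j F)) := fun j ↦
    ⟨(hspec j).1.cv (D.kern invSq 1 j).integrable, fun L hL x ↦ by
      rw [cv_cv _ _ (hspec j).1]
      refine (hspec j).2 _ (fun ξ hξ ↦ ?_) x
      rw [fourier_sconv, hL ξ hξ, zero_mul]⟩
  set S := D.besovNorm (s - 2) p q F with hSdef
  have hfin : C₂ * (C₁ * S) ≠ ∞ := by finiteness
  have hM : ∀ j x, ‖cv (D.kern invSq 1 j) (D.block j F) x‖ ≤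
      (C₂ * (C₁ * S)).toReal * (2 : ℝ) ^ j := by
    intro j x
    have hS : wt (s - 2) p j (D.block j F) ≤ S := by
      rw [hSdef, besovNorm_eq]
      exact le_eLpNorm_count (fun j ↦ wt (s - 2) p j (D.block j F)) (zero_lt_one.trans_le hq).ne' j
    have h : ‖cv (D.kern invSq 1 j) (D.block j F) x‖ₑ ≤ C₂ * (C₁ * S) * dy j := by
      refine (h₂ j _ (hg j) x).trans ?_
      rw [mul_assoc, mul_comm (dy _), ← mul_assoc]
      gcongr
      exact (hwt j).trans (by gcongr)
    have := ENNReal.toReal_mono (ENNReal.mul_ne_top hfin (dy_ne_top _)) h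
    rwa [toReal_enorm, ENNReal.toReal_mul, ← ofReal_two_rpow,
      ENNReal.toReal_ofReal (by positivity), Real.rpow_intCast] at this
  obtain ⟨u, hu⟩ := D.exists_distribution hg hM
  have hinv : negLaplacian (Submodule.Quotient.mk u) = F := by
    refine D.ext_block fun i x ↦ ?_
    obtain ⟨v, rfl⟩ := Submodule.Quotient.mk_surjective _ F
    rw [block_negLaplacian]
    have h := hu (reflect (-Δ (D.φ i)) x)
    have e : ∀ j, ∫ y, cv (D.kern invSq 1 j) (D.block j (Submodule.Quotient.mk v)) y *
        reflect (-Δ (D.φ i)) x y = ucv v (sconv (D.φ i) (D.φ j)) x := by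
      intro j
      have e1 : cv (D.kern invSq 1 j) (D.block j (Submodule.Quotient.mk v)) =
          ucv v (sconv (D.kern invSq 1 j) (D.φ j)) := by
        ext y
        rw [block_mk, cv_ucv]
      rw [← D.sconv_negLaplacian_invSq, ← cv_ucv, ← e1, cv_eq]
      simp only [reflect_apply, mul_comm]
    simp only [e] at h
    have e2 : ucv v (D.φ i) x =
        ∑ j ∈ Finset.Icc (i - 1) (i + 1), ucv v (sconv (D.φ i) (D.φ j)) x := by
      conv_lhs => rw [← D.sum_sconv_phi i, ucv_sum]
    rw [block_mk, e2]
    refine h.unique (hasSum_sum_of_ne_finset_zero fun j hj ↦ ?_)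
    rw [D.sconv_phi_phi_eq_zero, ucv_zero]
    rw [Finset.mem_Icc] at hj
    rw [lt_abs]
    omega
  refine ⟨Submodule.Quotient.mk u, hinv, ?_⟩
  rw [hSdef, besovNorm_eq, besovNorm_eq]
  refine eLpNorm_count_le_const_mul hC₁ (fun j ↦ ?_) q
  beta_reduce
  rw [block_eq_cv_negLaplacian, hinv]
  exact hwt j

end DyadicPartition

/-! ### Fixed points of quadratic maps -/

/-- B(x,x) - B(y,y) = B(x-y,x) + B(y,x-y) has norm at most 2Cr‖x-y‖ ≤ ‖x-y‖/2, which is absorbed on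
the left. Equal data give uniqueness; y = 0 gives ‖x‖ ≤ 2‖L‖. -/
theorem norm_sub_le_two_mul_of_quadratic {E : Type*} [NormedAddCommGroup E] {B : E → E → E}
    (hl : ∀ x y z, B (x - y) z = B x z - B y z) (hr : ∀ x y z, B x (y - z) = B x y - B x z)
    {C r : ℝ} (hC : 0 ≤ C) (hB : ∀ x y, ‖B x y‖ ≤ C * (‖x‖ * ‖y‖)) (hCr : 4 * C * r ≤ 1)
    {x y L M : E} (hx : ‖x‖ ≤ r) (hy : ‖y‖ ≤ r) (hxL : x = L + B x x) (hyM : y = M + B y y) :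
    ‖x - y‖ ≤ 2 * ‖L - M‖ := by
  have e : x - y = (L - M) + (B (x - y) x + B y (x - y)) := by
    rw [hl, hr]
    calc x - y = (L + B x x) - (M + B y y) := by rw [← hxL, ← hyM]
      _ = _ := by abel
  have h1 : ‖B (x - y) x‖ ≤ C * (‖x - y‖ * r) := (hB _ _).trans (by gcongr)
  have h2 : ‖B y (x - y)‖ ≤ C * (r * ‖x - y‖) := (hB _ _).trans (by gcongr)
  have h3 : ‖x - y‖ ≤ ‖L - M‖ + (C * (‖x - y‖ * r) + C * (r * ‖x - y‖)) := by
    calc ‖x - y‖ = ‖(L - M) + (B (x - y) x + B y (x - y))‖ := by rw [← e]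
      _ ≤ _ := (norm_add_le _ _).trans (by gcongr; exact (norm_add_le _ _).trans (add_le_add h1 h2))
  nlinarith [mul_le_mul_of_nonneg_right hCr (norm_nonneg (x - y))]

/-- Under 4Cr ≤ 1 the map x ↦ L + B(x,x) preserves the ball of radius r and contracts by 1/2 there.
Compatibility of B with differences is all the linearity required. -/
theorem exists_eq_add_quadratic {E : Type*} [NormedAddCommGroup E] [CompleteSpace E]
    {B : E → E → E} (hl : ∀ x y z, B (x - y) z = B x z - B y z)
    (hr : ∀ x y z, B x (y - z) = B x y - B x z) {C r : ℝ} (hC : 0 ≤ C) (hr0 : 0 ≤ r)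
    (hB : ∀ x y, ‖B x y‖ ≤ C * (‖x‖ * ‖y‖)) (hCr : 4 * C * r ≤ 1) {L : E} (hL : ‖L‖ ≤ r / 2) :
    ∃ x, ‖x‖ ≤ r ∧ x = L + B x x := by
  let f : E → E := fun x ↦ L + B x x
  have hmaps : Set.MapsTo f (Metric.closedBall 0 r) (Metric.closedBall 0 r) := by
    intro x hx
    rw [mem_closedBall_zero_iff] at hx ⊢
    calc ‖L + B x x‖ ≤ r / 2 + C * (r * r) :=
          (norm_add_le _ _).trans (add_le_add hL ((hB x x).trans (by gcongr)))
      _ ≤ r := by nlinarith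
  have hlip : ContractingWith (1 / 2) (hmaps.restrict f _ _) := by
    refine ⟨by rw [← NNReal.coe_lt_coe]; norm_num, LipschitzWith.of_dist_le_mul fun x y ↦ ?_⟩
    have hx := mem_closedBall_zero_iff.1 x.2
    have hy := mem_closedBall_zero_iff.1 y.2
    rw [Subtype.dist_eq, Subtype.dist_eq, Set.MapsTo.val_restrict_apply,
      Set.MapsTo.val_restrict_apply, dist_eq_norm, dist_eq_norm]
    have e : f x - f y = B (x - y) x + B y (x - y) := by
      simp only [f, hl, hr]
      abel
    rw [e]
    have h1 : ‖B (x - y : E) x‖ ≤ C * (‖(x - y : E)‖ * r) := (hB _ _).trans (by gcongr)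
    have h2 : ‖B (y : E) (x - y)‖ ≤ C * (r * ‖(x - y : E)‖) := (hB _ _).trans (by gcongr)
    refine (norm_add_le _ _).trans ?_
    push_cast
    nlinarith [mul_le_mul_of_nonneg_right hCr (norm_nonneg (x - y : E))]
  obtain ⟨x, hx, hfix, -⟩ := hlip.exists_fixedPoint' Metric.isClosed_closedBall.isComplete hmaps
    (Metric.mem_closedBall_self hr0) (edist_ne_top _ _)
  exact ⟨x, mem_closedBall_zero_iff.1 hx, hfix.symm⟩

namespace DyadicPartition

variable (D : DyadicPartition)

theorem ext_pair (D : DyadicPartition) {F G : DistModPoly} (h : ∀ ψ, pair ψ F = pair ψ G) :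
    F = G := D.ext_block fun _ _ ↦ h _

theorem continuous_block (j : ℤ) (F : DistModPoly) : Continuous (D.block j F) := by
  obtain ⟨u, rfl⟩ := Submodule.Quotient.mk_surjective _ F
  rw [block_mk]
  exact continuous_ucv u _

theorem block_add (j : ℤ) (F G : DistModPoly) : D.block j (F + G) = D.block j F + D.block j G := by
  ext x
  exact map_add _ F G

theorem block_neg (j : ℤ) (F : DistModPoly) : D.block j (-F) = -D.block j F := by
  ext x
  exact map_neg _ F

theorem block_sub (j : ℤ) (F G : DistModPoly) : D.block j (F - G) = D.block j F - D.block j G := by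
  ext x
  exact map_sub _ F G

theorem block_zero (j : ℤ) : D.block j 0 = 0 := by
  ext x
  exact map_zero _

section

variable {s : ℝ} {p q : ℝ≥0∞}

theorem besovNorm_zero : D.besovNorm s p q 0 = 0 := by
  simp [besovNorm_eq, seqNorm, wt, block_zero]

theorem besovNorm_neg (F : DistModPoly) : D.besovNorm s p q (-F) = D.besovNorm s p q F := by
  simp [besovNorm_eq, seqNorm, wt, block_neg]

theorem besovNorm_add_le (hp : 1 ≤ p) (hq : 1 ≤ q) (F G : DistModPoly) :
    D.besovNorm s p q (F + G) ≤ D.besovNorm s p q F + D.besovNorm s p q G := by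
  simp only [besovNorm_eq, seqNorm]
  refine le_trans (eLpNorm_mono_enorm (g := (fun j ↦ wt s p j (D.block j F)) +
    fun j ↦ wt s p j (D.block j G)) fun j ↦ ?_)
    (eLpNorm_add_le (measurable_of_countable _).aestronglyMeasurable
      (measurable_of_countable _).aestronglyMeasurable hq)
  simp only [enorm_eq_self, Pi.add_apply, wt]
  rw [block_add, ← mul_add]
  gcongr
  exact eLpNorm_add_le (D.continuous_block j F).aestronglyMeasurable
    (D.continuous_block j G).aestronglyMeasurable hp

theorem eq_zero_of_besovNorm_eq_zero (hp : p ≠ 0) (hq : q ≠ 0) {F : DistModPoly}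
    (h : D.besovNorm s p q F = 0) : F = 0 := by
  refine D.ext_block fun j x ↦ ?_
  have h1 : wt s p j (D.block j F) = 0 := by
    have := le_eLpNorm_count (fun j ↦ wt s p j (D.block j F)) hq j
    rw [besovNorm_eq, seqNorm] at h
    rw [h] at this
    exact le_antisymm this zero_le
  have h2 : eLpNorm (D.block j F) p volume = 0 := by
    rw [eLpNorm_eq_wt s, h1, mul_zero]
  rw [eLpNorm_eq_zero_iff (D.continuous_block j F).aestronglyMeasurable hp] at h2
  have h3 := ((D.continuous_block j F).ae_eq_iff_eq volume continuous_zero).1 h2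
  rw [h3, block_zero]

end

/-! ### The critical Besov space as a Banach space. -/

section Complete

variable {p q : ℝ≥0∞}

/-- The Littlewood-Paley decomposition. -/
theorem exists_mk_eq_hasSum (h : Admissible p q) {F : DistModPoly}
    (hF : D.besovNorm (crit p) p q F ≠ ∞) :
    ∃ u : 𝓢'(Plane, ℂ), Submodule.Quotient.mk u = F ∧
      ∀ ψ, HasSum (fun j ↦ ∫ x, D.block j F x * ψ x) (u ψ) := by
  obtain ⟨C, hC, hb⟩ := D.exists_enorm_le_of_spec h.one_le h.ne_top
  have hspec := D.spec_block_of_besovNorm h.one_le h.ne_top h.one_le_right hF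
  have hM : ∀ j x, ‖D.block j F x‖ ≤ (C * D.besovNorm (crit p) p q F).toReal * (2 : ℝ) ^ j := by
    intro j x
    have h1 : ‖D.block j F x‖ₑ ≤ C * D.besovNorm (crit p) p q F * dy j := by
      refine (hb j _ (hspec j) x).trans ?_
      rw [mul_assoc, mul_comm (dy _), ← mul_assoc, besovNorm_eq]
      gcongr
      exact le_eLpNorm_count (fun j ↦ wt (crit p) p j (D.block j F))
        (zero_lt_one.trans_le h.one_le_right).ne' j
    have := ENNReal.toReal_mono
      (ENNReal.mul_ne_top (ENNReal.mul_ne_top hC hF) (dy_ne_top _)) h1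
    rwa [toReal_enorm, ENNReal.toReal_mul, ← ofReal_two_rpow,
      ENNReal.toReal_ofReal (by positivity), Real.rpow_intCast] at this
  obtain ⟨u, hu⟩ := D.exists_distribution hspec hM
  refine ⟨u, D.ext_block fun i x ↦ ?_, hu⟩
  · rw [D.block_eq_sum_cv hspec hu]
    obtain ⟨v, rfl⟩ := Submodule.Quotient.mk_surjective _ F
    have e2 : ucv v (D.φ i) x =
        ∑ j ∈ Finset.Icc (i - 1) (i + 1), ucv v (sconv (D.φ i) (D.φ j)) x := by
      conv_lhs => rw [← D.sum_sconv_phi i, ucv_sum]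
    simp only [block_mk, e2, cv_ucv]

theorem hasSum_integral_block (h : Admissible p q) {F : DistModPoly}
    (hF : D.besovNorm (crit p) p q F ≠ ∞) (ψ : zeroMoments) :
    HasSum (fun j ↦ ∫ x, D.block j F x * (ψ : 𝓢(Plane, ℂ)) x) (pair ψ F) := by
  obtain ⟨u, hu, hs⟩ := D.exists_mk_eq_hasSum h hF
  simpa only [hu] using (show HasSum _ (pair ψ (Submodule.Quotient.mk u)) from hs ψ)

/-- The blocks of all f n form an absolutely convergent double series, so the sum exists as a
distribution. This is completeness in terms of series. -/
theorem exists_hasSum_pair (h : Admissible p q) :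
    ∃ C : ℝ≥0∞, C ≠ ∞ ∧ ∀ f : ℕ → DistModPoly, ∑' n, D.besovNorm (crit p) p q (f n) ≠ ∞ →
      ∃ F, D.besovNorm (crit p) p q F ≤ C * ∑' n, D.besovNorm (crit p) p q (f n) ∧
        ∀ ψ, HasSum (fun n ↦ pair ψ (f n)) (pair ψ F) := by
  obtain ⟨C, hC, hb⟩ := D.exists_distribution_tsum_of_wt (ι := ℕ) (q := q) h.one_le h.ne_top
    h.one_le_right
  refine ⟨C, hC, fun f hf ↦ ?_⟩
  have hfn : ∀ n, D.besovNorm (crit p) p q (f n) ≠ ∞ := fun n ↦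
    ne_top_of_le_ne_top hf (ENNReal.le_tsum (f := fun n ↦ D.besovNorm (crit p) p q (f n)) n)
  obtain ⟨u, hu, hs⟩ := hb (fun n j ↦ D.block j (f n))
    (fun n j ↦ D.spec_block_of_besovNorm h.one_le h.ne_top h.one_le_right (hfn n) j) _ hf (by
      simp only [besovNorm_eq]
      exact eLpNorm_count_tsum_le h.one_le_right fun n j ↦ wt (crit p) p j (D.block j (f n)))
  exact ⟨Submodule.Quotient.mk u, hu, fun ψ ↦ hs ψ _ fun n ↦ D.hasSum_integral_block h (hfn n) ψ⟩

/-- The critical Besov space. -/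
def besovGroup (h : Admissible p q) : AddSubgroup DistModPoly where
  carrier := {F | D.besovNorm (crit p) p q F ≠ ∞}
  zero_mem' := by simp [besovNorm_zero]
  add_mem' {F G} hF hG := ne_top_of_le_ne_top (ENNReal.add_ne_top.2 ⟨hF, hG⟩)
    (D.besovNorm_add_le h.one_le h.one_le_right F G)
  neg_mem' {F} hF := by simpa [besovNorm_neg] using hF

instance (h : Admissible p q) : NormedAddCommGroup (D.besovGroup h) :=
  AddGroupNorm.toNormedAddCommGroup
    { toFun := fun F ↦ (D.besovNorm (crit p) p q F).toReal
      map_zero' := by simp [besovNorm_zero]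
      add_le' := fun F G ↦ by
        rw [← ENNReal.toReal_add F.2 G.2]
        exact ENNReal.toReal_mono (ENNReal.add_ne_top.2 ⟨F.2, G.2⟩)
          (D.besovNorm_add_le h.one_le h.one_le_right F G)
      neg' := fun F ↦ by simp [besovNorm_neg]
      eq_zero_of_map_eq_zero' := fun F hF ↦ by
        rw [ENNReal.toReal_eq_zero_iff] at hF
        exact Subtype.ext (D.eq_zero_of_besovNorm_eq_zero (zero_lt_one.trans_le h.one_le).ne'
          (zero_lt_one.trans_le h.one_le_right).ne' (hF.resolve_right F.2)) }

theorem norm_besovGroup (h : Admissible p q) (F : D.besovGroup h) :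
    ‖F‖ = (D.besovNorm (crit p) p q F).toReal := rfl

theorem besovNorm_eq_ofReal (h : Admissible p q) (F : D.besovGroup h) :
    D.besovNorm (crit p) p q F = ENNReal.ofReal ‖F‖ := by
  rw [norm_besovGroup, ENNReal.ofReal_toReal F.2]

instance (h : Admissible p q) : CompleteSpace (D.besovGroup h) := by
  refine NormedAddCommGroup.completeSpace_of_summable_imp_tendsto fun f hf ↦ ?_
  obtain ⟨C, hC, hs⟩ := D.exists_hasSum_pair h
  have hfin : ∀ N, ∑' n, D.besovNorm (crit p) p q (f (n + N)) = ENNReal.ofReal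
      (∑' n, ‖f (n + N)‖) := by
    intro N
    simp only [besovNorm_eq_ofReal]
    exact (ENNReal.ofReal_tsum_of_nonneg (fun n ↦ norm_nonneg _)
      ((summable_nat_add_iff N).2 hf)).symm
  choose F hF hpair using fun N ↦ hs (fun n ↦ (f (n + N) : DistModPoly))
    (by rw [hfin]; exact ENNReal.ofReal_ne_top)
  have hFE : ∀ N, D.besovNorm (crit p) p q (F N) ≠ ∞ := fun N ↦
    ne_top_of_le_ne_top (ENNReal.mul_ne_top hC (by rw [hfin]; exact ENNReal.ofReal_ne_top)) (hF N)
  refine ⟨⟨F 0, hFE 0⟩, ?_⟩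
  -- The sum of the series from index N is the remainder after N terms, and its norm is bounded by C
  -- times the tail of the norms.
  have hdiff : ∀ N, (⟨F N, hFE N⟩ : D.besovGroup h) = ⟨F 0, hFE 0⟩ - ∑ n ∈ Finset.range N, f n := by
    intro N
    refine Subtype.ext (D.ext_pair fun ψ ↦ ?_)
    have h0 := (hasSum_nat_add_iff' N).2 (hpair 0 ψ)
    simp only [add_zero] at h0
    rw [(hpair N ψ).unique h0]
    simp
  rw [tendsto_iff_norm_sub_tendsto_zero]
  have hlim : Filter.Tendsto (fun N ↦ C.toReal * ∑' n, ‖f (n + N)‖) Filter.atTop (nhds 0) := by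
    simpa using (tendsto_sum_nat_add fun n ↦ ‖f n‖).const_mul C.toReal
  refine squeeze_zero (fun N ↦ norm_nonneg _) (fun N ↦ ?_) hlim
  rw [norm_sub_rev, ← hdiff, norm_besovGroup]
  have := ENNReal.toReal_mono (ENNReal.mul_ne_top hC (by rw [hfin]; exact ENNReal.ofReal_ne_top))
    (hF N)
  rwa [ENNReal.toReal_mul, hfin, ENNReal.toReal_ofReal (tsum_nonneg fun n ↦ norm_nonneg _)] at this

end Complete

end DyadicPartition

/-! ### Algebra of the bilinear form -/

theorem riesz_eq_riesz (D D' : DyadicPartition) {k m : ℤ} {G : Plane → ℂ} (hk : Spec k G)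
    (hm : Spec m G) (h : |m - k| < 7) (b : Fin 2) : D.riesz k b G = D'.riesz m b G := by
  rw [D'.riesz_eq_cv_oddKern (k := m) (by simp) hm b]
  exact hk.cv_congr fun ξ hξ ↦ by
    rw [D.fourier_kern_eq _ le_rfl hξ, D'.fourier_oddKern (DyadicPartition.annulus_one_subset h hξ)]

section

variable (D D' : DyadicPartition) {k l m n : ℤ} {G G' H : Plane → ℂ} {ψ : 𝓢(Plane, ℂ)}

/-- In physical space the cutoffs enter only through the operators P_b on G and H, and any cutoff
equal to 1 on the frequency supports gives the same result. -/
theorem bilinearMultiplier_congr (hk : Spec k G) (hm : Spec m G) (hl : Spec l H) (hn : Spec n H)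
    (hkm : |m - k| < 7) (hln : |n - l| < 7) (hψ : ψ ∈ zeroMoments) :
    bilinearMultiplier symbolB (D.cutoff k) (D.cutoff l) G H ψ =
      bilinearMultiplier symbolB (D'.cutoff m) (D'.cutoff n) G H ψ := by
  choose v hv hvF hvM using exists_fourier_eq_W_mul D (reflect_zero_mem hψ)
  rw [bilinearMultiplier_symbolB_eq D hk hl ψ hv hvF, bilinearMultiplier_symbolB_eq D' hm hn ψ hv hvF]
  simp only [DyadicPartition.rieszProd, riesz_eq_riesz D D' hk hm hkm, riesz_eq_riesz D D' hl hn hln]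

theorem bilinearMultiplier_comm (hG : Spec k G) (hH : Spec l H) (hψ : ψ ∈ zeroMoments) :
    bilinearMultiplier symbolB (D.cutoff k) (D.cutoff l) G H ψ =
      bilinearMultiplier symbolB (D.cutoff l) (D.cutoff k) H G ψ := by
  choose v hv hvF hvM using exists_fourier_eq_W_mul D (reflect_zero_mem hψ)
  rw [bilinearMultiplier_symbolB_eq D hG hH ψ hv hvF, bilinearMultiplier_symbolB_eq D hH hG ψ hv hvF]
  congr! 5 with b _ x
  simp only [DyadicPartition.rieszProd]
  ring

theorem bilinearMultiplier_add_left (hG : Spec k G) (hG' : Spec k G') (hH : Spec l H)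
    (hψ : ψ ∈ zeroMoments) :
    bilinearMultiplier symbolB (D.cutoff k) (D.cutoff l) (fun x ↦ G x + G' x) H ψ =
      bilinearMultiplier symbolB (D.cutoff k) (D.cutoff l) G H ψ +
        bilinearMultiplier symbolB (D.cutoff k) (D.cutoff l) G' H ψ := by
  choose v hv hvF hvM using exists_fourier_eq_W_mul D (reflect_zero_mem hψ)
  rw [bilinearMultiplier_symbolB_eq D hG hH ψ hv hvF, bilinearMultiplier_symbolB_eq D hG' hH ψ hv hvF,
    bilinearMultiplier_symbolB_eq D (hG.add hG') hH ψ hv hvF, ← mul_add, ← Finset.sum_add_distrib]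
  congr 2 with b
  rw [← integral_add ((hG.1.rieszProd D hH.1 k l b).integrable_mul (hv b).comp_neg)
    ((hG'.1.rieszProd D hH.1 k l b).integrable_mul (hv b).comp_neg)]
  congr 1 with x
  rw [← mul_add]
  congr 1
  simp only [DyadicPartition.rieszProd, DyadicPartition.riesz,
    cv_add_right (D.kern _ 1 k).integrable hG.1 hG'.1]
  ring

end

namespace DyadicPartition

namespace BilinearSum

variable {D : DyadicPartition} {G G' H : ℤ → Plane → ℂ} {N N' : DistModPoly}

theorem unique (h : D.BilinearSum G H N) (h' : D.BilinearSum G H N') : N = N' :=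
  D.ext_pair fun ψ ↦ (h ψ).unique (h' ψ)

theorem comm (hG : ∀ k, Spec k (G k)) (hH : ∀ k, Spec k (H k)) (h : D.BilinearSum G H N) :
    D.BilinearSum H G N := fun ψ ↦ by
  exact ((Equiv.prodComm ℤ ℤ).hasSum_iff.2 (h ψ)).congr_fun fun i ↦
    bilinearMultiplier_comm D (hH _) (hG _) ψ.2

theorem add_left (hG : ∀ k, Spec k (G k)) (hG' : ∀ k, Spec k (G' k)) (hH : ∀ k, Spec k (H k))
    (h : D.BilinearSum G H N) (h' : D.BilinearSum G' H N') :
    D.BilinearSum (fun k x ↦ G k x + G' k x) H (N + N') := fun ψ ↦ by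
  rw [map_add]
  exact ((h ψ).add (h' ψ)).congr_fun fun i ↦
    bilinearMultiplier_add_left D (hG _) (hG' _) (hH _) ψ.2

theorem zero_left : D.BilinearSum (fun _ _ ↦ 0) H 0 := fun ψ ↦ by
  rw [map_zero]
  exact hasSum_zero.congr_fun fun i ↦ by simp [bilinearMultiplier]

theorem sum_left {ι : Type*} (s : Finset ι) {G : ι → ℤ → Plane → ℂ} {N : ι → DistModPoly}
    (hG : ∀ i k, Spec k (G i k)) (hH : ∀ k, Spec k (H k)) (h : ∀ i, D.BilinearSum (G i) H (N i)) :
    D.BilinearSum (fun k x ↦ ∑ i ∈ s, G i k x) H (∑ i ∈ s, N i) := by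
  induction s using Finset.cons_induction with
  | empty => simpa using zero_left
  | cons a s ha ih =>
    simp only [Finset.sum_cons]
    exact add_left (hG a) (fun k ↦ Spec.sum s fun i _ ↦ hG i k) hH (h a) ih

theorem change (D' : DyadicPartition) (hG : ∀ k, Spec k (G k)) (hH : ∀ k, Spec k (H k))
    (h : D.BilinearSum G H N) : D'.BilinearSum G H N := fun ψ ↦
  (h ψ).congr_fun fun i ↦ bilinearMultiplier_congr D' D (hG _) (hG _) (hH _) (hH _) (by simp)
    (by simp) ψ.2

/-- Reindexing an unconditional sum; the cutoff attached to the old index may be exchanged for that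
of the new one because the function satisfies both localisations. -/
theorem shift_left {d : ℤ} (hd : |d| < 7) (hG : ∀ k, Spec k (G k)) (hG' : ∀ k, Spec k (G' k))
    (hH : ∀ k, Spec k (H k)) (e : ∀ k, G k = G' (k + d)) (h : D.BilinearSum G H N) :
    D.BilinearSum G' H N := fun ψ ↦ by
  rw [← (Equiv.prodCongr (Equiv.addRight d) (Equiv.refl ℤ)).hasSum_iff]
  refine (h ψ).congr_fun fun i ↦ ?_
  have h1 := hG i.1
  rw [e] at h1
  simp only [Function.comp_apply, Equiv.prodCongr_apply, Prod.map_fst, Prod.map_snd,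
    Equiv.coe_addRight, Equiv.refl_apply, e]
  exact bilinearMultiplier_congr D D (hG' _) h1 (hH _) (hH _) (by simpa using hd) (by simp) ψ.2

/-- The bilinear form depends on the first sequence only through its sum. -/
theorem regroup_left {p q : ℝ≥0∞} (hpq : Admissible p q) {E E' : ℤ → ℤ → Plane → ℂ} {s : Finset ℤ}
    (hs : ∀ d ∈ s, |d| < 7) (hE : ∀ d k, Spec k (E d k)) (hE' : ∀ d k, Spec k (E' d k))
    (hH : ∀ k, Spec k (H k)) (hEn : ∀ d, seqNorm (crit p) p q (E d) ≠ ∞)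
    (hHn : seqNorm (crit p) p q H ≠ ∞) (hEE' : ∀ d ∈ s, ∀ k, E d k = E' d (k + d))
    (h : D.BilinearSum (fun k x ↦ ∑ d ∈ s, E d k x) H N) :
    D.BilinearSum (fun k x ↦ ∑ d ∈ s, E' d k x) H N := by
  obtain ⟨C, -, hC⟩ := D.exists_bilinearSum hpq
  choose M hM _ using fun d ↦ hC (E d) H (hE d) hH (hEn d) hHn
  have h1 := sum_left s hE hH hM
  -- Each shifted component has its own convergent bilinear sum, so the components can be moved
  -- separately and added again.
  rw [h.unique h1]
  rw [← Finset.sum_attach s]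
  simp only [← Finset.sum_attach s fun d ↦ E' d _ _]
  exact sum_left s.attach (fun i ↦ hE' i) hH fun i ↦
    (hM i).shift_left (hs i i.2) (hE i) (hE' i) hH (hEE' i i.2)

end BilinearSum

/-! ### Independence of the partition of unity. -/

variable (D D' : DyadicPartition)

theorem sconv_comm (K L : 𝓢(Plane, ℂ)) : sconv K L = sconv L K :=
  schwartz_ext_fourier fun ξ ↦ by rw [fourier_sconv, fourier_sconv, mul_comm]

theorem sum_sconv_phi_phi (k : ℤ) :
    ∑ d ∈ Finset.Icc (-1) 1, sconv (D'.φ (k + d)) (D.φ k) = D.φ k := by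
  refine schwartz_ext_fourier fun ξ ↦ ?_
  have e : 𝓕 (∑ d ∈ Finset.Icc (-1) 1, sconv (D'.φ (k + d)) (D.φ k)) =
      ∑ d ∈ Finset.Icc (-1) 1, 𝓕 (sconv (D'.φ (k + d)) (D.φ k)) :=
    map_sum (FourierTransform.fourierCLM ℂ 𝓢(Plane, ℂ)) _ _
  have e2 : 𝓕 (D'.wide 1 k) ξ = ∑ d ∈ Finset.Icc (-1 : ℤ) 1, 𝓕 (D'.φ (k + d)) ξ := by
    rw [fourier_wide]
    refine Finset.sum_bij' (fun j _ ↦ j - k) (fun d _ ↦ k + d) ?_ ?_ ?_ ?_ ?_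
    · intro j hj; rw [Finset.mem_Icc] at *; push_cast at hj; omega
    · intro j hj; rw [Finset.mem_Icc] at *; push_cast; omega
    · intro j _; ring
    · intro j _; ring
    · intro j _; simp
  rw [e, FunLike.coe_sum, Finset.sum_apply]
  simp only [fourier_sconv]
  rw [← Finset.sum_mul, ← e2]
  by_cases h : 𝓕 (D.φ k) ξ = 0
  · rw [h, mul_zero]
  · rw [D'.fourier_wide_eq_one le_rfl (D.fourier_phi_support h), one_mul]

theorem block_eq_sum_cv_block (k : ℤ) (F : DistModPoly) (x : Plane) :
    D.block k F x = ∑ d ∈ Finset.Icc (-1) 1, cv (D'.φ (k + d)) (D.block k F) x := by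
  obtain ⟨u, rfl⟩ := Submodule.Quotient.mk_surjective _ F
  simp only [block_mk, cv_ucv]
  rw [← ucv_sum, sum_sconv_phi_phi]

theorem cv_phi_block (k l : ℤ) (F : DistModPoly) :
    cv (D'.φ l) (D.block k F) = cv (D.φ k) (D'.block l F) := by
  obtain ⟨u, rfl⟩ := Submodule.Quotient.mk_surjective _ F
  ext x
  simp only [block_mk, cv_ucv]
  rw [sconv_comm]

theorem _root_.QG.Spec.cv {j : ℤ} {G : Plane → ℂ} (hG : Spec j G) (K : 𝓢(Plane, ℂ)) :
    Spec j (cv K G) :=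
  ⟨hG.1.cv K.integrable, fun L hL x ↦ by
    rw [cv_cv _ _ hG.1]
    refine hG.2 _ (fun ξ hξ ↦ ?_) x
    rw [fourier_sconv, hL ξ hξ, zero_mul]⟩

theorem exists_seqNorm_cv_phi_le (D : DyadicPartition) {s : ℝ} {p q : ℝ≥0∞} (hp : 1 ≤ p)
    (hp' : p ≠ ∞) : ∃ C : ℝ≥0∞, C ≠ ∞ ∧ ∀ (G : ℤ → Plane → ℂ) (r : ℤ → ℤ),
      (∀ k, Continuous (G k)) → seqNorm s p q (fun k ↦ cv (D.φ (r k)) (G k)) ≤ C * seqNorm s p q G := by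
  obtain ⟨C, hC, h⟩ := D.exists_eLpNorm_cv_kern_le (HomSymbol.const 1) 0
  refine ⟨C, hC, fun G r hG ↦ eLpNorm_count_le_const_mul hC (fun k ↦ ?_) q⟩
  have h1 := h (r k) (G k) (hG k) p hp hp'
  rw [← D.phi_eq_kern, show (HomSymbol.const 1).deg = 0 from rfl, Int.cast_zero, zero_mul,
      dy_zero, mul_one] at h1
  beta_reduce
  rw [wt, wt]
  calc _ ≤ dy (s * k) * (C * eLpNorm (G k) p volume) := by gcongr
    _ = _ := by ring

/-- The Besov norms of two partitions are equivalent. -/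
theorem exists_besovNorm_le_besovNorm {p q : ℝ≥0∞} (hpq : Admissible p q) :
    ∃ C : ℝ≥0∞, C ≠ ∞ ∧ ∀ F, D.besovNorm (crit p) p q F ≠ ∞ →
      D'.besovNorm (crit p) p q F ≤ C * D.besovNorm (crit p) p q F := by
  obtain ⟨C, hC, h⟩ := D'.exists_besovNorm_le (crit p) hpq.one_le hpq.ne_top hpq.one_le_right
  refine ⟨C, hC, fun F hF ↦ ?_⟩
  obtain ⟨u, hu, hs⟩ := D.exists_mk_eq_hasSum hpq hF
  have := h _ u (D.spec_block_of_besovNorm hpq.one_le hpq.ne_top hpq.one_le_right hF) hs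
  rwa [hu, ← besovNorm_eq] at this

/-- The double blocks φ'_{k+d} * φ_k * F with |d| ≤ 1 refine both decompositions: collected by k
they give the blocks of D, collected by k + d those of D'. -/
theorem regroup_block_left {p q : ℝ≥0∞} (hpq : Admissible p q) {F N : DistModPoly}
    {H : ℤ → Plane → ℂ} (hF : D.besovNorm (crit p) p q F ≠ ∞) (hH : ∀ k, Spec k (H k))
    (hHn : seqNorm (crit p) p q H ≠ ∞) {D₀ : DyadicPartition}
    (h : D₀.BilinearSum (fun k ↦ D.block k F) H N) : D₀.BilinearSum (fun k ↦ D'.block k F) H N := by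
  obtain ⟨C, hC, hle⟩ := D.exists_besovNorm_le_besovNorm D' hpq
  have hF' : D'.besovNorm (crit p) p q F ≠ ∞ :=
    ne_top_of_le_ne_top (ENNReal.mul_ne_top hC hF) (hle F hF)
  have hS := D.spec_block_of_besovNorm hpq.one_le hpq.ne_top hpq.one_le_right hF
  have hS' := D'.spec_block_of_besovNorm hpq.one_le hpq.ne_top hpq.one_le_right hF'
  obtain ⟨C₁, hC₁, h₁⟩ := D'.exists_seqNorm_cv_phi_le (s := crit p) (q := q) hpq.one_le hpq.ne_top
  have e : (fun k ↦ D.block k F) = fun k x ↦ ∑ d ∈ Finset.Icc (-1) 1,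
      cv (D'.φ (k + d)) (D.block k F) x := by
    ext k x
    exact D.block_eq_sum_cv_block D' k F x
  have e' : (fun k ↦ D'.block k F) = fun k x ↦ ∑ d ∈ Finset.Icc (-1) 1,
      cv (D.φ (k - d)) (D'.block k F) x := by
    ext k x
    rw [D'.block_eq_sum_cv_block D k F x]
    refine Finset.sum_bij' (fun d _ ↦ -d) (fun d _ ↦ -d) ?_ ?_ ?_ ?_ ?_
    · intro j hj; rw [Finset.mem_Icc] at *; omega
    · intro j hj; rw [Finset.mem_Icc] at *; omega
    · intro j _; ring
    · intro j _; ring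
    · intro j _; simp
  rw [e] at h
  rw [e']
  refine h.regroup_left (E := fun d k ↦ cv (D'.φ (k + d)) (D.block k F))
    (E' := fun d k ↦ cv (D.φ (k - d)) (D'.block k F)) hpq (fun d hd ↦ ?_) (fun d k ↦ (hS k).cv _)
    (fun d k ↦ (hS' k).cv _) hH (fun d ↦ ?_) hHn fun d _ k ↦ ?_
  · rw [Finset.mem_Icc] at hd
    rw [abs_lt]
    omega
  · refine ne_top_of_le_ne_top (ENNReal.mul_ne_top hC₁ hF) ?_
    rw [besovNorm_eq]
    exact h₁ _ (fun k ↦ k + d) fun k ↦ (hS k).1.1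
  · rw [cv_phi_block, add_sub_cancel_right]

/-- The bilinear form does not depend on the partition of unity. -/
theorem IsBilinear.change {D D' : DyadicPartition} {p q : ℝ≥0∞} (hpq : Admissible p q)
    {F G N : DistModPoly} (hF : D.besovNorm (crit p) p q F ≠ ∞)
    (hG : D.besovNorm (crit p) p q G ≠ ∞) (h : D.IsBilinear F G N) :
    D'.IsBilinear F G N := by
  obtain ⟨C, hC, hle⟩ := D.exists_besovNorm_le_besovNorm D' hpq
  have hF' : D'.besovNorm (crit p) p q F ≠ ∞ :=
    ne_top_of_le_ne_top (ENNReal.mul_ne_top hC hF) (hle F hF)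
  have hG' : D'.besovNorm (crit p) p q G ≠ ∞ :=
    ne_top_of_le_ne_top (ENNReal.mul_ne_top hC hG) (hle G hG)
  have hS := D.spec_block_of_besovNorm hpq.one_le hpq.ne_top hpq.one_le_right hG
  have hS' := D'.spec_block_of_besovNorm hpq.one_le hpq.ne_top hpq.one_le_right hF'
  have hT := D'.spec_block_of_besovNorm hpq.one_le hpq.ne_top hpq.one_le_right hG'
  rw [besovNorm_eq] at hG hF'
  have h0 : D.BilinearSum (fun k ↦ D.block k F) (fun k ↦ D.block k G) N := h
  have h1 := D.regroup_block_left D' hpq hF hS hG h0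
  have h2 := D.regroup_block_left D' hpq (by rwa [besovNorm_eq]) hS' hF' (h1.comm hS' hS)
  have h3 : D'.BilinearSum (fun k ↦ D'.block k F) (fun k ↦ D'.block k G) N :=
    (h2.comm hT hS').change D' hS' hT
  exact h3

/-- The bilinear form on the critical Besov space. -/
theorem exists_bilinear (D : DyadicPartition) {p q : ℝ≥0∞} (h : Admissible p q) :
    ∃ (B : D.besovGroup h → D.besovGroup h → D.besovGroup h) (C : ℝ), 0 ≤ C ∧
      (∀ x y : D.besovGroup h, D.IsBilinear x y (B x y)) ∧ (∀ x y z, B (x - y) z = B x z - B y z) ∧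
      (∀ x y z, B x (y - z) = B x y - B x z) ∧ ∀ x y, ‖B x y‖ ≤ C * (‖x‖ * ‖y‖) := by
  obtain ⟨C, hC, hb⟩ := D.exists_bilinearSum h
  have hS : ∀ (x : D.besovGroup h) k, Spec k (D.block k x) := fun x ↦
    D.spec_block_of_besovNorm h.one_le h.ne_top h.one_le_right x.2
  choose B hB hBC using fun x y : D.besovGroup h ↦ hb (fun k ↦ D.block k x) (fun k ↦ D.block k y)
    (hS x) (hS y) (by rw [← besovNorm_eq]; exact x.2) (by rw [← besovNorm_eq]; exact y.2)
  simp only [← besovNorm_eq] at hBC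
  have hfin : ∀ x y : D.besovGroup h, C * (D.besovNorm (crit p) p q (x : DistModPoly) *
      D.besovNorm (crit p) p q (y : DistModPoly)) ≠ ∞ :=
    fun x y ↦ ENNReal.mul_ne_top hC (ENNReal.mul_ne_top x.2 y.2)
  have hl : ∀ x y z : D.besovGroup h, B (x - y) z = B x z - B y z := by
    intro x y z
    -- Subtraction is reduced to addition in the first slot and to uniqueness of the limit of the
    -- series.
    rw [eq_sub_iff_add_eq]
    refine ((hB (x - y) z).add_left (hS _) (hS y) (hS z) (hB y z)).unique ?_
    convert hB x z using 3 with k t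
    rw [AddSubgroup.coe_sub, block_sub, Pi.sub_apply, sub_add_cancel]
  have hc : ∀ x y : D.besovGroup h, B x y = B y x := fun x y ↦ ((hB x y).comm (hS x) (hS y)).unique (hB y x)
  refine ⟨fun x y ↦ ⟨B x y, ne_top_of_le_ne_top (hfin x y) (hBC x y)⟩, C.toReal,
    ENNReal.toReal_nonneg, hB, fun x y z ↦ Subtype.ext (hl x y z), fun x y z ↦ Subtype.ext ?_,
    fun x y ↦ ?_⟩
  · change B x (y - z) = B x y - B x z
    rw [hc, hl, hc y, hc z]
  · have := ENNReal.toReal_mono (hfin x y) (hBC x y)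
    rwa [ENNReal.toReal_mul, ENNReal.toReal_mul] at this

end DyadicPartition

/-! ### Complex conjugation -/

theorem norm_iteratedFDeriv_conj (f : Plane → ℂ) (n : ℕ) (x : Plane) :
    ‖iteratedFDeriv ℝ n (fun y ↦ starRingEnd ℂ (f y)) x‖ = ‖iteratedFDeriv ℝ n f x‖ :=
  Complex.conjLIE.norm_iteratedFDeriv_comp_left f x n

/-- Complex conjugation of Schwartz functions. -/
def conjSchwartz : 𝓢(Plane, ℂ) →SL[starRingEnd ℂ] 𝓢(Plane, ℂ) :=
  SchwartzMap.mkCLM (fun ψ x ↦ starRingEnd ℂ (ψ x)) (fun _ _ _ ↦ by simp) (fun _ _ _ ↦ by simp)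
    (fun ψ ↦ Complex.conjCLE.contDiff.comp (ψ.smooth _)) fun n ↦ ⟨{n}, 1, zero_le_one, fun ψ x ↦ by
      rw [norm_iteratedFDeriv_conj, one_mul, Finset.sup_singleton]
      exact SchwartzMap.le_seminorm ℂ n.1 n.2 ψ x⟩

theorem conjSchwartz_apply (ψ : 𝓢(Plane, ℂ)) (x : Plane) :
    conjSchwartz ψ x = starRingEnd ℂ (ψ x) := rfl

theorem conjSchwartz_conjSchwartz (ψ : 𝓢(Plane, ℂ)) : conjSchwartz (conjSchwartz ψ) = ψ := by
  ext x
  simp [conjSchwartz_apply]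

theorem hat_conjSchwartz (ψ : 𝓢(Plane, ℂ)) (ξ : Plane) :
    hat (conjSchwartz ψ) ξ = starRingEnd ℂ (hat ψ (-ξ)) := by
  rw [hat, hat, ← integral_conj]
  congr 1 with x
  rw [conjSchwartz_apply, map_mul, ← Complex.exp_conj]
  congr 2
  simp

theorem reflect_conjSchwartz (ψ : 𝓢(Plane, ℂ)) (x : Plane) :
    reflect (conjSchwartz ψ) x = conjSchwartz (reflect ψ x) := by
  ext y
  rw [conjSchwartz_apply, reflect_apply, reflect_apply, conjSchwartz_apply]

theorem lineDeriv_conjSchwartz (ψ : 𝓢(Plane, ℂ)) (m : Plane) :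
    ∂_{m} (conjSchwartz ψ) = conjSchwartz (∂_{m} ψ) := by
  ext x
  rw [conjSchwartz_apply, SchwartzMap.lineDerivOp_apply_eq_fderiv,
    SchwartzMap.lineDerivOp_apply_eq_fderiv]
  have h := (Complex.conjCLE.toContinuousLinearMap.hasFDerivAt (x := ψ x)).comp x
    (ψ.differentiableAt (x := x)).hasFDerivAt
  have h' : fderiv ℝ (conjSchwartz ψ) x = _ := h.fderiv
  rw [h']
  rfl

theorem laplacian_conjSchwartz (ψ : 𝓢(Plane, ℂ)) :
    Δ (conjSchwartz ψ) = conjSchwartz (Δ ψ) := by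
  rw [SchwartzMap.laplacian_eq_sum (EuclideanSpace.basisFun (Fin 2) ℝ),
    SchwartzMap.laplacian_eq_sum (EuclideanSpace.basisFun (Fin 2) ℝ)]
  simp only [lineDeriv_conjSchwartz, map_sum]

/-- Complex conjugation of tempered distributions. -/
def conjDistribution : 𝓢'(Plane, ℂ) →ₛₗ[starRingEnd ℂ] 𝓢'(Plane, ℂ) where
  toFun u := ((starL ℂ : ℂ ≃L⋆[ℂ] ℂ).toContinuousLinearMap.comp
    (u : 𝓢(Plane, ℂ) →L[ℂ] ℂ)).comp conjSchwartz
  map_add' u v := by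
    ext ψ
    exact map_add (starRingEnd ℂ) _ _
  map_smul' c u := by
    ext ψ
    exact map_mul (starRingEnd ℂ) _ _

theorem conjDistribution_apply (u : 𝓢'(Plane, ℂ)) (ψ : 𝓢(Plane, ℂ)) :
    conjDistribution u ψ = starRingEnd ℂ (u (conjSchwartz ψ)) := rfl

theorem polyEval_map_conj (P : MvPolynomial (Fin 2) ℂ) (x : Plane) :
    polyEval (MvPolynomial.map (starRingEnd ℂ) P) x = starRingEnd ℂ (polyEval P x) := by
  rw [polyEval, polyEval, MvPolynomial.eval_map, MvPolynomial.eval, MvPolynomial.coe_eval₂Hom,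
    MvPolynomial.eval₂_comp_left (starRingEnd ℂ)]
  congr 1
  ext i
  simp

theorem conjDistribution_mem_polynomials {u : 𝓢'(Plane, ℂ)} (hu : u ∈ polynomials) :
    conjDistribution u ∈ polynomials := by
  obtain ⟨P, rfl⟩ := hu
  refine ⟨MvPolynomial.map (starRingEnd ℂ) P, ?_⟩
  ext ψ
  rw [conjDistribution_apply, polyDistribution_apply, polyDistribution_apply, ← integral_conj]
  congr 1 with x
  rw [polyEval_map_conj, conjSchwartz_apply, map_mul, Complex.conj_conj]

theorem conjSchwartz_mem_zeroMoments {ψ : 𝓢(Plane, ℂ)} (hψ : ψ ∈ zeroMoments) :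
    conjSchwartz ψ ∈ zeroMoments := by
  intro P
  have h := congrArg (starRingEnd ℂ) (hψ (MvPolynomial.map (starRingEnd ℂ) P))
  rw [← integral_conj, map_zero] at h
  simpa only [map_mul, polyEval_map_conj, Complex.conj_conj, conjSchwartz_apply] using h

/-- Complex conjugation modulo polynomials. -/
def conjMod : DistModPoly →ₛₗ[starRingEnd ℂ] DistModPoly :=
  polynomials.mapQ polynomials conjDistribution fun _ ↦ conjDistribution_mem_polynomials

theorem conjMod_mk (u : 𝓢'(Plane, ℂ)) :
    conjMod (Submodule.Quotient.mk u) = Submodule.Quotient.mk (conjDistribution u) := rfl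

theorem pair_conjMod (ψ : zeroMoments) (F : DistModPoly) : pair ψ (conjMod F) =
    starRingEnd ℂ (pair ⟨conjSchwartz ψ, conjSchwartz_mem_zeroMoments ψ.2⟩ F) := by
  obtain ⟨u, rfl⟩ := Submodule.Quotient.mk_surjective _ F
  rfl

/-- A real u is determined by the real test functions ψ + ψ̄ and i(ψ - ψ̄), on which it agrees with
its conjugate. Conversely a fixed class has the real representative (u + ū)/2. -/
theorem isReal_iff (F : DistModPoly) : IsReal F ↔ conjMod F = F := by
  constructor
  · rintro ⟨u, rfl, hu⟩
    rw [conjMod_mk]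
    congr 1
    ext ψ
    have key : ∀ χ : 𝓢(Plane, ℂ), conjSchwartz χ = χ → starRingEnd ℂ (u χ) = u χ := by
      intro χ hχ
      refine Complex.conj_eq_iff_im.2 (hu χ fun x ↦ Complex.conj_eq_iff_im.1 ?_)
      rw [← conjSchwartz_apply, hχ]
    have h1 := key (ψ + conjSchwartz ψ) (by rw [map_add, conjSchwartz_conjSchwartz, add_comm])
    have h2 := key (Complex.I • (ψ - conjSchwartz ψ)) (by
      rw [map_smulₛₗ, map_sub, conjSchwartz_conjSchwartz, Complex.conj_I, neg_smul, ← smul_neg,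
        neg_sub])
    rw [conjDistribution_apply]
    simp only [map_add, map_smul, map_sub, smul_eq_mul, map_mul, Complex.conj_I] at h1 h2
    have h3 := mul_left_cancel₀ Complex.I_ne_zero
      (show Complex.I * (starRingEnd ℂ (u (conjSchwartz ψ)) - starRingEnd ℂ (u ψ)) =
        Complex.I * (u ψ - u (conjSchwartz ψ)) by linear_combination h2)
    linear_combination (h1 + h3) / 2
  · intro h
    obtain ⟨u, rfl⟩ := Submodule.Quotient.mk_surjective _ F
    refine ⟨(1 / 2 : ℂ) • (u + conjDistribution u), ?_, fun ψ hψ ↦ ?_⟩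
    · rw [Submodule.Quotient.mk_smul, Submodule.Quotient.mk_add, ← conjMod_mk, h, ← two_smul ℂ,
        smul_smul]
      norm_num
    · have e : conjSchwartz ψ = ψ := by
        ext x
        rw [conjSchwartz_apply]
        exact Complex.conj_eq_iff_im.2 (hψ x)
      have e2 : ((1 / 2 : ℂ) • (u + conjDistribution u)) ψ =
          (1 / 2 : ℂ) * (u ψ + starRingEnd ℂ (u ψ)) := by
        rw [_root_.smul_apply, _root_.add_apply, conjDistribution_apply, e, smul_eq_mul]
      rw [e2]
      simp

theorem negLaplacian_conjMod (F : DistModPoly) : negLaplacian (conjMod F) = conjMod (negLaplacian F) := by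
  obtain ⟨u, rfl⟩ := Submodule.Quotient.mk_surjective _ F
  have e : ∀ u : 𝓢'(Plane, ℂ), negLaplacian (Submodule.Quotient.mk u) =
      Submodule.Quotient.mk (-Δ u) := fun u ↦ by
    rw [negLaplacian, Submodule.mapQ_apply]
    simp
  rw [conjMod_mk, e, e, conjMod_mk, map_neg]
  congr 2
  ext ψ
  rw [conjDistribution_apply, TemperedDistribution.laplacian_apply_apply,
    TemperedDistribution.laplacian_apply_apply, conjDistribution_apply, laplacian_conjSchwartz]

/-- This Hermitian symmetry says that ℬ commutes with complex conjugation. -/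
theorem symbolB_neg (ξ η : Plane) : symbolB (-ξ) (-η) = starRingEnd ℂ (symbolB ξ η) := by
  have hp : ∀ b, perp (-η) b = -perp η b := fun b ↦ by fin_cases b <;> simp [perp]
  have hT : ∀ a, symbolT a (-ξ) (-η) = starRingEnd ℂ (symbolT a ξ η) := by
    intro a
    simp only [symbolT, PiLp.neg_apply, norm_neg, map_div₀, map_mul, Complex.conj_ofReal,
      Complex.conj_I, map_ofNat]
    rw [mul_neg, neg_mul, div_neg, ← neg_div]
    congr 1
    push_cast
    ring
  simp only [symbolB, ← neg_add, norm_neg, map_mul, map_sum, map_inv₀, Complex.conj_ofReal,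
    Complex.conj_I, hp, hT, PiLp.neg_apply]
  push_cast
  simp only [mul_neg, neg_mul]

theorem bilinearMultiplier_conj {χ₁ χ₂ χ₁' χ₂' G H : Plane → ℂ}
    (h₁ : ∀ ξ, χ₁' ξ = starRingEnd ℂ (χ₁ (-ξ))) (h₂ : ∀ ξ, χ₂' ξ = starRingEnd ℂ (χ₂ (-ξ)))
    (ψ : 𝓢(Plane, ℂ)) :
    bilinearMultiplier symbolB χ₁' χ₂' (fun x ↦ starRingEnd ℂ (G x)) (fun x ↦ starRingEnd ℂ (H x))
      (conjSchwartz ψ) = starRingEnd ℂ (bilinearMultiplier symbolB χ₁ χ₂ G H ψ) := by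
  rw [bilinearMultiplier, bilinearMultiplier, ← integral_conj]
  congr 1 with y
  rw [map_mul, map_mul, map_mul, ← integral_conj, map_zpow₀]
  congr 2
  · simp only [map_mul, Complex.conj_ofReal, map_ofNat]
  have : (volume : Measure (Plane × Plane)).IsNegInvariant := by
    exact ⟨((Measure.measurePreserving_neg (volume : Measure Plane)).prod
      (Measure.measurePreserving_neg (volume : Measure Plane))).map_eq⟩
  rw [← integral_neg_eq_self]
  congr 1 with w
  simp only [Prod.fst_neg, Prod.snd_neg, map_mul, h₁, h₂, neg_neg, symbolB_neg, hat_conjSchwartz,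
    ← Complex.exp_conj, inner_neg_right, map_neg, Complex.conj_I, Complex.conj_ofReal]
  congr 2
  · congr 1
    push_cast
    ring
  · congr 3
    abel

namespace DyadicPartition

variable (D : DyadicPartition)

/-- The conjugate partition of unity. -/
def conj : DyadicPartition where
  φ j := conjSchwartz (D.φ j)
  hat_im ξ := by simp [hat_conjSchwartz, D.hat_im]
  hat_nonneg ξ := by simpa [hat_conjSchwartz] using D.hat_nonneg (-ξ)
  hat_le_one ξ := by simpa [hat_conjSchwartz] using D.hat_le_one (-ξ)
  hat_support ξ h := by
    rw [hat_conjSchwartz] at h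
    simpa using D.hat_support (-ξ) fun h0 ↦ h (by rw [h0, map_zero])
  hat_eq_one ξ h h' := by
    rw [hat_conjSchwartz, D.hat_eq_one (-ξ) (by simpa using h) (by simpa using h'), map_one]
  hat_dilate j ξ := by rw [hat_conjSchwartz, hat_conjSchwartz, D.hat_dilate, smul_neg]
  hat_sum ξ h := by
    have h1 := (D.hat_sum (-ξ) (neg_ne_zero.2 h)).map (starRingEnd ℂ) Complex.continuous_conj
    rw [map_one] at h1
    exact h1.congr_fun fun j ↦ hat_conjSchwartz _ _

theorem conj_phi (j : ℤ) : D.conj.φ j = conjSchwartz (D.φ j) := rfl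

/-- The transform of φ₀ is real but not assumed even, so φ_j need not be real, and conjugation
replaces the partition by its conjugate. -/
theorem conj_block (j : ℤ) (F : DistModPoly) :
    D.conj.block j (conjMod F) = fun x ↦ starRingEnd ℂ (D.block j F x) := by
  obtain ⟨u, rfl⟩ := Submodule.Quotient.mk_surjective _ F
  ext x
  rw [conjMod_mk, block_mk, block_mk, ucv, ucv, conj_phi, reflect_conjSchwartz,
    conjDistribution_apply, conjSchwartz_conjSchwartz]

theorem conj_besovNorm (s : ℝ) (p q : ℝ≥0∞) (F : DistModPoly) :
    D.conj.besovNorm s p q (conjMod F) = D.besovNorm s p q F := by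
  rw [besovNorm, besovNorm]
  congr! 3 with j
  rw [conj_block]
  exact eLpNorm_congr_norm_ae (Filter.Eventually.of_forall fun x ↦ by simp)

theorem IsBilinear.conj {D : DyadicPartition} {F G N : DistModPoly} (h : D.IsBilinear F G N) :
    D.conj.IsBilinear (conjMod F) (conjMod G) (conjMod N) := fun ψ ↦ by
  rw [pair_conjMod]
  refine ((h ⟨conjSchwartz ψ, conjSchwartz_mem_zeroMoments ψ.2⟩).map (starRingEnd ℂ)
    Complex.continuous_conj).congr_fun fun i ↦ ?_
  have hc : ∀ k ξ, D.conj.cutoff k ξ = starRingEnd ℂ (D.cutoff k (-ξ)) := fun k ξ ↦ by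
    simp only [cutoff, conj_phi, hat_conjSchwartz, map_add]
  rw [conj_block, conj_block, Function.comp_apply, ← bilinearMultiplier_conj (hc _) (hc _),
    conjSchwartz_conjSchwartz]

end DyadicPartition

/-! ### Solutions of the stationary equation -/

namespace DyadicPartition

variable {D : DyadicPartition} {p q : ℝ≥0∞}

theorem isSolution_iff {h : Admissible p q} {B : D.besovGroup h → D.besovGroup h → D.besovGroup h}
    (hB : ∀ x y : D.besovGroup h, D.IsBilinear x y (B x y)) {f : DistModPoly} {L : D.besovGroup h}
    (hL : IsInvLaplacian f L) (x : D.besovGroup h) : D.IsSolution f x ↔ x = L + B x x := by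
  constructor
  · rintro ⟨L', N, hL', hN, e⟩
    refine Subtype.ext ?_
    have h1 : L' = L := D.negLaplacian_injective (hL'.trans hL.symm)
    have h2 : N = B x x := D.ext_pair fun ψ ↦ (hN ψ).unique (hB x x ψ)
    rw [e, h1, h2]
    rfl
  · intro e
    exact ⟨L, B x x, hL, hB x x, congrArg Subtype.val e⟩

/-- The complex conjugate of a solution is a solution for the conjugate force. -/
theorem IsSolution.conj (hpq : Admissible p q) {f θ : DistModPoly}
    (hθ : D.besovNorm (crit p) p q θ ≠ ∞) (h : D.IsSolution f θ) :
    D.IsSolution (conjMod f) (conjMod θ) := by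
  obtain ⟨L, N, hL, hN, e⟩ := h
  have hθ' : D.conj.besovNorm (crit p) p q (conjMod θ) ≠ ∞ := by rwa [conj_besovNorm]
  -- Conjugating the bilinear series gives one for the conjugate partition; independence of the
  -- partition brings it back to D.
  refine ⟨conjMod L, conjMod N, ?_, hN.conj.change hpq hθ' hθ', ?_⟩
  · rw [IsInvLaplacian, negLaplacian_conjMod]
    exact congrArg conjMod hL
  · rw [← map_add]
    exact congrArg conjMod e

theorem mem_besovBall_iff (h : Admissible p q) {r : ℝ} (hr : 0 ≤ r) (x : D.besovGroup h) :
    (x : DistModPoly) ∈ D.besovBall (crit p) p q r ↔ ‖x‖ ≤ r := by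
  rw [besovBall, besovSpace, Set.mem_ofPred_eq, Set.mem_ofPred_eq, besovNorm_eq_ofReal,
    ENNReal.ofReal_le_ofReal_iff hr]
  simp

/-- The constants for which small forces have unique small solutions. -/
theorem exists_radii (D : DyadicPartition) (h : Admissible p q) :
    ∃ δ ε K : ℝ, 0 < δ ∧ 0 < ε ∧ 0 ≤ K ∧
      (∀ f ∈ D.besovBall (crit p - 2) p q δ, ∃ x : D.besovGroup h, ‖x‖ ≤ ε ∧ D.IsSolution f x ∧
        D.besovNorm (crit p) p q (conjMod x) ≤ ENNReal.ofReal ε) ∧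
      ∀ f ∈ D.besovBall (crit p - 2) p q δ, ∀ g ∈ D.besovBall (crit p - 2) p q δ,
        ∀ x y : D.besovGroup h, ‖x‖ ≤ ε → ‖y‖ ≤ ε → D.IsSolution f x → D.IsSolution g y →
          D.besovNorm (crit p) p q ((x : DistModPoly) - y) ≤
            ENNReal.ofReal K * D.besovNorm (crit p - 2) p q (f - g) := by
  obtain ⟨B, C, hC, hB, hl, hr, hBC⟩ := D.exists_bilinear h
  obtain ⟨C₁, hC₁, h₁⟩ := D.exists_isInvLaplacian h.one_le h.ne_top h.one_le_right
  obtain ⟨C₂, hC₂, h₂⟩ := D.conj.exists_besovNorm_le_besovNorm D h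
  have hB0 : B 0 0 = 0 := by simpa using hl 0 0 0
  set a := C₁.toReal
  set b := C₂.toReal
  have ha : 0 ≤ a := ENNReal.toReal_nonneg
  have hb : 0 ≤ b := ENNReal.toReal_nonneg
  -- Chosen for 4Cε ≤ 1; the added 1 covers C = 0.
  set ε := 1 / (4 * (C + 1)) with hε
  have hε0 : 0 < ε := by positivity
  have hCε : 4 * C * ε ≤ 1 := by
    rw [hε, mul_one_div, div_le_one (by positivity)]
    linarith
  -- The factor a + 1 makes ‖L‖ ≤ ε/2. The factor b + 1 makes the solution so small that its
  -- conjugate, whose norm may grow by the factor b, stays in the ball.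
  set δ := ε / (2 * (a + 1) * (b + 1)) with hδ
  have hδ0 : 0 < δ := by positivity
  have hδε : 2 * (a + 1) * (b + 1) * δ = ε := by
    rw [hδ]
    field_simp
  have haδ : a * δ ≤ ε / 2 := by nlinarith [mul_nonneg hb hδ0.le, mul_nonneg ha (mul_nonneg hb hδ0.le)]
  have hbδ : b * (2 * (a * δ)) ≤ ε := by
    nlinarith [mul_nonneg hb hδ0.le, mul_nonneg ha hδ0.le, mul_nonneg ha (mul_nonneg hb hδ0.le)]
  have hinv : ∀ f ∈ D.besovBall (crit p - 2) p q δ, ∃ L : D.besovGroup h, IsInvLaplacian f L ∧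
      ‖L‖ ≤ a * δ := by
    rintro f ⟨hf, hfδ⟩
    obtain ⟨L, hL, hLn⟩ := h₁ f (ne_of_lt hf)
    have hLn' := hLn.trans (mul_le_mul_right hfδ C₁)
    have hfin : C₁ * ENNReal.ofReal δ ≠ ∞ := ENNReal.mul_ne_top hC₁ ENNReal.ofReal_ne_top
    refine ⟨⟨L, ne_top_of_le_ne_top hfin hLn'⟩, hL, ?_⟩
    have := ENNReal.toReal_mono hfin hLn'
    rwa [ENNReal.toReal_mul, ENNReal.toReal_ofReal hδ0.le] at this
  refine ⟨δ, ε, 2 * (a + 1), hδ0, hε0, by positivity, fun f hf ↦ ?_, fun f hf g hg x y hx hy hfx hgy ↦ ?_⟩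
  · obtain ⟨L, hL, hLn⟩ := hinv f hf
    obtain ⟨x, hx, e⟩ := exists_eq_add_quadratic hl hr hC hε0.le hBC hCε (hLn.trans haδ)
    refine ⟨x, hx, (isSolution_iff hB hL x).2 e, ?_⟩
    -- Comparison with the zero solution for zero force.
    have hx2 : ‖x‖ ≤ 2 * (a * δ) := by
      have := norm_sub_le_two_mul_of_quadratic (y := 0) (M := 0) hl hr hC hBC hCε hx
        (by simpa using hε0.le) e (by rw [hB0, add_zero])
      rw [sub_zero, sub_zero] at this
      linarith
    have hx' : D.conj.besovNorm (crit p) p q (conjMod x) = ENNReal.ofReal ‖x‖ := by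
      rw [conj_besovNorm, besovNorm_eq_ofReal]
    refine (h₂ _ (by rw [hx']; exact ENNReal.ofReal_ne_top)).trans ?_
    rw [hx', ← ENNReal.ofReal_toReal hC₂, ← ENNReal.ofReal_mul hb]
    exact ENNReal.ofReal_le_ofReal (le_trans (by gcongr) hbδ)
  · obtain ⟨L, hL, -⟩ := hinv f hf
    obtain ⟨M, hM, -⟩ := hinv g hg
    have e := norm_sub_le_two_mul_of_quadratic hl hr hC hBC hCε hx hy
      ((isSolution_iff hB hL x).1 hfx) ((isSolution_iff hB hM y).1 hgy)
    -- The constant 2(a + 1) is positive, so an infinite norm makes the bound trivial.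
    by_cases hfg : D.besovNorm (crit p - 2) p q (f - g) = ∞
    · rw [hfg, ENNReal.mul_top (by rw [Ne, ENNReal.ofReal_eq_zero, not_le]; positivity)]
      exact le_top
    obtain ⟨J, hJ, hJn⟩ := h₁ _ hfg
    have hJ' : J = L - M := D.negLaplacian_injective (by
      rw [map_sub]
      exact hJ.trans (by rw [← hL, ← hM]))
    rw [hJ', ← AddSubgroup.coe_sub, besovNorm_eq_ofReal] at hJn
    rw [← AddSubgroup.coe_sub, besovNorm_eq_ofReal]
    calc ENNReal.ofReal ‖x - y‖ ≤ ENNReal.ofReal (2 * ‖L - M‖) := ENNReal.ofReal_le_ofReal e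
      _ = 2 * ENNReal.ofReal ‖L - M‖ := by rw [ENNReal.ofReal_mul (by norm_num)]; norm_num
      _ ≤ 2 * (C₁ * D.besovNorm (crit p - 2) p q (f - g)) := by gcongr
      _ = ENNReal.ofReal (2 * a) * D.besovNorm (crit p - 2) p q (f - g) := by
        rw [ENNReal.ofReal_mul (by norm_num), ENNReal.ofReal_toReal hC₁, mul_assoc]
        norm_num
      _ ≤ _ := by
        gcongr
        linarith

end DyadicPartition

end QG

end

/-! ### The theorem. -/

theorem theorem1p1 (D : QG.DyadicPartition) (p q : ℝ≥0∞)
    (hpq : (1 ≤ p ∧ p < 4 ∧ 1 ≤ q) ∨ (p = 4 ∧ q = 2)) :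
    ∃ δ₀ ε₀ : ℝ, 0 < δ₀ ∧ 0 < ε₀ ∧
      ∃ Φ : D.besovBall (2 / p.toReal - 3) p q δ₀ → D.besovBall (2 / p.toReal - 1) p q ε₀,
        (∀ f : D.besovBall (2 / p.toReal - 3) p q δ₀, D.IsSolution f (Φ f)) ∧
        (∀ (f : D.besovBall (2 / p.toReal - 3) p q δ₀) 
            (θ : D.besovBall (2 / p.toReal - 1) p q ε₀), D.IsSolution f θ → θ = Φ f) ∧
        (∃ K : ℝ≥0, ∀ f g, D.besovNorm (2 / p.toReal - 1) p q ((Φ f : QG.DistModPoly) - Φ g) ≤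
          K * D.besovNorm (2 / p.toReal - 3) p q ((f : QG.DistModPoly) - g)) ∧
        (∀ f : D.besovBall (2 / p.toReal - 3) p q δ₀, QG.IsReal f → QG.IsReal (Φ f)) := by
  have hs : 2 / p.toReal - 3 = QG.crit p - 2 := by
    rw [QG.crit]
    ring
  rw [hs]
  change ∃ δ₀ ε₀ : ℝ, 0 < δ₀ ∧ 0 < ε₀ ∧
      ∃ Φ : D.besovBall (QG.crit p - 2) p q δ₀ → D.besovBall (QG.crit p) p q ε₀, _ ∧ _ ∧
        (∃ K : ℝ≥0, ∀ f g, D.besovNorm (QG.crit p) p q ((Φ f : QG.DistModPoly) - Φ g) ≤ _) ∧ _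
  have h : QG.Admissible p q := hpq
  obtain ⟨δ, ε, K, hδ, hε, hK, hex, hlip⟩ := D.exists_radii h
  have hball := D.mem_besovBall_iff h hε.le
  choose x hx hsol hconj using hex
  -- Uniqueness is the Lipschitz bound with equal forces, since an element of zero norm is zero.
  have huniq : ∀ (f) (hf : f ∈ D.besovBall (QG.crit p - 2) p q δ),
      ∀ θ ∈ D.besovBall (QG.crit p) p q ε, D.IsSolution f θ → θ = x f hf := by
    intro f hf θ hθ hθs
    let y : D.besovGroup h := ⟨θ, hθ.1.ne⟩
    have h0 := hlip f hf f hf y (x f hf) ((hball y).1 hθ) (hx f hf) hθs (hsol f hf)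
    rw [sub_self, QG.DyadicPartition.besovNorm_zero, mul_zero] at h0
    exact sub_eq_zero.1 (D.eq_zero_of_besovNorm_eq_zero (zero_lt_one.trans_le h.one_le).ne'
      (zero_lt_one.trans_le h.one_le_right).ne' (le_antisymm h0 zero_le))
  refine ⟨δ, ε, hδ, hε, fun f ↦ ⟨x f f.2, (hball _).2 (hx f f.2)⟩, fun f ↦ hsol f f.2,
    fun f θ hθ ↦ Subtype.ext (huniq f f.2 θ θ.2 hθ), ⟨K.toNNReal, fun f g ↦ ?_⟩, fun f hf ↦ ?_⟩
  · exact hlip f f.2 g g.2 _ _ (hx f f.2) (hx g g.2) (hsol f f.2) (hsol g g.2)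
  -- For real f the conjugate of the solution solves the same equation and lies in the ball, so it
  -- is the solution.
  · rw [QG.isReal_iff] at hf ⊢
    refine huniq f f.2 _ ⟨(hconj f f.2).trans_lt ENNReal.ofReal_lt_top, hconj f f.2⟩ ?_
    have := (hsol f f.2).conj h (x f f.2).2
    rwa [hf] at this
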